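/- **Setting.** Let $0<q<1$, $d\ge 2$ and $\boldsymbol\alpha=(\alpha_1,\dots,\alpha_d)$ with all $\alpha_i>0$. For a finite sequence $v$ put $V_k=\sum_{i=1}^k v_i$ and $\widetilde V_k=\sum_{i=2}^k v_i$ (so $A_k,\widetilde A_k$ for $\boldsymbol\alpha$, $N_k$ for $\boldsymbol n$, $M_k$ for $\boldsymbol m$, $Y_k,\widetilde Y_k$ for $\boldsymbol y$, $X_k$ for $\boldsymbol x$, $L_k$ for $\boldsymbol\ell$, $T_k$ for $\boldsymbol t$). All multi-indices have non-negative integer entries. Let $(a;q)_n=\prod_{j=0}^{n-1}(1-aq^j)$ and let ${}_r\phi_s$ be the usual basic hypergeometric series. *$q$-Hahn functions.* Let $$h_n(x,\alpha,\beta,N;q)=(q^{\alpha+1};q)_n(q^{-N};q)_n\,{}_3\phi_2\!\left({q^{-n},\,q^{n+\alpha+\beta+1},\,q^{-x}\atop q^{\alpha+1},\,q^{-N}};q,q\right),$$ $$\omega(x)=\frac{(q^{\alpha+1};q)_x(q^{\beta+1};q)_{N-x}}{(q;q)_x(q;q)_{N-x}}q^{(N-x)(\alpha+1)},$$ $$\eta(n)=\frac{(q^{\alpha+\beta+2};q)_{n+N}}{(q;q)_{N-n}}q^{2\binom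 n2-2Nn}\,\frac{1-q^{\alpha+\beta+1}}{1-q^{2n+\alpha+\beta+1}}\,\frac{(q;q)_n(q^{\alpha+1};q)_n(q^{\beta+1};q)_n}{(q^{\alpha+\beta+1};q)_n}q^{n(\alpha+1)}.$$ For integers $x,N$ put $\widehat h_n(x,\alpha,\beta,N;q)=\sqrt{\omega(x)/\eta(n)}\,h_n(x,\alpha,\beta,N;q)$ if $0\le x\le N$ and $n\le N$, and $0$ otherwise. *Little $q$-Jacobi functions.* Let $p_n(x,\alpha,\beta;q)=(q^{\alpha+1};q)_n\,{}_2\phi_1\!\left({q^{-n},\,q^{n+\alpha+\beta+1}\atop q^{\alpha+1}};q,q^{x+1}\right)$ and, for integers $x\ge 0$, $\widehat p_n(x,\alpha,\beta;q)=\sqrt{\mu(x)/\kappa(n)}\,p_n(x,\alpha,\beta;q)$ with $$\mu(x)=\frac{(q^{\alpha+1};q)_\infty}{(q^{\alpha+\beta+2};q)_\infty}\frac{(q^{\beta+1};q)_x}{(q;q)_x}q^{x(\alpha+1)},\qquad \kappa(n)=\frac{1-q^{\alpha+\beta+1}}{1-q^{2n+\alpha+\beta+1}}\frac{(q;q)_n(q^{\alpha+1};q)_n(q^{\beta+1};q)_n}{(q^{\alpha+\beta+1};q)_n}q^{n(\alpha+1)};$$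 for integers $x<0$ put $\widehat p_n=0$. *$q$-Racah functions.* Let $$r_n(x,a,b,c,N;q)=(q^{a+1};q)_n(q^{b+c+1};q)_n(q^{-N};q)_n\,q^{n(N-c)/2}\,{}_4\phi_3\!\left({q^{-n},\,q^{n+a+b+1},\,q^{-x},\,q^{x+c-N}\atop q^{a+1},\,q^{b+c+1},\,q^{-N}};q,q\right),$$ $$\sigma(x)=\frac{1-q^{2x+c-N}}{1-q^{c-N}}\frac{(q^{c-N};q)_x(q^{a+1};q)_x(q^{b+c+1};q)_x(q^{-N};q)_x}{(q;q)_x(q^{c-a-N};q)_x(q^{-b-N};q)_x(q^{c+1};q)_x}q^{-x(a+b+1)},$$ $$\upsilon(n)=\frac{(q^{-c};q)_N(q^{a+b+2};q)_N}{(q^{a-c+1};q)_N(q^{b+1};q)_N}(q;q)_n(q^{a+1};q)_n(q^{b+1};q)_n(q^{a-c+1};q)_n(q^{b+c+1};q)_n(q^{-N};q)_n\,\frac{1-q^{a+b+1}}{1-q^{2n+a+b+1}}\,\frac{(q^{N+a+b+2};q)_n}{(q^{a+b+1};q)_n}.$$ For integers $x,N$ put $\widehat r_n(x,a,b,c,N;q)=\sqrt{\sigma(x)/\upsilon(n)}\,r_n(x,a,b,c,N;q)$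 if $0\le x\le N$ and $n\le N$, and $0$ otherwise. *The two $q$-Hahn bases.* For $\boldsymbol n,\boldsymbol m,\boldsymbol y$ of length $d$ let $$\Psi_{\boldsymbol n}(\boldsymbol y)=\delta_{N_dY_d}\prod_{k=1}^{d-1}\widehat h_{n_k}(Y_k-N_{k-1},\,2N_{k-1}+A_k+k-1,\,\alpha_{k+1},\,Y_{k+1}-N_{k-1};q),$$ $$\Xi_{\boldsymbol m}(\boldsymbol y)=\delta_{M_dY_d}\prod_{k=1}^{d-2}\widehat h_{m_k}(\widetilde Y_{k+1}-M_{k-1},\,2M_{k-1}+\widetilde A_{k+1}+k-1,\,\alpha_{k+2},\,\widetilde Y_{k+2}-M_{k-1};q)\;\cdot\;\widehat h_{m_{d-1}}(y_1,\,\alpha_1,\,2M_{d-2}+\widetilde A_d+d-2,\,Y_d-M_{d-2};q).$$ Their overlap coefficients are $\mathcal R_{\boldsymbol m}(\boldsymbol n)=\sum_{\boldsymbol y}\Xi_{\boldsymbol m}(\boldsymbol y)\Psi_{\boldsymbol n}(\boldsymbol y)$ (a finite sum). *The two $q$-Jacobi systems.* For $\boldsymbol t,\boldsymbol x$ of length $d-1$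 let $$\mathcal J_{\boldsymbol t}(\boldsymbol x)=\prod_{k=1}^{d-1}(-1)^{t_k}\,\widehat p_{t_k}(x_k,\,2T_{k-1}+A_k+k-1,\,\alpha_{k+1};q),$$ $$\mathcal Q_{\boldsymbol t}(\boldsymbol x)=\prod_{k=1}^{d-2}\widehat h_{t_k}(X_k-T_{k-1},\,2T_{k-1}+\widetilde A_{k+1}+k-1,\,\alpha_{k+2},\,X_{k+1}-T_{k-1};q)\;\cdot\;(-1)^{t_{d-1}}\,\widehat p_{t_{d-1}}(X_{d-1}-T_{d-2},\,\alpha_1,\,2T_{d-2}+\widetilde A_d+d-2;q).$$ *The representation.* Let $W$ be the complex inner product space with orthonormal basis $e_{\boldsymbol y}=e_{y_1}\otimes\cdots\otimes e_{y_d}$ (finite linear combinations). Let $A_0^{(k)},A_\pm^{(k)}$ act on the $k$-th factor by $A_0e_y=(y+\tfrac{\alpha_k+1}2)e_y$, $A_+e_y=\sqrt{\sigma_{y+1}}\,e_{y+1}$, $A_-e_y=\sqrt{\sigma_y}\,e_{y-1}$, where $\sigma_y=q^{1/2}(1-q^y)(1-q^{y+\alpha_k})/(1-q)^2$ (positive-discrete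 series representation of $su_q(1,1)$). For $S=\{i,\dots,j\}$ let $A_0^S=\sum_{k\in S}A_0^{(k)}$, $A_\pm^S=\sum_{k\in S}q^{\sum_{l=i}^{k-1}A_0^{(l)}}A_\pm^{(k)}$ and $$\Gamma^S=\frac{q^{-1/2}q^{A_0^S}+q^{1/2}q^{-A_0^S}}{(q^{1/2}-q^{-1/2})^2}-A_+^SA_-^Sq^{1-A_0^S},\qquad \gamma(a)=\frac{q^{a/2}+q^{-a/2}}{(q^{1/2}-q^{-1/2})^2}.$$ Let $g_{\boldsymbol n}=\sum_{\boldsymbol y}\Psi_{\boldsymbol n}(\boldsymbol y)e_{\boldsymbol y}$ and $u_{\boldsymbol m}=\sum_{\boldsymbol y}\Xi_{\boldsymbol m}(\boldsymbol y)e_{\boldsymbol y}$. *Gasper–Rahman polynomials.* For $s\ge0$, $\boldsymbol\ell,\boldsymbol y$ of length $s$, $\boldsymbol\beta=(\beta_0,\dots,\beta_{s+1})$ and $M\in\mathbb N_0$, put $y_0=0$, $y_{s+1}=M$ and $$Z_{\boldsymbol\ell}(\boldsymbol y;\boldsymbol\beta,M;q)=\prod_{k=1}^s r_{\ell_k}(y_k-L_{k-1},\,2L_{k-1}+\beta_k-\beta_0-1,\,\beta_{k+1}-\beta_k-1,\,y_{k+1}+L_{k-1}+\beta_k,\,y_{k+1}-L_{k-1};q),$$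 $$\chi(\boldsymbol y)=\prod_{k=0}^s\frac{(q^{\beta_{k+1}-\beta_k};q)_{y_{k+1}-y_k}(q^{\beta_{k+1}};q)_{y_{k+1}+y_k}}{(q;q)_{y_{k+1}-y_k}(q^{\beta_k+1};q)_{y_{k+1}+y_k}}\prod_{k=1}^s\frac{1-q^{2y_k+\beta_k}}{1-q^{\beta_k}}q^{y_k(\beta_{k-1}-\beta_k)},$$ $$\Upsilon_{\boldsymbol\ell}=q^{-M(2L_s+\beta_s)+L_s(L_s-1)+\beta_0(M-L_s)}\frac{(q^{\beta_{s+1}};q)_{M+L_s}(q^{\beta_{s+1}-\beta_0};q)_{M+L_s}}{(q;q)_{M-L_s}(q^{\beta_0+1};q)_{M-L_s}}\prod_{k=1}^s\frac{(q;q)_{\ell_k}(q^{\beta_{k+1}-\beta_k};q)_{\ell_k}(q^{\beta_k-\beta_0};q)_{L_k+L_{k-1}}}{(q^{\beta_{k+1}-\beta_0-1};q)_{L_k+L_{k-1}}}\frac{1-q^{\beta_{k+1}-\beta_0-1}}{1-q^{\beta_{k+1}-\beta_0-1+2L_k}}.$$ **Theorem.** 1. For all $\boldsymbol m,\boldsymbol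 n$, $$\mathcal R_{\boldsymbol m}(\boldsymbol n)=\delta_{m_dn_d}\,\delta_{M_{d-1}N_{d-1}}\prod_{k=1}^{d-2}(-1)^{m_k}\,\widehat r_{m_k}(N_k-M_{k-1},\,2M_{k-1}+\widetilde A_{k+1}+k-1,\,\alpha_{k+2},\,N_{k+1}+M_{k-1}+A_{k+1}+k,\,N_{k+1}-M_{k-1};q).$$ 2. With $s=d-2$, $\ell_i=m_i$ and $y_i=N_i$ for $1\le i\le d-2$, $M=N_{d-1}$ and $\beta_k=A_{k+1}+k$ for $0\le k\le d-1$, $$\mathcal R_{\boldsymbol m}(\boldsymbol n)=\delta_{m_dn_d}\,\delta_{M_{d-1}N_{d-1}}\,(-1)^{M_{d-2}}\sqrt{\frac{\chi(\boldsymbol y)}{\Upsilon_{\boldsymbol\ell}}}\;Z_{\boldsymbol\ell}(\boldsymbol y;\boldsymbol\beta,M;q).$$ 3. ($3nj$ coefficients.) $(g_{\boldsymbol n})$ and $(u_{\boldsymbol m})$ are orthonormal bases of $W$. The vectors $v$ with $\Gamma^{[1;k]}v=\gamma(2N_{k-1}+A_k+k-1)v$ for $2\le k\le d$ and $q^{A_0^{[1;d]}}v=q^{N_d+(A_d+d)/2}v$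 are exactly the multiples of $g_{\boldsymbol n}$. The vectors $v$ with $\Gamma^{[2;k]}v=\gamma(2M_{k-2}+\widetilde A_k+k-2)v$ for $3\le k\le d$, $\Gamma^{[1;d]}v=\gamma(2M_{d-1}+A_d+d-1)v$ and $q^{A_0^{[1;d]}}v=q^{M_d+(A_d+d)/2}v$ are exactly the multiples of $u_{\boldsymbol m}$. Moreover $\langle u_{\boldsymbol m},g_{\boldsymbol n}\rangle=\mathcal R_{\boldsymbol m}(\boldsymbol n)$. 4. ($q$-Hahn connection coefficients.) $\Xi_{\boldsymbol m}(\boldsymbol y)=\sum_{\boldsymbol n}\mathcal R_{\boldsymbol m}(\boldsymbol n)\Psi_{\boldsymbol n}(\boldsymbol y)$ for all $\boldsymbol m,\boldsymbol y$. 5. ($q$-Jacobi connection coefficients.) The systems $(\mathcal J_{\boldsymbol t})$ and $(\mathcal Q_{\boldsymbol t})$ are orthonormal in $\ell^2(\mathbb N_0^{d-1})$, and for all $\boldsymbol t,\boldsymbol t',\boldsymbol x$ of length $d-1$ and every $c\in\mathbb N_0$, $$\mathcal Q_{\boldsymbol t}(\boldsymbol x)=\sum_{\boldsymbol t':\,T'_{d-1}=T_{d-1}}\mathcal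 R_{(\boldsymbol t,c)}((\boldsymbol t',c))\,\mathcal J_{\boldsymbol t'}(\boldsymbol x),\qquad \sum_{\boldsymbol x}\mathcal Q_{\boldsymbol t}(\boldsymbol x)\mathcal J_{\boldsymbol t'}(\boldsymbol x)=\mathcal R_{(\boldsymbol t,c)}((\boldsymbol t',c)).$$ -/

import Mathlib

open scoped BigOperators ComplexConjugate

noncomputable section

namespace SUq

/-! ### Basic hypergeometric notation -/

/-- The `q`-Pochhammer symbol `(a;q)_n`. -/
def qPoch (a q : ℝ) (n : ℕ) : ℝ := ∏ j ∈ Finset.range n, (1 - a * q ^ j)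

/-- The infinite `q`-Pochhammer symbol `(a;q)_∞`. -/
def qPochInf (a q : ℝ) : ℝ := ∏' j : ℕ, (1 - a * q ^ j)

/-- The basic hypergeometric series `ᵣφₛ(a; b; q, z)`. All the instances below terminate because
one of the upper parameters is `q ^ (-n)`. -/
def basicHyp (a b : List ℝ) (q z : ℝ) : ℝ :=
  ∑' k : ℕ, (a.map (fun c => qPoch c q k)).prod /
      (qPoch q q k * (b.map (fun c => qPoch c q k)).prod) *
    ((-1) ^ k * q ^ (k.choose 2)) ^ (1 + (b.length : ℤ) - (a.length : ℤ)) * z ^ k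

/-! ### Partial sums of multi-indices (0-based: the first entry of `v` has index `0`) -/

/-- `V_k = v₁ + ⋯ + v_k`, the sum of the first `k` entries of a multi-index `v`. -/
def psum {d : ℕ} (v : Fin d → ℕ) (k : ℕ) : ℕ := ∑ i : Fin d with i.val < k, v i

/-- `Ṽ_k = v₂ + ⋯ + v_k`, the same sum without the first entry. -/
def psumTail {d : ℕ} (v : Fin d → ℕ) (k : ℕ) : ℕ := ∑ i : Fin d with 1 ≤ i.val ∧ i.val < k, v i

/-- `A_k = α₁ + ⋯ + α_k`, the sum of the first `k` entries of a real vector `α`. -/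
def rsum {d : ℕ} (α : Fin d → ℝ) (k : ℕ) : ℝ := ∑ i : Fin d with i.val < k, α i

/-- `Ã_k = α₂ + ⋯ + α_k`, the same sum without the first entry. -/
def rsumTail {d : ℕ} (α : Fin d → ℝ) (k : ℕ) : ℝ := ∑ i : Fin d with 1 ≤ i.val ∧ i.val < k, α i

/-! ### Univariate `q`-Hahn, little `q`-Jacobi and `q`-Racah functions -/

/-- The `q`-Hahn polynomial `h_n(x,α,β,N;q)`. -/
def hahn (q : ℝ) (n : ℕ) (x α β N : ℝ) : ℝ :=
  qPoch (q ^ (α + 1)) q n * qPoch (q ^ (-N)) q n *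
    basicHyp [q ^ (-(n : ℝ)), q ^ ((n : ℝ) + α + β + 1), q ^ (-x)]
      [q ^ (α + 1), q ^ (-N)] q q

/-- The `q`-Hahn weight `ω(x;α,β,N;q)`, for `0 ≤ x ≤ N`. -/
def hahnWeight (q : ℝ) (x : ℕ) (α β : ℝ) (N : ℕ) : ℝ :=
  qPoch (q ^ (α + 1)) q x * qPoch (q ^ (β + 1)) q (N - x) /
    (qPoch q q x * qPoch q q (N - x)) * q ^ (((N : ℝ) - x) * (α + 1))

/-- The squared norm `η(n,α,β,N;q)` of the `q`-Hahn polynomials, for `0 ≤ n ≤ N`. -/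
def hahnNorm (q : ℝ) (n : ℕ) (α β : ℝ) (N : ℕ) : ℝ :=
  qPoch (q ^ (α + β + 2)) q (n + N) / qPoch q q (N - n) *
    q ^ (2 * (n.choose 2 : ℝ) - 2 * N * n) *
    ((1 - q ^ (α + β + 1)) / (1 - q ^ (2 * (n : ℝ) + α + β + 1))) *
    (qPoch q q n * qPoch (q ^ (α + 1)) q n * qPoch (q ^ (β + 1)) q n /
      qPoch (q ^ (α + β + 1)) q n) * q ^ ((n : ℝ) * (α + 1))

/-- The orthonormal `q`-Hahn functions on the grid `{0,…,N}`, with degrees `0 ≤ n ≤ N`; they are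
zero for arguments and degrees outside these ranges. -/
def hahnHat (q : ℝ) (n : ℕ) (x : ℤ) (α β : ℝ) (N : ℤ) : ℝ :=
  if 0 ≤ x ∧ x ≤ N ∧ (n : ℤ) ≤ N then
    Real.sqrt (hahnWeight q x.toNat α β N.toNat / hahnNorm q n α β N.toNat) *
      hahn q n x α β N
  else 0

/-- The little `q`-Jacobi polynomial `p_n(x,α,β;q)`. -/
def jacobi (q : ℝ) (n : ℕ) (x α β : ℝ) : ℝ :=
  qPoch (q ^ (α + 1)) q n *
    basicHyp [q ^ (-(n : ℝ)), q ^ ((n : ℝ) + α + β + 1)] [q ^ (α + 1)] q (q ^ (x + 1))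

/-- The little `q`-Jacobi weight `μ(x,α,β;q)`. -/
def jacobiWeight (q : ℝ) (x : ℕ) (α β : ℝ) : ℝ :=
  qPochInf (q ^ (α + 1)) q / qPochInf (q ^ (α + β + 2)) q *
    (qPoch (q ^ (β + 1)) q x / qPoch q q x) * q ^ ((x : ℝ) * (α + 1))

/-- The squared norm `κ(n,α,β;q)` of the little `q`-Jacobi polynomials. -/
def jacobiNorm (q : ℝ) (n : ℕ) (α β : ℝ) : ℝ :=
  (1 - q ^ (α + β + 1)) / (1 - q ^ (2 * (n : ℝ) + α + β + 1)) *
    (qPoch q q n * qPoch (q ^ (α + 1)) q n * qPoch (q ^ (β + 1)) q n /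
      qPoch (q ^ (α + β + 1)) q n) * q ^ ((n : ℝ) * (α + 1))

/-- The orthonormal little `q`-Jacobi functions on the grid `{0,1,2,…}`, zero off the grid. -/
def jacobiHat (q : ℝ) (n : ℕ) (x : ℤ) (α β : ℝ) : ℝ :=
  if 0 ≤ x then
    Real.sqrt (jacobiWeight q x.toNat α β / jacobiNorm q n α β) * jacobi q n x α β
  else 0

/-- The `q`-Racah polynomial `r_n(x,a,b,c,N;q)`. -/
def racah (q : ℝ) (n : ℕ) (x a b c N : ℝ) : ℝ :=
  qPoch (q ^ (a + 1)) q n * qPoch (q ^ (b + c + 1)) q n * qPoch (q ^ (-N)) q n *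
    q ^ ((n : ℝ) * (N - c) / 2) *
    basicHyp [q ^ (-(n : ℝ)), q ^ ((n : ℝ) + a + b + 1), q ^ (-x), q ^ (x + c - N)]
      [q ^ (a + 1), q ^ (b + c + 1), q ^ (-N)] q q

/-- The `q`-Racah weight `σ(x,a,b,c,N;q)`. -/
def racahWeight (q : ℝ) (x : ℕ) (a b c : ℝ) (N : ℕ) : ℝ :=
  (1 - q ^ (2 * (x : ℝ) + c - N)) / (1 - q ^ (c - N)) *
    (qPoch (q ^ (c - N)) q x * qPoch (q ^ (a + 1)) q x * qPoch (q ^ (b + c + 1)) q x *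
        qPoch (q ^ (-(N : ℝ))) q x /
      (qPoch q q x * qPoch (q ^ (c - a - N)) q x * qPoch (q ^ (-b - N)) q x *
        qPoch (q ^ (c + 1)) q x)) * q ^ (-(x : ℝ) * (a + b + 1))

/-- The squared norm `υ(n,a,b,c,N;q)` of the `q`-Racah polynomials. -/
def racahNorm (q : ℝ) (n : ℕ) (a b c : ℝ) (N : ℕ) : ℝ :=
  qPoch (q ^ (-c)) q N * qPoch (q ^ (a + b + 2)) q N /
      (qPoch (q ^ (a - c + 1)) q N * qPoch (q ^ (b + 1)) q N) *
    (qPoch q q n * qPoch (q ^ (a + 1)) q n * qPoch (q ^ (b + 1)) q n *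
      qPoch (q ^ (a - c + 1)) q n * qPoch (q ^ (b + c + 1)) q n * qPoch (q ^ (-(N : ℝ))) q n) *
    ((1 - q ^ (a + b + 1)) / (1 - q ^ (2 * (n : ℝ) + a + b + 1))) *
    (qPoch (q ^ ((N : ℝ) + a + b + 2)) q n / qPoch (q ^ (a + b + 1)) q n)

/-- The orthonormal `q`-Racah functions on the grid `{0,…,N}`, with degrees `0 ≤ n ≤ N`; they are
zero for arguments and degrees outside these ranges. -/
def racahHat (q : ℝ) (n : ℕ) (x : ℤ) (a b c : ℝ) (N : ℤ) : ℝ :=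
  if 0 ≤ x ∧ x ≤ N ∧ (n : ℤ) ≤ N then
    Real.sqrt (racahWeight q x.toNat a b c N.toNat / racahNorm q n a b c N.toNat) *
      racah q n x a b c N
  else 0

/-! ### The multivariate `q`-Hahn bases and their overlaps

The number of tensor factors is `d = s + 2 ≥ 2`. -/

/-- The nested Clebsch–Gordan coefficients (first `q`-Hahn basis) `Ψ_n^{(α)}(y)`. The factor
with index `k : Fin (s + 1)` is the factor number `k + 1` in the usual 1-based numbering. -/
def Psi (q : ℝ) {s : ℕ} (α : Fin (s + 2) → ℝ) (n y : Fin (s + 2) → ℕ) : ℝ :=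
  (if psum n (s + 2) = psum y (s + 2) then 1 else 0) *
    ∏ k : Fin (s + 1),
      hahnHat q (n k.castSucc) ((psum y (k.val + 1) : ℤ) - psum n k.val)
        (2 * (psum n k.val : ℝ) + rsum α (k.val + 1) + k.val) (α k.succ)
        ((psum y (k.val + 2) : ℤ) - psum n k.val)

/-- The nested Clebsch–Gordan coefficients (second `q`-Hahn basis) `Ξ_m^{(α)}(y)`. -/
def Xi (q : ℝ) {s : ℕ} (α : Fin (s + 2) → ℝ) (m y : Fin (s + 2) → ℕ) : ℝ :=
  (if psum m (s + 2) = psum y (s + 2) then 1 else 0) *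
    (∏ k : Fin s,
      hahnHat q (m k.castSucc.castSucc) ((psumTail y (k.val + 2) : ℤ) - psum m k.val)
        (2 * (psum m k.val : ℝ) + rsumTail α (k.val + 2) + k.val) (α k.succ.succ)
        ((psumTail y (k.val + 3) : ℤ) - psum m k.val)) *
    hahnHat q (m (Fin.last s).castSucc) (y 0) (α 0)
      (2 * (psum m s : ℝ) + rsumTail α (s + 2) + s) ((psum y (s + 2) : ℤ) - psum m s)

/-- The overlap (interbasis expansion) coefficients `R_m^{(α)}(n) = ∑_y Ξ_m(y) Ψ_n(y)`; only the
finitely many `y` with `y₁ + ⋯ + y_d = n₁ + ⋯ + n_d` contribute. -/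
def overlap (q : ℝ) {s : ℕ} (α : Fin (s + 2) → ℝ) (m n : Fin (s + 2) → ℕ) : ℝ :=
  ∑' y : Fin (s + 2) → ℕ, Xi q α m y * Psi q α n y

/-! ### The multivariate `q`-Jacobi bases -/

/-- The first multivariate `q`-Jacobi basis `𝒥_t^{(α)}(x)`. -/
def JacobiJ (q : ℝ) {s : ℕ} (α : Fin (s + 2) → ℝ) (t x : Fin (s + 1) → ℕ) : ℝ :=
  ∏ k : Fin (s + 1), (-1) ^ (t k) *
    jacobiHat q (t k) (x k) (2 * (psum t k.val : ℝ) + rsum α (k.val + 1) + k.val) (α k.succ)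

/-- The second (mixed `q`-Hahn and `q`-Jacobi) basis `𝒬_t^{(α)}(x)`. -/
def JacobiQ (q : ℝ) {s : ℕ} (α : Fin (s + 2) → ℝ) (t x : Fin (s + 1) → ℕ) : ℝ :=
  (∏ k : Fin s,
      hahnHat q (t k.castSucc) ((psum x (k.val + 1) : ℤ) - psum t k.val)
        (2 * (psum t k.val : ℝ) + rsumTail α (k.val + 2) + k.val) (α k.succ.succ)
        ((psum x (k.val + 2) : ℤ) - psum t k.val)) *
    ((-1) ^ (t (Fin.last s)) *
      jacobiHat q (t (Fin.last s)) ((psum x (s + 1) : ℤ) - psum t s) (α 0)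
        (2 * (psum t s : ℝ) + rsumTail α (s + 2) + s))

/-! ### The Gasper–Rahman multivariate `q`-Racah polynomials -/

/-- The sequence `(y₀, y₁, …, y_s, y_{s+1})` with `y₀ = 0` and `y_{s+1} = M`. -/
def bordered {s : ℕ} (y : Fin s → ℕ) (M : ℕ) : Fin (s + 2) → ℕ :=
  Fin.snoc (α := fun _ => ℕ) (Fin.cons (α := fun _ => ℕ) 0 y : Fin (s + 1) → ℕ) M

/-- The multivariate `q`-Racah polynomial `Z_ℓ(y;β,M;q)`, with parameters
`β = (β₀, …, β_{s+1})`. -/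
def gasperRahman (q : ℝ) {s : ℕ} (l y : Fin s → ℕ) (β : Fin (s + 2) → ℝ) (M : ℕ) : ℝ :=
  ∏ k : Fin s,
    racah q (l k) ((bordered y M k.succ.castSucc : ℝ) - psum l k.val)
      (2 * (psum l k.val : ℝ) + β k.succ.castSucc - β 0 - 1)
      (β k.succ.succ - β k.succ.castSucc - 1)
      ((bordered y M k.succ.succ : ℝ) + psum l k.val + β k.succ.castSucc)
      ((bordered y M k.succ.succ : ℝ) - psum l k.val)

/-- The weight `χ^{(β)}(y)` on the simplex `0 ≤ y₁ ≤ ⋯ ≤ y_s ≤ M`. -/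
def grWeight (q : ℝ) {s : ℕ} (y : Fin s → ℕ) (β : Fin (s + 2) → ℝ) (M : ℕ) : ℝ :=
  (∏ k : Fin (s + 1),
      qPoch (q ^ (β k.succ - β k.castSucc)) q (bordered y M k.succ - bordered y M k.castSucc) *
          qPoch (q ^ (β k.succ)) q (bordered y M k.succ + bordered y M k.castSucc) /
        (qPoch q q (bordered y M k.succ - bordered y M k.castSucc) *
          qPoch (q ^ (β k.castSucc + 1)) q (bordered y M k.succ + bordered y M k.castSucc))) *
    ∏ k : Fin s,
      (1 - q ^ (2 * (y k : ℝ) + β k.succ.castSucc)) / (1 - q ^ (β k.succ.castSucc)) *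
        q ^ ((y k : ℝ) * (β k.castSucc.castSucc - β k.succ.castSucc))

/-- The squared norm `Υ_ℓ^{(β)}` of `Z_ℓ(·;β,M;q)` for the weight `χ^{(β)}`, for
`ℓ₁ + ⋯ + ℓ_s ≤ M`. -/
def grNorm (q : ℝ) {s : ℕ} (l : Fin s → ℕ) (β : Fin (s + 2) → ℝ) (M : ℕ) : ℝ :=
  q ^ (-(M : ℝ) * (2 * (psum l s : ℝ) + β (Fin.last s).castSucc) +
      (psum l s : ℝ) * ((psum l s : ℝ) - 1) + β 0 * ((M : ℝ) - psum l s)) *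
    (qPoch (q ^ (β (Fin.last (s + 1)))) q (M + psum l s) *
        qPoch (q ^ (β (Fin.last (s + 1)) - β 0)) q (M + psum l s) /
      (qPoch q q (M - psum l s) * qPoch (q ^ (β 0 + 1)) q (M - psum l s))) *
    ∏ k : Fin s,
      (qPoch q q (l k) * qPoch (q ^ (β k.succ.succ - β k.succ.castSucc)) q (l k) *
          qPoch (q ^ (β k.succ.castSucc - β 0)) q (psum l (k.val + 1) + psum l k.val) /
        qPoch (q ^ (β k.succ.succ - β 0 - 1)) q (psum l (k.val + 1) + psum l k.val)) *
      ((1 - q ^ (β k.succ.succ - β 0 - 1)) /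
        (1 - q ^ (β k.succ.succ - β 0 - 1 + 2 * (psum l (k.val + 1) : ℝ))))

/-! ### The `d`-fold tensor product of positive-discrete series representations of `su_q(1,1)` -/

/-- The space `W^{(α)} = V^{(α₁)} ⊗ ⋯ ⊗ V^{(α_d)}`, in coordinates with respect to the
orthonormal direct product basis `e_y = e_{y₁} ⊗ ⋯ ⊗ e_{y_d}`. -/
abbrev TensorSpace (d : ℕ) : Type := (Fin d → ℕ) →₀ ℂ

/-- The direct product basis vector `e_y`. -/
def prodBasis {d : ℕ} (y : Fin d → ℕ) : TensorSpace d := Finsupp.single y 1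

/-- The Hermitian inner product for which the vectors `e_y` are orthonormal. -/
def innerW {d : ℕ} (v w : TensorSpace d) : ℂ := v.sum fun y c => conj c * w y

/-- The structure constant `σ_n^{(α)}` of the representation `V^{(α)}`. -/
def structConst (q α : ℝ) (n : ℕ) : ℝ :=
  q ^ (1 / 2 : ℝ) * ((1 - q ^ n) * (1 - q ^ ((n : ℝ) + α))) / (1 - q) ^ 2

/-- The eigenvalue of `A₀^S = ∑_{k ∈ S} A₀^{(k)}` on `e_y`. -/
def weightOn {d : ℕ} (α : Fin d → ℝ) (S : Finset (Fin d)) (y : Fin d → ℕ) : ℝ :=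
  ∑ k ∈ S, ((y k : ℝ) + (α k + 1) / 2)

/-- The operator `q^{c A₀^S}`. -/
def qPowA0 (q : ℝ) {d : ℕ} (α : Fin d → ℝ) (S : Finset (Fin d)) (c : ℝ) :
    TensorSpace d →ₗ[ℂ] TensorSpace d :=
  Finsupp.linearCombination ℂ fun y => ((q ^ (c * weightOn α S y) : ℝ) : ℂ) • prodBasis y

/-- The operator `A₊^{(k)}`, acting on the factor `k`. -/
def raiseAt (q : ℝ) {d : ℕ} (α : Fin d → ℝ) (k : Fin d) : TensorSpace d →ₗ[ℂ] TensorSpace d :=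
  Finsupp.linearCombination ℂ fun y =>
    ((Real.sqrt (structConst q (α k) (y k + 1)) : ℝ) : ℂ) •
      prodBasis (Function.update y k (y k + 1))

/-- The operator `A₋^{(k)}`, acting on the factor `k`; it kills `e_y` if `y_k = 0`, because
`σ_0 = 0`. -/
def lowerAt (q : ℝ) {d : ℕ} (α : Fin d → ℝ) (k : Fin d) : TensorSpace d →ₗ[ℂ] TensorSpace d :=
  Finsupp.linearCombination ℂ fun y =>
    ((Real.sqrt (structConst q (α k) (y k)) : ℝ) : ℂ) •
      prodBasis (Function.update y k (y k - 1))

/-- The set `[i;j] = {i, …, j}` of tensor factors, in the usual 1-based numbering. -/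
def segment {d : ℕ} (i j : ℕ) : Finset (Fin d) :=
  Finset.univ.filter fun k => i ≤ k.val + 1 ∧ k.val + 1 ≤ j

/-- `A₊^S = ∑_{k ∈ S} q^{∑_{l ∈ S, l < k} A₀^{(l)}} A₊^{(k)}`. -/
def raiseOn (q : ℝ) {d : ℕ} (α : Fin d → ℝ) (S : Finset (Fin d)) :
    TensorSpace d →ₗ[ℂ] TensorSpace d :=
  ∑ k ∈ S, qPowA0 q α (S.filter fun l => l < k) 1 ∘ₗ raiseAt q α k

/-- `A₋^S = ∑_{k ∈ S} q^{∑_{l ∈ S, l < k} A₀^{(l)}} A₋^{(k)}`. -/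
def lowerOn (q : ℝ) {d : ℕ} (α : Fin d → ℝ) (S : Finset (Fin d)) :
    TensorSpace d →ₗ[ℂ] TensorSpace d :=
  ∑ k ∈ S, qPowA0 q α (S.filter fun l => l < k) 1 ∘ₗ lowerAt q α k

/-- The intermediate Casimir operator
`Γ^S = (q^{-1/2} q^{A₀^S} + q^{1/2} q^{-A₀^S}) / (q^{1/2} - q^{-1/2})² - A₊^S A₋^S q^{1 - A₀^S}`. -/
def casimir (q : ℝ) {d : ℕ} (α : Fin d → ℝ) (S : Finset (Fin d)) :
    TensorSpace d →ₗ[ℂ] TensorSpace d :=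
  ((((q ^ (1 / 2 : ℝ) - q ^ (-1 / 2 : ℝ)) ^ 2)⁻¹ : ℝ) : ℂ) •
      (((q ^ (-1 / 2 : ℝ) : ℝ) : ℂ) • qPowA0 q α S 1 +
        ((q ^ (1 / 2 : ℝ) : ℝ) : ℂ) • qPowA0 q α S (-1)) -
    raiseOn q α S ∘ₗ lowerOn q α S ∘ₗ ((q : ℂ) • qPowA0 q α S (-1))

/-- The Casimir eigenvalue `γ(a)` on `V^{(a)}`. -/
def casimirVal (q a : ℝ) : ℝ :=
  (q ^ (a / 2) + q ^ (-a / 2)) / (q ^ (1 / 2 : ℝ) - q ^ (-1 / 2 : ℝ)) ^ 2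

/-- The eigenvalue equations of the first coupled basis: `v` is a joint eigenvector of
`Γ^{[1;2]}, …, Γ^{[1;d]}` and `q^{A₀^{[1;d]}}` with quantum numbers `n`. -/
def IsCoupledFirst (q : ℝ) {d : ℕ} (α : Fin d → ℝ) (n : Fin d → ℕ) (v : TensorSpace d) : Prop :=
  (∀ k : ℕ, 2 ≤ k → k ≤ d → casimir q α (segment 1 k) v =
      ((casimirVal q (2 * (psum n (k - 1) : ℝ) + rsum α k + k - 1) : ℝ) : ℂ) • v) ∧
    qPowA0 q α (segment 1 d) 1 v =
      ((q ^ ((psum n d : ℝ) + (rsum α d + d) / 2) : ℝ) : ℂ) • v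

/-- The eigenvalue equations of the second coupled basis: `v` is a joint eigenvector of
`Γ^{[2;3]}, …, Γ^{[2;d]}`, `Γ^{[1;d]}` and `q^{A₀^{[1;d]}}` with quantum numbers `m`. -/
def IsCoupledSecond (q : ℝ) {d : ℕ} (α : Fin d → ℝ) (m : Fin d → ℕ) (v : TensorSpace d) : Prop :=
  (∀ k : ℕ, 3 ≤ k → k ≤ d → casimir q α (segment 2 k) v =
      ((casimirVal q (2 * (psum m (k - 2) : ℝ) + rsumTail α k + k - 2) : ℝ) : ℂ) • v) ∧
    casimir q α (segment 1 d) v =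
      ((casimirVal q (2 * (psum m (d - 1) : ℝ) + rsum α d + d - 1) : ℝ) : ℂ) • v ∧
    qPowA0 q α (segment 1 d) 1 v =
      ((q ^ ((psum m d : ℝ) + (rsum α d + d) / 2) : ℝ) : ℂ) • v

/-- The vector `∑_y F(y) e_y`, the sum being over the `y` with `y₁ + ⋯ + y_d = L`. -/
def vectorOf {d : ℕ} (F : (Fin d → ℕ) → ℝ) (L : ℕ) : TensorSpace d :=
  ∑ y ∈ Finset.piAntidiag Finset.univ L, (F y : ℂ) • prodBasis y

/-- The first coupled basis vector `g_n^{(α)} = ∑_y Ψ_n^{(α)}(y) e_y`. -/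
def coupledFirst (q : ℝ) {s : ℕ} (α : Fin (s + 2) → ℝ) (n : Fin (s + 2) → ℕ) :
    TensorSpace (s + 2) :=
  vectorOf (Psi q α n) (psum n (s + 2))

/-- The second coupled basis vector `u_m^{(α)} = ∑_y Ξ_m^{(α)}(y) e_y`. -/
def coupledSecond (q : ℝ) {s : ℕ} (α : Fin (s + 2) → ℝ) (m : Fin (s + 2) → ℕ) :
    TensorSpace (s + 2) :=
  vectorOf (Xi q α m) (psum m (s + 2))

/-- A family of vectors is an orthonormal basis of the tensor product space. -/
def IsOrthonormalBasis {d : ℕ} (b : (Fin d → ℕ) → TensorSpace d) : Prop :=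
  (∀ n n', innerW (b n) (b n') = if n = n' then 1 else 0) ∧
    Submodule.span ℂ (Set.range b) = ⊤

end SUq

end

open scoped BigOperators ComplexConjugate

noncomputable section

namespace SUq

/-! ### The `q`-Pochhammer symbol -/

section Pochhammer

variable {q : ℝ}

/-! The $q$-Hahn functions are Clebsch–Gordan coefficients. By `hahnHat_raise` and `hahnHat_lower`,
coupling two factors with parameters $\alpha,\beta$ in degree $n$ intertwines the coproduct action
of $A_\pm$ with the action on one factor with parameter $2n+\alpha+\beta+1$. Both relations come
from contiguous relations of ${}_3\phi_2$ series. They also give orthonormality: $A_+$ and $A_-$ are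
adjoint, so inner products on the grid $\{0,\dots,N+1\}$ reduce to those on $\{0,\dots,N\}$, and
only the norm in top degree needs a summation ($q$-Vandermonde).

The overlap problem is local. For three factors, the coupling orders `coupleRight` and `coupleLeft`
of the same total degree obey the same ladder relations, so an expansion of one in the other with
constant coefficients (`coupleRight_eq`) need only be checked on lowest weight vectors with $z=0$:
the lowering relation carries it to all $z$, the raising relation to all total weights. At $z=0$ the
coefficient is a single sum, `hahnTriple_sum`. Two of its three $q$-Hahn factors sit at an end point
or in top degree, where they are products; a $q$-Vandermonde sum leaves a balanced ${}_4\phi_3$, and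
Sears' transformation puts it in $q$-Racah form. Induction on the number of factors (`nestedAlt_eq`)
then moves the first factor past the others, one $6j$ step at a time, and produces the product of
$q$-Racah functions. Orthonormality of the nested functions converts this expansion into the formula
for the overlaps (`nested_overlap`).

The representation-theoretic part rests on iterated ladder relations. On a coupled function $A_+A_-$
acts by the square of a ladder coefficient, which makes the intermediate Casimir operators diagonal.
Since $\gamma$ is injective on the positive reals, their eigenvalues together with the total weight
determine all partial sums of the index, so the joint spectrum is simple. The connection formula for
the $q$-Hahn bases is completeness in each finite-dimensional weight space.

For the $q$-Jacobi systems let the first variable tend to infinity. Then $\Psi$ and $\Xi$ tend to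
$\mathcal J$ and $\mathcal Q$, the coefficients of the finite expansion stay fixed, and
orthonormality of the little $q$-Jacobi functions follows by dominated convergence.

The Gasper–Rahman form is a factorization: the quotient of weight and norm of the $k$-th $q$-Racah
factor is a factor of $\chi$ over a factor of $\Upsilon$ times a telescoping quotient
(`racahWeight_div_racahNorm`). -/

@[simp] lemma qPoch_zero (a q : ℝ) : qPoch a q 0 = 1 := by simp [qPoch]

lemma qPoch_succ (a q : ℝ) (n : ℕ) : qPoch a q (n + 1) = qPoch a q n * (1 - a * q ^ n) := by
  simp [qPoch, Finset.prod_range_succ]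

lemma qPoch_add (a q : ℝ) (m n : ℕ) :
    qPoch a q (m + n) = qPoch a q m * qPoch (a * q ^ m) q n := by
  simp [qPoch, Finset.prod_range_add, pow_add, mul_assoc]

lemma qPoch_succ' (a q : ℝ) (n : ℕ) : qPoch a q (n + 1) = (1 - a) * qPoch (a * q) q n := by
  rw [add_comm, qPoch_add]; simp [qPoch]

lemma qPoch_split (a q : ℝ) {m n : ℕ} (h : m ≤ n) :
    qPoch a q n = qPoch a q m * qPoch (a * q ^ m) q (n - m) := by
  rw [← qPoch_add, Nat.add_sub_cancel' h]

lemma qPoch_pos {a : ℝ} (hq0 : 0 < q) (hq1 : q < 1) (ha0 : 0 ≤ a) (ha : a < 1) (n : ℕ) :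
    0 < qPoch a q n :=
  Finset.prod_pos fun j _ => by
    have : a * q ^ j ≤ a * 1 := mul_le_mul_of_nonneg_left (pow_le_one₀ hq0.le hq1.le) ha0
    linarith

lemma qPoch_inv_pow_eq_zero (hq0 : 0 < q) {n k : ℕ} (h : n < k) : qPoch (q ^ n)⁻¹ q k = 0 :=
  Finset.prod_eq_zero (Finset.mem_range.2 h) (by
    rw [inv_mul_cancel₀ (pow_pos hq0 n).ne', sub_self])

/-- `(q^{-n};q)_k` in terms of `(q;q)`. -/
lemma qPoch_inv_pow (hq0 : 0 < q) (k m : ℕ) :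
    qPoch (q ^ (k + m))⁻¹ q k * qPoch q q m * q ^ ((k + m) * k) =
      (-1) ^ k * q ^ (k.choose 2) * qPoch q q (k + m) := by
  induction k with
  | zero => simp
  | succ k ih =>
    have e1 : qPoch (q ^ (k + 1 + m))⁻¹ q (k + 1) =
        (1 - (q ^ (k + 1 + m))⁻¹) * qPoch (q ^ (k + m))⁻¹ q k := by
      rw [qPoch_succ']
      congr 2
      rw [show k + 1 + m = (k + m) + 1 by ring, pow_succ]
      field_simp
    have e2 : qPoch q q (k + 1 + m) = qPoch q q (k + m) * (1 - q ^ (k + 1 + m)) := by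
      rw [show k + 1 + m = (k + m) + 1 by ring, qPoch_succ, pow_succ' q (k + m)]
    rw [e1, e2, Nat.choose_succ_succ' k 1, Nat.choose_one_right, pow_add q k (k.choose (1 + 1))]
    have e3 : (k + 1 + m) * (k + 1) = (k + m) * k + k + (k + 1 + m) := by ring
    have e4 : (1 - (q ^ (k + 1 + m))⁻¹) * q ^ (k + 1 + m) = -(1 - q ^ (k + 1 + m)) := by
      field_simp; ring
    rw [e3, pow_add q _ (k + 1 + m), pow_add q _ k]
    generalize q ^ (k + 1 + m) = z at *
    generalize qPoch (q ^ (k + m))⁻¹ q k = w at *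
    linear_combination (1 - z⁻¹) * z * q ^ k * ih +
      q ^ k * (-1) ^ k * q ^ k.choose 2 * qPoch q q (k + m) * e4

/-- Reversal of the order of the factors of a `q`-Pochhammer symbol. -/
lemma qPoch_reverse (hq0 : 0 < q) {a : ℝ} (ha : a ≠ 0) (n : ℕ) :
    qPoch (q / (a * q ^ n)) q n * a ^ n * q ^ (n.choose 2) = (-1) ^ n * qPoch a q n := by
  induction n with
  | zero => simp
  | succ n ih =>
    have e1 : qPoch (q / (a * q ^ (n + 1))) q (n + 1) =
        (1 - q / (a * q ^ (n + 1))) * qPoch (q / (a * q ^ n)) q n := by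
      rw [qPoch_succ']; congr 2; field_simp; ring
    have e4 : (1 - q / (a * q ^ (n + 1))) * (a * q ^ n) = -(1 - a * q ^ n) := by
      field_simp; ring
    rw [e1, qPoch_succ, Nat.choose_succ_succ' n 1, Nat.choose_one_right, pow_add q n]
    linear_combination (1 - q / (a * q ^ (n + 1))) * (a * q ^ n) * ih +
      (-1) ^ n * qPoch a q n * e4

end Pochhammer

/-! ### Gaussian binomial coefficients and the `q`-Vandermonde and `q`-Saalschütz sums -/

/-- The Gaussian binomial coefficient. -/
def qbin (q : ℝ) : ℕ → ℕ → ℝ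
  | _, 0 => 1
  | 0, _ + 1 => 0
  | n + 1, k + 1 => qbin q n (k + 1) + q ^ (n - k) * qbin q n k

section Summations

variable {q : ℝ}

@[simp] lemma qbin_zero_right (q : ℝ) (n : ℕ) : qbin q n 0 = 1 := by cases n <;> rfl

lemma qbin_succ_succ (q : ℝ) (n k : ℕ) :
    qbin q (n + 1) (k + 1) = qbin q n (k + 1) + q ^ (n - k) * qbin q n k := rfl

lemma qbin_eq_zero {n k : ℕ} (h : n < k) : qbin q n k = 0 := by
  induction n generalizing k with
  | zero => obtain ⟨k, rfl⟩ := Nat.exists_eq_add_of_lt h; simp [qbin]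
  | succ n ih =>
    obtain ⟨k, rfl⟩ : ∃ j, k = j + 1 := ⟨k - 1, by omega⟩
    rw [qbin_succ_succ, ih (by omega), ih (by omega)]; simp

@[simp] lemma qbin_self (q : ℝ) (n : ℕ) : qbin q n n = 1 := by
  induction n with
  | zero => simp
  | succ n ih => rw [qbin_succ_succ, qbin_eq_zero (Nat.lt_succ_self n), ih]; simp

/-- A division-free form of the quotient formula, valid for every real $q$. The induction is double
because the two terms of the Pascal rule lower $k$ and $m$ separately. -/
lemma qbin_add_mul (q : ℝ) (k m : ℕ) :
    qbin q (k + m) k * (qPoch q q k * qPoch q q m) = qPoch q q (k + m) := by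
  induction k generalizing m with
  | zero => simp
  | succ k ih =>
    induction m with
    | zero => simp
    | succ m ihm =>
      have h1 := ih (m + 1)
      rw [show k + 1 + (m + 1) = (k + m + 1) + 1 by ring, qbin_succ_succ]
      rw [show k + 1 + m = k + m + 1 by ring] at ihm
      rw [show k + (m + 1) = k + m + 1 by ring] at h1
      rw [show k + m + 1 - k = m + 1 by omega, qPoch_succ q q k, qPoch_succ q q (k + m + 1)]
      rw [qPoch_succ q q k] at ihm
      rw [qPoch_succ q q m] at h1 ⊢
      have e : q * q ^ (k + m + 1) = q ^ (m + 1) * (q * q ^ k) := by ring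
      rw [e]
      linear_combination (1 - q * q ^ m) * ihm + q ^ (m + 1) * (1 - q * q ^ k) * h1

lemma qPoch_q_ne_zero (hq0 : 0 < q) (hq1 : q < 1) (n : ℕ) : qPoch q q n ≠ 0 :=
  (qPoch_pos hq0 hq1 hq0.le hq1 n).ne'

lemma qbin_add (hq0 : 0 < q) (hq1 : q < 1) (k m : ℕ) :
    qbin q (k + m) k = qPoch q q (k + m) / (qPoch q q k * qPoch q q m) := by
  have := qPoch_q_ne_zero hq0 hq1
  rw [eq_div_iff (mul_ne_zero (this k) (this m)), qbin_add_mul]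

/-- Both sides are the multinomial quotient $(q;q)_{j+i+p}/((q;q)_j(q;q)_i(q;q)_p)$. It serves to
interchange the summations in `sears`. -/
lemma qbin_trinomial (hq0 : 0 < q) (hq1 : q < 1) (j i p : ℕ) :
    qbin q (j + i + p) (j + i) * qbin q (j + i) j = qbin q (j + i + p) j * qbin q (i + p) i := by
  have hne := qPoch_q_ne_zero hq0 hq1
  rw [qbin_add hq0 hq1, qbin_add hq0 hq1, qbin_add hq0 hq1, add_assoc j i p, qbin_add hq0 hq1]
  have := hne j; have := hne i; have := hne p; have := hne (j + i); have := hne (i + p)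
  field_simp

/-- The `q`-Chu–Vandermonde sum. -/
theorem qVandermonde (q a e : ℝ) (n : ℕ) :
    ∑ k ∈ Finset.range (n + 1), qbin q n k * qPoch a q k * qPoch e q (n - k) * e ^ k =
      qPoch (a * e) q n := by
  induction n with
  | zero => simp
  | succ n ih =>
    rw [Finset.sum_range_succ']
    have h1 : ∀ k ∈ Finset.range (n + 1), qbin q (n + 1) (k + 1) * qPoch a q (k + 1) *
        qPoch e q (n + 1 - (k + 1)) * e ^ (k + 1) =
        qbin q n (k + 1) * qPoch a q (k + 1) * qPoch e q (n - k) * e ^ (k + 1) +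
        qbin q n k * qPoch a q k * qPoch e q (n - k) * e ^ k * (q ^ (n - k) * (1 - a * q ^ k) * e) := by
      intro k _
      rw [qbin_succ_succ, qPoch_succ a q k, Nat.add_sub_add_right]; ring
    rw [Finset.sum_congr rfl h1, Finset.sum_add_distrib]
    -- Shifted back by one, the first part of the Pascal rule and the term $k=0$ reassemble into the
    -- sum for $n$ with an extra factor $1-eq^{n-k}$. Adding the second part, with its factor
    -- $q^{n-k}(1-aq^k)e$, gives $1-aeq^n$ for every $k$.
    have h2 : ∑ k ∈ Finset.range (n + 1), qbin q n (k + 1) * qPoch a q (k + 1) *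
        qPoch e q (n - k) * e ^ (k + 1) + qbin q (n + 1) 0 * qPoch a q 0 * qPoch e q (n + 1 - 0) * e ^ 0
        = ∑ k ∈ Finset.range (n + 1), qbin q n k * qPoch a q k * qPoch e q (n - k) * e ^ k *
          (1 - e * q ^ (n - k)) := by
      rw [Finset.sum_range_succ, qbin_eq_zero (Nat.lt_succ_self n), Finset.sum_range_succ' _ n]
      congr 1
      · rw [zero_mul, zero_mul, zero_mul, add_zero]
        refine Finset.sum_congr rfl fun k hk => ?_
        have : n - k = n - (k + 1) + 1 := by have := Finset.mem_range.1 hk; omega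
        rw [this, qPoch_succ e]; generalize n - (k + 1) = p; ring
      · simp [qPoch_succ]
    rw [add_right_comm, h2, ← Finset.sum_add_distrib, qPoch_succ, ← ih, Finset.sum_mul]
    refine Finset.sum_congr rfl fun k hk => ?_
    have : q ^ n = q ^ (n - k) * q ^ k := by
      rw [← pow_add, Nat.sub_add_cancel (by have := Finset.mem_range.1 hk; omega)]
    rw [this]; ring

/-- The `q`-Pfaff–Saalschütz sum, in polynomial form. -/
theorem qSaalschutz (hq0 : 0 < q) (hq1 : q < 1) (a b e : ℝ) (n : ℕ) :
    ∑ k ∈ Finset.range (n + 1), qbin q n k * qPoch a q k * qPoch b q k * qPoch e q (n - k) *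
      qPoch (a * b * e * q ^ k) q (n - k) * e ^ k = qPoch (a * e) q n * qPoch (b * e) q n := by
  have hne := qPoch_q_ne_zero hq0 hq1
  have h1 : ∀ k ∈ Finset.range (n + 1), qbin q n k * qPoch a q k * qPoch b q k * qPoch e q (n - k) *
      qPoch (a * b * e * q ^ k) q (n - k) * e ^ k =
      ∑ i ∈ Finset.range (n - k + 1), qbin q n i * qPoch (a * e) q i * qPoch b q (n - i) *
        b ^ i * qPoch e q i * (qbin q (n - i) k * qPoch a q k *
          qPoch (e * q ^ i) q (n - i - k) * (e * q ^ i) ^ k) := by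
    intro k hk
    -- The symbol with base $abeq^k$ is expanded by $q$-Vandermonde. After interchanging the sums,
    -- the inner sum over $k$ and then the outer sum over $i$ are again $q$-Vandermonde sums.
    rw [show a * b * e * q ^ k = (a * e) * (b * q ^ k) by ring, ← qVandermonde, Finset.mul_sum,
      Finset.sum_mul]
    refine Finset.sum_congr rfl fun i hi => ?_
    obtain ⟨p, rfl⟩ : ∃ p, n = k + i + p := ⟨n - k - i, by
      have := Finset.mem_range.1 hk; have := Finset.mem_range.1 hi; omega⟩
    rw [show k + i + p - k = i + p by omega, show k + i + p - i = k + p by omega,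
      show i + p - i = p by omega, show k + p - k = p by omega, add_assoc k i p, qbin_add hq0 hq1,
      qbin_add hq0 hq1, qbin_add hq0 hq1, show k + (i + p) = i + (k + p) by ring, qbin_add hq0 hq1,
      qPoch_add b q k p, qPoch_add e q i p]
    have := hne k; have := hne i; have := hne p; have := hne (k + p); have := hne (i + p)
    field_simp
    ring
  rw [Finset.sum_congr rfl h1, Finset.sum_comm' (s' := fun i => Finset.range (n - i + 1))
    (t' := Finset.range (n + 1)) (by intro x y; simp only [Finset.mem_range]; omega)]
  rw [mul_comm (qPoch (a * e) q n), mul_comm b e, ← qVandermonde q e b, Finset.sum_mul]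
  refine Finset.sum_congr rfl fun i hi => ?_
  have hi' : i ≤ n := by have := Finset.mem_range.1 hi; omega
  rw [← Finset.mul_sum, qVandermonde, qPoch_split (a * e) q hi']
  rw [mul_assoc a e]; ring

/-- Sears' transformation of terminating balanced `₄φ₃` series, in polynomial form. -/
theorem sears (hq0 : 0 < q) (hq1 : q < 1) (a u v e g : ℝ) (n : ℕ) :
    ∑ k ∈ Finset.range (n + 1), qbin q n k * g ^ k * qPoch g q (n - k) * qPoch a q k *
        qPoch (u * e) q k * qPoch (v * e) q k * qPoch (u * v * e * q ^ k) q (n - k) *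
        qPoch (a * e * g * q ^ k) q (n - k) =
      ∑ j ∈ Finset.range (n + 1), qbin q n j * (g * e) ^ j * qPoch u q j * qPoch v q j *
        qPoch a q j * qPoch (u * v * e * q ^ j) q (n - j) * qPoch (e * g) q (n - j) *
        qPoch (a * g * q ^ j) q (n - j) := by
  have hne := qPoch_q_ne_zero hq0 hq1
  let F : ℕ → ℕ → ℝ := fun j i => qbin q n j * (g * e) ^ j * qPoch u q j * qPoch v q j *
        qPoch a q j * qPoch (u * v * e * q ^ j) q (n - j) *
        (qbin q (n - j) i * qPoch (a * q ^ j) q i * qPoch e q i * qPoch g q (n - j - i) *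
          qPoch (a * q ^ j * e * g * q ^ i) q (n - j - i) * g ^ i)
  have h1 : ∀ k ∈ Finset.range (n + 1), qbin q n k * g ^ k * qPoch g q (n - k) * qPoch a q k *
        qPoch (u * e) q k * qPoch (v * e) q k * qPoch (u * v * e * q ^ k) q (n - k) *
        qPoch (a * e * g * q ^ k) q (n - k) =
      ∑ j ∈ Finset.range (k + 1), F j (k - j) := by
    intro k hk
    -- The product of the symbols with bases $ue$ and $ve$ is expanded by $q$-Saalschütz. Summed
    -- along diagonals, the inner sum over $i=k-j$ is a second Saalschütz sum, with parameters
    -- $aq^j$, $e$, $g$.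
    rw [mul_assoc _ (qPoch (u * e) q k), ← qSaalschutz hq0 hq1, Finset.mul_sum, Finset.sum_mul,
      Finset.sum_mul]
    refine Finset.sum_congr rfl fun j hj => ?_
    obtain ⟨i, rfl⟩ : ∃ i, k = j + i := ⟨k - j, by have := Finset.mem_range.1 hj; omega⟩
    obtain ⟨p, rfl⟩ : ∃ p, n = j + i + p := ⟨n - (j + i), by have := Finset.mem_range.1 hk; omega⟩
    simp only [F]
    rw [show j + i + p - (j + i) = p by omega, show j + i - j = i by omega,
      show j + i + p - j = i + p by omega, show i + p - i = p by omega, qPoch_add a q j i,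
      qPoch_add (u * v * e * q ^ j) q i p, pow_add q j i, ← mul_assoc (u * v * e),
      show a * e * g * (q ^ j * q ^ i) = a * q ^ j * e * g * q ^ i by ring]
    linear_combination g ^ (j + i) * qPoch g q p * (qPoch a q j * qPoch (a * q ^ j) q i) *
      qPoch u q j * qPoch v q j * qPoch e q i * qPoch (u * v * e * q ^ j) q i * e ^ j *
      qPoch (u * v * e * q ^ j * q ^ i) q p * qPoch (a * q ^ j * e * g * q ^ i) q p *
      qbin_trinomial hq0 hq1 j i p
  rw [Finset.sum_congr rfl h1]
  rw [Finset.sum_range_diag_flip]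
  refine Finset.sum_congr rfl fun j hj => ?_
  have hj' : j ≤ n := by have := Finset.mem_range.1 hj; omega
  simp only [F]
  rw [← Finset.mul_sum, show n + 1 - j = n - j + 1 by omega, qSaalschutz hq0 hq1,
    show a * q ^ j * g = a * g * q ^ j by ring]
  ring

/-- The coefficients of terminating series: `(q^{-n};q)_k q^k / (q;q)_k`. -/
def qcoef (q : ℝ) (n k : ℕ) : ℝ := qPoch (q ^ n)⁻¹ q k * q ^ k / qPoch q q k

@[simp] lemma qcoef_zero_right (q : ℝ) (n : ℕ) : qcoef q n 0 = 1 := by simp [qcoef]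

lemma qcoef_eq_zero (hq0 : 0 < q) {n k : ℕ} (h : n < k) : qcoef q n k = 0 := by
  simp [qcoef, qPoch_inv_pow_eq_zero hq0 h]

lemma one_sub_pow_succ_ne_zero (hq0 : 0 < q) (hq1 : q < 1) (k : ℕ) : 1 - q * q ^ k ≠ 0 := by
  have : q * q ^ k < 1 := by rw [← pow_succ']; exact pow_lt_one₀ hq0.le hq1 (Nat.succ_ne_zero k)
  linarith

lemma qcoef_succ_right (hq0 : 0 < q) (hq1 : q < 1) (n k : ℕ) :
    qcoef q n (k + 1) * (1 - q * q ^ k) = qcoef q n k * ((1 - (q ^ n)⁻¹ * q ^ k) * q) := by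
  have h1 := one_sub_pow_succ_ne_zero hq0 hq1 k
  have h2 := qPoch_q_ne_zero hq0 hq1 k
  rw [qcoef, qcoef, qPoch_succ, qPoch_succ, div_mul_eq_mul_div, div_mul_eq_mul_div,
    div_eq_div_iff (mul_ne_zero h2 h1) h2]
  ring

/-- A Pascal rule for these coefficients; it drives the induction in `qVandermonde_qcoef`. -/
lemma qcoef_succ_succ (hq0 : 0 < q) (hq1 : q < 1) (n k : ℕ) :
    qcoef q (n + 1) (k + 1) = (q ^ (k + 1))⁻¹ * qcoef q n (k + 1) - (q ^ k)⁻¹ * qcoef q n k := by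
  have h1 := one_sub_pow_succ_ne_zero hq0 hq1 k
  have h2 := qPoch_q_ne_zero hq0 hq1 k
  have e : qPoch (q ^ (n + 1))⁻¹ q (k + 1) = (1 - (q ^ (n + 1))⁻¹) * qPoch (q ^ n)⁻¹ q k := by
    rw [qPoch_succ']; congr 2; rw [pow_succ]; field_simp
  rw [qcoef, qcoef, qcoef, e, qPoch_succ, qPoch_succ]
  field_simp
  ring

/-- The `q`-Chu–Vandermonde sum for a terminating `₂φ₁` with argument `q`. -/
theorem qVandermonde_qcoef (hq0 : 0 < q) (hq1 : q < 1) (a d : ℝ) (n : ℕ) :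
    ∑ k ∈ Finset.range (n + 1), qcoef q n k * qPoch a q k * qPoch (d * q ^ k) q (n - k) =
      ∏ j ∈ Finset.range n, (a - d * q ^ j) := by
  induction n generalizing d with
  | zero => simp
  | succ n ih =>
    rw [Finset.sum_range_succ']
    have h1 : ∀ k ∈ Finset.range (n + 1), qcoef q (n + 1) (k + 1) * qPoch a q (k + 1) *
        qPoch (d * q ^ (k + 1)) q (n + 1 - (k + 1)) =
        (q ^ (k + 1))⁻¹ * qcoef q n (k + 1) * qPoch a q (k + 1) *
          qPoch (d * q ^ (k + 1)) q (n - k) -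
        qcoef q n k * qPoch a q k * qPoch (d * q * q ^ k) q (n - k) *
          ((q ^ k)⁻¹ * (1 - a * q ^ k)) := by
      intro k _
      rw [qcoef_succ_succ hq0 hq1, qPoch_succ a q k, Nat.add_sub_add_right, pow_succ' q k,
        ← mul_assoc d q]
      ring
    rw [Finset.sum_congr rfl h1, Finset.sum_sub_distrib]
    -- The coefficients $q^{-k}(1-dq^k)$ obtained here and $q^{-k}(1-aq^k)$ in the subtracted sum
    -- differ by $a-d$ for every $k$. So the factor $a-d$ comes out, and the sum for $n$ with $dq$
    -- in place of $d$ remains.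
    have h2 : ∑ k ∈ Finset.range (n + 1), (q ^ (k + 1))⁻¹ * qcoef q n (k + 1) * qPoch a q (k + 1) *
          qPoch (d * q ^ (k + 1)) q (n - k) +
          qcoef q (n + 1) 0 * qPoch a q 0 * qPoch (d * q ^ 0) q (n + 1 - 0)
        = ∑ k ∈ Finset.range (n + 1), qcoef q n k * qPoch a q k * qPoch (d * q * q ^ k) q (n - k) *
          ((q ^ k)⁻¹ * (1 - d * q ^ k)) := by
      rw [Finset.sum_range_succ, qcoef_eq_zero hq0 (Nat.lt_succ_self n), Finset.sum_range_succ' _ n]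
      congr 1
      · rw [mul_zero, zero_mul, zero_mul, add_zero]
        refine Finset.sum_congr rfl fun k hk => ?_
        have : n - k = n - (k + 1) + 1 := by have := Finset.mem_range.1 hk; omega
        rw [this, qPoch_succ' (d * q ^ (k + 1)), show d * q ^ (k + 1) * q = d * q * q ^ (k + 1) by ring]
        ring
      · simp [qPoch_succ']; ring
    rw [sub_add_eq_add_sub, h2, ← Finset.sum_sub_distrib, Finset.prod_range_succ']
    have e : ∀ j, a - d * q ^ (j + 1) = a - d * q * q ^ j := fun j => by ring
    simp only [e]
    rw [← ih, Finset.sum_mul]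
    refine Finset.sum_congr rfl fun k _ => ?_
    field_simp
    ring

end Summations

/-! ### The `q`-Hahn polynomials in multiplicative form -/

section HahnPolynomials

variable {q : ℝ}

/-- The `q`-Hahn polynomial with parameters `A = q^{α+1}`, `B = q^{β+1}`, `V = q^{-x}` and
`Z = q^{-N}`. -/
def hahnPoly (q A B : ℝ) (n : ℕ) (V Z : ℝ) : ℝ :=
  ∑ k ∈ Finset.range (n + 1), qcoef q n k * qPoch (A * B * q ^ n / q) q k *
    qPoch (A * q ^ k) q (n - k) * qPoch (Z * q ^ k) q (n - k) * qPoch V q k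

lemma one_sub_mul_qPoch_mul (a q : ℝ) (k : ℕ) :
    (1 - a) * qPoch (a * q) q k = qPoch a q k * (1 - a * q ^ k) := by
  rw [← qPoch_succ', qPoch_succ]

/-- The contiguous relation of the `q`-Hahn polynomials behind the action of `A₊`. -/
lemma hahnPoly_raise (q A B : ℝ) (n : ℕ) {X U V Z : ℝ} (hX : X * V = 1) (hU : U * Z = 1) :
    (1 - X) * hahnPoly q A B n (V * q) (Z * q) + (X - U) * hahnPoly q A B n V (Z * q) =
      (q ^ n - U) * hahnPoly q A B n V Z := by
  -- The relation holds term by term in $k$: each of the two shifted symbols, in $V$ and in $Z$,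
  -- differs from the unshifted one only in its end factors.
  simp only [hahnPoly, Finset.mul_sum]
  rw [← Finset.sum_add_distrib]
  refine Finset.sum_congr rfl fun k hk => ?_
  have h1 := one_sub_mul_qPoch_mul V q k
  have h2 := one_sub_mul_qPoch_mul (Z * q ^ k) q (n - k)
  have h3 : q ^ n = q ^ k * q ^ (n - k) := by
    rw [← pow_add, Nat.add_sub_cancel' (by have := Finset.mem_range.1 hk; omega)]
  have h1' : (1 - X) * qPoch (V * q) q k = qPoch V q k * (q ^ k - X) := by
    linear_combination (-X) * h1 + (qPoch V q k * q ^ k - qPoch (V * q) q k) * hX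
  have h2' : (q ^ k - U) * qPoch (Z * q ^ k * q) q (n - k) =
      qPoch (Z * q ^ k) q (n - k) * (q ^ n - U) := by
    rw [h3]
    linear_combination (-U) * h2 + (q ^ k * q ^ (n - k) * qPoch (Z * q ^ k) q (n - k) -
      q ^ k * qPoch (Z * q ^ k * q) q (n - k)) * hU
  rw [show Z * q * q ^ k = Z * q ^ k * q by ring]
  linear_combination qcoef q n k * qPoch (A * B * q ^ n / q) q k * qPoch (A * q ^ k) q (n - k) *
    (qPoch (Z * q ^ k * q) q (n - k) * h1' + qPoch V q k * h2')

/-- The contiguous relation of the `q`-Hahn polynomials behind the action of `A₋`. -/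
lemma hahnPoly_lower (hq0 : 0 < q) (hq1 : q < 1) (A B : ℝ) (n : ℕ) {X U V Z : ℝ}
    (hX : X * V = 1) (hU : U * Z = 1) :
    (1 - A * X) * hahnPoly q A B n (V / q) (Z / q) + A * (X - B * U) * hahnPoly q A B n V (Z / q) =
      ((q ^ n)⁻¹ - A * B * U) * hahnPoly q A B n V Z := by
  have hqn : q ≠ 0 := hq0.ne'
  let c : ℕ → ℝ := fun k => qcoef q n k * qPoch (A * B * q ^ n / q) q k *
    qPoch (A * q ^ k) q (n - k)
  -- Here the relation fails term by term, and `s` is the defect. It contains $(V;q)_{k-1}$ instead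
  -- of $(V;q)_k$, so shifting its index by one turns it into a correction of the terms with index
  -- below $n$. At $k=0$ the factor $1-q^k$ vanishes, so the truncated $k-1$ is harmless.
  let s : ℕ → ℝ := fun k => c k * qPoch (Z / q * q ^ k) q (n - k) *
    ((q ^ k)⁻¹ * (1 - q ^ k) * (1 - A * q ^ k / q)) * qPoch V q (k - 1)
  have step : ∀ k ∈ Finset.range (n + 1),
      (1 - A * X) * (c k * qPoch (Z / q * q ^ k) q (n - k) * qPoch (V / q) q k) +
        A * (X - B * U) * (c k * qPoch (Z / q * q ^ k) q (n - k) * qPoch V q k) =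
      c k * qPoch (Z / q * q ^ k) q (n - k) * qPoch V q k * ((q ^ k)⁻¹ - A * B * U) - s k := by
    intro k _
    rcases k with _ | k
    · simp [s]; ring
    · have e : qPoch (V / q) q (k + 1) = (1 - V / q) * qPoch V q k := by
        rw [qPoch_succ', div_mul_cancel₀ _ hqn]
      simp only [s, Nat.add_sub_cancel]
      rw [e, qPoch_succ V]
      have hk : q ^ (k + 1) ≠ 0 := pow_ne_zero _ hqn
      have : (1 - A * X) * (1 - V / q) + A * (X - B * U) * (1 - V * q ^ k) =
          (1 - V * q ^ k) * ((q ^ (k + 1))⁻¹ - A * B * U) -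
            (q ^ (k + 1))⁻¹ * (1 - q ^ (k + 1)) * (1 - A * q ^ (k + 1) / q) := by
        field_simp
        linear_combination (A * q ^ (k + 1) - A * q ^ (2 * k + 2)) * hX
      linear_combination c (k + 1) * qPoch (Z / q * q ^ (k + 1)) q (n - (k + 1)) *
        qPoch V q k * this
  have shift : ∑ k ∈ Finset.range (n + 1), s k = ∑ k ∈ Finset.range n,
      c k * qPoch (Z * q ^ k) q (n - (k + 1)) * qPoch V q k *
        ((q ^ k)⁻¹ * (1 - (q ^ n)⁻¹ * q ^ k) * (1 - A * B * q ^ n / q * q ^ k)) := by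
    rw [Finset.sum_range_succ']
    have : s 0 = 0 := by simp [s]
    rw [this, add_zero]
    refine Finset.sum_congr rfl fun k hk => ?_
    have hk' : n - k = n - (k + 1) + 1 := by have := Finset.mem_range.1 hk; omega
    simp only [s, c, Nat.add_sub_cancel]
    rw [hk', qPoch_succ' (A * q ^ k), qPoch_succ (A * B * q ^ n / q),
      show Z / q * q ^ (k + 1) = Z * q ^ k by field_simp; ring,
      show A * q ^ k * q = A * q ^ (k + 1) by ring]
    have h := qcoef_succ_right hq0 hq1 n k
    have e1 : A * q ^ (k + 1) / q = A * q ^ k := by field_simp; ring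
    have e2 : (q ^ (k + 1))⁻¹ * q = (q ^ k)⁻¹ := by field_simp; ring
    rw [e1, ← e2, pow_succ' q k] 
    generalize qPoch (A * B * q ^ n / q) q k = P
    linear_combination (q * q ^ k)⁻¹ * P * (1 - A * B * q ^ n / q * q ^ k) *
      qPoch (A * (q * q ^ k)) q (n - (k + 1)) * qPoch (Z * q ^ k) q (n - (k + 1)) *
      (1 - A * q ^ k) * qPoch V q k * h
  have expand : (1 - A * X) * hahnPoly q A B n (V / q) (Z / q) +
      A * (X - B * U) * hahnPoly q A B n V (Z / q) =
      ∑ k ∈ Finset.range (n + 1), c k * qPoch (Z / q * q ^ k) q (n - k) * qPoch V q k *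
        ((q ^ k)⁻¹ - A * B * U) - ∑ k ∈ Finset.range (n + 1), s k := by
    rw [← Finset.sum_sub_distrib, ← Finset.sum_congr rfl step, Finset.sum_add_distrib]
    simp only [hahnPoly, Finset.mul_sum, c]
  rw [expand, shift, Finset.sum_range_succ, add_sub_right_comm, ← Finset.sum_sub_distrib,
    hahnPoly, Finset.sum_range_succ, mul_add, Finset.mul_sum]
  congr 1
  · refine Finset.sum_congr rfl fun k hk => ?_
    obtain ⟨p, rfl⟩ : ∃ p, n = k + p + 1 := ⟨n - k - 1, by have := Finset.mem_range.1 hk; omega⟩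
    rw [show k + p + 1 - k = p + 1 by omega, show k + p + 1 - (k + 1) = p by omega,
      qPoch_succ' (Z / q * q ^ k), show Z / q * q ^ k * q = Z * q ^ k by field_simp,
      qPoch_succ (Z * q ^ k)]
    -- After the shift, term and correction share all other factors. What is left is a rational
    -- identity that uses only $UZ=1$.
    have key : (1 - Z / q * q ^ k) * ((q ^ k)⁻¹ - A * B * U) -
        ((q ^ k)⁻¹ * (1 - (q ^ (k + p + 1))⁻¹ * q ^ k) *
          (1 - A * B * q ^ (k + p + 1) / q * q ^ k)) =
        ((q ^ (k + p + 1))⁻¹ - A * B * U) * (1 - Z * q ^ k * q ^ p) := by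
      rw [pow_succ, pow_add]
      field_simp
      linear_combination (A * B * q ^ (2 * k + p) - A * B * q ^ (2 * k + 2 * p + 1)) * hU
    simp only [c, show k + p + 1 - k = p + 1 by omega]
    linear_combination qcoef q (k + p + 1) k * qPoch (A * B * q ^ (k + p + 1) / q) q k *
      qPoch (A * q ^ k) q (p + 1) * qPoch (Z * q ^ k) q p * qPoch V q k * key
  · simp only [c, Nat.sub_self, qPoch_zero]; ring

/-- Evaluates the right-hand side of `qVandermonde_qcoef` at the parameters of the $q$-Hahn
polynomials, for the end point and for the top degree alike. -/
lemma prod_sub_eq_qPoch (hq0 : 0 < q) (A B : ℝ) (x p : ℕ) :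
    ∏ j ∈ Finset.range x, (A * B * q ^ (x + p) / q - A * q ^ j) =
      (-A) ^ x * q ^ (x.choose 2) * qPoch (B * q ^ p) q x := by
  induction x generalizing p with
  | zero => simp
  | succ x ih =>
    rw [Finset.prod_range_succ, show x + 1 + p = x + (p + 1) by ring, ih, qPoch_succ',
      Nat.choose_succ_succ' x 1, Nat.choose_one_right, pow_add q x (x.choose (1 + 1)),
      show B * q ^ p * q = B * q ^ (p + 1) by ring]
    have : A * B * q ^ (x + (p + 1)) / q = A * B * q ^ (x + p) := by field_simp; ring
    rw [this]; ring

/-- The value of a `q`-Hahn polynomial at the right end point `x = N`. -/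
lemma hahnPoly_end (hq0 : 0 < q) (hq1 : q < 1) (A B : ℝ) (n : ℕ) (Z : ℝ) :
    hahnPoly q A B n Z Z = qPoch Z q n * ((-A) ^ n * q ^ (n.choose 2) * qPoch B q n) := by
  have h := qVandermonde_qcoef hq0 hq1 (A * B * q ^ n / q) A n
  have h' := prod_sub_eq_qPoch hq0 A B n 0
  rw [add_zero, pow_zero, mul_one] at h'
  rw [← h', ← h, hahnPoly, Finset.mul_sum]
  refine Finset.sum_congr rfl fun k hk => ?_
  rw [qPoch_split Z q (show k ≤ n by have := Finset.mem_range.1 hk; omega)]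
  ring

/-- The `q`-Hahn polynomial of top degree `n = N`. -/
lemma hahnPoly_top (hq0 : 0 < q) (hq1 : q < 1) (A B : ℝ) (x p : ℕ) :
    hahnPoly q A B (x + p) (q ^ x)⁻¹ (q ^ (x + p))⁻¹ =
      qPoch (q ^ (x + p))⁻¹ q (x + p) * qPoch (A * q ^ x) q p *
        ((-A) ^ x * q ^ (x.choose 2) * qPoch (B * q ^ p) q x) := by
  rw [← prod_sub_eq_qPoch hq0, ← qVandermonde_qcoef hq0 hq1, hahnPoly, Finset.mul_sum]
  have hs : Finset.range (x + 1) ⊆ Finset.range (x + p + 1) :=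
    Finset.range_subset_range.2 (by omega)
  rw [← Finset.sum_subset hs]
  · refine Finset.sum_congr rfl fun k hk => ?_
    have hk' : k ≤ x := by have := Finset.mem_range.1 hk; omega
    -- Since $Z=q^{-n}$, the factor $(q^{-n};q)_k$ of `qcoef` completes the $Z$-symbol to $(Z;q)_n$,
    -- and $(q^{-x};q)_k$ takes its place. This leaves a $q$-Vandermonde sum of length $x$.
    rw [qPoch_split (q ^ (x + p))⁻¹ q (show k ≤ x + p by omega), qcoef, qcoef,
      show x + p - k = (x - k) + p by omega, qPoch_add (A * q ^ k) q (x - k) p, mul_assoc A (q ^ k),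
      ← pow_add, Nat.add_sub_cancel' hk']
    ring
  · intro k _ hk
    rw [qPoch_inv_pow_eq_zero hq0 (by simpa using hk)]
    simp

lemma two_mul_choose_two (n : ℕ) : 2 * n.choose 2 + n = n * n := by
  induction n with
  | zero => rfl
  | succ n ih => rw [Nat.choose_succ_succ' n 1, Nat.choose_one_right]; linarith

/-- The weight of the `q`-Hahn polynomials in multiplicative form. -/
def hW (q A B : ℝ) (N x : ℕ) : ℝ :=
  qPoch A q x * qPoch B q (N - x) / (qPoch q q x * qPoch q q (N - x)) * A ^ (N - x)

/-- The squared norm of the `q`-Hahn polynomials in multiplicative form. -/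
def hE (q A B : ℝ) (N n : ℕ) : ℝ :=
  qPoch (A * B) q (n + N) / qPoch q q (N - n) * (q ^ (2 * n.choose 2) / q ^ (2 * N * n)) *
    ((1 - A * B / q) / (1 - q ^ (2 * n) * (A * B / q))) *
    (qPoch q q n * qPoch A q n * qPoch B q n / qPoch (A * B / q) q n) * A ^ n

/-- Reversed form of the `q`-Chu–Vandermonde sum. -/
lemma qVandermonde_reversed (hq0 : 0 < q) (hq1 : q < 1) {A B : ℝ} (hA : A ≠ 0) (hB : B ≠ 0)
    (N : ℕ) : ∑ x ∈ Finset.range (N + 1), qbin q N x * A ^ x * q ^ (2 * x.choose 2) *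
      qPoch (A * q ^ x) q (N - x) * qPoch (B * q ^ (N - x)) q x = qPoch (A * B * q ^ N / q) q N := by
  have hqn : q ≠ 0 := hq0.ne'
  have h0 := qPoch_reverse hq0 (a := A * B * q ^ N / q)
    (div_ne_zero (mul_ne_zero (mul_ne_zero hA hB) (pow_ne_zero _ hqn)) hqn) N
  -- With these inverted parameters every symbol is of the kind treated by `qPoch_reverse`.
  -- Reversing all of them gives the claim up to powers of $A$, $B$, $q$, which are matched in `e6`.
  have h1 := qVandermonde q (q / (A * q ^ N)) (q / (B * q ^ N)) N
  rw [show q / (A * q ^ N) * (q / (B * q ^ N)) = q / (A * B * q ^ N / q * q ^ N) by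
    field_simp] at h1
  rw [← h1, ← Finset.sum_flip, Finset.sum_mul, Finset.sum_mul] at h0
  have hsgn : ((-1 : ℝ) ^ N) * (-1) ^ N = 1 := by rw [← mul_pow]; simp
  have h2 : qPoch (A * B * q ^ N / q) q N =
      (-1) ^ N * ((-1) ^ N * qPoch (A * B * q ^ N / q) q N) := by rw [← mul_assoc, hsgn, one_mul]
  rw [h2, ← h0, Finset.mul_sum]
  refine Finset.sum_congr rfl fun x hx => ?_
  obtain ⟨p, rfl⟩ : ∃ p, N = x + p := ⟨N - x, by have := Finset.mem_range.1 hx; omega⟩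
  rw [show x + p - x = p by omega, show x + p - p = x by omega]
  have e1 := qPoch_reverse hq0 (a := A * q ^ x) (mul_ne_zero hA (pow_ne_zero _ hqn)) p
  have e2 := qPoch_reverse hq0 (a := B * q ^ p) (mul_ne_zero hB (pow_ne_zero _ hqn)) x
  rw [mul_assoc A, ← pow_add] at e1
  rw [mul_assoc B, ← pow_add, add_comm p x] at e2
  have e3 : qbin q (x + p) x = qbin q (x + p) p := by
    rw [qbin_add hq0 hq1, add_comm x p, qbin_add hq0 hq1, mul_comm]
  have e4 : qPoch (A * q ^ x) q p = (-1) ^ p * ((-1) ^ p * qPoch (A * q ^ x) q p) := by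
    rw [← mul_assoc, ← mul_pow]; simp
  have e5 : qPoch (B * q ^ p) q x = (-1) ^ x * ((-1) ^ x * qPoch (B * q ^ p) q x) := by
    rw [← mul_assoc, ← mul_pow]; simp
  rw [e3, e4, e5, ← e1, ← e2, pow_add (-1 : ℝ) x p]
  have e6 : A ^ x * q ^ (2 * x.choose 2) * ((A * q ^ x) ^ p * q ^ p.choose 2) *
      ((B * q ^ p) ^ x * q ^ x.choose 2) =
      (q / (B * q ^ (x + p))) ^ p * (A * B * q ^ (x + p) / q) ^ (x + p) *
        q ^ ((x + p).choose 2) := by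
    have c1 := two_mul_choose_two x
    have c2 := two_mul_choose_two p
    have c3 := two_mul_choose_two (x + p)
    have c4 : (x + p).choose 2 = x.choose 2 + p.choose 2 + x * p := by nlinarith
    have e7 : (q / (B * q ^ (x + p))) ^ p * (A * B * q ^ (x + p) / q) ^ p = A ^ p := by
      rw [← mul_pow]; congr 1; field_simp
    have e8 : (A * B * q ^ (x + p) / q) ^ x * q ^ x =
        A ^ x * B ^ x * q ^ (2 * x.choose 2) * q ^ x * q ^ (p * x) := by
      rw [← mul_pow, div_mul_cancel₀ _ hqn, mul_pow, mul_pow, ← pow_mul, mul_assoc _ _ (q ^ x),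
        ← pow_add q _ x, c1]
      ring
    have e9 := mul_right_cancel₀ (pow_ne_zero x hqn)
      (e8.trans (by ring : _ = A ^ x * B ^ x * q ^ (2 * x.choose 2) * q ^ (p * x) * q ^ x))
    rw [pow_add (A * B * q ^ (x + p) / q) x p, e9, c4]
    linear_combination (-A ^ x * B ^ x * q ^ (2 * x.choose 2) * q ^ (p * x) *
      q ^ (x.choose 2 + p.choose 2 + x * p)) * e7
  linear_combination qbin q (x + p) p * qPoch (q / (A * q ^ (x + p))) q p *
    qPoch (q / (B * q ^ (x + p))) q x * (-1) ^ x * (-1) ^ p * e6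

end HahnPolynomials

/-! ### Normalized `q`-Hahn functions -/

section HahnFunctions

variable {q : ℝ}

lemma rpow_add_one_lt (hq0 : 0 < q) (hq1 : q < 1) {α : ℝ} (hα : 0 < α) : q ^ (α + 1) < q := by
  calc q ^ (α + 1) < q ^ (1 : ℝ) := Real.rpow_lt_rpow_of_exponent_gt hq0 hq1 (by linarith)
    _ = q := Real.rpow_one q

lemma hW_pos (hq0 : 0 < q) (hq1 : q < 1) {A B : ℝ} (hA0 : 0 < A) (hA : A < q) (hB0 : 0 < B)
    (hB : B < q) (N x : ℕ) : 0 < hW q A B N x := by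
  have h1 := qPoch_pos hq0 hq1 hq0.le hq1
  have h2 := qPoch_pos hq0 hq1 hA0.le (hA.trans hq1)
  have h3 := qPoch_pos hq0 hq1 hB0.le (hB.trans hq1)
  exact mul_pos (div_pos (mul_pos (h2 _) (h3 _)) (mul_pos (h1 _) (h1 _))) (pow_pos hA0 _)

lemma mul_div_lt_one (hq0 : 0 < q) (hq1 : q < 1) {A B : ℝ} (hA : A < q) (hB0 : 0 < B)
    (hB : B < q) : A * B / q < 1 := by
  rw [div_lt_one hq0]; nlinarith

lemma hE_pos (hq0 : 0 < q) (hq1 : q < 1) {A B : ℝ} (hA0 : 0 < A) (hA : A < q) (hB0 : 0 < B)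
    (hB : B < q) (N n : ℕ) : 0 < hE q A B N n := by
  have hAB := mul_div_lt_one hq0 hq1 hA hB0 hB
  have hAB0 : 0 < A * B / q := by positivity
  have h0 : A * B < 1 := by rw [div_lt_one hq0] at hAB; linarith
  have h1 := qPoch_pos hq0 hq1 hq0.le hq1
  have h2 := qPoch_pos hq0 hq1 hA0.le (hA.trans hq1)
  have h3 := qPoch_pos hq0 hq1 hB0.le (hB.trans hq1)
  have h4 := qPoch_pos hq0 hq1 hAB0.le hAB
  have h5 := qPoch_pos hq0 hq1 (by positivity : (0 : ℝ) ≤ A * B) h0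
  have h6 : q ^ (2 * n) * (A * B / q) < 1 := by
    have := pow_le_one₀ hq0.le hq1.le (n := 2 * n)
    nlinarith
  exact mul_pos (mul_pos (mul_pos (mul_pos (div_pos (h5 _) (h1 _)) (by positivity))
    (div_pos (by linarith) (by linarith)))
    (div_pos (mul_pos (mul_pos (h1 _) (h2 _)) (h3 _)) (h4 _))) (pow_pos hA0 _)

lemma hahnWeight_eq (hq0 : 0 < q) {x N : ℕ} (hx : x ≤ N) (α β : ℝ) :
    hahnWeight q x α β N = hW q (q ^ (α + 1)) (q ^ (β + 1)) N x := by
  rw [hahnWeight, hW, mul_comm ((N : ℝ) - x), Real.rpow_mul hq0.le, ← Nat.cast_sub hx,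
    Real.rpow_natCast]

lemma rpow_params (hq0 : 0 < q) (α β : ℝ) :
    q ^ (α + β + 2) = q ^ (α + 1) * q ^ (β + 1) ∧
    q ^ (α + β + 1) = q ^ (α + 1) * q ^ (β + 1) / q := by
  have h : q ^ (α + β + 2) = q ^ (α + 1) * q ^ (β + 1) := by
    rw [← Real.rpow_add hq0]; congr 1; ring
  refine ⟨h, ?_⟩
  rw [← h, eq_div_iff hq0.ne', ← Real.rpow_add_one hq0.ne']; congr 1; ring

lemma hahnNorm_eq (hq0 : 0 < q) (n N : ℕ) (α β : ℝ) :
    hahnNorm q n α β N = hE q (q ^ (α + 1)) (q ^ (β + 1)) N n := by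
  obtain ⟨h1, h2⟩ := rpow_params hq0 α β
  have h3 : q ^ (2 * (n : ℝ) + α + β + 1) = q ^ (2 * n) * (q ^ (α + 1) * q ^ (β + 1) / q) := by
    rw [← h2, ← Real.rpow_natCast, ← Real.rpow_add hq0]; congr 1; push_cast; ring
  have h4 : q ^ (2 * (n.choose 2 : ℝ) - 2 * N * n) = q ^ (2 * n.choose 2) / q ^ (2 * N * n) := by
    rw [← Real.rpow_natCast, ← Real.rpow_natCast, ← Real.rpow_sub hq0]; congr 1; push_cast; ring
  have h5 : q ^ ((n : ℝ) * (α + 1)) = (q ^ (α + 1)) ^ n := by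
    rw [mul_comm, Real.rpow_mul hq0.le, Real.rpow_natCast]
  rw [hahnNorm, hE, h1, h2, h3, h4, h5]

/-- The series terminates because $(q^{-n};q)_k=0$ for $k>n$. The assumption $n\le N$ keeps the
denominator $(q^{-N};q)_k$ non-zero for $k\le n$, so that it cancels against the prefactor. -/
lemma hahn_eq (hq0 : 0 < q) (hq1 : q < 1) {n N : ℕ} (hn : n ≤ N) (x : ℕ) {α β : ℝ} (hα : 0 < α) :
    hahn q n x α β N =
      hahnPoly q (q ^ (α + 1)) (q ^ (β + 1)) n (q ^ x)⁻¹ (q ^ N)⁻¹ := by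
  have hinv : ∀ m : ℕ, q ^ (-(m : ℝ)) = (q ^ m)⁻¹ := fun m => by
    rw [Real.rpow_neg hq0.le, Real.rpow_natCast]
  have h1 : q ^ ((n : ℝ) + α + β + 1) = q ^ (α + 1) * q ^ (β + 1) * q ^ n / q := by
    rw [mul_div_right_comm, ← (rpow_params hq0 α β).2, ← Real.rpow_natCast, ← Real.rpow_add hq0]
    congr 1; ring
  rw [hahn, basicHyp, hinv, hinv, hinv, h1, tsum_eq_sum (s := Finset.range (n + 1))]
  · rw [hahnPoly, Finset.mul_sum]
    refine Finset.sum_congr rfl fun k hk => ?_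
    have hk' : k ≤ n := by have := Finset.mem_range.1 hk; omega
    have hA : qPoch (q ^ (α + 1)) q k ≠ 0 := (qPoch_pos hq0 hq1 (Real.rpow_pos_of_pos hq0 _).le
      ((rpow_add_one_lt hq0 hq1 hα).trans hq1) k).ne'
    have hZ : qPoch (q ^ N)⁻¹ q k ≠ 0 := by
      intro h0
      obtain ⟨p, rfl⟩ : ∃ p, N = k + p := ⟨N - k, by omega⟩
      have := qPoch_inv_pow hq0 k p
      rw [h0, zero_mul, zero_mul] at this
      exact mul_ne_zero (mul_ne_zero (pow_ne_zero _ (by norm_num)) (pow_ne_zero _ hq0.ne'))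
        (qPoch_q_ne_zero hq0 hq1 _) this.symm
    have hQ := qPoch_q_ne_zero hq0 hq1 k
    rw [qPoch_split (q ^ (α + 1)) q hk', qPoch_split (q ^ N)⁻¹ q hk', qcoef]
    simp only [List.map_cons, List.map_nil, List.prod_cons, List.prod_nil, List.length_cons,
      List.length_nil]
    norm_num
    generalize qPoch (q ^ (α + 1)) q k = u at *
    generalize qPoch (q ^ N)⁻¹ q k = v at *
    generalize qPoch q q k = w at *
    field_simp
  · intro k hk
    simp [qPoch_inv_pow_eq_zero hq0 (show n < k by simpa using hk)]

lemma hahnHat_eq_zero_left {n : ℕ} {x N : ℤ} {α β : ℝ} (h : x < 0) : hahnHat q n x α β N = 0 :=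
  if_neg (by omega)

lemma hahnHat_eq_zero_right {n : ℕ} {x N : ℤ} {α β : ℝ} (h : N < x) : hahnHat q n x α β N = 0 :=
  if_neg (by omega)

lemma hahnHat_eq_zero_deg {n : ℕ} {x N : ℤ} {α β : ℝ} (h : N < n) : hahnHat q n x α β N = 0 :=
  if_neg (by omega)

lemma hahnHat_eq (hq0 : 0 < q) (hq1 : q < 1) {n N x : ℕ} (hn : n ≤ N) (hx : x ≤ N) {α β : ℝ}
    (hα : 0 < α) :
    hahnHat q n x α β N = √(hW q (q ^ (α + 1)) (q ^ (β + 1)) N x /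
      hE q (q ^ (α + 1)) (q ^ (β + 1)) N n) *
        hahnPoly q (q ^ (α + 1)) (q ^ (β + 1)) n (q ^ x)⁻¹ (q ^ N)⁻¹ := by
  rw [hahnHat, if_pos ⟨by omega, by omega, by omega⟩, Int.toNat_natCast, Int.toNat_natCast,
    hahnWeight_eq hq0 hx, hahnNorm_eq hq0, Int.cast_natCast, Int.cast_natCast,
    hahn_eq hq0 hq1 hn x hα]

/-- Together with `hW_succ` and `hE_succ`: quotients of neighbouring weights and norms consist of
the factors that make up the ladder constants. Hence the square roots in the ladder relations can be
combined. -/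
lemma hW_succ_succ (hq0 : 0 < q) (hq1 : q < 1) (A B : ℝ) (N x : ℕ) :
    hW q A B (N + 1) (x + 1) * (1 - q * q ^ x) = hW q A B N x * (1 - A * q ^ x) := by
  have h1 := qPoch_q_ne_zero hq0 hq1
  have h2 := one_sub_pow_succ_ne_zero hq0 hq1 x
  rw [hW, hW, Nat.add_sub_add_right, qPoch_succ, qPoch_succ]
  have := h1 x; have := h1 (N - x)
  generalize qPoch q q x = u at *
  generalize qPoch q q (N - x) = v at *
  generalize 1 - q * q ^ x = w at *
  field_simp

lemma hW_succ (hq0 : 0 < q) (hq1 : q < 1) (A B : ℝ) (x p : ℕ) :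
    hW q A B (x + p + 1) x * (1 - q * q ^ p) = hW q A B (x + p) x * (A * (1 - B * q ^ p)) := by
  have h1 := qPoch_q_ne_zero hq0 hq1
  have h2 := one_sub_pow_succ_ne_zero hq0 hq1 p
  rw [hW, hW, show x + p + 1 - x = p + 1 by omega, Nat.add_sub_cancel_left, qPoch_succ, qPoch_succ,
    pow_succ]
  have := h1 x; have := h1 p
  generalize qPoch q q x = u at *
  generalize qPoch q q p = v at *
  generalize 1 - q * q ^ p = w at *
  field_simp

lemma hE_succ (hq0 : 0 < q) (hq1 : q < 1) (A B : ℝ) (n p : ℕ) :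
    hE q A B (n + p + 1) n * ((1 - q * q ^ p) * (q ^ n) ^ 2) =
      hE q A B (n + p) n * (1 - A * B * q ^ (2 * n + p)) := by
  have h1 := qPoch_q_ne_zero hq0 hq1 p
  have h2 := one_sub_pow_succ_ne_zero hq0 hq1 p
  have hq := hq0.ne'
  rw [hE, hE, show n + p + 1 - n = p + 1 by omega, Nat.add_sub_cancel_left,
    show n + (n + p + 1) = 2 * n + p + 1 by ring, show n + (n + p) = 2 * n + p by ring, qPoch_succ,
    qPoch_succ, show 2 * (n + p + 1) * n = 2 * (n + p) * n + 2 * n by ring, pow_add q (2 * (n + p) * n)]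
  generalize (1 - A * B / q) / (1 - q ^ (2 * n) * (A * B / q)) *
    1 = t at *
  generalize (qPoch q q n * qPoch A q n * qPoch B q n / qPoch (A * B / q) q n) = s
  generalize (1 - A * B / q) / (1 - q ^ (2 * n) * (A * B / q)) = t
  generalize qPoch q q p = v at *
  generalize 1 - q * q ^ p = w at *
  rw [← pow_mul, mul_comm n 2]
  field_simp

/-- The matrix coefficients `√σ_x` of the ladder operators, extended by zero. -/
def ladder (q α : ℝ) (x : ℤ) : ℝ := if 0 ≤ x then √(structConst q α x.toNat) else 0

lemma ladder_natCast (q α : ℝ) (x : ℕ) : ladder q α x = √(structConst q α x) := by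
  simp [ladder]

@[simp] lemma ladder_zero (q α : ℝ) : ladder q α 0 = 0 := by simp [ladder, structConst]

lemma ladder_of_neg {α : ℝ} {x : ℤ} (h : x < 0) : ladder q α x = 0 := if_neg (by omega)

lemma ladder_succ (hq0 : 0 < q) (α : ℝ) (x : ℕ) : ladder q α ((x + 1 : ℕ) : ℤ) =
    √(q ^ (1 / 2 : ℝ) / (1 - q) ^ 2 * ((1 - q * q ^ x) * (1 - q ^ (α + 1) * q ^ x))) := by
  rw [ladder_natCast, structConst]
  have : q ^ (((x + 1 : ℕ) : ℝ) + α) = q ^ (α + 1) * q ^ x := by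
    rw [← Real.rpow_natCast, ← Real.rpow_add hq0]; congr 1; push_cast; ring
  rw [this, pow_succ']
  congr 1; ring

/-- The pattern by which square roots leave the ladder relations: the product of two roots becomes a
common root $\sqrt Q$ times a rational factor $t$. -/
lemma sqrt_mul_sqrt_eq {a b Q t : ℝ} (ha : 0 ≤ a) (hQ : 0 ≤ Q) (ht : 0 ≤ t) (h : a * b = Q * t ^ 2) :
    √a * √b = √Q * t := by
  rw [← Real.sqrt_mul ha, h, Real.sqrt_mul hQ, Real.sqrt_sq ht]

lemma sqrt_mul_sqrt_mul_eq {a b Q t : ℝ} (P : ℝ) (ha : 0 ≤ a) (hQ : 0 ≤ Q) (ht : 0 ≤ t)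
    (h : a * b = Q * t ^ 2) : √a * (√b * P) = √Q * (t * P) := by
  rw [← mul_assoc, sqrt_mul_sqrt_eq ha hQ ht h, mul_assoc]

/-- As a square root the weight factor can be merged with the roots of the structure constants. -/
lemma rpow_half_shift (hq0 : 0 < q) (α : ℝ) (x : ℕ) :
    q ^ ((x : ℝ) + (α + 1) / 2) = √((q ^ x) ^ 2 * q ^ (α + 1)) := by
  rw [Real.sqrt_eq_rpow, ← pow_mul, ← Real.rpow_natCast, ← Real.rpow_add hq0, ← Real.rpow_mul hq0.le]
  congr 1; push_cast; ring

lemma coupled_param (hq0 : 0 < q) (n : ℕ) (α β : ℝ) :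
    q ^ (2 * (n : ℝ) + α + β + 1 + 1) = q ^ (α + 1) * q ^ (β + 1) * q ^ (2 * n) := by
  rw [← Real.rpow_natCast, ← Real.rpow_add hq0, ← Real.rpow_add hq0]; congr 1; push_cast; ring

lemma structFactor_pos (hq0 : 0 < q) (hq1 : q < 1) : 0 < q ^ (1 / 2 : ℝ) / (1 - q) ^ 2 :=
  div_pos (Real.rpow_pos_of_pos hq0 _) (pow_pos (by linarith) 2)

lemma one_sub_mul_pow_pos (hq0 : 0 < q) (hq1 : q < 1) {A : ℝ} (hA0 : 0 < A) (hA : A < q) (k : ℕ) :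
    0 < 1 - A * q ^ k := by
  have := pow_le_one₀ hq0.le hq1.le (n := k)
  nlinarith

lemma one_sub_pow_succ_pos (hq0 : 0 < q) (hq1 : q < 1) (k : ℕ) : 0 < 1 - q * q ^ k := by
  have : q * q ^ k < 1 := by rw [← pow_succ']; exact pow_lt_one₀ hq0.le hq1 (Nat.succ_ne_zero k)
  linarith

lemma mul_mul_pow_pos (hq0 : 0 < q) (hq1 : q < 1) {A B : ℝ} (hA0 : 0 < A) (hA : A < q)
    (hB0 : 0 < B) (hB : B < q) (k : ℕ) : 0 < 1 - A * B * q ^ k :=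
  one_sub_mul_pow_pos hq0 hq1 (mul_pos hA0 hB0) (by nlinarith) k

/-- All three terms carry the same root $\sqrt Q$. Without it the relation is `hahnPoly_raise` for
$X=q^x$ and $U=q^{N+1}$. -/
lemma hahnHat_raise_nat (hq0 : 0 < q) (hq1 : q < 1) {α β : ℝ} (hα : 0 < α) (hβ : 0 < β)
    {n N x : ℕ} (hn : n ≤ N) (hx : x ≤ N + 1) :
    ladder q α x * hahnHat q n ((x : ℤ) - 1) α β N +
      q ^ ((x : ℝ) + (α + 1) / 2) * ladder q β ((N + 1 : ℕ) - x : ℤ) * hahnHat q n x α β N =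
    ladder q (2 * n + α + β + 1) ((N + 1 : ℕ) - n : ℤ) * hahnHat q n x α β (N + 1 : ℕ) := by
  have hA0 := Real.rpow_pos_of_pos hq0 (α + 1)
  have hA := rpow_add_one_lt hq0 hq1 hα
  have hB0 := Real.rpow_pos_of_pos hq0 (β + 1)
  have hB := rpow_add_one_lt hq0 hq1 hβ
  have hc := structFactor_pos hq0 hq1
  have hcpl := coupled_param hq0 n α β
  have hlA := ladder_succ hq0 α
  have hlB := ladder_succ hq0 β
  have hlC := ladder_succ hq0 (2 * n + α + β + 1)
  have hrp := rpow_half_shift hq0 α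
  have hhat : ∀ {n N x : ℕ}, n ≤ N → x ≤ N → _ := fun hn hx =>
    hahnHat_eq (q := q) hq0 hq1 hn hx (α := α) (β := β) hα
  rw [hcpl] at hlC
  have hWp := hW_pos hq0 hq1 hA0 hA hB0 hB
  have hEp := hE_pos hq0 hq1 hA0 hA hB0 hB
  generalize q ^ (α + 1) = A at *
  generalize q ^ (β + 1) = B at *
  generalize q ^ (1 / 2 : ℝ) / (1 - q) ^ 2 = c at *
  set Q := c * hW q A B (N + 1) x / hE q A B N n with hQdef
  have hQ : 0 ≤ Q := (div_pos (mul_pos hc (hWp _ _)) (hEp _ _)).le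
  have hEne := (hEp N n).ne'
  have hEne' := (hEp (N + 1) n).ne'
  have c1 : ladder q α x * hahnHat q n ((x : ℤ) - 1) α β N =
      √Q * ((1 - q ^ x) * hahnPoly q A B n ((q ^ x)⁻¹ * q) ((q ^ (N + 1))⁻¹ * q)) := by
    rcases x with _ | x
    · simp
    · have e1 : (q ^ (x + 1))⁻¹ * q = (q ^ x)⁻¹ := by field_simp; ring
      have e2 : (q ^ (N + 1))⁻¹ * q = (q ^ N)⁻¹ := by field_simp; ring
      rw [show (((x + 1 : ℕ) : ℤ) - 1) = (x : ℤ) by push_cast; ring, hlA, hhat hn (by omega), e1, e2]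
      have h0 := one_sub_pow_succ_pos hq0 hq1 x
      have h1 := one_sub_mul_pow_pos hq0 hq1 hA0 hA x
      refine sqrt_mul_sqrt_mul_eq _ (by positivity) hQ (by rw [pow_succ']; exact h0.le) ?_
      have := hW_succ_succ hq0 hq1 A B N x
      rw [hQdef, pow_succ', mul_div_assoc', div_mul_eq_mul_div, div_left_inj' hEne]
      linear_combination (-c * (1 - q * q ^ x)) * this
  have c2 : q ^ ((x : ℝ) + (α + 1) / 2) * ladder q β ((N + 1 : ℕ) - x : ℤ) * hahnHat q n x α β N =
      √Q * ((q ^ x - q ^ (N + 1)) * hahnPoly q A B n (q ^ x)⁻¹ ((q ^ (N + 1))⁻¹ * q)) := by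
    rcases Nat.lt_or_ge N x with h | h
    · obtain rfl : x = N + 1 := by omega
      simp
    · obtain ⟨p, rfl⟩ : ∃ p, N = x + p := ⟨N - x, by omega⟩
      have e2 : (q ^ (x + p + 1))⁻¹ * q = (q ^ (x + p))⁻¹ := by field_simp; ring
      rw [show (((x + p + 1 : ℕ) : ℤ) - (x : ℤ)) = ((p + 1 : ℕ) : ℤ) by push_cast; ring, hlB,
        hhat hn (by omega), e2, hrp]
      have h0 := one_sub_pow_succ_pos hq0 hq1 p
      have h1 := one_sub_mul_pow_pos hq0 hq1 hB0 hB p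
      have e3 : q ^ x - q ^ (x + p + 1) = q ^ x * (1 - q * q ^ p) := by ring
      rw [← Real.sqrt_mul (by positivity), e3]
      refine sqrt_mul_sqrt_mul_eq _ (by positivity) hQ (by positivity) ?_
      have := hW_succ hq0 hq1 A B x p
      rw [hQdef, mul_div_assoc', div_mul_eq_mul_div, div_left_inj' hEne]
      linear_combination (-c * (q ^ x) ^ 2 * (1 - q * q ^ p)) * this
  have c3 : ladder q (2 * n + α + β + 1) ((N + 1 : ℕ) - n : ℤ) * hahnHat q n x α β (N + 1 : ℕ) =
      √Q * ((q ^ n - q ^ (N + 1)) * hahnPoly q A B n (q ^ x)⁻¹ (q ^ (N + 1))⁻¹) := by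
    obtain ⟨p, rfl⟩ : ∃ p, N = n + p := ⟨N - n, by omega⟩
    rw [show (((n + p + 1 : ℕ) : ℤ) - (n : ℤ)) = ((p + 1 : ℕ) : ℤ) by push_cast; ring, hlC,
      hhat (by omega) hx]
    have h0 := one_sub_pow_succ_pos hq0 hq1 p
    have h1 := mul_mul_pow_pos hq0 hq1 hA0 hA hB0 hB (2 * n + p)
    have e3 : q ^ n - q ^ (n + p + 1) = q ^ n * (1 - q * q ^ p) := by ring
    rw [e3]
    have e4 : A * B * q ^ (2 * n) * q ^ p = A * B * q ^ (2 * n + p) := by ring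
    rw [e4]
    refine sqrt_mul_sqrt_mul_eq _ (by positivity) hQ (by positivity) ?_
    have := hE_succ hq0 hq1 A B n p
    rw [hQdef, mul_div_assoc', div_mul_eq_mul_div, div_eq_div_iff hEne' hEne]
    linear_combination (-c * (1 - q * q ^ p) * hW q A B (n + p + 1) x) * this
  rw [c1, c2, c3, ← mul_add]
  congr 1
  exact hahnPoly_raise q A B n (mul_inv_cancel₀ (pow_ne_zero _ hq0.ne'))
    (mul_inv_cancel₀ (pow_ne_zero _ hq0.ne'))

/-- Each term has a vanishing factor: $(q^{-x};q)_k$ if $k>N$, and the $Z$-symbol if $k\le N$. This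
lets the degree $n=N+1$ be included in `hahnHat_lower_nat`. -/
lemma hahnPoly_eq_zero (hq0 : 0 < q) (A B : ℝ) {n x N : ℕ} (hx : x ≤ N) (hn : N < n) :
    hahnPoly q A B n (q ^ x)⁻¹ (q ^ N)⁻¹ = 0 := by
  refine Finset.sum_eq_zero fun k hk => ?_
  rcases Nat.lt_or_ge N k with h | h
  · rw [qPoch_inv_pow_eq_zero hq0 (show x < k by omega), mul_zero]
  · have : qPoch ((q ^ N)⁻¹ * q ^ k) q (n - k) = 0 := by
      refine Finset.prod_eq_zero (Finset.mem_range.2 (show N - k < n - k by omega)) ?_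
      rw [mul_assoc, ← pow_add, Nat.add_sub_cancel' h, inv_mul_cancel₀ (pow_ne_zero _ hq0.ne'),
        sub_self]
    rw [this, mul_zero, zero_mul]

/-- The same elimination of roots, now leading to `hahnPoly_lower` with $X=q^x$ and $U=q^N$. For
$n=N+1$ it says that a lowest weight vector is annihilated. -/
lemma hahnHat_lower_nat (hq0 : 0 < q) (hq1 : q < 1) {α β : ℝ} (hα : 0 < α) (hβ : 0 < β)
    {n N x : ℕ} (hn : n ≤ N + 1) (hx : x ≤ N) :
    ladder q α (x + 1 : ℕ) * hahnHat q n (x + 1 : ℕ) α β (N + 1 : ℕ) +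
      q ^ ((x : ℝ) + (α + 1) / 2) * ladder q β ((N + 1 : ℕ) - x : ℤ) *
        hahnHat q n x α β (N + 1 : ℕ) =
    ladder q (2 * n + α + β + 1) ((N + 1 : ℕ) - n : ℤ) * hahnHat q n x α β N := by
  have hA0 := Real.rpow_pos_of_pos hq0 (α + 1)
  have hA := rpow_add_one_lt hq0 hq1 hα
  have hB0 := Real.rpow_pos_of_pos hq0 (β + 1)
  have hB := rpow_add_one_lt hq0 hq1 hβ
  have hc := structFactor_pos hq0 hq1
  have hcpl := coupled_param hq0 n α β
  have hlA := ladder_succ hq0 α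
  have hlB := ladder_succ hq0 β
  have hlC := ladder_succ hq0 (2 * n + α + β + 1)
  have hrp := rpow_half_shift hq0 α
  have hhat : ∀ {n N x : ℕ}, n ≤ N → x ≤ N → _ := fun hn hx =>
    hahnHat_eq (q := q) hq0 hq1 hn hx (α := α) (β := β) hα
  rw [hcpl] at hlC
  have hWp := hW_pos hq0 hq1 hA0 hA hB0 hB
  have hEp := hE_pos hq0 hq1 hA0 hA hB0 hB
  generalize q ^ (α + 1) = A at *
  generalize q ^ (β + 1) = B at *
  generalize q ^ (1 / 2 : ℝ) / (1 - q) ^ 2 = c at *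
  set Q := c * hW q A B N x / hE q A B (N + 1) n with hQdef
  have hQ : 0 ≤ Q := (div_pos (mul_pos hc (hWp _ _)) (hEp _ _)).le
  have hEne := (hEp N n).ne'
  have hEne' := (hEp (N + 1) n).ne'
  have c1 : ladder q α (x + 1 : ℕ) * hahnHat q n (x + 1 : ℕ) α β (N + 1 : ℕ) =
      √Q * ((1 - A * q ^ x) * hahnPoly q A B n ((q ^ x)⁻¹ / q) ((q ^ N)⁻¹ / q)) := by
    have e1 : (q ^ (x + 1))⁻¹ = (q ^ x)⁻¹ / q := by field_simp; ring
    have e2 : (q ^ (N + 1))⁻¹ = (q ^ N)⁻¹ / q := by field_simp; ring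
    rw [hlA, hhat hn (by omega), e1, e2]
    have h0 := one_sub_pow_succ_pos hq0 hq1 x
    have h1 := one_sub_mul_pow_pos hq0 hq1 hA0 hA x
    refine sqrt_mul_sqrt_mul_eq _ (by positivity) hQ h1.le ?_
    have := hW_succ_succ hq0 hq1 A B N x
    rw [hQdef, mul_div_assoc', div_mul_eq_mul_div, div_left_inj' hEne']
    linear_combination (c * (1 - A * q ^ x)) * this
  have c2 : q ^ ((x : ℝ) + (α + 1) / 2) * ladder q β ((N + 1 : ℕ) - x : ℤ) *
      hahnHat q n x α β (N + 1 : ℕ) =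
      √Q * (A * (q ^ x - B * q ^ N) * hahnPoly q A B n (q ^ x)⁻¹ ((q ^ N)⁻¹ / q)) := by
    obtain ⟨p, rfl⟩ : ∃ p, N = x + p := ⟨N - x, by omega⟩
    have e2 : (q ^ (x + p + 1))⁻¹ = (q ^ (x + p))⁻¹ / q := by field_simp; ring
    rw [show (((x + p + 1 : ℕ) : ℤ) - (x : ℤ)) = ((p + 1 : ℕ) : ℤ) by push_cast; ring, hlB,
      hhat hn (by omega), e2, hrp]
    have h0 := one_sub_pow_succ_pos hq0 hq1 p
    have h1 := one_sub_mul_pow_pos hq0 hq1 hB0 hB p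
    have e3 : q ^ x - B * q ^ (x + p) = q ^ x * (1 - B * q ^ p) := by ring
    rw [← Real.sqrt_mul (by positivity), e3]
    refine sqrt_mul_sqrt_mul_eq _ (by positivity) hQ (by positivity) ?_
    have := hW_succ hq0 hq1 A B x p
    rw [hQdef, mul_div_assoc', div_mul_eq_mul_div, div_left_inj' hEne']
    linear_combination (c * A * (q ^ x) ^ 2 * (1 - B * q ^ p)) * this
  have c3 : ladder q (2 * n + α + β + 1) ((N + 1 : ℕ) - n : ℤ) * hahnHat q n x α β N =
      √Q * (((q ^ n)⁻¹ - A * B * q ^ N) * hahnPoly q A B n (q ^ x)⁻¹ (q ^ N)⁻¹) := by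
    rcases Nat.lt_or_ge N n with h | h
    · obtain rfl : n = N + 1 := by omega
      rw [hahnPoly_eq_zero hq0 A B hx (Nat.lt_succ_self N)]
      simp
    obtain ⟨p, rfl⟩ : ∃ p, N = n + p := ⟨N - n, by omega⟩
    rw [show (((n + p + 1 : ℕ) : ℤ) - (n : ℤ)) = ((p + 1 : ℕ) : ℤ) by push_cast; ring, hlC,
      hhat (by omega) hx]
    have h0 := one_sub_pow_succ_pos hq0 hq1 p
    have h1 := mul_mul_pow_pos hq0 hq1 hA0 hA hB0 hB (2 * n + p)
    have hqn : q ^ n ≠ 0 := pow_ne_zero _ hq0.ne'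
    have e3 : (q ^ n)⁻¹ - A * B * q ^ (n + p) = (q ^ n)⁻¹ * (1 - A * B * q ^ (2 * n + p)) := by
      field_simp; ring
    rw [e3]
    have e4 : A * B * q ^ (2 * n) * q ^ p = A * B * q ^ (2 * n + p) := by ring
    rw [e4]
    refine sqrt_mul_sqrt_mul_eq _ (by positivity) hQ (by positivity) ?_
    have := hE_succ hq0 hq1 A B n p
    rw [hQdef, mul_div_assoc', div_mul_eq_mul_div, div_eq_div_iff hEne hEne']
    have e5 : (q ^ n)⁻¹ * q ^ n = 1 := inv_mul_cancel₀ hqn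
    linear_combination c * (1 - A * B * q ^ (2 * n + p)) * hW q A B (n + p) x *
      (((q ^ n)⁻¹) ^ 2 * this -
        hE q A B (n + p + 1) n * (1 - q * q ^ p) * ((q ^ n)⁻¹ * q ^ n + 1) * e5)
  rw [c1, c2, c3, ← mul_add]
  congr 1
  exact hahnPoly_lower hq0 hq1 A B n (mul_inv_cancel₀ (pow_ne_zero _ hq0.ne'))
    (mul_inv_cancel₀ (pow_ne_zero _ hq0.ne'))

/-- `A₊` maps a coupled vector to the next one. -/
theorem hahnHat_raise (hq0 : 0 < q) (hq1 : q < 1) {α β : ℝ} (hα : 0 < α) (hβ : 0 < β)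
    (n : ℕ) (x N : ℤ) :
    ladder q α x * hahnHat q n (x - 1) α β (N - 1) +
      q ^ ((x : ℝ) + (α + 1) / 2) * ladder q β (N - x) * hahnHat q n x α β (N - 1) =
    ladder q (2 * n + α + β + 1) (N - n) * hahnHat q n x α β N := by
  rcases lt_or_ge x 0 with hx | hx
  · rw [hahnHat_eq_zero_left hx, hahnHat_eq_zero_left hx, hahnHat_eq_zero_left (by omega)]; simp
  rcases lt_or_ge N x with hxN | hxN
  · rw [hahnHat_eq_zero_right hxN, hahnHat_eq_zero_right (show N - 1 < x by omega),
      hahnHat_eq_zero_right (by omega)]; simp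
  rcases lt_or_ge (N - 1) n with hn | hn
  · rw [hahnHat_eq_zero_deg hn, hahnHat_eq_zero_deg hn]
    rcases lt_or_ge N n with hn' | hn'
    · rw [hahnHat_eq_zero_deg hn']; simp
    · rw [show N - n = 0 by omega]; simp
  · lift x to ℕ using hx
    obtain ⟨M, rfl⟩ : ∃ M : ℕ, N = ((M + 1 : ℕ) : ℤ) := ⟨(N - 1).toNat, by omega⟩
    have := hahnHat_raise_nat hq0 hq1 hα hβ (n := n) (N := M) (x := x) (by omega) (by omega)
    rw [show ((M + 1 : ℕ) : ℤ) - 1 = (M : ℤ) by push_cast; ring, Int.cast_natCast]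
    exact this

/-- `A₋` maps a coupled vector to the previous one. -/
theorem hahnHat_lower (hq0 : 0 < q) (hq1 : q < 1) {α β : ℝ} (hα : 0 < α) (hβ : 0 < β)
    (n : ℕ) (x N : ℤ) :
    ladder q α (x + 1) * hahnHat q n (x + 1) α β (N + 1) +
      q ^ ((x : ℝ) + (α + 1) / 2) * ladder q β (N + 1 - x) * hahnHat q n x α β (N + 1) =
    ladder q (2 * n + α + β + 1) (N + 1 - n) * hahnHat q n x α β N := by
  rcases lt_or_ge x 0 with hx | hx
  · rw [hahnHat_eq_zero_left hx, hahnHat_eq_zero_left hx]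
    rcases lt_or_ge (x + 1) 0 with h | h
    · rw [ladder_of_neg h]; simp
    · rw [show x + 1 = 0 by omega]; simp
  rcases lt_or_ge N x with hxN | hxN
  · rw [hahnHat_eq_zero_right hxN, hahnHat_eq_zero_right (show N + 1 < x + 1 by omega)]
    rcases lt_or_ge (N + 1) x with h | h
    · rw [hahnHat_eq_zero_right h]; simp
    · rw [show N + 1 - x = 0 by omega]; simp
  rcases lt_or_ge (N + 1) n with hn | hn
  · rw [hahnHat_eq_zero_deg hn, hahnHat_eq_zero_deg hn, hahnHat_eq_zero_deg (by omega)]; simp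
  · lift x to ℕ using hx
    lift N to ℕ using by omega
    have := hahnHat_lower_nat hq0 hq1 hα hβ (n := n) (N := N) (x := x) (by omega) (by omega)
    push_cast at this ⊢
    exact this

end HahnFunctions

/-! ### Orthonormality of the `q`-Hahn functions -/

section HahnOrthogonality

variable {q : ℝ}

lemma qPoch_inv_pow_self (hq0 : 0 < q) (N : ℕ) :
    qPoch (q ^ N)⁻¹ q N = (-1) ^ N * q ^ (N.choose 2) / q ^ (N * N) * qPoch q q N := by
  have h := qPoch_inv_pow hq0 N 0
  rw [add_zero, qPoch_zero, mul_one] at h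
  rw [div_mul_eq_mul_div, eq_div_iff (pow_ne_zero _ hq0.ne'), h]

/-- The squared norm of the `q`-Hahn polynomial of top degree. -/
lemma hE_top (hq0 : 0 < q) (hq1 : q < 1) {A B : ℝ} (hA0 : 0 < A) (hA : A < q) (hB0 : 0 < B)
    (hB : B < q) (N : ℕ) : hE q A B N N = q ^ (2 * N.choose 2) / q ^ (2 * (N * N)) *
      qPoch (A * B * q ^ N / q) q N * (qPoch q q N * qPoch A q N * qPoch B q N) * A ^ N := by
  have hAB := mul_div_lt_one hq0 hq1 hA hB0 hB
  have hAB0 : 0 < A * B / q := by positivity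
  have h4 := (qPoch_pos hq0 hq1 hAB0.le hAB N).ne'
  have h6 : q ^ (2 * N) * (A * B / q) < 1 := by
    have := pow_le_one₀ hq0.le hq1.le (n := 2 * N)
    nlinarith
  have h6' : 1 - q ^ (2 * N) * (A * B / q) ≠ 0 := by linarith
  have key : (1 - A * B / q) * qPoch (A * B) q (N + N) =
      qPoch (A * B / q) q N * qPoch (A * B * q ^ N / q) q N * (1 - q ^ (2 * N) * (A * B / q)) := by
    have e1 := qPoch_succ' (A * B / q) q (N + N)
    have e2 := qPoch_succ (A * B / q) q (N + N)
    rw [div_mul_cancel₀ _ hq0.ne'] at e1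
    rw [← e1, e2, qPoch_add, ← two_mul, mul_comm (q ^ (2 * N)), div_mul_eq_mul_div (A * B) q (q ^ N)]
  rw [hE, Nat.sub_self, qPoch_zero, mul_assoc 2 N N]
  generalize qPoch (A * B * q ^ N / q) q N = z at *
  generalize qPoch (A * B / q) q N = y at *
  generalize 1 - q ^ (2 * N) * (A * B / q) = w at *
  generalize qPoch (A * B) q (N + N) = t at *
  generalize q ^ (2 * N.choose 2) / q ^ (2 * (N * N)) = s
  generalize 1 - A * B / q = v at *
  field_simp
  linear_combination s * (qPoch q q N * qPoch A q N * qPoch B q N) * key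

/-- In top degree the polynomial is a product by `hahnPoly_top`, and the sum over $x$ becomes
`qVandermonde_reversed`. -/
lemma hahnPoly_top_norm (hq0 : 0 < q) (hq1 : q < 1) {A B : ℝ} (hA0 : 0 < A) (hA : A < q)
    (hB0 : 0 < B) (hB : B < q) (N : ℕ) :
    ∑ x ∈ Finset.range (N + 1), hW q A B N x *
      hahnPoly q A B N (q ^ x)⁻¹ (q ^ N)⁻¹ ^ 2 = hE q A B N N := by
  have hq := qPoch_q_ne_zero hq0 hq1
  rw [hE_top hq0 hq1 hA0 hA hB0 hB, ← qVandermonde_reversed hq0 hq1 hA0.ne' hB0.ne', Finset.mul_sum,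
    Finset.sum_mul, Finset.sum_mul]
  refine Finset.sum_congr rfl fun x hx => ?_
  obtain ⟨p, rfl⟩ : ∃ p, N = x + p := ⟨N - x, by have := Finset.mem_range.1 hx; omega⟩
  rw [hahnPoly_top hq0 hq1, qPoch_inv_pow_self hq0, hW, Nat.add_sub_cancel_left,
    qbin_add hq0 hq1, qPoch_add A q x p]
  have hB' : qPoch B q (x + p) = qPoch B q p * qPoch (B * q ^ p) q x := by
    rw [add_comm, qPoch_add]
  rw [hB']
  have s1 : ((-1 : ℝ) ^ (x + p)) ^ 2 = 1 := by rw [← pow_mul, mul_comm, pow_mul]; simp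
  have s2 : ((-A) ^ x) ^ 2 = A ^ x * A ^ x := by rw [← pow_mul, mul_comm, pow_mul]; simp; ring
  have s3 : (q ^ (x + p).choose 2) ^ 2 = q ^ (2 * (x + p).choose 2) := by rw [← pow_mul, mul_comm]
  have s4 : (q ^ x.choose 2) ^ 2 = q ^ (2 * x.choose 2) := by rw [← pow_mul, mul_comm]
  have s5 : (q ^ ((x + p) * (x + p))) ^ 2 = q ^ (2 * ((x + p) * (x + p))) := by
    rw [← pow_mul, mul_comm]
  have s6 := pow_ne_zero (2 * ((x + p) * (x + p))) hq0.ne'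
  rw [mul_pow, mul_pow, mul_pow _ (qPoch q q _), div_pow, mul_pow, mul_pow, mul_pow, s1, s2, s3, s4,
    s5, one_mul, pow_add A]
  have := hq x; have := hq p; have := hq (x + p)
  generalize q ^ (2 * ((x + p) * (x + p))) = z at *
  generalize qPoch q q x = u1 at *
  generalize qPoch q q p = u2 at *
  generalize qPoch q q (x + p) = u3 at *
  field_simp

lemma ladder_pos (hq0 : 0 < q) (hq1 : q < 1) {α : ℝ} (hα : 0 < α) {x : ℤ} (hx : 0 < x) :
    0 < ladder q α x := by
  obtain ⟨y, rfl⟩ : ∃ y : ℕ, x = ((y + 1 : ℕ) : ℤ) := ⟨(x - 1).toNat, by omega⟩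
  rw [ladder_succ hq0]
  have h1 := structFactor_pos hq0 hq1
  have h2 := one_sub_pow_succ_pos hq0 hq1 y
  have h3 := one_sub_mul_pow_pos hq0 hq1 (Real.rpow_pos_of_pos hq0 (α + 1))
    (rpow_add_one_lt hq0 hq1 hα) y
  positivity

lemma hahnHat_top_norm (hq0 : 0 < q) (hq1 : q < 1) {α β : ℝ} (hα : 0 < α) (hβ : 0 < β) (N : ℕ) :
    ∑ x ∈ Finset.range (N + 1), hahnHat q N x α β N * hahnHat q N x α β N = 1 := by
  have hA0 := Real.rpow_pos_of_pos hq0 (α + 1)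
  have hA := rpow_add_one_lt hq0 hq1 hα
  have hB0 := Real.rpow_pos_of_pos hq0 (β + 1)
  have hB := rpow_add_one_lt hq0 hq1 hβ
  have hE := hE_pos hq0 hq1 hA0 hA hB0 hB N N
  rw [← div_self hE.ne', ← hahnPoly_top_norm hq0 hq1 hA0 hA hB0 hB, Finset.sum_div]
  refine Finset.sum_congr rfl fun x hx => ?_
  have hW := hW_pos hq0 hq1 hA0 hA hB0 hB N x
  rw [hahnHat_eq hq0 hq1 le_rfl (by have := Finset.mem_range.1 hx; omega) hα, mul_mul_mul_comm,
    Real.mul_self_sqrt (div_pos hW hE).le, hahnPoly_top_norm hq0 hq1 hA0 hA hB0 hB]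
  ring

/-- Summation by parts: the adjointness of `A₊` and `A₋`. -/
lemma hahnHat_step (hq0 : 0 < q) (hq1 : q < 1) {α β : ℝ} (hα : 0 < α) (hβ : 0 < β) (n m N : ℕ) :
    ladder q (2 * n + α + β + 1) ((N + 1 : ℕ) - n) *
      ∑ x ∈ Finset.range (N + 1 + 1), hahnHat q n x α β (N + 1 : ℕ) * hahnHat q m x α β (N + 1 : ℕ) =
    ladder q (2 * m + α + β + 1) ((N + 1 : ℕ) - m) *
      ∑ x ∈ Finset.range (N + 1), hahnHat q n x α β N * hahnHat q m x α β N := by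
  have h1 : ∀ x ∈ Finset.range (N + 1 + 1), ladder q (2 * n + α + β + 1) ((N + 1 : ℕ) - n) *
      (hahnHat q n x α β (N + 1 : ℕ) * hahnHat q m x α β (N + 1 : ℕ)) =
      ladder q α x * hahnHat q n ((x : ℤ) - 1) α β N * hahnHat q m x α β (N + 1 : ℕ) +
      q ^ ((x : ℝ) + (α + 1) / 2) * ladder q β ((N + 1 : ℕ) - x) * hahnHat q n x α β N *
        hahnHat q m x α β (N + 1 : ℕ) := by
    intro x _
    have := hahnHat_raise hq0 hq1 hα hβ n x (N + 1 : ℕ)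
    rw [show ((N + 1 : ℕ) : ℤ) - 1 = (N : ℤ) by push_cast; ring, Int.cast_natCast] at this
    rw [← mul_assoc, ← this]; ring
  have h2 : ∀ x ∈ Finset.range (N + 1), ladder q (2 * m + α + β + 1) ((N + 1 : ℕ) - m) *
      (hahnHat q n x α β N * hahnHat q m x α β N) =
      ladder q α (x + 1 : ℕ) * hahnHat q n (((x + 1 : ℕ) : ℤ) - 1) α β N *
        hahnHat q m (x + 1 : ℕ) α β (N + 1 : ℕ) +
      q ^ ((x : ℝ) + (α + 1) / 2) * ladder q β ((N + 1 : ℕ) - x) * hahnHat q n x α β N *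
        hahnHat q m x α β (N + 1 : ℕ) := by
    intro x _
    have := hahnHat_lower hq0 hq1 hα hβ m x N
    rw [Int.cast_natCast] at this
    push_cast
    rw [add_sub_cancel_right, mul_left_comm, ← this]; ring
  -- The first group of terms is shifted by one. The boundary terms $x=0$ of the first group and
  -- $x=N+1$ of the second contain the ladder coefficient at zero and drop out.
  rw [Finset.mul_sum, Finset.mul_sum, Finset.sum_congr rfl h1, Finset.sum_congr rfl h2,
    Finset.sum_add_distrib, Finset.sum_add_distrib, Finset.sum_range_succ' _ (N + 1),
    Finset.sum_range_succ (fun x : ℕ => q ^ ((x : ℝ) + (α + 1) / 2) * ladder q β ((N + 1 : ℕ) - x) *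
      hahnHat q n x α β N * hahnHat q m x α β (N + 1 : ℕ)) (N + 1)]
  simp

/-- Induction on $N$ by `hahnHat_step`. For $n\le N$ the left ladder coefficient is positive, so the
sum is determined by the one for $N$. For $m=N+1$ the right coefficient is zero, which separates the
top degree from the others; the norm of the top degree is the one value computed directly. -/
theorem hahnHat_orthonormal (hq0 : 0 < q) (hq1 : q < 1) {α β : ℝ} (hα : 0 < α) (hβ : 0 < β)
    {n m N : ℕ} (hn : n ≤ N) (hm : m ≤ N) :
    ∑ x ∈ Finset.range (N + 1), hahnHat q n x α β N * hahnHat q m x α β N =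
      if n = m then 1 else 0 := by
  induction N generalizing n m with
  | zero =>
    obtain rfl : n = 0 := by omega
    obtain rfl : m = 0 := by omega
    simpa using hahnHat_top_norm hq0 hq1 hα hβ 0
  | succ N ih =>
    have step : ∀ {n m : ℕ}, n ≤ N → m ≤ N + 1 → ∑ x ∈ Finset.range (N + 1 + 1),
        hahnHat q n x α β (N + 1 : ℕ) * hahnHat q m x α β (N + 1 : ℕ) =
        if n = m then 1 else 0 := by
      intro n m hn hm
      have hs := ladder_pos hq0 hq1 (show 0 < 2 * n + α + β + 1 by positivity)
        (x := ((N + 1 : ℕ) : ℤ) - n) (by omega)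
      refine mul_left_cancel₀ hs.ne' ?_
      rw [hahnHat_step hq0 hq1 hα hβ]
      rcases Nat.lt_or_ge N m with h | h
      · obtain rfl : m = N + 1 := by omega
        rw [if_neg (by omega), sub_self, ladder_zero]; simp
      · rw [ih hn h]
        split_ifs with h
        · rw [h]
        · simp
    rcases Nat.lt_or_ge N n with h | h
    · obtain rfl : n = N + 1 := by omega
      rcases Nat.lt_or_ge N m with h' | h'
      · obtain rfl : m = N + 1 := by omega
        rw [if_pos rfl]; exact hahnHat_top_norm hq0 hq1 hα hβ (N + 1)
      · simp_rw [mul_comm (hahnHat q (N + 1) _ _ _ _)]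
        rw [step h' le_rfl]; simp [eq_comm]
    · exact step h hm

/-- A square array with orthonormal rows has orthonormal columns. -/
lemma orthonormal_dual {ι κ : Type*} [DecidableEq ι] [DecidableEq κ] {s : Finset ι} {t : Finset κ}
    (hst : s.card = t.card) (f : ι → κ → ℝ)
    (h : ∀ i ∈ s, ∀ j ∈ s, ∑ x ∈ t, f i x * f j x = if i = j then 1 else 0) :
    ∀ x ∈ t, ∀ y ∈ t, ∑ i ∈ s, f i x * f i y = if x = y then 1 else 0 := by
  classical
  let e : s ≃ t := Finset.equivOfCardEq hst
  let M : Matrix s s ℝ := fun i j => f i (e j)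
  have h1 : M * M.transpose = 1 := by
    ext i j
    rw [Matrix.mul_apply, Matrix.one_apply]
    have := h i i.2 j j.2
    rw [← Finset.sum_coe_sort t] at this
    rw [← e.sum_comp] at this
    simp only [Subtype.ext_iff]
    exact this
  have h2 : M.transpose * M = 1 := mul_eq_one_comm.1 h1
  intro x hx y hy
  have := congrFun (congrFun h2 (e.symm ⟨x, hx⟩)) (e.symm ⟨y, hy⟩)
  have h3 : ∀ i : s, M.transpose (e.symm ⟨x, hx⟩) i * M i (e.symm ⟨y, hy⟩) = f i x * f i y := by
    intro i
    change f i (e (e.symm ⟨x, hx⟩)) * f i (e (e.symm ⟨y, hy⟩)) = _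
    rw [e.apply_symm_apply, e.apply_symm_apply]
  rw [Matrix.mul_apply, Matrix.one_apply, Finset.sum_congr rfl fun i _ => h3 i,
    Finset.sum_coe_sort s (fun i => f i x * f i y)] at this
  rw [this]
  simp only [EmbeddingLike.apply_eq_iff_eq, Subtype.mk.injEq]

theorem hahnHat_complete (hq0 : 0 < q) (hq1 : q < 1) {α β : ℝ} (hα : 0 < α) (hβ : 0 < β)
    {x y N : ℕ} (hx : x ≤ N) (hy : y ≤ N) :
    ∑ n ∈ Finset.range (N + 1), hahnHat q n x α β N * hahnHat q n y α β N =
      if x = y then 1 else 0 :=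
  orthonormal_dual rfl (fun n x : ℕ => hahnHat q n x α β N)
    (fun n hn m hm => hahnHat_orthonormal hq0 hq1 hα hβ
      (by have := Finset.mem_range.1 hn; omega) (by have := Finset.mem_range.1 hm; omega))
    x (Finset.mem_range.2 (by omega)) y (Finset.mem_range.2 (by omega))

end HahnOrthogonality

/-! ### Evaluation of the `q`-Hahn sum defining the `6j` coefficients -/

section SixJSums

variable {q : ℝ}

lemma choose_two_add (i j : ℕ) : (i + j).choose 2 = i.choose 2 + j.choose 2 + i * j := by
  have c1 := two_mul_choose_two i
  have c2 := two_mul_choose_two j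
  have c3 := two_mul_choose_two (i + j)
  nlinarith

lemma pow_mul_self_eq (q : ℝ) (k : ℕ) : q ^ (k * k) = (q ^ k.choose 2) ^ 2 * q ^ k := by
  rw [← two_mul_choose_two, pow_add, mul_comm, pow_mul]; ring

lemma qPoch_inv_pow' (hq0 : 0 < q) (hq1 : q < 1) (k m : ℕ) :
    qPoch (q ^ (k + m))⁻¹ q k = (-1) ^ k * qPoch q q (k + m) /
      (qPoch q q m * q ^ k.choose 2 * q ^ k * (q ^ m) ^ k) := by
  have h := qPoch_inv_pow hq0 k m
  rw [add_mul, pow_add q (k * k), pow_mul_self_eq, pow_mul q m k] at h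
  have h1 := qPoch_q_ne_zero hq0 hq1 m
  have h2 := pow_ne_zero (k.choose 2) hq0.ne'
  have h3 := pow_ne_zero k hq0.ne'
  have h4 := pow_ne_zero k (pow_ne_zero m hq0.ne')
  rw [eq_div_iff (by positivity)]
  refine mul_right_cancel₀ h2 ?_
  linear_combination h

lemma qcoef_add (hq0 : 0 < q) (hq1 : q < 1) (k m : ℕ) :
    qcoef q (k + m) k = (-1) ^ k * qPoch q q (k + m) /
      (qPoch q q k * qPoch q q m * q ^ k.choose 2 * (q ^ m) ^ k) := by
  have h1 := qPoch_q_ne_zero hq0 hq1 m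
  have h1' := qPoch_q_ne_zero hq0 hq1 k
  have h2 := pow_ne_zero (k.choose 2) hq0.ne'
  have h3 := pow_ne_zero k hq0.ne'
  have h4 := pow_ne_zero k (pow_ne_zero m hq0.ne')
  rw [qcoef, qPoch_inv_pow' hq0 hq1]
  generalize qPoch q q m = u1 at *
  generalize qPoch q q k = u2 at *
  generalize qPoch q q (k + m) = u3 at *
  field_simp

lemma qPoch_reverse' (hq0 : 0 < q) {a : ℝ} (ha : a ≠ 0) (n : ℕ) :
    qPoch (q / (a * q ^ n)) q n = (-1) ^ n * qPoch a q n / (a ^ n * q ^ (n.choose 2)) := by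
  rw [eq_div_iff (mul_ne_zero (pow_ne_zero _ ha) (pow_ne_zero _ hq0.ne')), ← mul_assoc,
    qPoch_reverse hq0 ha]

lemma prod_sub_mul_eq_qPoch (B C q : ℝ) (m r : ℕ) :
    ∏ j ∈ Finset.range r, (B * q ^ m - B * C * q ^ (2 * m) * q ^ j) =
      (B * q ^ m) ^ r * qPoch (C * q ^ m) q r := by
  have h : ∀ j, B * q ^ m - B * C * q ^ (2 * m) * q ^ j = B * q ^ m * (1 - C * q ^ m * q ^ j) :=
    fun j => by ring
  simp only [h]
  rw [Finset.prod_mul_distrib, Finset.prod_const, Finset.card_range, qPoch]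

/-- The factor $(q^{-x};q)_k$ removes the terms with $x<k$. The remaining $r+1$ terms, read
backwards, are a $q$-Vandermonde sum in the form `qVandermonde_qcoef`. -/
lemma alternating_sum (hq0 : 0 < q) (hq1 : q < 1) {B D : ℝ} (hD : ∀ i, qPoch D q i ≠ 0)
    (m k r : ℕ) :
    ∑ x ∈ Finset.range (k + r + 1), (-1) ^ x * q ^ x.choose 2 * qPoch B q (m + (k + r) - x) /
      (qPoch q q x * qPoch q q (k + r - x) * qPoch D q (k + r - x)) * qPoch (q ^ x)⁻¹ q k =
      (q ^ k)⁻¹ * qPoch B q m * ((-1) ^ r * q ^ r.choose 2 / (qPoch q q r * qPoch D q r)) *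
        ∏ j ∈ Finset.range r, (B * q ^ m - D * q ^ j) := by
  have hQ := qPoch_q_ne_zero hq0 hq1
  rw [add_assoc, Finset.sum_range_add, Finset.sum_eq_zero (s := Finset.range k), zero_add,
    ← qVandermonde_qcoef hq0 hq1, ← Finset.sum_flip, Finset.mul_sum]
  · refine Finset.sum_congr rfl fun i hi => ?_
    obtain ⟨j, rfl⟩ : ∃ j, r = i + j := ⟨r - i, by have := Finset.mem_range.1 hi; omega⟩
    rw [show i + j - i = j by omega, show m + (k + (i + j)) - (k + j) = m + i by omega,
      show k + (i + j) - (k + j) = i by omega, qPoch_inv_pow' hq0 hq1, qcoef_add hq0 hq1,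
      qPoch_add B q m i, qPoch_add D q i j, choose_two_add, choose_two_add i j, pow_add q,
      pow_add q, pow_add q, pow_add q, pow_add (-1 : ℝ), pow_add (-1 : ℝ), pow_mul, pow_mul']
    have hDi := hD i
    have hDj : qPoch (D * q ^ i) q j ≠ 0 := by
      have := hD (i + j); rw [qPoch_add] at this; exact right_ne_zero_of_mul this
    have := hQ i; have := hQ j; have := hQ (k + j); have := hQ (i + j)
    have := pow_ne_zero (k.choose 2) hq0.ne'
    have := pow_ne_zero (j.choose 2) hq0.ne'
    have := pow_ne_zero (i.choose 2) hq0.ne'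
    have := pow_ne_zero k hq0.ne'
    have := pow_ne_zero j hq0.ne'
    have := pow_ne_zero i hq0.ne'
    have hs : ((-1 : ℝ) ^ k) * (-1) ^ k = 1 := by rw [← mul_pow]; simp
    have hs' : ((-1 : ℝ) ^ i) * (-1) ^ i = 1 := by rw [← mul_pow]; simp
    have e' : (q ^ k) ^ j = (q ^ j) ^ k := by rw [← pow_mul, ← pow_mul']
    rw [e']
    generalize qPoch q q i = u1 at *
    generalize qPoch q q j = u2 at *
    generalize qPoch q q (k + j) = u3 at *
    generalize qPoch q q (i + j) = u4 at *
    generalize qPoch D q i = u5 at *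
    generalize qPoch (D * q ^ i) q j = u6 at *
    have h7 := pow_ne_zero k ‹q ^ j ≠ 0›
    have h8 := pow_ne_zero i ‹q ^ j ≠ 0›
    generalize (q ^ j) ^ k = v1 at *
    generalize (q ^ j) ^ i = v2 at *
    generalize q ^ k.choose 2 = v3 at *
    generalize q ^ i.choose 2 = v4 at *
    generalize q ^ j.choose 2 = v5 at *
    generalize q ^ k = v6 at *
    generalize (-1 : ℝ) ^ k = t1 at *
    generalize (-1 : ℝ) ^ i = t2 at *
    field_simp
    linear_combination qPoch B q m * qPoch (B * q ^ m) q i * (hs - hs')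
  · intro x hx
    rw [qPoch_inv_pow_eq_zero hq0 (Finset.mem_range.1 hx), mul_zero]

/-- The summand of the terminating `₄φ₃` series before Sears' transformation. -/
def preSears (q A B C : ℝ) (m J n r k : ℕ) : ℝ :=
  qbin q n k * (C * q ^ r) ^ k * qPoch (C * q ^ r) q (n - k) * qPoch (A * B * q ^ n / q) q k *
    qPoch (q ^ J)⁻¹ q k * qPoch (q / (B * C * q ^ (2 * m + J))) q k *
    qPoch ((q ^ (m + J))⁻¹ * q ^ k) q (n - k) * qPoch (A * q ^ k) q (n - k)

/-- Expanding the polynomial and summing over $x$ first turns the double sum into a single one,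
since the inner sum is `alternating_sum`. The choice $D=BCq^{2m}$ makes the resulting product a
Pochhammer symbol. The condition $m+J=n+r$ expresses conservation of the total degree. -/
lemma hahnSum_eq_preSears (hq0 : 0 < q) (hq1 : q < 1) {A B C : ℝ} (hB0 : 0 < B)
    (hB : B < q) (hC0 : 0 < C) (hC : C < q) {m J n r : ℕ} (hL : m + J = n + r) :
    ∑ x ∈ Finset.range (J + 1), (-1) ^ x * q ^ x.choose 2 * qPoch B q (m + J - x) /
      (qPoch q q x * qPoch q q (J - x) * qPoch (B * C * q ^ (2 * m)) q (J - x)) *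
        hahnPoly q A B n (q ^ x)⁻¹ (q ^ (m + J))⁻¹ =
    qPoch B q m * ((-(B * q ^ m)) ^ J * q ^ J.choose 2) * qPoch (C * q ^ m) q J /
      (qPoch q q J * qPoch (B * C * q ^ (2 * m)) q J * qPoch (C * q ^ r) q n) *
      ∑ k ∈ Finset.range (n + 1), preSears q A B C m J n r k := by
  have hQ := qPoch_q_ne_zero hq0 hq1
  have hp : ∀ k : ℕ, q ^ k ≠ 0 := fun k => pow_ne_zero k hq0.ne'
  have hD0 : 0 < B * C * q ^ (2 * m) := by positivity
  have hD1 : B * C * q ^ (2 * m) < 1 := by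
    have h1 := pow_le_one₀ hq0.le hq1.le (n := 2 * m)
    have h2 : B * C < 1 := by nlinarith
    nlinarith [mul_pos hB0 hC0]
  have hD : ∀ i, qPoch (B * C * q ^ (2 * m)) q i ≠ 0 := fun i =>
    (qPoch_pos hq0 hq1 hD0.le hD1 i).ne'
  have hCr : ∀ s i, qPoch (C * q ^ s) q i ≠ 0 := fun s i =>
    (qPoch_pos hq0 hq1 (by positivity) (by
      have h1 := pow_le_one₀ hq0.le hq1.le (n := s)
      nlinarith) i).ne'
  simp only [hahnPoly, Finset.mul_sum]
  rw [Finset.sum_comm]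
  refine Finset.sum_congr rfl fun k hk => ?_
  obtain ⟨s, rfl⟩ : ∃ s, n = k + s := ⟨n - k, by have := Finset.mem_range.1 hk; omega⟩
  rw [preSears, show k + s - k = s by omega]
  -- For $k>J$ both sides contain a symbol that vanishes: $(q^{-x};q)_k$ with $x\le J$ on the left,
  -- $(q^{-J};q)_k$ on the right.
  rcases Nat.lt_or_ge J k with h | h
  · rw [qPoch_inv_pow_eq_zero hq0 h]
    refine (Finset.sum_eq_zero fun x hx => ?_).trans (by ring)
    rw [qPoch_inv_pow_eq_zero hq0 (show x < k by have := Finset.mem_range.1 hx; omega)]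
    ring
  · obtain ⟨p, rfl⟩ : ∃ p, J = k + p := ⟨J - k, by omega⟩
    have h1 := alternating_sum hq0 hq1 hD m k p (B := B)
    rw [prod_sub_mul_eq_qPoch] at h1
    have h2 : ∀ x : ℕ, (-1) ^ x * q ^ x.choose 2 * qPoch B q (m + (k + p) - x) /
        (qPoch q q x * qPoch q q (k + p - x) * qPoch (B * C * q ^ (2 * m)) q (k + p - x)) *
        (qcoef q (k + s) k * qPoch (A * B * q ^ (k + s) / q) q k * qPoch (A * q ^ k) q s *
          qPoch ((q ^ (m + (k + p)))⁻¹ * q ^ k) q s * qPoch (q ^ x)⁻¹ q k) =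
        qcoef q (k + s) k * qPoch (A * B * q ^ (k + s) / q) q k * qPoch (A * q ^ k) q s *
          qPoch ((q ^ (m + (k + p)))⁻¹ * q ^ k) q s *
        ((-1) ^ x * q ^ x.choose 2 * qPoch B q (m + (k + p) - x) /
        (qPoch q q x * qPoch q q (k + p - x) * qPoch (B * C * q ^ (2 * m)) q (k + p - x)) *
          qPoch (q ^ x)⁻¹ q k) := fun x => by ring
    simp only [h2]
    rw [← Finset.mul_sum, h1]
    have e1 : qPoch (q / (B * C * q ^ (2 * m + (k + p)))) q k = (-1) ^ k *
        qPoch (B * C * q ^ (2 * m) * q ^ p) q k /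
          ((B * C * q ^ (2 * m) * q ^ p) ^ k * q ^ k.choose 2) := by
      rw [← qPoch_reverse' hq0 (by positivity), show B * C * q ^ (2 * m + (k + p)) =
        B * C * q ^ (2 * m) * q ^ p * q ^ k by ring]
    have e2 : qPoch (B * C * q ^ (2 * m)) q (k + p) = qPoch (B * C * q ^ (2 * m)) q p *
        qPoch (B * C * q ^ (2 * m) * q ^ p) q k := by rw [add_comm, qPoch_add]
    have e3 : qPoch (C * q ^ r) q (k + s) = qPoch (C * q ^ r) q s *
        qPoch (C * q ^ m * q ^ p) q k := by
      rw [add_comm, qPoch_add, mul_assoc C, mul_assoc C, ← pow_add, ← pow_add,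
        show r + s = m + p by omega]
    have e4 : qPoch (C * q ^ m) q (k + p) = qPoch (C * q ^ m) q p *
        qPoch (C * q ^ m * q ^ p) q k := by rw [add_comm, qPoch_add]
    have e5 : q ^ r = q ^ m * q ^ p / q ^ s := by
      rw [eq_div_iff (hp s), ← pow_add, ← pow_add]; congr 1; omega
    rw [e1, e2, e3, e4, qPoch_inv_pow' hq0 hq1, qcoef_add hq0 hq1, qbin_add hq0 hq1]
    have d1 := hD p
    have d2 : qPoch (B * C * q ^ (2 * m) * q ^ p) q k ≠ 0 := by
      have := hD (k + p); rw [e2] at this; exact right_ne_zero_of_mul this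
    have d3 := hCr r s
    have d4 : qPoch (C * q ^ m * q ^ p) q k ≠ 0 := by
      rw [mul_assoc, ← pow_add]; exact hCr _ _
    have := hQ k; have := hQ p; have := hQ s; have := hQ (k + p); have := hQ (k + s)
    generalize qPoch (C * q ^ r) q s = w1 at *
    generalize qPoch (C * q ^ m * q ^ p) q k = w2 at *
    generalize qPoch (B * C * q ^ (2 * m)) q p = w3 at *
    generalize qPoch (B * C * q ^ (2 * m) * q ^ p) q k = w4 at *
    generalize qPoch (A * B * q ^ (k + s) / q) q k = w5 at *
    generalize qPoch (A * q ^ k) q s = w6 at *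
    generalize qPoch ((q ^ (m + (k + p)))⁻¹ * q ^ k) q s = w7 at *
    generalize qPoch (C * q ^ m) q p = w8 at *
    generalize qPoch B q m = w9 at *
    generalize qPoch q q k = u1 at *
    generalize qPoch q q p = u2 at *
    generalize qPoch q q s = u3 at *
    generalize qPoch q q (k + p) = u4 at *
    generalize qPoch q q (k + s) = u5 at *
    have := hp (k.choose 2); have := hp k; have := hp p; have := hp s; have := hp m
    rw [e5, choose_two_add, pow_add q, pow_add q (k.choose 2), pow_mul q k p, two_mul m, pow_add q m,
      pow_add (-(B * q ^ m)) k p, neg_pow (B * q ^ m) k, neg_pow (B * q ^ m) p]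
    have e6 : (q ^ k) ^ p = (q ^ p) ^ k := by rw [← pow_mul, ← pow_mul']
    rw [e6]
    have hs : ((-1 : ℝ) ^ k) * (-1) ^ k = 1 := by rw [← mul_pow]; simp
    generalize (-1 : ℝ) ^ k = t1 at *
    generalize q ^ k.choose 2 = v3 at *
    generalize q ^ p.choose 2 = v4 at *
    simp only [mul_pow, div_pow]
    have := pow_ne_zero k ‹q ^ p ≠ 0›
    have := pow_ne_zero k ‹q ^ s ≠ 0›
    have := pow_ne_zero k ‹q ^ m ≠ 0›
    generalize (q ^ p) ^ k = z1 at *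
    generalize (q ^ s) ^ k = z2 at *
    generalize (q ^ m) ^ k = z3 at *
    generalize q ^ k = z4 at *
    field_simp
    linear_combination (-(t1 * w5 * w6 * w7 * w9 * v4 * w8)) * hs

/-- The terminating `₄φ₃` series of the `q`-Racah polynomials. -/
def racahSeries (q A B C : ℝ) (m L n : ℕ) : ℝ :=
  ∑ j ∈ Finset.range (n + 1), qcoef q n j * (qPoch (q ^ m)⁻¹ q j *
    qPoch (B * C * q ^ m / q) q j * qPoch (A * B * q ^ n / q) q j) /
    (qPoch B q j * qPoch (A * B * C * q ^ L / q) q j * qPoch (q ^ L)⁻¹ q j)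

lemma qPoch_inv_pow_ne_zero (hq0 : 0 < q) (hq1 : q < 1) {L k : ℕ} (h : k ≤ L) :
    qPoch (q ^ L)⁻¹ q k ≠ 0 := by
  obtain ⟨p, rfl⟩ : ∃ p, L = k + p := ⟨L - k, by omega⟩
  have h1 := qPoch_q_ne_zero hq0 hq1 p
  have h2 := qPoch_q_ne_zero hq0 hq1 (k + p)
  have := hq0.ne'
  rw [qPoch_inv_pow' hq0 hq1]
  have h3 : (-1 : ℝ) ^ k ≠ 0 := pow_ne_zero _ (by norm_num)
  positivity

lemma sum_preSears (hq0 : 0 < q) (hq1 : q < 1) {A B C : ℝ} (hA0 : 0 < A) (hA : A < q) (hB0 : 0 < B)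
    (hB : B < q) (hC0 : 0 < C) (hC : C < q) {m J n r : ℕ} (hL : m + J = n + r) :
    ∑ k ∈ Finset.range (n + 1), preSears q A B C m J n r k =
      qPoch (q / (B * q ^ n)) q n * qPoch (q ^ (m + J))⁻¹ q n *
        qPoch (A * B * C * q ^ (m + J) / q) q n * racahSeries q A B C m (m + J) n := by
  have hQ := qPoch_q_ne_zero hq0 hq1
  have hp : ∀ k : ℕ, q ^ k ≠ 0 := fun k => pow_ne_zero k hq0.ne'
  have hqn := hq0.ne'
  have hG0 : 0 < A * B * C * q ^ (m + J) / q := by positivity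
  have hG1 : A * B * C * q ^ (m + J) / q < 1 := by
    rw [div_lt_one hq0]
    have h1 := pow_le_one₀ hq0.le hq1.le (n := m + J)
    have h2 : A * B < 1 := by nlinarith
    have h3 : A * B * C < q := by nlinarith [mul_pos hA0 hB0]
    nlinarith [mul_pos (mul_pos hA0 hB0) hC0]
  -- The second and third arguments $u,v$ are the numerator parameters of `racahSeries` that depend
  -- on $m$. The fourth, $e$, is chosen so that $ue=q^{-J}$ and $ve=q/(BCq^{2m+J})$ are the
  -- numerators in `preSears`. The relation $m+J=n+r$ enters through $aeg=A$, $eg=q/(Bq^n)$ and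
  -- $ag=ABCq^{m+J-1}$.
  have h := sears hq0 hq1 (A * B * q ^ n / q) (B * C * q ^ m / q) ((q ^ m)⁻¹)
    (q / (B * C * q ^ (m + J))) (C * q ^ r) n
  have e1 : B * C * q ^ m / q * (q / (B * C * q ^ (m + J))) = (q ^ J)⁻¹ := by
    rw [pow_add]; field_simp
  have e2 : (q ^ m)⁻¹ * (q / (B * C * q ^ (m + J))) = q / (B * C * q ^ (2 * m + J)) := by
    rw [two_mul, pow_add, pow_add, pow_add]; field_simp
  have e3 : B * C * q ^ m / q * (q ^ m)⁻¹ * (q / (B * C * q ^ (m + J))) = (q ^ (m + J))⁻¹ := by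
    rw [pow_add]; field_simp
  have e4 : A * B * q ^ n / q * (q / (B * C * q ^ (m + J))) * (C * q ^ r) = A := by
    rw [hL, pow_add]; field_simp
  have e5 : q / (B * C * q ^ (m + J)) * (C * q ^ r) = q / (B * q ^ n) := by
    rw [hL, pow_add]; field_simp
  have e6 : A * B * q ^ n / q * (C * q ^ r) = A * B * C * q ^ (m + J) / q := by
    rw [hL, pow_add]; field_simp
  have e7 : C * q ^ r * (q / (B * C * q ^ (m + J))) = q / (B * q ^ n) := by rw [mul_comm, e5]
  simp only [e3, e4, e5, e6, e7, e1, e2] at h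
  refine (Eq.trans (Finset.sum_congr rfl fun k _ => ?_) h).trans ?_
  · rw [preSears]
  rw [racahSeries, Finset.mul_sum]
  refine Finset.sum_congr rfl fun j hj => ?_
  obtain ⟨s, rfl⟩ : ∃ s, n = j + s := ⟨n - j, by have := Finset.mem_range.1 hj; omega⟩
  have d1 := qPoch_inv_pow_ne_zero hq0 hq1 (show j ≤ m + J by omega)
  have d2 := (qPoch_pos hq0 hq1 hB0.le (hB.trans hq1) j).ne'
  have d3 := (qPoch_pos hq0 hq1 hG0.le hG1 j).ne'
  have e8 : qPoch (q / (B * q ^ (j + s))) q (j + s) = qPoch (q / (B * q ^ (j + s))) q s *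
      ((-1) ^ j * qPoch B q j / (B ^ j * q ^ j.choose 2)) := by
    rw [← qPoch_reverse' hq0 hB0.ne', add_comm j s, qPoch_add]
    congr 2; rw [pow_add]; field_simp
  rw [Nat.add_sub_cancel_left, qPoch_add (q ^ (m + J))⁻¹ q j s, qPoch_add (_ / q) q j s, e8,
    qcoef_add hq0 hq1, qbin_add hq0 hq1]
  have := hQ j; have := hQ s
  have hs : ((-1 : ℝ) ^ j) * (-1) ^ j = 1 := by rw [← mul_pow]; simp
  generalize (-1 : ℝ) ^ j = t1 at *
  generalize qPoch (q ^ (m + J))⁻¹ q j = w1 at *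
  generalize qPoch ((q ^ (m + J))⁻¹ * q ^ j) q s = w2 at *
  generalize qPoch (A * B * C * q ^ (m + J) / q) q j = w3 at *
  generalize qPoch (A * B * C * q ^ (m + J) / q * q ^ j) q s = w4 at *
  generalize qPoch (q / (B * q ^ (j + s))) q s = w5 at *
  generalize qPoch (q ^ m)⁻¹ q j = w6 at *
  generalize qPoch (B * C * q ^ m / q) q j = w7 at *
  generalize qPoch (A * B * q ^ (j + s) / q) q j = w8 at *
  generalize qPoch B q j = w9 at *
  generalize qPoch q q j = u1 at *
  generalize qPoch q q s = u2 at *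
  generalize qPoch q q (j + s) = u3 at *
  have := hp (j.choose 2); have := hp j; have := hp s
  rw [pow_add q j s, div_pow, mul_pow, mul_pow, ← pow_mul q j j, pow_mul_self_eq]
  have := pow_ne_zero j ‹q ^ s ≠ 0›
  generalize q ^ j.choose 2 = v3 at *
  generalize (q ^ s) ^ j = v4 at *
  generalize q ^ j = v5 at *
  field_simp
  linear_combination (-(u3 * w7 * w6 * w8 * w2 * w5 * w4)) * hs

end SixJSums

/-! ### Multiplicative form of the $q$-Racah polynomials, weights and norms at the parameters of the
$6j$ coefficients. -/

section RacahNormalization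

variable {q : ℝ}

lemma rpow_neg_nat (hq0 : 0 < q) (m : ℕ) : q ^ (-(m : ℝ)) = (q ^ m)⁻¹ := by
  rw [Real.rpow_neg hq0.le, Real.rpow_natCast]

lemma rpow_one_sub (hq0 : 0 < q) (y : ℝ) : q ^ (1 - y) = q / q ^ y := by
  rw [Real.rpow_sub hq0, Real.rpow_one]

lemma rpow_param_nat (hq0 : 0 < q) (k : ℕ) (α β : ℝ) :
    q ^ ((k : ℝ) + α + β + 1) = q ^ (α + 1) * q ^ (β + 1) * q ^ k / q := by
  rw [mul_div_right_comm, ← (rpow_params hq0 α β).2, ← Real.rpow_natCast, ← Real.rpow_add hq0]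
  congr 1; ring

lemma rpow_param_three (hq0 : 0 < q) (k : ℕ) (α β γ : ℝ) :
    q ^ ((k : ℝ) + α + β + γ + 2) = q ^ (α + 1) * q ^ (β + 1) * q ^ (γ + 1) * q ^ k / q := by
  rw [eq_div_iff hq0.ne', ← Real.rpow_natCast, ← Real.rpow_add hq0, ← Real.rpow_add hq0,
    ← Real.rpow_add hq0, ← Real.rpow_add_one hq0.ne']
  congr 1; ring

/-- The `q`-Racah polynomials occurring as `6j` coefficients. -/
lemma racah_eq (hq0 : 0 < q) (m n L : ℕ) (a b c : ℝ) :
    racah q m n b c (L + a + b + 1) L =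
      qPoch (q ^ (b + 1)) q m *
        qPoch (q ^ (a + 1) * q ^ (b + 1) * q ^ (c + 1) * q ^ L / q) q m * qPoch (q ^ L)⁻¹ q m *
        q ^ (-((m : ℝ) * (a + b + 1) / 2)) *
        racahSeries q (q ^ (a + 1)) (q ^ (b + 1)) (q ^ (c + 1)) m L n := by
  have h1 : q ^ (c + ((L : ℝ) + a + b + 1) + 1) =
      q ^ (a + 1) * q ^ (b + 1) * q ^ (c + 1) * q ^ L / q := by
    rw [← rpow_param_three hq0]; congr 1; ring
  have h2 : q ^ ((m : ℝ) * ((L : ℝ) - ((L : ℝ) + a + b + 1)) / 2) =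
      q ^ (-((m : ℝ) * (a + b + 1) / 2)) := by congr 1; ring
  have h3 : q ^ ((n : ℝ) + ((L : ℝ) + a + b + 1) - L) = q ^ (a + 1) * q ^ (b + 1) * q ^ n / q := by
    rw [← rpow_param_nat hq0]; congr 1; ring
  rw [racah, basicHyp, h1, h2, h3, rpow_param_nat hq0, rpow_neg_nat hq0, rpow_neg_nat hq0,
    rpow_neg_nat hq0, tsum_eq_sum (s := Finset.range (n + 1)), racahSeries]
  · congr 1
    refine Finset.sum_congr rfl fun k _ => ?_
    rw [qcoef]
    simp only [List.map_cons, List.map_nil, List.prod_cons, List.prod_nil, List.length_cons,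
      List.length_nil]
    norm_num
    ring
  · intro k hk
    simp [qPoch_inv_pow_eq_zero hq0 (show n < k by simpa using hk)]

lemma neg_one_pow_mul_self (n : ℕ) : ((-1 : ℝ) ^ n) * (-1) ^ n = 1 := by
  rw [← mul_pow]; simp

/-- With $c=L+a+b+1$, $L=n+r$, two symbols have inverse powers as bases, those coming from $-N$ and
from $-b-N$ in the weight. Rewriting both gives two signs $(-1)^n$, which cancel, and leaves
positive factors only. -/
lemma racahWeight_eq (hq0 : 0 < q) (hq1 : q < 1) {n r : ℕ} (a b : ℝ) {c : ℝ} (hc : 0 < c) :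
    racahWeight q n b c ((n + r : ℕ) + a + b + 1) (n + r) =
    (1 - q ^ (2 * n) * (q ^ (a + 1) * q ^ (b + 1) / q)) / (1 - q ^ (a + 1) * q ^ (b + 1) / q) *
      (qPoch (q ^ (a + 1) * q ^ (b + 1) / q) q n * qPoch (q ^ (b + 1)) q n *
        qPoch (q ^ (a + 1) * q ^ (b + 1) * q ^ (c + 1) * q ^ (n + r) / q) q n *
        (qPoch q q (n + r) / (qPoch q q r * q ^ n)) * (q ^ (c + 1)) ^ n /
      (qPoch q q n * qPoch (q ^ (a + 1)) q n * qPoch (q ^ (c + 1) * q ^ r) q n *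
        qPoch (q ^ (a + 1) * q ^ (b + 1) * q ^ (n + r)) q n)) *
      (q / (q ^ (b + 1) * q ^ (c + 1))) ^ n := by
  have h1 : q ^ (2 * (n : ℝ) + ((n + r : ℕ) + a + b + 1) - (n + r : ℕ)) =
      q ^ (2 * n) * (q ^ (a + 1) * q ^ (b + 1) / q) := by
    rw [← (rpow_params hq0 a b).2, ← Real.rpow_natCast, ← Real.rpow_add hq0]
    congr 1; push_cast; ring
  have h2 : q ^ (((n + r : ℕ) : ℝ) + a + b + 1 - (n + r : ℕ)) = q ^ (a + 1) * q ^ (b + 1) / q := by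
    rw [← (rpow_params hq0 a b).2]; congr 1; ring
  have h3 : q ^ (c + (((n + r : ℕ) : ℝ) + a + b + 1) + 1) =
      q ^ (a + 1) * q ^ (b + 1) * q ^ (c + 1) * q ^ (n + r) / q := by
    rw [← rpow_param_three hq0]; congr 1; ring
  have h4 : q ^ (((n + r : ℕ) : ℝ) + a + b + 1 - b - (n + r : ℕ)) = q ^ (a + 1) := by
    congr 1; ring
  have h5 : q ^ (-c - ((n + r : ℕ) : ℝ)) = q / (q ^ (c + 1) * q ^ r * q ^ n) := by
    rw [← Real.rpow_natCast, ← Real.rpow_natCast, ← Real.rpow_add hq0, ← Real.rpow_add hq0,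
      ← rpow_one_sub hq0]
    congr 1; push_cast; ring
  have h6 : q ^ (((n + r : ℕ) : ℝ) + a + b + 1 + 1) = q ^ (a + 1) * q ^ (b + 1) * q ^ (n + r) := by
    rw [← Real.rpow_natCast, ← Real.rpow_add hq0, ← Real.rpow_add hq0]; congr 1; ring
  have h7 : q ^ (-(n : ℝ) * (b + c + 1)) = (q / (q ^ (b + 1) * q ^ (c + 1))) ^ n := by
    rw [← inv_div, ← (rpow_params hq0 b c).2, inv_pow, ← Real.rpow_natCast, ← Real.rpow_mul hq0.le,
      ← Real.rpow_neg hq0.le]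
    congr 1; ring
  have hC0 := Real.rpow_pos_of_pos hq0 (c + 1)
  have hC := rpow_add_one_lt hq0 hq1 hc
  rw [racahWeight, h1, h2, h3, h4, h5, h6, h7, rpow_neg_nat hq0]
  generalize q ^ (a + 1) = A
  generalize q ^ (b + 1) = B
  generalize q ^ (c + 1) = C at *
  have hCr : qPoch (C * q ^ r) q n ≠ 0 := (qPoch_pos hq0 hq1 (by positivity) (by
    have h1 := pow_le_one₀ hq0.le hq1.le (n := r)
    nlinarith) n).ne'
  rw [qPoch_inv_pow' hq0 hq1, qPoch_reverse' hq0 (by positivity)]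
  congr 2
  have hs := neg_one_pow_mul_self n
  have hs0 : (-1 : ℝ) ^ n ≠ 0 := pow_ne_zero _ (by norm_num)
  have := qPoch_q_ne_zero hq0 hq1 r
  have := pow_ne_zero n hq0.ne'
  have := pow_ne_zero (n.choose 2) hq0.ne'
  have := pow_ne_zero n (pow_ne_zero r hq0.ne')
  rw [mul_pow]
  generalize (-1 : ℝ) ^ n = t at *
  generalize qPoch q q r = u1 at *
  generalize qPoch (C * q ^ r) q n = u2 at *
  generalize q ^ n.choose 2 = v1 at *
  generalize (q ^ r) ^ n = v2 at *
  generalize q ^ n = v3 at *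
  rw [← sub_eq_zero]
  field_simp
  ring

/-- Four symbols have to be reversed, two of length $m+J$ and two of length $m$. In each pair the
signs cancel, and every factor of the result is positive in the range of the theorem. -/
lemma racahNorm_eq (hq0 : 0 < q) (hq1 : q < 1) {m J : ℕ} {a : ℝ} (ha : 0 < a) (b c : ℝ) :
    racahNorm q m b c ((m + J : ℕ) + a + b + 1) (m + J) =
    qPoch (q ^ (a + 1) * q ^ (b + 1)) q (m + J) * qPoch (q ^ (b + 1) * q ^ (c + 1)) q (m + J) /
      (qPoch (q ^ (a + 1)) q (m + J) * qPoch (q ^ (c + 1)) q (m + J) * (q ^ (b + 1)) ^ (m + J)) *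
    (qPoch q q m * qPoch (q ^ (b + 1)) q m * qPoch (q ^ (c + 1)) q m *
      (qPoch (q ^ (a + 1) * q ^ J) q m / ((q ^ (a + 1)) ^ m * (q ^ J) ^ m * q ^ m.choose 2)) *
      qPoch (q ^ (a + 1) * q ^ (b + 1) * q ^ (c + 1) * q ^ (m + J) / q) q m *
      (qPoch q q (m + J) / (qPoch q q J * q ^ m.choose 2 * q ^ m * (q ^ J) ^ m))) *
    ((1 - q ^ (b + 1) * q ^ (c + 1) / q) / (1 - q ^ (2 * m) * (q ^ (b + 1) * q ^ (c + 1) / q))) *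
    (qPoch (q ^ (b + 1) * q ^ (c + 1) * q ^ (m + J)) q m /
      qPoch (q ^ (b + 1) * q ^ (c + 1) / q) q m) := by
  have h1 : q ^ (-(((m + J : ℕ) : ℝ) + a + b + 1)) =
      q / (q ^ (a + 1) * q ^ (b + 1) * q ^ (m + J)) := by
    rw [← Real.rpow_natCast, ← Real.rpow_add hq0, ← Real.rpow_add hq0, ← rpow_one_sub hq0]
    congr 1; ring
  have h2 := (rpow_params hq0 b c).1
  have h3 : q ^ (b - (((m + J : ℕ) : ℝ) + a + b + 1) + 1) = q / (q ^ (a + 1) * q ^ (m + J)) := by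
    rw [← Real.rpow_natCast, ← Real.rpow_add hq0, ← rpow_one_sub hq0]
    congr 1; ring
  have h4 : q ^ (c + (((m + J : ℕ) : ℝ) + a + b + 1) + 1) =
      q ^ (a + 1) * q ^ (b + 1) * q ^ (c + 1) * q ^ (m + J) / q := by
    rw [← rpow_param_three hq0]; congr 1; ring
  have h5 : q ^ (2 * (m : ℝ) + b + c + 1) = q ^ (2 * m) * (q ^ (b + 1) * q ^ (c + 1) / q) := by
    rw [← (rpow_params hq0 b c).2, ← Real.rpow_natCast, ← Real.rpow_add hq0]
    congr 1; push_cast; ring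
  have h6 : q ^ (((m + J : ℕ) : ℝ) + b + c + 2) = q ^ (b + 1) * q ^ (c + 1) * q ^ (m + J) := by
    rw [← Real.rpow_natCast, ← Real.rpow_add hq0, ← Real.rpow_add hq0]; congr 1; ring
  have hA0 := Real.rpow_pos_of_pos hq0 (a + 1)
  have hB0 := Real.rpow_pos_of_pos hq0 (b + 1)
  have hA := rpow_add_one_lt hq0 hq1 ha
  rw [racahNorm, h1, h2, h3, h4, h5, h6, (rpow_params hq0 b c).2, rpow_neg_nat hq0]
  generalize q ^ (a + 1) = A at *
  generalize q ^ (b + 1) = B at *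
  generalize q ^ (c + 1) = C
  have e1 : qPoch (q / (A * q ^ (m + J))) q m =
      (-1) ^ m * qPoch (A * q ^ J) q m / ((A * q ^ J) ^ m * q ^ m.choose 2) := by
    rw [← qPoch_reverse' hq0 (by positivity)]; congr 2; ring
  rw [e1, qPoch_inv_pow' hq0 hq1, qPoch_reverse' hq0 hA0.ne', qPoch_reverse' hq0 (by positivity)]
  have hAL := (qPoch_pos hq0 hq1 hA0.le (hA.trans hq1) (m + J)).ne'
  have s1 := neg_one_pow_mul_self m
  have s2 : (-1 : ℝ) ^ (m + J) ≠ 0 := pow_ne_zero _ (by norm_num)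
  have z1 := pow_ne_zero ((m + J).choose 2) hq0.ne'
  congr 2
  have f1 : (-1) ^ (m + J) * qPoch (A * B) q (m + J) / ((A * B) ^ (m + J) * q ^ (m + J).choose 2) *
      qPoch (B * C) q (m + J) / ((-1) ^ (m + J) * qPoch A q (m + J) /
        (A ^ (m + J) * q ^ (m + J).choose 2) * qPoch C q (m + J)) =
      qPoch (A * B) q (m + J) * qPoch (B * C) q (m + J) /
        (qPoch A q (m + J) * qPoch C q (m + J) * B ^ (m + J)) := by
    rw [mul_pow]
    have := pow_ne_zero (m + J) hA0.ne'
    have := pow_ne_zero (m + J) hB0.ne'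
    generalize A ^ (m + J) = x1 at *
    generalize B ^ (m + J) = x2 at *
    generalize (-1 : ℝ) ^ (m + J) = t at *
    generalize qPoch A q (m + J) = w at *
    generalize q ^ (m + J).choose 2 = v at *
    field_simp
  rw [f1, mul_pow]
  congr 1
  linear_combination qPoch q q m * qPoch B q m * qPoch C q m *
    (qPoch (A * q ^ J) q m / (A ^ m * (q ^ J) ^ m * q ^ m.choose 2)) *
    qPoch (A * B * C * q ^ (m + J) / q) q m *
    (qPoch q q (m + J) / (qPoch q q J * q ^ m.choose 2 * q ^ m * (q ^ J) ^ m)) * s1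

end RacahNormalization

/-! ### The summand of the $6j$ sum: isolating its dependence on $x$. -/

section RacahCoefficient

variable {q : ℝ}

/-- The `x`-independent part of the squared normalization in the sum defining a `6j` coefficient. -/
def hahnTripleConst (q A B C : ℝ) (m : ℕ) : ℝ :=
  1 / (A ^ m * qPoch (B * C) q (2 * m) * (q ^ m.choose 2) ^ 2 *
    ((1 - B * C / q) / (1 - q ^ (2 * m) * (B * C / q)) *
      (qPoch q q m * qPoch B q m * qPoch C q m / qPoch (B * C / q) q m) * B ^ m))

/-- Up to a factor free of $x$, the product of the three weights is a square, so no root depending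
on $x$ survives in the sum. The norms of the second and third function stay unevaluated as `e2` and
`e3`; the first norm involves $p=J-x$ and must be expanded. -/
lemma hahnTriple_weight (hq0 : 0 < q) (hq1 : q < 1) {A B C : ℝ} (hA0 : 0 < A) (hB0 : 0 < B)
    (hB : B < q) (hC0 : 0 < C) (hC : C < q) (m x p : ℕ) (e2 e3 : ℝ) :
    hW q B C (m + p) (m + p) / hE q B C (m + p) m *
      (hW q A (B * C * q ^ (2 * m)) (x + p) x / e2) * (hW q A B (m + (x + p)) x / e3) =
    hahnTripleConst q A B C m / (e2 * e3) *
      (qPoch A q x * qPoch B q (m + p) * q ^ ((m + p) * m) * A ^ (m + p) /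
        (qPoch q q x * qPoch q q (m + p))) ^ 2 := by
  have hBC := mul_div_lt_one hq0 hq1 hB hC0 hC
  have hBC1 : B * C < 1 := by rw [div_lt_one hq0] at hBC; linarith
  have hD1 : B * C * q ^ (2 * m) < 1 := by
    have h1 := pow_le_one₀ hq0.le hq1.le (n := 2 * m)
    have : 0 < B * C := by positivity
    nlinarith
  have z1 := (qPoch_pos hq0 hq1 (by positivity) hBC1 (2 * m)).ne'
  have z2 := (qPoch_pos hq0 hq1 (by positivity) hD1 p).ne'
  have z3 := qPoch_q_ne_zero hq0 hq1
  have z4 := pow_ne_zero (m + p) hA0.ne'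
  have z5 := pow_ne_zero m hA0.ne'
  have z6 := (qPoch_pos hq0 hq1 (by positivity) hBC m).ne'
  have z7 := (qPoch_pos hq0 hq1 hB0.le (hB.trans hq1) m).ne'
  have z8 := (qPoch_pos hq0 hq1 hC0.le (hC.trans hq1) m).ne'
  have hp : A ^ p = A ^ (m + p) / A ^ m := by
    rw [eq_div_iff z5, ← pow_add, add_comm]
  rw [hW, hW, hW, hE, hahnTripleConst, Nat.sub_self, qPoch_zero, qPoch_zero, pow_zero,
    show m + (x + p) - x = m + p by omega, show x + p - x = p by omega,
    show m + p - m = p by omega, show m + (m + p) = 2 * m + p by ring, qPoch_add _ _ (2 * m) p, hp,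
    show 2 * (m + p) * m = (m + p) * m * 2 by ring, pow_mul _ _ 2, mul_comm 2 (m.choose 2),
    pow_mul _ _ 2]
  have z9 := pow_ne_zero ((m + p) * m) hq0.ne'
  have z10 := pow_ne_zero (m.choose 2) hq0.ne'
  have z11 := z3 m
  have z12 := z3 x
  have z13 := z3 p
  have z14 := z3 (m + p)
  have z15 := pow_ne_zero m hB0.ne'
  have z16 : 1 - B * C / q ≠ 0 := by linarith
  have z17 : 1 - q ^ (2 * m) * (B * C / q) ≠ 0 := by
    have h1 := pow_le_one₀ hq0.le hq1.le (n := 2 * m)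
    have : 0 < B * C / q := by positivity
    nlinarith
  generalize 1 - B * C / q = y1 at *
  generalize 1 - q ^ (2 * m) * (B * C / q) = y2 at *
  generalize qPoch (B * C) q (2 * m) = x1 at *
  generalize qPoch (B * C * q ^ (2 * m)) q p = x2 at *
  generalize qPoch (B * C / q) q m = x3 at *
  generalize qPoch B q m = x4 at *
  generalize qPoch C q m = x5 at *
  generalize A ^ (m + p) = x6 at *
  generalize A ^ m = x7 at *
  generalize B ^ m = x8 at *
  generalize qPoch q q m = x9 at *
  generalize qPoch q q x = x10 at *
  generalize qPoch q q p = x11 at *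
  generalize qPoch q q (m + p) = x12 at *
  generalize q ^ ((m + p) * m) = x13 at *
  generalize q ^ m.choose 2 = x14 at *
  generalize qPoch A q x = x15 at *
  generalize qPoch B q (m + p) = x16 at *
  field_simp

/-- The first polynomial is taken at its right end point and the second has top degree, so both are
products. The bracket on the right depends on $x$ and $p$ only through $x+p$; the last factor is the
summand of `hahnSum_eq_preSears`. -/
lemma hahnTriple_poly (hq0 : 0 < q) (hq1 : q < 1) {A B C D : ℝ} (hD0 : 0 < D) (hD : D < 1)
    (m x p : ℕ) :
    (qPoch A q x * qPoch B q (m + p) * q ^ ((m + p) * m) * A ^ (m + p) /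
        (qPoch q q x * qPoch q q (m + p))) *
      (hahnPoly q B C m (q ^ (m + p))⁻¹ (q ^ (m + p))⁻¹ *
        hahnPoly q A D (x + p) (q ^ x)⁻¹ (q ^ (x + p))⁻¹) =
    (B ^ m * (q ^ m.choose 2) ^ 2 * qPoch C q m * qPoch (q ^ (x + p))⁻¹ q (x + p) *
        qPoch A q (x + p) * qPoch D q (x + p) * A ^ (m + (x + p))) *
      ((-1) ^ x * q ^ x.choose 2 * qPoch B q (m + p) /
        (qPoch q q x * qPoch q q p * qPoch D q p)) := by
  have z2 := (qPoch_pos hq0 hq1 hD0.le hD p).ne'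
  have z3 := qPoch_q_ne_zero hq0 hq1
  have s := neg_one_pow_mul_self m
  rw [hahnPoly_end hq0 hq1, hahnPoly_top hq0 hq1, qPoch_inv_pow' hq0 hq1, qPoch_add A q x p,
    show qPoch D q (x + p) = qPoch D q p * qPoch (D * q ^ p) q x by rw [add_comm, qPoch_add],
    add_mul m p m, pow_add q (m * m), pow_mul_self_eq, pow_mul q p m, neg_pow B, neg_pow A,
    show m + (x + p) = (m + p) + x by ring, pow_add A (m + p) x]
  have z10 := pow_ne_zero (m.choose 2) hq0.ne'
  have z11 := pow_ne_zero m hq0.ne'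
  have z12 := pow_ne_zero m (pow_ne_zero p hq0.ne')
  have z13 := z3 x
  have z14 := z3 p
  have z15 := z3 (m + p)
  generalize (-1 : ℝ) ^ m = t at *
  generalize qPoch q q x = x10 at *
  generalize qPoch q q p = x11 at *
  generalize qPoch q q (m + p) = x12 at *
  generalize (q ^ p) ^ m = x13 at *
  generalize q ^ m = x14 at *
  generalize q ^ m.choose 2 = x15 at *
  generalize qPoch D q p = x16 at *
  generalize qPoch A q x = y1
  generalize qPoch B q (m + p) = y2
  generalize A ^ (m + p) = y3
  generalize B ^ m = y4
  generalize qPoch C q m = y5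
  generalize qPoch (q ^ (x + p))⁻¹ q (x + p) = y6
  generalize qPoch (A * q ^ x) q p = y7
  generalize (-1 : ℝ) ^ x = y8
  generalize A ^ x = y9
  generalize q ^ x.choose 2 = y10
  generalize qPoch (D * q ^ p) q x = y11
  clear z3
  have e : x15 ^ 2 * x14 * x13 / (x10 * x12) * (t * x12 / (x11 * x15 * x14 * x13) * (t * x15)) =
      x15 ^ 2 / (x10 * x11 * x16) * x16 * (t * t) := by
    field_simp
  rw [s, mul_one] at e
  linear_combination y1 * y2 * y3 * y4 * y5 * y6 * y7 * y8 * y9 * y10 * y11 * e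

/-- The square root of `hahnTriple_weight` times `hahnTriple_poly`. The root on the right depends on
$x$ and $p$ only through $J=x+p$, so it comes out of the sum. -/
lemma hahnTriple_term (hq0 : 0 < q) (hq1 : q < 1) {A B C : ℝ} (hA0 : 0 < A) (hA : A < q)
    (hB0 : 0 < B) (hB : B < q) (hC0 : 0 < C) (hC : C < q) (m x p n : ℕ) :
    √(hW q B C (m + p) (m + p) / hE q B C (m + p) m) *
        hahnPoly q B C m (q ^ (m + p))⁻¹ (q ^ (m + p))⁻¹ *
      (√(hW q A (B * C * q ^ (2 * m)) (x + p) x / hE q A (B * C * q ^ (2 * m)) (x + p) (x + p)) *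
        hahnPoly q A (B * C * q ^ (2 * m)) (x + p) (q ^ x)⁻¹ (q ^ (x + p))⁻¹) *
      √(hW q A B (m + (x + p)) x / hE q A B (m + (x + p)) n) =
    √(hahnTripleConst q A B C m / (hE q A (B * C * q ^ (2 * m)) (x + p) (x + p) *
        hE q A B (m + (x + p)) n)) *
      (B ^ m * (q ^ m.choose 2) ^ 2 * qPoch C q m * qPoch (q ^ (x + p))⁻¹ q (x + p) *
        qPoch A q (x + p) * qPoch (B * C * q ^ (2 * m)) q (x + p) * A ^ (m + (x + p))) *
      ((-1) ^ x * q ^ x.choose 2 * qPoch B q (m + p) /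
        (qPoch q q x * qPoch q q p * qPoch (B * C * q ^ (2 * m)) q p)) := by
  have hD0 : 0 < B * C * q ^ (2 * m) := by positivity
  have hDq : B * C * q ^ (2 * m) < q := by
    have h1 := pow_le_one₀ hq0.le hq1.le (n := 2 * m)
    have : B * C < q := by nlinarith
    have : 0 < B * C := by positivity
    nlinarith
  have p1 := hW_pos hq0 hq1 hB0 hB hC0 hC
  have p2 := hE_pos hq0 hq1 hB0 hB hC0 hC
  have p3 := hW_pos hq0 hq1 hA0 hA hD0 hDq
  have p4 := hE_pos hq0 hq1 hA0 hA hD0 hDq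
  have p5 := hW_pos hq0 hq1 hA0 hA hB0 hB
  have p6 := hE_pos hq0 hq1 hA0 hA hB0 hB
  have w := hahnTriple_weight hq0 hq1 hA0 hB0 hB hC0 hC m x p
    (hE q A (B * C * q ^ (2 * m)) (x + p) (x + p)) (hE q A B (m + (x + p)) n)
  have hg : 0 < qPoch A q x * qPoch B q (m + p) * q ^ ((m + p) * m) * A ^ (m + p) /
        (qPoch q q x * qPoch q q (m + p)) := by
    have := qPoch_pos hq0 hq1 hA0.le (hA.trans hq1) x
    have := qPoch_pos hq0 hq1 hB0.le (hB.trans hq1) (m + p)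
    have := qPoch_pos hq0 hq1 hq0.le hq1
    have := this x
    have := ‹∀ n, 0 < qPoch q q n› (m + p)
    positivity
  have e := congrArg Real.sqrt w
  rw [Real.sqrt_mul (mul_pos (div_pos (p1 _ _) (p2 _ _)) (div_pos (p3 _ _) (p4 _ _))).le,
    Real.sqrt_mul (div_pos (p1 _ _) (p2 _ _)).le, Real.sqrt_mul' _ (sq_nonneg _),
    Real.sqrt_sq hg.le] at e
  rw [mul_assoc (√(hahnTripleConst q A B C m / _)),
    ← hahnTriple_poly hq0 hq1 hD0 (hDq.trans hq1) m x p]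
  linear_combination hahnPoly q B C m (q ^ (m + p))⁻¹ (q ^ (m + p))⁻¹ *
    hahnPoly q A (B * C * q ^ (2 * m)) (x + p) (q ^ x)⁻¹ (q ^ (x + p))⁻¹ * e

end RacahCoefficient

/-! ### The constants on the two sides of the $6j$ evaluation. -/

section RacahCoefficient

variable {q : ℝ}

/-- The weight of the `q`-Racah polynomials in multiplicative form. -/
def rW (q A B C : ℝ) (n r : ℕ) : ℝ :=
  (1 - q ^ (2 * n) * (A * B / q)) / (1 - A * B / q) *
    (qPoch (A * B / q) q n * qPoch B q n * qPoch (A * B * C * q ^ (n + r) / q) q n *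
      (qPoch q q (n + r) / (qPoch q q r * q ^ n)) * C ^ n /
    (qPoch q q n * qPoch A q n * qPoch (C * q ^ r) q n * qPoch (A * B * q ^ (n + r)) q n)) *
    (q / (B * C)) ^ n

/-- The squared norm of the `q`-Racah polynomials in multiplicative form. -/
def rE (q A B C : ℝ) (m J : ℕ) : ℝ :=
  qPoch (A * B) q (m + J) * qPoch (B * C) q (m + J) /
      (qPoch A q (m + J) * qPoch C q (m + J) * B ^ (m + J)) *
    (qPoch q q m * qPoch B q m * qPoch C q m *
      (qPoch (A * q ^ J) q m / (A ^ m * (q ^ J) ^ m * q ^ m.choose 2)) *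
      qPoch (A * B * C * q ^ (m + J) / q) q m *
      (qPoch q q (m + J) / (qPoch q q J * q ^ m.choose 2 * q ^ m * (q ^ J) ^ m))) *
    ((1 - B * C / q) / (1 - q ^ (2 * m) * (B * C / q))) *
    (qPoch (B * C * q ^ (m + J)) q m / qPoch (B * C / q) q m)

lemma mul_pow_lt (hq0 : 0 < q) (hq1 : q < 1) {X Y : ℝ} (hX0 : 0 < X) (hX : X < Y) (k : ℕ) :
    X * q ^ k < Y := by
  have h1 := pow_le_one₀ hq0.le hq1.le (n := k)
  nlinarith

lemma div_qPoch (hq0 : 0 < q) (hq1 : q < 1) {a : ℝ} (ha0 : 0 < a) (ha : a < 1) (m n : ℕ) :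
    qPoch (a * q ^ m) q n = qPoch a q (m + n) / qPoch a q m := by
  rw [eq_div_iff (qPoch_pos hq0 hq1 ha0.le ha m).ne', qPoch_add, mul_comm]

/-- The left-hand coefficient in the evaluation of the `6j` coefficients. -/
def sixJLeft (q A B C : ℝ) (m J n r : ℕ) : ℝ :=
  B ^ m * (q ^ m.choose 2) ^ 2 * qPoch C q r * qPoch A q J * A ^ (m + J) * qPoch B q m *
    (B * q ^ m) ^ J / q ^ J * (qPoch B q n / (B ^ n * q ^ n.choose 2)) *
    (qPoch q q (m + J) / (qPoch q q r * q ^ n.choose 2 * q ^ n * (q ^ r) ^ n)) *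
    qPoch (A * B * C * q ^ (m + J) / q) q n

/-- The right-hand coefficient in the evaluation of the `6j` coefficients. -/
def sixJRight (q A B C : ℝ) (m J n r : ℕ) (t : ℝ) : ℝ :=
  qPoch B q m * qPoch (A * B * C * q ^ (m + J) / q) q m *
    (qPoch q q (m + J) / (qPoch q q J * q ^ m.choose 2 * q ^ m * (q ^ J) ^ m)) * t *
    (qPoch q q r * (A * B * q ^ (2 * n)) ^ r * qPoch C q r / q ^ r)

/-- Refers the norm to a base $G$ chosen in advance. The top-degree norms on the two sides of the
$6j$ evaluation then share the base $G=ABCq^{m+J-1}$, with $k=m$ and $k=n$. -/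
lemma hE_top' (hq0 : 0 < q) (hq1 : q < 1) {A B G : ℝ} (hA0 : 0 < A) (hA : A < q) (hB0 : 0 < B)
    (hB : B < q) {N k : ℕ} (hG : A * B * q ^ N / q = G * q ^ k) (hG0 : 0 < G) (hG1 : G < 1) :
    hE q A B N N = qPoch G q (k + N) / qPoch G q k * (qPoch q q N * qPoch A q N * qPoch B q N) *
      A ^ N / ((q ^ N.choose 2) ^ 2 * (q ^ N) ^ 2) := by
  rw [hE_top hq0 hq1 hA0 hA hB0 hB, hG, div_qPoch hq0 hq1 hG0 hG1, mul_comm 2 (N.choose 2),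
    pow_mul, mul_comm 2 (N * N), pow_mul _ (N * N), pow_mul_self_eq]
  have z1 := pow_ne_zero (N.choose 2) hq0.ne'
  have z2 := pow_ne_zero N hq0.ne'
  have e : (q ^ N.choose 2) ^ 2 / ((q ^ N.choose 2) ^ 2 * q ^ N) ^ 2 =
    1 / ((q ^ N.choose 2) ^ 2 * (q ^ N) ^ 2) := by field_simp
  rw [e]; ring

end RacahCoefficient

/-! ### Equality of the squared normalizations. -/

section RacahCoefficient

variable {q : ℝ}

/-- Squaring removes all roots and leaves an identity between products. Shifted symbols are reduced
by `div_qPoch` to a few bases, after which everything cancels. The number $t$ stands for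
$q^{-m(a+b+1)/2}$, and only its square is needed. -/
lemma sixJ_sq (hq0 : 0 < q) (hq1 : q < 1) {A B C : ℝ} (hA0 : 0 < A) (hA : A < q)
    (hB0 : 0 < B) (hB : B < q) (hC0 : 0 < C) (hC : C < q) {m J n r : ℕ} (hL : m + J = n + r)
    {t : ℝ} (ht : t ^ 2 * (A * B / q) ^ m = 1) :
    hahnTripleConst q A B C m / (hE q A (B * C * q ^ (2 * m)) J J * hE q A B (m + J) n) *
      sixJLeft q A B C m J n r ^ 2 =
    rW q A B C n r / rE q A B C m J *
      (hW q (A * B * q ^ (2 * n)) C r r / hE q (A * B * q ^ (2 * n)) C r r *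
        sixJRight q A B C m J n r t ^ 2) := by
  have hAB0 : 0 < A * B := by positivity
  have hBC0 : 0 < B * C := by positivity
  have hAB := mul_div_lt_one hq0 hq1 hA hB0 hB
  have hBC := mul_div_lt_one hq0 hq1 hB hC0 hC
  have hABq : A * B < q := by rwa [div_lt_one hq0] at hAB
  have hBCq : B * C < q := by rwa [div_lt_one hq0] at hBC
  have hG0 : 0 < A * B * C * q ^ (m + J) / q := by positivity
  have hG1 : A * B * C * q ^ (m + J) / q < 1 := by
    rw [div_lt_one hq0]
    exact mul_pow_lt hq0 hq1 (by positivity) (by nlinarith) _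
  have z3 := qPoch_q_ne_zero hq0 hq1
  have zA := fun k => (qPoch_pos hq0 hq1 hA0.le (hA.trans hq1) k).ne'
  have zB := fun k => (qPoch_pos hq0 hq1 hB0.le (hB.trans hq1) k).ne'
  have zC := fun k => (qPoch_pos hq0 hq1 hC0.le (hC.trans hq1) k).ne'
  have zAB := fun k => (qPoch_pos hq0 hq1 hAB0.le (hABq.trans hq1) k).ne'
  have zBC := fun k => (qPoch_pos hq0 hq1 hBC0.le (hBCq.trans hq1) k).ne'
  have zABq := (qPoch_pos hq0 hq1 (by positivity) hAB n).ne'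
  have zBCq := (qPoch_pos hq0 hq1 (by positivity) hBC m).ne'
  have zG := fun k => (qPoch_pos hq0 hq1 hG0.le hG1 k).ne'
  have zE := (qPoch_pos hq0 hq1 (by positivity)
    ((mul_pow_lt hq0 hq1 hAB0 hABq (2 * n)).trans hq1) r).ne'
  have x1 : 1 - A * B / q ≠ 0 := by linarith
  have x2 : 1 - B * C / q ≠ 0 := by linarith
  have x3 : 1 - q ^ (2 * n) * (A * B / q) ≠ 0 := by
    have := mul_pow_lt hq0 hq1 (by positivity) hAB (2 * n)
    rw [mul_comm]; linarith
  have x4 : 1 - q ^ (2 * m) * (B * C / q) ≠ 0 := by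
    have := mul_pow_lt hq0 hq1 (by positivity) hBC (2 * m)
    rw [mul_comm]; linarith
  have e2 := hE_top' hq0 hq1 hA0 hA (show 0 < B * C * q ^ (2 * m) by positivity)
    (mul_pow_lt hq0 hq1 hBC0 hBCq _) (N := J) (k := m)
    (show A * (B * C * q ^ (2 * m)) * q ^ J / q = A * B * C * q ^ (m + J) / q * q ^ m by
      rw [two_mul, pow_add, pow_add]; ring) hG0 hG1
  have e4 := hE_top' hq0 hq1 (show 0 < A * B * q ^ (2 * n) by positivity)
    (mul_pow_lt hq0 hq1 hAB0 hABq _) hC0 hC (N := r) (k := n)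
    (show A * B * q ^ (2 * n) * C * q ^ r / q = A * B * C * q ^ (m + J) / q * q ^ n by
      rw [hL, two_mul, pow_add, pow_add]; ring) hG0 hG1
  rw [e2, e4, hahnTripleConst, hE, hW, rW, rE, sixJLeft, sixJRight, hL]
  rw [hL] at zG
  have d1 : qPoch (B * C * q ^ (2 * m)) q J = qPoch (B * C) q (m + (n + r)) / qPoch (B * C) q (2 * m) := by
    rw [div_qPoch hq0 hq1 hBC0 (hBCq.trans hq1), ← hL]; congr 2; ring
  have d2 : qPoch (B * C * q ^ (n + r)) q m = qPoch (B * C) q (m + (n + r)) / qPoch (B * C) q (n + r) := by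
    rw [div_qPoch hq0 hq1 hBC0 (hBCq.trans hq1), add_comm m]
  have d3 : qPoch (A * B * q ^ (n + r)) q n = qPoch (A * B) q (n + (n + r)) / qPoch (A * B) q (n + r) := by
    rw [div_qPoch hq0 hq1 hAB0 (hABq.trans hq1), add_comm n (n + r)]
  have d4 : qPoch (C * q ^ r) q n = qPoch C q (n + r) / qPoch C q r := by
    rw [div_qPoch hq0 hq1 hC0 (hC.trans hq1), add_comm n]
  have d5 : qPoch (A * q ^ J) q m = qPoch A q (n + r) / qPoch A q J := by
    rw [div_qPoch hq0 hq1 hA0 (hA.trans hq1), ← hL, add_comm m]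
  rw [d1, d2, d3, d4, d5, Nat.sub_self, qPoch_zero, qPoch_zero, pow_zero,
    show n + r - n = r by omega]
  -- powers
  have w1 : ∀ x : ℝ, x ≠ 0 → x ^ J = x ^ n * x ^ r / x ^ m := fun x hx => by
    rw [eq_div_iff (pow_ne_zero _ hx), ← pow_add, ← pow_add, ← hL, add_comm]
  have w2 : q ^ r.choose 2 = q ^ m.choose 2 * q ^ J.choose 2 * (q ^ J) ^ m /
      (q ^ n.choose 2 * (q ^ r) ^ n) := by
    have h1 := choose_two_add m J
    rw [hL, choose_two_add n r] at h1
    rw [eq_div_iff (by positivity), ← pow_mul, ← pow_mul, ← pow_add, ← pow_add, ← pow_add,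
      ← pow_add]
    congr 1
    linarith [mul_comm n r, mul_comm m J]
  have w3 : (B * q ^ m) ^ J = B ^ J * (q ^ J) ^ m := by
    rw [mul_pow, ← pow_mul, ← pow_mul, mul_comm m J]
  have w4 : q ^ (2 * n.choose 2) / q ^ (2 * (n + r) * n) =
      1 / ((q ^ n.choose 2) ^ 2 * (q ^ n) ^ 2 * ((q ^ r) ^ n) ^ 2) := by
    have z := pow_ne_zero (n.choose 2) hq0.ne'
    have z' := pow_ne_zero n hq0.ne'
    have z'' := pow_ne_zero n (pow_ne_zero r hq0.ne')
    rw [show 2 * (n + r) * n = (n * n) * 2 + (r * n) * 2 by ring, pow_add, pow_mul q (n * n) 2,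
      pow_mul_self_eq, pow_mul q (r * n) 2, pow_mul q r n, mul_comm 2 (n.choose 2),
      pow_mul q _ 2]
    field_simp
  have w5 : (A * B * q ^ (2 * n)) ^ r = A ^ r * B ^ r * ((q ^ r) ^ n) ^ 2 := by
    rw [mul_pow, mul_pow, ← pow_mul, ← pow_mul, ← pow_mul]; congr 2; ring
  have w6 : t ^ 2 = q ^ m / (A ^ m * B ^ m) := by
    rw [eq_div_iff (by positivity), ← mul_pow, ← one_mul (q ^ m), ← ht, div_pow]
    have := pow_ne_zero m hq0.ne'
    field_simp
  rw [w3, w4, w5, div_pow q, mul_pow B C n, pow_add A n r, pow_add B n r]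
  have zu := pow_ne_zero m (pow_ne_zero J hq0.ne')
  have zw := pow_ne_zero n (pow_ne_zero r hq0.ne')
  have zsm := pow_ne_zero (m.choose 2) hq0.ne'
  have zsJ := pow_ne_zero (J.choose 2) hq0.ne'
  have zsn := pow_ne_zero (n.choose 2) hq0.ne'
  have zqm := pow_ne_zero m hq0.ne'
  have zqn := pow_ne_zero n hq0.ne'
  have zqr := pow_ne_zero r hq0.ne'
  have zAm := pow_ne_zero m hA0.ne'
  have zAn := pow_ne_zero n hA0.ne'
  have zAr := pow_ne_zero r hA0.ne'
  have zBm := pow_ne_zero m hB0.ne'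
  have zBn := pow_ne_zero n hB0.ne'
  have zBr := pow_ne_zero r hB0.ne'
  have zCn := pow_ne_zero n hC0.ne'
  have zt : t ≠ 0 := by rintro rfl; simp at ht
  have w7 : q ^ m = t ^ 2 * (A ^ m * B ^ m) := by rw [w6, div_mul_cancel₀ _ (mul_ne_zero zAm zBm)]
  rw [w2]
  generalize (q ^ J) ^ m = u at *
  generalize (q ^ r) ^ n = w at *
  rw [w1 A hA0.ne', w1 B hB0.ne', w1 q hq0.ne']
  replace z3 := (⟨z3 m, z3 n, z3 r, z3 J, z3 (n + r)⟩ : _ ∧ _ ∧ _ ∧ _ ∧ _)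
  replace zA := (⟨zA J, zA n, zA (n + r)⟩ : _ ∧ _ ∧ _)
  replace zB := (⟨zB m, zB n⟩ : _ ∧ _)
  replace zC := (⟨zC m, zC r, zC (n + r)⟩ : _ ∧ _ ∧ _)
  replace zAB := (⟨zAB (n + (n + r)), zAB (n + r)⟩ : _ ∧ _)
  replace zBC := (⟨zBC (2 * m), zBC (n + r), zBC (m + (n + r))⟩ : _ ∧ _ ∧ _)
  replace zG := (⟨zG m, zG n, zG (n + r)⟩ : _ ∧ _ ∧ _)
  obtain ⟨i1, i2, i3, i4, i5⟩ := z3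
  obtain ⟨a1, a2, a3⟩ := zA
  obtain ⟨b1, b2⟩ := zB
  obtain ⟨c1, c2, c3⟩ := zC
  obtain ⟨f1, f2⟩ := zAB
  obtain ⟨g1, g2, g3⟩ := zBC
  obtain ⟨h1, h2, h3⟩ := zG
  clear d1 d2 d3 d4 d5 e2 e4 w1 w2 w3 w4 w5 w6 ht hG0 hG1 hAB0 hBC0 hAB hBC hABq hBCq
  rw [w7]
  clear w7
  generalize 1 - B * C / q = y1 at *
  generalize 1 - q ^ (2 * m) * (B * C / q) = y2 at *
  generalize 1 - A * B / q = y3 at *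
  generalize 1 - q ^ (2 * n) * (A * B / q) = y4 at *
  generalize qPoch (A * B * C * q ^ (n + r) / q) q (n + r) = y5 at *
  generalize qPoch (A * B * C * q ^ (n + r) / q) q n = y6 at *
  generalize qPoch (A * B * C * q ^ (n + r) / q) q m = y7 at *
  generalize qPoch (A * B * q ^ (2 * n)) q r = y8 at *
  generalize qPoch (A * B / q) q n = y9 at *
  generalize qPoch (B * C / q) q m = y10 at *
  generalize qPoch (B * C) q (2 * m) = y11 at *
  generalize qPoch (B * C) q (m + (n + r)) = y12 at *
  generalize qPoch (B * C) q (n + r) = y13 at *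
  generalize qPoch (A * B) q (n + (n + r)) = y14 at *
  generalize qPoch (A * B) q (n + r) = y15 at *
  generalize qPoch A q (n + r) = y16 at *
  generalize qPoch A q n = y17 at *
  generalize qPoch A q J = y18 at *
  generalize qPoch B q m = y19 at *
  generalize qPoch B q n = y20 at *
  generalize qPoch C q m = y21 at *
  generalize qPoch C q (n + r) = y22 at *
  generalize qPoch C q r = y23 at *
  generalize qPoch q q (n + r) = y24 at *
  generalize qPoch q q m = y25 at *
  generalize qPoch q q n = y26 at *
  generalize qPoch q q r = y27 at *
  generalize qPoch q q J = y28 at *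
  generalize A ^ m = v1 at *
  generalize A ^ n = v2 at *
  generalize A ^ r = v3 at *
  generalize B ^ m = v4 at *
  generalize B ^ n = v5 at *
  generalize B ^ r = v6 at *
  generalize C ^ n = v7 at *
  generalize q ^ n = v8 at *
  generalize q ^ r = v9 at *
  generalize q ^ n.choose 2 = v10 at *
  generalize q ^ m.choose 2 = v11 at *
  generalize q ^ J.choose 2 = v12 at *
  clear hq0 hq1 hA0 hA hB0 hB hC0 hC zqm hL
  field_simp

end RacahCoefficient

/-! ### Signs, square roots and the final evaluation of the $6j$ sum. -/

section RacahCoefficient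

variable {q : ℝ}

/-- Collects the constants of `hahnTriple_term`, `hahnSum_eq_preSears` and `sum_preSears`. The signs
$(-1)^J$ and $(-1)^n$ each occur twice and cancel. -/
lemma sixJLeft_eq (hq0 : 0 < q) (hq1 : q < 1) {A B C : ℝ}
    (hB0 : 0 < B) (hB : B < q) (hC0 : 0 < C) (hC : C < q) {m J n r : ℕ} (hL : m + J = n + r) :
    (B ^ m * (q ^ m.choose 2) ^ 2 * qPoch C q m * qPoch (q ^ J)⁻¹ q J *
        qPoch A q J * qPoch (B * C * q ^ (2 * m)) q J * A ^ (m + J)) *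
      (qPoch B q m * ((-(B * q ^ m)) ^ J * q ^ J.choose 2) * qPoch (C * q ^ m) q J /
        (qPoch q q J * qPoch (B * C * q ^ (2 * m)) q J * qPoch (C * q ^ r) q n)) *
      (qPoch (q / (B * q ^ n)) q n * qPoch (q ^ (m + J))⁻¹ q n *
        qPoch (A * B * C * q ^ (m + J) / q) q n) = sixJLeft q A B C m J n r := by
  have hBC0 : 0 < B * C := by positivity
  have hBC := mul_div_lt_one hq0 hq1 hB hC0 hC
  have hBCq : B * C < q := by rwa [div_lt_one hq0] at hBC
  have z1 := (qPoch_pos hq0 hq1 (by positivity)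
    ((mul_pow_lt hq0 hq1 hBC0 hBCq (2 * m)).trans hq1) J).ne'
  have z2 := (qPoch_pos hq0 hq1 hC0.le (hC.trans hq1) m).ne'
  have z3 := (qPoch_pos hq0 hq1 hC0.le (hC.trans hq1) r).ne'
  have z4 := (qPoch_pos hq0 hq1 hC0.le (hC.trans hq1) (n + r)).ne'
  rw [sixJLeft, div_qPoch hq0 hq1 hC0 (hC.trans hq1), div_qPoch hq0 hq1 hC0 (hC.trans hq1),
    qPoch_inv_pow_self hq0, pow_mul_self_eq, qPoch_reverse' hq0 hB0.ne', add_comm r n, hL,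
    qPoch_inv_pow' hq0 hq1, neg_pow (B * q ^ m)]
  have s1 := neg_one_pow_mul_self n
  have s2 := neg_one_pow_mul_self J
  have z5 := pow_ne_zero (J.choose 2) hq0.ne'
  have z6 := pow_ne_zero J hq0.ne'
  have z7 := qPoch_q_ne_zero hq0 hq1 J
  generalize (-1 : ℝ) ^ n = t1 at *
  generalize (-1 : ℝ) ^ J = t2 at *
  generalize qPoch C q m = y1 at *
  generalize qPoch C q r = y2 at *
  generalize qPoch C q (n + r) = y3 at *
  generalize qPoch (B * C * q ^ (2 * m)) q J = y4 at *
  generalize q ^ J.choose 2 = y5 at *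
  generalize q ^ J = y6 at *
  generalize qPoch q q J = y7 at *
  have e : y1 * (t2 * y5 / (y5 ^ 2 * y6) * y7) * y4 * (t2 * y5 * (y3 / y1) / (y7 * y4 * (y3 / y2))) =
      t2 * t2 * y2 / y6 := by
    field_simp
  rw [s2, one_mul] at e
  generalize qPoch A q J = y8
  generalize qPoch B q m = y9
  generalize qPoch B q n = y10
  generalize (B * q ^ m) ^ J = y11
  generalize B ^ m = y12
  generalize A ^ (n + r) = y13
  generalize qPoch (A * B * C * q ^ (n + r) / q) q n = y14
  generalize qPoch q q (n + r) = y15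
  have e2 := congrArg₂ (· * ·) e s1
  linear_combination y12 * (q ^ m.choose 2) ^ 2 * y8 * y13 * y9 * y11 * (y10 / (B ^ n * q ^ n.choose 2)) *
    (y15 / (qPoch q q r * q ^ n.choose 2 * q ^ n * (q ^ r) ^ n)) * y14 * e2

/-- The sign $(-1)^r$ occurs twice. The remaining $(-1)^m$, from $(q^{-(m+J)};q)_m$, is the sign of
the $6j$ coefficient. -/
lemma sixJRight_eq (hq0 : 0 < q) (hq1 : q < 1) {A B C : ℝ} {m J n r : ℕ} (t : ℝ) :
    qPoch B q m * qPoch (A * B * C * q ^ (m + J) / q) q m * qPoch (q ^ (m + J))⁻¹ q m * t *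
      (qPoch (q ^ r)⁻¹ q r * ((-(A * B * q ^ (2 * n))) ^ r * q ^ (r.choose 2) * qPoch C q r)) =
    (-1) ^ m * sixJRight q A B C m J n r t := by
  rw [sixJRight, qPoch_inv_pow_self hq0, pow_mul_self_eq, qPoch_inv_pow' hq0 hq1, neg_pow (A * B * q ^ (2 * n))]
  have s2 := neg_one_pow_mul_self r
  have z5 := pow_ne_zero (r.choose 2) hq0.ne'
  have z6 := pow_ne_zero r hq0.ne'
  have e : (-1) ^ r * q ^ r.choose 2 / ((q ^ r.choose 2) ^ 2 * q ^ r) * ((-1) ^ r * q ^ r.choose 2) =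
      (-1) ^ r * (-1) ^ r / q ^ r := by field_simp
  rw [s2] at e
  linear_combination qPoch B q m * qPoch (A * B * C * q ^ (m + J) / q) q m *
    ((-1) ^ m * qPoch q q (m + J) / (qPoch q q J * q ^ m.choose 2 * q ^ m * (q ^ J) ^ m)) * t *
    (qPoch q q r * (A * B * q ^ (2 * n)) ^ r * qPoch C q r) * e

/-- Both coefficients are positive, so roots may be taken in `sixJ_sq`. -/
lemma sixJ_sqrt (hq0 : 0 < q) (hq1 : q < 1) {A B C : ℝ} (hA0 : 0 < A) (hA : A < q)
    (hB0 : 0 < B) (hB : B < q) (hC0 : 0 < C) (hC : C < q) {m J n r : ℕ} (hL : m + J = n + r)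
    {t : ℝ} (ht0 : 0 < t) (ht : t ^ 2 * (A * B / q) ^ m = 1) :
    √(hahnTripleConst q A B C m / (hE q A (B * C * q ^ (2 * m)) J J * hE q A B (m + J) n)) *
      sixJLeft q A B C m J n r =
    √(rW q A B C n r / rE q A B C m J) *
      (√(hW q (A * B * q ^ (2 * n)) C r r / hE q (A * B * q ^ (2 * n)) C r r) *
        sixJRight q A B C m J n r t) := by
  have hAB0 : 0 < A * B := by positivity
  have hAB := mul_div_lt_one hq0 hq1 hA hB0 hB
  have hABq : A * B < q := by rwa [div_lt_one hq0] at hAB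
  have hG0 : 0 < A * B * C * q ^ (m + J) / q := by positivity
  have hG1 : A * B * C * q ^ (m + J) / q < 1 := by
    rw [div_lt_one hq0]
    exact mul_pow_lt hq0 hq1 (by positivity) (by nlinarith) _
  have pA := qPoch_pos hq0 hq1 hA0.le (hA.trans hq1)
  have pB := qPoch_pos hq0 hq1 hB0.le (hB.trans hq1)
  have pC := qPoch_pos hq0 hq1 hC0.le (hC.trans hq1)
  have pQ := qPoch_pos hq0 hq1 hq0.le hq1
  have pG := qPoch_pos hq0 hq1 hG0.le hG1
  have pl : 0 < sixJLeft q A B C m J n r := by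
    have := pC r; have := pA J; have := pB m; have := pB n; have := pQ (m + J); have := pQ r
    have := pG n
    unfold sixJLeft; positivity
  have pr : 0 < sixJRight q A B C m J n r t := by
    have := pC r; have := pB m; have := pQ (m + J); have := pQ r; have := pQ J
    have := pG m
    unfold sixJRight; positivity
  have w4 : 0 < hW q (A * B * q ^ (2 * n)) C r r / hE q (A * B * q ^ (2 * n)) C r r :=
    div_pos (hW_pos hq0 hq1 (by positivity) (mul_pow_lt hq0 hq1 hAB0 hABq _) hC0 hC _ _)
      (hE_pos hq0 hq1 (by positivity) (mul_pow_lt hq0 hq1 hAB0 hABq _) hC0 hC _ _)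
  have e := congrArg Real.sqrt (sixJ_sq hq0 hq1 hA0 hA hB0 hB hC0 hC hL ht)
  rwa [Real.sqrt_mul' _ (sq_nonneg _), Real.sqrt_mul' _ (mul_nonneg w4.le (sq_nonneg _)),
    Real.sqrt_mul w4.le, Real.sqrt_sq pl.le, Real.sqrt_sq pr.le] at e

/-- This is the inner product of a right-coupled lowest weight vector with the $q$-Hahn function of
degree $n$ on the line $z=0$. Both sides contain the same `racahSeries`, and `sixJ_sqrt` compares
what stands in front of it. The last factor on the right is the outer factor of `coupleLeft` at
$z=0$. -/
theorem hahnTriple_sum (hq0 : 0 < q) (hq1 : q < 1) {a b c : ℝ} (ha : 0 < a) (hb : 0 < b)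
    (hc : 0 < c) {m J n r : ℕ} (hL : m + J = n + r) :
    ∑ x ∈ Finset.range (m + J + 1), hahnHat q m ((m + J : ℕ) - x) b c ((m + J : ℕ) - x) *
      hahnHat q J x a (2 * m + b + c + 1) J * hahnHat q n x a b (m + J : ℕ) =
    (-1) ^ m * racahHat q m n b c ((m + J : ℕ) + a + b + 1) (m + J : ℕ) *
      hahnHat q r r (2 * n + a + b + 1) c r := by
  have hA0 := Real.rpow_pos_of_pos hq0 (a + 1)
  have hA := rpow_add_one_lt hq0 hq1 ha
  have hB0 := Real.rpow_pos_of_pos hq0 (b + 1)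
  have hB := rpow_add_one_lt hq0 hq1 hb
  have hC0 := Real.rpow_pos_of_pos hq0 (c + 1)
  have hC := rpow_add_one_lt hq0 hq1 hc
  have hred : ∀ x ∈ Finset.range (J + 1), hahnHat q m ((m + J : ℕ) - x) b c ((m + J : ℕ) - x) *
      hahnHat q J x a (2 * m + b + c + 1) J * hahnHat q n x a b (m + J : ℕ) =
      √(hahnTripleConst q (q ^ (a + 1)) (q ^ (b + 1)) (q ^ (c + 1)) m /
        (hE q (q ^ (a + 1)) (q ^ (b + 1) * q ^ (c + 1) * q ^ (2 * m)) J J *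
          hE q (q ^ (a + 1)) (q ^ (b + 1)) (m + J) n)) *
      ((q ^ (b + 1)) ^ m * (q ^ m.choose 2) ^ 2 * qPoch (q ^ (c + 1)) q m * qPoch (q ^ J)⁻¹ q J *
        qPoch (q ^ (a + 1)) q J * qPoch (q ^ (b + 1) * q ^ (c + 1) * q ^ (2 * m)) q J *
        (q ^ (a + 1)) ^ (m + J)) *
      ((-1) ^ x * q ^ x.choose 2 * qPoch (q ^ (b + 1)) q (m + J - x) /
        (qPoch q q x * qPoch q q (J - x) *
          qPoch (q ^ (b + 1) * q ^ (c + 1) * q ^ (2 * m)) q (J - x)) *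
        hahnPoly q (q ^ (a + 1)) (q ^ (b + 1)) n (q ^ x)⁻¹ (q ^ (m + J))⁻¹) := by
    intro x hx
    obtain ⟨p, rfl⟩ : ∃ p, J = x + p := ⟨J - x, by simp at hx; omega⟩
    have h1 := hahnTriple_term hq0 hq1 hA0 hA hB0 hB hC0 hC m x p n
    rw [show (((m + (x + p) : ℕ) : ℤ) - x) = ((m + p : ℕ) : ℤ) by push_cast; ring,
      hahnHat_eq hq0 hq1 (by omega) le_rfl hb, hahnHat_eq hq0 hq1 le_rfl (by omega) ha,
      hahnHat_eq hq0 hq1 (by omega) (by omega) ha, coupled_param hq0,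
      show m + (x + p) - x = m + p by omega, show x + p - x = p by omega]
    linear_combination hahnPoly q (q ^ (a + 1)) (q ^ (b + 1)) n (q ^ x)⁻¹ (q ^ (m + (x + p)))⁻¹ * h1
  -- For $x>J$ the second factor vanishes, so the range can be cut down to $x\le J$, where $p=J-x$
  -- makes sense.
  rw [← Finset.sum_subset (Finset.range_subset_range.2 (show J + 1 ≤ m + J + 1 by omega)),
    Finset.sum_congr rfl hred, ← Finset.mul_sum, hahnSum_eq_preSears hq0 hq1 hB0 hB hC0 hC hL,
    sum_preSears hq0 hq1 hA0 hA hB0 hB hC0 hC hL]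
  · have hle : (0 : ℤ) ≤ (n : ℤ) ∧ (n : ℤ) ≤ (m + J : ℕ) ∧ (m : ℤ) ≤ (m + J : ℕ) := by omega
    have hn2 : (0 : ℝ) < 2 * n + a + b + 1 := by positivity
    have hE := racah_eq hq0 m n (m + J) a b c
    have hw := racahWeight_eq hq0 hq1 a b hc (n := n) (r := r)
    rw [← hL] at hw
    rw [racahHat, if_pos hle, Int.toNat_natCast, Int.toNat_natCast, hw,
      racahNorm_eq hq0 hq1 ha, Int.cast_natCast, Int.cast_natCast, hE,
      hahnHat_eq hq0 hq1 le_rfl le_rfl hn2, hahnPoly_end hq0 hq1, coupled_param hq0]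
    have ht0 : 0 < q ^ (-((m : ℝ) * (a + b + 1) / 2)) := Real.rpow_pos_of_pos hq0 _
    have ht : (q ^ (-((m : ℝ) * (a + b + 1) / 2))) ^ 2 * (q ^ (a + 1) * q ^ (b + 1) / q) ^ m = 1 := by
      rw [← (rpow_params hq0 a b).2, ← Real.rpow_natCast, ← Real.rpow_natCast, ← Real.rpow_mul hq0.le,
        ← Real.rpow_mul hq0.le, ← Real.rpow_add hq0, ← Real.rpow_zero q]
      congr 1; push_cast; ring
    have k1 := sixJ_sqrt hq0 hq1 hA0 hA hB0 hB hC0 hC hL ht0 ht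
    have k2 := sixJLeft_eq (A := q ^ (a + 1)) hq0 hq1 hB0 hB hC0 hC hL
    have k3 := sixJRight_eq hq0 hq1 (A := q ^ (a + 1)) (B := q ^ (b + 1)) (C := q ^ (c + 1))
      (m := m) (J := J) (n := n) (r := r) (q ^ (-((m : ℝ) * (a + b + 1) / 2)))
    have s1 := neg_one_pow_mul_self m
    rw [← k2] at k1
    have k4 : sixJRight q (q ^ (a + 1)) (q ^ (b + 1)) (q ^ (c + 1)) m J n r
        (q ^ (-((m : ℝ) * (a + b + 1) / 2))) = (-1) ^ m * ((-1) ^ m *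
        sixJRight q (q ^ (a + 1)) (q ^ (b + 1)) (q ^ (c + 1)) m J n r
          (q ^ (-((m : ℝ) * (a + b + 1) / 2)))) := by rw [← mul_assoc, s1, one_mul]
    rw [k4, ← k3, rW, rE] at k1
    generalize racahSeries q (q ^ (a + 1)) (q ^ (b + 1)) (q ^ (c + 1)) m (m + J) n = R
    rw [← hL] at k1
    linear_combination R * k1
  · intro x _ hx
    rw [hahnHat_eq_zero_right (n := J) (by simp at hx; omega)]
    ring

end RacahCoefficient

/-! ### The `6j` expansion of coupled `q`-Hahn functions -/

section SixJ

variable {q : ℝ}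

/-- Threefold coupling where the second and third factor are coupled first. -/
def coupleRight (q : ℝ) (m₁ m₂ : ℕ) (a b c : ℝ) (x y z : ℤ) : ℝ :=
  hahnHat q m₁ y b c (y + z) * hahnHat q m₂ x a (2 * m₁ + b + c + 1) (x + y + z - m₁)

/-- Threefold coupling where the first two factors are coupled first. -/
def coupleLeft (q : ℝ) (n₁ n₂ : ℕ) (a b c : ℝ) (x y z : ℤ) : ℝ :=
  hahnHat q n₁ x a b (x + y) * hahnHat q n₂ (x + y - n₁) (2 * n₁ + a + b + 1) c (x + y + z - n₁)

/-- The lowering operator of the threefold tensor product on functions. -/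
def lowerThree (q a b c : ℝ) (f : ℤ → ℤ → ℤ → ℝ) (x y z : ℤ) : ℝ :=
  ladder q a (x + 1) * f (x + 1) y z + q ^ ((x : ℝ) + (a + 1) / 2) *
    (ladder q b (y + 1) * f x (y + 1) z +
      q ^ ((y : ℝ) + (b + 1) / 2) * (ladder q c (z + 1) * f x y (z + 1)))

/-- The raising operator of the threefold tensor product on functions. -/
def raiseThree (q a b c : ℝ) (f : ℤ → ℤ → ℤ → ℝ) (x y z : ℤ) : ℝ :=
  ladder q a x * f (x - 1) y z + q ^ ((x : ℝ) + (a + 1) / 2) *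
    (ladder q b y * f x (y - 1) z +
      q ^ ((y : ℝ) + (b + 1) / 2) * (ladder q c z * f x y (z - 1)))

/-- Two applications of `hahnHat_lower`. Lowering the inner pair $(y,z)$ produces the ladder
coefficient of the coupled pair, which the second application, to $x$ and that pair, requires. -/
lemma lowerThree_coupleRight (hq0 : 0 < q) (hq1 : q < 1) {a b c : ℝ} (ha : 0 < a) (hb : 0 < b)
    (hc : 0 < c) (m₁ m₂ : ℕ) (x y z : ℤ) :
    lowerThree q a b c (coupleRight q m₁ m₂ a b c) x y z =
      ladder q (2 * (m₁ + m₂ : ℕ) + a + b + c + 2) (x + y + z + 1 - (m₁ + m₂ : ℕ)) *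
        coupleRight q m₁ m₂ a b c x y z := by
  have h1 := hahnHat_lower hq0 hq1 hb hc m₁ y (y + z)
  have h2 := hahnHat_lower hq0 hq1 ha (show (0 : ℝ) < 2 * m₁ + b + c + 1 by positivity) m₂ x
    (x + y + z - m₁)
  rw [show 2 * (m₂ : ℝ) + a + (2 * m₁ + b + c + 1) + 1 = 2 * (m₁ + m₂ : ℕ) + a + b + c + 2 by
      push_cast; ring,
    show x + y + z - (m₁ : ℤ) + 1 - m₂ = x + y + z + 1 - (m₁ + m₂ : ℕ) by push_cast; ring,
    show x + y + z - (m₁ : ℤ) + 1 - x = y + z + 1 - m₁ by ring] at h2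
  rw [show y + z + 1 - y = z + 1 by ring] at h1
  simp only [lowerThree, coupleRight]
  rw [show x + 1 + y + z - (m₁ : ℤ) = x + y + z - m₁ + 1 by ring,
    show x + (y + 1) + z - (m₁ : ℤ) = x + y + z - m₁ + 1 by ring,
    show x + y + (z + 1) - (m₁ : ℤ) = x + y + z - m₁ + 1 by ring,
    show y + 1 + z = y + z + 1 by ring, show y + (z + 1) = y + z + 1 by ring]
  linear_combination hahnHat q m₁ y b c (y + z) * h2 + q ^ ((x : ℝ) + (a + 1) / 2) *
    hahnHat q m₂ x a (2 * m₁ + b + c + 1) (x + y + z - m₁ + 1) * h1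

lemma raiseThree_coupleRight (hq0 : 0 < q) (hq1 : q < 1) {a b c : ℝ} (ha : 0 < a) (hb : 0 < b)
    (hc : 0 < c) (m₁ m₂ : ℕ) (x y z : ℤ) :
    raiseThree q a b c (coupleRight q m₁ m₂ a b c) x y z =
      ladder q (2 * (m₁ + m₂ : ℕ) + a + b + c + 2) (x + y + z - (m₁ + m₂ : ℕ)) *
        coupleRight q m₁ m₂ a b c x y z := by
  have h1 := hahnHat_raise hq0 hq1 hb hc m₁ y (y + z)
  have h2 := hahnHat_raise hq0 hq1 ha (show (0 : ℝ) < 2 * m₁ + b + c + 1 by positivity) m₂ x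
    (x + y + z - m₁)
  rw [show 2 * (m₂ : ℝ) + a + (2 * m₁ + b + c + 1) + 1 = 2 * (m₁ + m₂ : ℕ) + a + b + c + 2 by
      push_cast; ring,
    show x + y + z - (m₁ : ℤ) - m₂ = x + y + z - (m₁ + m₂ : ℕ) by push_cast; ring,
    show x + y + z - (m₁ : ℤ) - x = y + z - m₁ by ring] at h2
  rw [show y + z - y = z by ring] at h1
  simp only [raiseThree, coupleRight]
  rw [show x - 1 + y + z - (m₁ : ℤ) = x + y + z - m₁ - 1 by ring,
    show x + (y - 1) + z - (m₁ : ℤ) = x + y + z - m₁ - 1 by ring,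
    show x + y + (z - 1) - (m₁ : ℤ) = x + y + z - m₁ - 1 by ring,
    show y - 1 + z = y + z - 1 by ring, show y + (z - 1) = y + z - 1 by ring]
  linear_combination hahnHat q m₁ y b c (y + z) * h2 + q ^ ((x : ℝ) + (a + 1) / 2) *
    hahnHat q m₂ x a (2 * m₁ + b + c + 1) (x + y + z - m₁ - 1) * h1

/-- The weight of a coupled vector is the sum of the weights of its two factors: $q^{A_0}$ is
group-like. -/
lemma coupled_weight (hq0 : 0 < q) (n : ℕ) (a b : ℝ) (x y : ℤ) :
    q ^ (((x + y - (n : ℤ) : ℤ) : ℝ) + (2 * n + a + b + 1 + 1) / 2) =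
      q ^ ((x : ℝ) + (a + 1) / 2) * q ^ ((y : ℝ) + (b + 1) / 2) := by
  rw [← Real.rpow_add hq0]; congr 1; push_cast; ring

lemma lowerThree_coupleLeft (hq0 : 0 < q) (hq1 : q < 1) {a b c : ℝ} (ha : 0 < a) (hb : 0 < b)
    (hc : 0 < c) (n₁ n₂ : ℕ) (x y z : ℤ) :
    lowerThree q a b c (coupleLeft q n₁ n₂ a b c) x y z =
      ladder q (2 * (n₁ + n₂ : ℕ) + a + b + c + 2) (x + y + z + 1 - (n₁ + n₂ : ℕ)) *
        coupleLeft q n₁ n₂ a b c x y z := by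
  have h1 := hahnHat_lower hq0 hq1 ha hb n₁ x (x + y)
  have h2 := hahnHat_lower hq0 hq1 (show (0 : ℝ) < 2 * n₁ + a + b + 1 by positivity) hc n₂
    (x + y - n₁) (x + y + z - n₁)
  rw [show 2 * (n₂ : ℝ) + (2 * n₁ + a + b + 1) + c + 1 = 2 * (n₁ + n₂ : ℕ) + a + b + c + 2 by
      push_cast; ring,
    show x + y + z - (n₁ : ℤ) + 1 - n₂ = x + y + z + 1 - (n₁ + n₂ : ℕ) by push_cast; ring,
    show x + y + z - (n₁ : ℤ) + 1 - (x + y - n₁) = z + 1 by ring, coupled_weight hq0] at h2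
  rw [show x + y + 1 - x = y + 1 by ring] at h1
  simp only [lowerThree, coupleLeft]
  rw [show x + 1 + y + z - (n₁ : ℤ) = x + y + z - n₁ + 1 by ring,
    show x + (y + 1) + z - (n₁ : ℤ) = x + y + z - n₁ + 1 by ring,
    show x + y + (z + 1) - (n₁ : ℤ) = x + y + z - n₁ + 1 by ring,
    show x + 1 + y = x + y + 1 by ring, show x + (y + 1) = x + y + 1 by ring]
  rw [show x + y + 1 - (n₁ : ℤ) = x + y - n₁ + 1 by ring] at *
  linear_combination hahnHat q n₁ x a b (x + y) * h2 +
    hahnHat q n₂ (x + y - n₁ + 1) (2 * n₁ + a + b + 1) c (x + y + z - n₁ + 1) * h1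

lemma raiseThree_coupleLeft (hq0 : 0 < q) (hq1 : q < 1) {a b c : ℝ} (ha : 0 < a) (hb : 0 < b)
    (hc : 0 < c) (n₁ n₂ : ℕ) (x y z : ℤ) :
    raiseThree q a b c (coupleLeft q n₁ n₂ a b c) x y z =
      ladder q (2 * (n₁ + n₂ : ℕ) + a + b + c + 2) (x + y + z - (n₁ + n₂ : ℕ)) *
        coupleLeft q n₁ n₂ a b c x y z := by
  have h1 := hahnHat_raise hq0 hq1 ha hb n₁ x (x + y)
  have h2 := hahnHat_raise hq0 hq1 (show (0 : ℝ) < 2 * n₁ + a + b + 1 by positivity) hc n₂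
    (x + y - n₁) (x + y + z - n₁)
  rw [show 2 * (n₂ : ℝ) + (2 * n₁ + a + b + 1) + c + 1 = 2 * (n₁ + n₂ : ℕ) + a + b + c + 2 by
      push_cast; ring,
    show x + y + z - (n₁ : ℤ) - n₂ = x + y + z - (n₁ + n₂ : ℕ) by push_cast; ring,
    show x + y + z - (n₁ : ℤ) - (x + y - n₁) = z by ring, coupled_weight hq0] at h2
  rw [show x + y - x = y by ring] at h1
  simp only [raiseThree, coupleLeft]
  rw [show x - 1 + y + z - (n₁ : ℤ) = x + y + z - n₁ - 1 by ring,
    show x + (y - 1) + z - (n₁ : ℤ) = x + y + z - n₁ - 1 by ring,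
    show x + y + (z - 1) - (n₁ : ℤ) = x + y + z - n₁ - 1 by ring,
    show x - 1 + y = x + y - 1 by ring, show x + (y - 1) = x + y - 1 by ring]
  rw [show x + y - 1 - (n₁ : ℤ) = x + y - n₁ - 1 by ring] at *
  linear_combination hahnHat q n₁ x a b (x + y) * h2 +
    hahnHat q n₂ (x + y - n₁ - 1) (2 * n₁ + a + b + 1) c (x + y + z - n₁ - 1) * h1

lemma coupleRight_eq_zero {m₁ m₂ : ℕ} {a b c : ℝ} {x y z : ℤ}
    (h : x < 0 ∨ y < 0 ∨ z < 0 ∨ x + y + z < (m₁ + m₂ : ℕ)) :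
    coupleRight q m₁ m₂ a b c x y z = 0 := by
  unfold coupleRight
  rcases h with h | h | h | h
  · rw [hahnHat_eq_zero_left h, mul_zero]
  · rw [hahnHat_eq_zero_left h, zero_mul]
  · rw [hahnHat_eq_zero_right (by omega), zero_mul]
  · rw [hahnHat_eq_zero_deg (N := x + y + z - m₁) (by push_cast at h; omega), mul_zero]

lemma coupleLeft_eq_zero {n₁ n₂ : ℕ} {a b c : ℝ} {x y z : ℤ}
    (h : x < 0 ∨ y < 0 ∨ z < 0 ∨ x + y + z < (n₁ + n₂ : ℕ)) :
    coupleLeft q n₁ n₂ a b c x y z = 0 := by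
  unfold coupleLeft
  rcases h with h | h | h | h
  · rw [hahnHat_eq_zero_left h, zero_mul]
  · rw [hahnHat_eq_zero_right (by omega), zero_mul]
  · rw [hahnHat_eq_zero_right (x := x + y - n₁) (by omega), mul_zero]
  · rw [hahnHat_eq_zero_deg (N := x + y + z - n₁) (by push_cast at h; omega), mul_zero]

/-- The `6j` coefficients. -/
def sixJ (q : ℝ) (m n : ℕ) (a b c : ℝ) (L : ℕ) : ℝ :=
  (-1) ^ m * racahHat q m n b c (L + a + b + 1) L

/-- On the line $z=0$, $x+y=m_1+m_2$, the inner factors of `coupleLeft` form a complete orthonormal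
system in $x$. The coefficients of `coupleRight` in it are the sums evaluated in `hahnTriple_sum`.
-/
lemma coupleRight_base (hq0 : 0 < q) (hq1 : q < 1) {a b c : ℝ} (ha : 0 < a) (hb : 0 < b)
    (hc : 0 < c) (m₁ m₂ x y : ℕ) (hxy : x + y = m₁ + m₂) :
    coupleRight q m₁ m₂ a b c x y 0 = ∑ p ∈ Finset.HasAntidiagonal.antidiagonal (m₁ + m₂),
      sixJ q m₁ p.1 a b c (m₁ + m₂) * coupleLeft q p.1 p.2 a b c x y 0 := by
  set F : ℕ → ℝ := fun x => hahnHat q m₁ ((m₁ + m₂ : ℕ) - x) b c ((m₁ + m₂ : ℕ) - x) *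
      hahnHat q m₂ x a (2 * m₁ + b + c + 1) m₂ with hF
  have h1 : coupleRight q m₁ m₂ a b c x y 0 = F x := by
    simp only [coupleRight, hF]
    rw [show (y : ℤ) + 0 = ((m₁ + m₂ : ℕ) : ℤ) - x by omega,
      show (y : ℤ) = ((m₁ + m₂ : ℕ) : ℤ) - x by omega,
      show (x : ℤ) + (((m₁ + m₂ : ℕ) : ℤ) - x) + 0 - m₁ = m₂ by push_cast; ring]
  have h2 : ∀ p ∈ Finset.HasAntidiagonal.antidiagonal (m₁ + m₂),
      sixJ q m₁ p.1 a b c (m₁ + m₂) * coupleLeft q p.1 p.2 a b c x y 0 =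
      ∑ x' ∈ Finset.range (m₁ + m₂ + 1), F x' * hahnHat q p.1 x' a b (m₁ + m₂ : ℕ) *
        hahnHat q p.1 x a b (m₁ + m₂ : ℕ) := by
    rintro ⟨n, r⟩ hp
    rw [Finset.HasAntidiagonal.mem_antidiagonal] at hp
    simp only at hp ⊢
    rw [← Finset.sum_mul, hahnTriple_sum hq0 hq1 ha hb hc hp.symm, sixJ, coupleLeft,
      show (x : ℤ) + y = (m₁ + m₂ : ℕ) by omega, add_zero,
      show ((m₁ + m₂ : ℕ) : ℤ) - n = r by omega]
    ring
  rw [h1, Finset.sum_congr rfl h2, Finset.sum_comm, Finset.sum_eq_single_of_mem x]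
  · rw [Finset.Nat.sum_antidiagonal_eq_sum_range_succ_mk]
    simp only [mul_assoc]
    rw [← Finset.mul_sum, hahnHat_complete hq0 hq1 ha hb (by omega) (by omega), if_pos rfl, mul_one]
  · simp; omega
  · intro x' hx' hne
    rw [Finset.Nat.sum_antidiagonal_eq_sum_range_succ_mk]
    simp only [mul_assoc]
    rw [← Finset.mul_sum, hahnHat_complete hq0 hq1 ha hb (by simp at hx'; omega) (by omega),
      if_neg hne, mul_zero]

/-- The difference of the two sides vanishes for negative arguments and below total weight
$m_1+m_2$, and it satisfies the ladder relations common to both couplings. These relations determine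
it from its values at $z=0$ on the lowest level, where `coupleRight_base` applies. -/
theorem coupleRight_eq (hq0 : 0 < q) (hq1 : q < 1) {a b c : ℝ} (ha : 0 < a) (hb : 0 < b)
    (hc : 0 < c) (m₁ m₂ : ℕ) (x y z : ℤ) :
    coupleRight q m₁ m₂ a b c x y z = ∑ p ∈ Finset.HasAntidiagonal.antidiagonal (m₁ + m₂),
      sixJ q m₁ p.1 a b c (m₁ + m₂) * coupleLeft q p.1 p.2 a b c x y z := by
  set D : ℤ → ℤ → ℤ → ℝ := fun x y z => coupleRight q m₁ m₂ a b c x y z -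
    ∑ p ∈ Finset.HasAntidiagonal.antidiagonal (m₁ + m₂),
      sixJ q m₁ p.1 a b c (m₁ + m₂) * coupleLeft q p.1 p.2 a b c x y z with hD
  suffices H : ∀ x y z, D x y z = 0 from sub_eq_zero.1 (H x y z)
  have hzero : ∀ x y z : ℤ, x < 0 ∨ y < 0 ∨ z < 0 ∨ x + y + z < (m₁ + m₂ : ℕ) → D x y z = 0 := by
    intro x y z h
    simp only [hD]
    rw [coupleRight_eq_zero h, Finset.sum_eq_zero, sub_zero]
    rintro ⟨n, r⟩ hp
    rw [Finset.HasAntidiagonal.mem_antidiagonal] at hp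
    simp only at hp ⊢
    rw [coupleLeft_eq_zero (by rwa [hp]), mul_zero]
  have hlower : ∀ x y z : ℤ, lowerThree q a b c D x y z =
      ladder q (2 * (m₁ + m₂ : ℕ) + a + b + c + 2) (x + y + z + 1 - (m₁ + m₂ : ℕ)) * D x y z := by
    intro x y z
    have e : lowerThree q a b c D x y z = lowerThree q a b c (coupleRight q m₁ m₂ a b c) x y z -
        ∑ p ∈ Finset.HasAntidiagonal.antidiagonal (m₁ + m₂), sixJ q m₁ p.1 a b c (m₁ + m₂) *
          lowerThree q a b c (coupleLeft q p.1 p.2 a b c) x y z := by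
      simp only [lowerThree, hD, mul_sub, mul_add, Finset.sum_add_distrib, Finset.mul_sum]
      simp only [mul_left_comm (sixJ q m₁ _ a b c (m₁ + m₂))]
      ring
    rw [e, lowerThree_coupleRight hq0 hq1 ha hb hc]
    simp only [hD, mul_sub, Finset.mul_sum]
    congr 1
    refine Finset.sum_congr rfl ?_
    rintro ⟨n, r⟩ hp
    rw [Finset.HasAntidiagonal.mem_antidiagonal] at hp
    simp only at hp ⊢
    rw [lowerThree_coupleLeft hq0 hq1 ha hb hc, hp]
    ring
  have hraise : ∀ x y z : ℤ, raiseThree q a b c D x y z =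
      ladder q (2 * (m₁ + m₂ : ℕ) + a + b + c + 2) (x + y + z - (m₁ + m₂ : ℕ)) * D x y z := by
    intro x y z
    have e : raiseThree q a b c D x y z = raiseThree q a b c (coupleRight q m₁ m₂ a b c) x y z -
        ∑ p ∈ Finset.HasAntidiagonal.antidiagonal (m₁ + m₂), sixJ q m₁ p.1 a b c (m₁ + m₂) *
          raiseThree q a b c (coupleLeft q p.1 p.2 a b c) x y z := by
      simp only [raiseThree, hD, mul_sub, mul_add, Finset.sum_add_distrib, Finset.mul_sum]
      simp only [mul_left_comm (sixJ q m₁ _ a b c (m₁ + m₂))]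
      ring
    rw [e, raiseThree_coupleRight hq0 hq1 ha hb hc]
    simp only [hD, mul_sub, Finset.mul_sum]
    congr 1
    refine Finset.sum_congr rfl ?_
    rintro ⟨n, r⟩ hp
    rw [Finset.HasAntidiagonal.mem_antidiagonal] at hp
    simp only at hp ⊢
    rw [raiseThree_coupleLeft hq0 hq1 ha hb hc, hp]
    ring
  -- On the lowest level the ladder coefficient is zero, so the lowering operator annihilates `D`.
  -- If `D` vanishes at $z$, the only term left is the value at $z+1$, with a positive coefficient.
  have hbase : ∀ z : ℕ, ∀ x y : ℤ, x + y + z = (m₁ + m₂ : ℕ) → D x y z = 0 := by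
    intro z
    induction z with
    | zero =>
      intro x y h
      rcases lt_or_ge x 0 with hx | hx
      · exact hzero _ _ _ (Or.inl hx)
      rcases lt_or_ge y 0 with hy | hy
      · exact hzero _ _ _ (Or.inr (Or.inl hy))
      lift x to ℕ using hx
      lift y to ℕ using hy
      simp only [hD]
      rw [Nat.cast_zero, coupleRight_base hq0 hq1 ha hb hc m₁ m₂ x y (by omega), sub_self]
    | succ z ih =>
      intro x y h
      have := hlower x y z
      push_cast at h
      rw [show x + y + z + 1 - ((m₁ + m₂ : ℕ) : ℤ) = 0 by push_cast; omega, ladder_zero, zero_mul,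
        lowerThree, ih _ _ (by push_cast; omega), ih _ _ (by push_cast; omega)] at this
      have h1 := ladder_pos hq0 hq1 hc (show (0 : ℤ) < z + 1 by omega)
      have h2 := Real.rpow_pos_of_pos hq0 ((x : ℝ) + (a + 1) / 2)
      have h3 := Real.rpow_pos_of_pos hq0 ((y : ℝ) + (b + 1) / 2)
      push_cast
      simpa [h1.ne', h2.ne', h3.ne'] using this
  -- The raising relation expresses a positive multiple of `D` at level $k+1$ through its values at
  -- level $k$.
  have hall : ∀ k : ℕ, ∀ x y z : ℤ, x + y + z = (m₁ + m₂ : ℕ) + k → D x y z = 0 := by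
    intro k
    induction k with
    | zero =>
      intro x y z h
      rcases lt_or_ge z 0 with hz | hz
      · exact hzero _ _ _ (Or.inr (Or.inr (Or.inl hz)))
      lift z to ℕ using hz
      exact hbase z x y (by simpa using h)
    | succ k ih =>
      intro x y z h
      push_cast at h
      have := hraise x y z
      rw [raiseThree, ih _ _ _ (by push_cast; omega), ih _ _ _ (by push_cast; omega),
        ih _ _ _ (by push_cast; omega)] at this
      have h1 := ladder_pos hq0 hq1
        (show (0 : ℝ) < 2 * (m₁ + m₂ : ℕ) + a + b + c + 2 by positivity)
        (show 0 < x + y + z - ((m₁ + m₂ : ℕ) : ℤ) by push_cast; omega)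
      simp only [mul_zero, add_zero] at this
      exact (mul_eq_zero.1 this.symm).resolve_left h1.ne'
  intro x y z
  rcases lt_or_ge (x + y + z) ((m₁ + m₂ : ℕ) : ℤ) with h | h
  · exact hzero _ _ _ (Or.inr (Or.inr (Or.inr h)))
  · exact hall (x + y + z - (m₁ + m₂ : ℕ)).toNat x y z (by omega)

end SixJ

/-! ### Sequences and their partial sums -/

section Sequences

/-- The sum of the first `k` entries of a sequence. -/
def part (v : ℕ → ℕ) (k : ℕ) : ℕ := ∑ i ∈ Finset.range k, v i

/-- The sum of the first `k` entries of a real sequence. -/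
def rpart (v : ℕ → ℝ) (k : ℕ) : ℝ := ∑ i ∈ Finset.range k, v i

@[simp] lemma part_zero (v : ℕ → ℕ) : part v 0 = 0 := by simp [part]

@[simp] lemma rpart_zero (v : ℕ → ℝ) : rpart v 0 = 0 := by simp [rpart]

lemma part_succ (v : ℕ → ℕ) (k : ℕ) : part v (k + 1) = part v k + v k := Finset.sum_range_succ _ _

lemma rpart_succ (v : ℕ → ℝ) (k : ℕ) : rpart v (k + 1) = rpart v k + v k :=
  Finset.sum_range_succ _ _

lemma part_succ' (v : ℕ → ℕ) (k : ℕ) : part v (k + 1) = part (v ∘ Nat.succ) k + v 0 :=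
  Finset.sum_range_succ' _ _

lemma rpart_succ' (v : ℕ → ℝ) (k : ℕ) : rpart v (k + 1) = rpart (v ∘ Nat.succ) k + v 0 :=
  Finset.sum_range_succ' _ _

lemma part_congr {v w : ℕ → ℕ} {k : ℕ} (h : ∀ i < k, v i = w i) : part v k = part w k :=
  Finset.sum_congr rfl fun i hi => h i (Finset.mem_range.1 hi)

lemma part_mono (v : ℕ → ℕ) {i j : ℕ} (h : i ≤ j) : part v i ≤ part v j :=
  Finset.sum_le_sum_of_subset (Finset.range_subset_range.2 h)

/-- The sequences of `d` natural numbers with sum `p`, extended by zero. -/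
def comps (d p : ℕ) : Finset (ℕ → ℕ) := Finset.piAntidiag (Finset.range d) p

lemma mem_comps {d p : ℕ} {f : ℕ → ℕ} : f ∈ comps d p ↔ part f d = p ∧ ∀ i, d ≤ i → f i = 0 := by
  rw [comps, Finset.mem_piAntidiag, part]
  refine and_congr Iff.rfl (forall_congr' fun i => ?_)
  rw [Finset.mem_range]
  constructor
  · intro h hi
    by_contra h'
    exact absurd (h h') (by omega)
  · intro h h'
    by_contra hi
    exact h' (h (by omega))

lemma update_mem_comps {k b p : ℕ} (hb : b ≤ p) {f : ℕ → ℕ} (hf : f ∈ comps k b) :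
    Function.update f k (p - b) ∈ comps (k + 1) p := by
  rw [mem_comps] at hf ⊢
  constructor
  · rw [part_succ, Function.update_self, part_congr (w := f), hf.1]
    · omega
    · intro i hi
      rw [Function.update_of_ne (by omega)]
  · intro i hi
    rw [Function.update_of_ne (by omega), hf.2 i (by omega)]

/-- A sum over sequences, split at the last entry. -/
lemma sum_comps_succ {M : Type*} [AddCommMonoid M] (F : (ℕ → ℕ) → M) (k p : ℕ) :
    ∑ f ∈ comps (k + 1) p, F f =
      ∑ b ∈ Finset.range (p + 1), ∑ f ∈ comps k b, F (Function.update f k (p - b)) := by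
  rw [Finset.sum_sigma']
  symm
  refine Finset.sum_bij' (fun s _ => Function.update s.2 k (p - s.1))
    (fun f _ => ⟨part f k, Function.update f k 0⟩) ?_ ?_ ?_ ?_ ?_
  · rintro ⟨b, f⟩ h
    simp only [Finset.mem_sigma, Finset.mem_range] at h
    exact update_mem_comps (Nat.lt_succ_iff.1 h.1) h.2
  · intro f hf
    rw [mem_comps, part_succ] at hf
    simp only [Finset.mem_sigma, Finset.mem_range, mem_comps]
    refine ⟨by omega, part_congr fun i hi => Function.update_of_ne (by omega) _ _, fun i hi => ?_⟩
    rcases eq_or_ne i k with rfl | h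
    · simp
    · rw [Function.update_of_ne h]; exact hf.2 i (by omega)
  · rintro ⟨b, f⟩ h
    simp only [Finset.mem_sigma, Finset.mem_range, mem_comps] at h
    have e1 : part (Function.update f k (p - b)) k = b := by
      rw [← h.2.1]; exact part_congr fun i hi => Function.update_of_ne (by omega) _ _
    have e2 : Function.update (Function.update f k (p - b)) k 0 = f := by
      rw [Function.update_idem, Function.update_eq_self_iff, h.2.2 k le_rfl]
    simp only [e1, e2]
  · intro f hf
    rw [mem_comps, part_succ] at hf
    simp only [Function.update_idem]
    rw [Function.update_eq_self_iff]; omega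
  · intros; rfl

/-- Prepend an entry to a sequence. -/
def consSeq (a : ℕ) (g : ℕ → ℕ) : ℕ → ℕ := fun i => Nat.casesOn i a g

@[simp] lemma consSeq_zero (a : ℕ) (g : ℕ → ℕ) : consSeq a g 0 = a := rfl

@[simp] lemma consSeq_succ (a : ℕ) (g : ℕ → ℕ) (i : ℕ) : consSeq a g (i + 1) = g i := rfl

@[simp] lemma consSeq_comp_succ (a : ℕ) (g : ℕ → ℕ) : consSeq a g ∘ Nat.succ = g := rfl

lemma consSeq_eta (f : ℕ → ℕ) : consSeq (f 0) (f ∘ Nat.succ) = f := by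
  ext i; cases i <;> rfl

/-- A sum over sequences, split at the first entry. -/
lemma sum_comps_cons {M : Type*} [AddCommMonoid M] (F : (ℕ → ℕ) → M) (k p : ℕ) :
    ∑ f ∈ comps (k + 1) p, F f =
      ∑ b ∈ Finset.range (p + 1), ∑ g ∈ comps k b, F (consSeq (p - b) g) := by
  rw [Finset.sum_sigma']
  symm
  refine Finset.sum_bij' (fun s _ => consSeq (p - s.1) s.2)
    (fun f _ => ⟨part (f ∘ Nat.succ) k, f ∘ Nat.succ⟩) ?_ ?_ ?_ ?_ ?_
  · rintro ⟨b, f⟩ h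
    simp only [Finset.mem_sigma, Finset.mem_range, mem_comps] at h ⊢
    refine ⟨?_, fun i hi => ?_⟩
    · rw [part_succ', consSeq_comp_succ, h.2.1, consSeq_zero]; omega
    · obtain ⟨j, rfl⟩ : ∃ j, i = j + 1 := ⟨i - 1, by omega⟩
      rw [consSeq_succ]; exact h.2.2 j (by omega)
  · intro f hf
    rw [mem_comps, part_succ'] at hf
    simp only [Finset.mem_sigma, Finset.mem_range, mem_comps]
    exact ⟨by omega, trivial, fun i hi => hf.2 (i + 1) (by omega)⟩
  · rintro ⟨b, f⟩ h
    simp only [Finset.mem_sigma, Finset.mem_range, mem_comps] at h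
    simp only [consSeq_comp_succ, h.2.1]
  · intro f hf
    rw [mem_comps, part_succ'] at hf
    simp only
    rw [show p - part (f ∘ Nat.succ) k = f 0 by omega, consSeq_eta]
  · intros; rfl

end Sequences

/-! ### The multivariate `q`-Hahn functions on sequences -/

section Nested

variable {q : ℝ}

/-- The factor with index `j` of the nested `q`-Hahn functions. -/
def nestedFactor (q : ℝ) (α : ℕ → ℝ) (n y : ℕ → ℕ) (j : ℕ) : ℝ :=
  hahnHat q (n j) ((part y (j + 1) : ℤ) - part n j)
    (2 * (part n j : ℝ) + rpart α (j + 1) + j) (α (j + 1)) ((part y (j + 2) : ℤ) - part n j)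

/-- The nested `q`-Hahn functions in `k + 1` variables, without the constraint on the total sum. -/
def nested (q : ℝ) (α : ℕ → ℝ) (k : ℕ) (n y : ℕ → ℕ) : ℝ :=
  ∏ j ∈ Finset.range k, nestedFactor q α n y j

/-- The nested `q`-Hahn functions in `k + 2` variables where the first variable is coupled last. -/
def nestedAlt (q : ℝ) (α : ℕ → ℝ) (k : ℕ) (m y : ℕ → ℕ) : ℝ :=
  nested q (α ∘ Nat.succ) k m (y ∘ Nat.succ) *
    hahnHat q (m k) (y 0) (α 0) (2 * (part m k : ℝ) + rpart (α ∘ Nat.succ) (k + 1) + k)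
      ((part y (k + 2) : ℤ) - part m k)

/-- The factor with index `j` of the multivariate `q`-Racah functions. -/
def racahFactor (q : ℝ) (α : ℕ → ℝ) (m n : ℕ → ℕ) (j : ℕ) : ℝ :=
  (-1) ^ (m j) * racahHat q (m j) ((part n (j + 1) : ℤ) - part m j)
    (2 * (part m j : ℝ) + rpart (α ∘ Nat.succ) (j + 1) + j) (α (j + 2))
    ((part n (j + 2) : ℝ) + part m j + rpart α (j + 2) + ((j : ℝ) + 1))
    ((part n (j + 2) : ℤ) - part m j)

/-- The multivariate `q`-Racah functions. -/
def racahProd (q : ℝ) (α : ℕ → ℝ) (k : ℕ) (m n : ℕ → ℕ) : ℝ :=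
  ∏ j ∈ Finset.range k, racahFactor q α m n j

lemma nestedFactor_congr (α : ℕ → ℝ) {n n' y y' : ℕ → ℕ} {j : ℕ} (hn : ∀ i ≤ j, n i = n' i)
    (hy : ∀ i ≤ j + 1, y i = y' i) : nestedFactor q α n y j = nestedFactor q α n' y' j := by
  rw [nestedFactor, nestedFactor, hn j le_rfl, part_congr fun i (hi : i < j) => hn i hi.le,
    part_congr fun i (hi : i < j + 1) => hy i hi.le,
    part_congr fun i (hi : i < j + 2) => hy i (by omega)]

lemma nested_congr (α : ℕ → ℝ) {n n' y y' : ℕ → ℕ} {k : ℕ} (hn : ∀ i < k, n i = n' i)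
    (hy : ∀ i < k + 1, y i = y' i) : nested q α k n y = nested q α k n' y' :=
  Finset.prod_congr rfl fun j hj => by
    rw [Finset.mem_range] at hj
    exact nestedFactor_congr α (fun i hi => hn i (by omega)) (fun i hi => hy i (by omega))

lemma nested_succ (α : ℕ → ℝ) (k : ℕ) (n y : ℕ → ℕ) :
    nested q α (k + 1) n y = nested q α k n y * nestedFactor q α n y k :=
  Finset.prod_range_succ _ _

lemma racahFactor_congr (α : ℕ → ℝ) {m m' n n' : ℕ → ℕ} {j : ℕ} (hm : ∀ i ≤ j, m i = m' i)
    (hn : ∀ i ≤ j + 1, n i = n' i) : racahFactor q α m n j = racahFactor q α m' n' j := by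
  rw [racahFactor, racahFactor, hm j le_rfl, part_congr fun i (hi : i < j) => hm i hi.le,
    part_congr fun i (hi : i < j + 1) => hn i hi.le,
    part_congr fun i (hi : i < j + 2) => hn i (by omega)]

lemma racahProd_congr (α : ℕ → ℝ) {m m' n n' : ℕ → ℕ} {k : ℕ} (hm : ∀ i < k, m i = m' i)
    (hn : ∀ i < k + 1, n i = n' i) : racahProd q α k m n = racahProd q α k m' n' :=
  Finset.prod_congr rfl fun j hj => by
    rw [Finset.mem_range] at hj
    exact racahFactor_congr α (fun i hi => hm i (by omega)) (fun i hi => hn i (by omega))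

lemma rpart_pos {α : ℕ → ℝ} (hα : ∀ i, 0 < α i) (k : ℕ) : 0 < rpart α (k + 1) :=
  Finset.sum_pos (fun i _ => hα i) ⟨0, by simp⟩

/-- The connection formula between the two families of multivariate `q`-Hahn functions. -/
theorem nestedAlt_eq (hq0 : 0 < q) (hq1 : q < 1) {α : ℕ → ℝ} (hα : ∀ i, 0 < α i) (k : ℕ)
    (m y : ℕ → ℕ) : nestedAlt q α k m y =
      ∑ n ∈ comps (k + 1) (part m (k + 1)), racahProd q α k m n * nested q α (k + 1) n y := by
  induction k generalizing m with
  | zero =>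
    rw [sum_comps_succ, Finset.sum_eq_single 0]
    · have : comps 0 0 = {0} := by simp [comps]
      rw [this, Finset.sum_singleton]
      simp only [nestedAlt, nested, racahProd, nestedFactor, part_succ, part_zero, rpart_succ,
        rpart_zero]
      simp
    · intro b _ hb
      have : comps 0 b = ∅ := by simp [comps, hb]
      rw [this, Finset.sum_empty]
    · simp
  | succ k ih =>
    set b := 2 * (part m k : ℝ) + rpart (α ∘ Nat.succ) (k + 1) + k with hb
    have hb0 : 0 < b := by
      have := rpart_pos (α := α ∘ Nat.succ) (fun i => hα _) k
      positivity
    -- The last inner coupling and the outermost one form a threefold coupling of factor $0$, the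
    -- block of factors $1,\dots,k+1$ already coupled to parameter $b$, and factor $k+2$.
    have e1 : nestedAlt q α (k + 1) m y = nested q (α ∘ Nat.succ) k m (y ∘ Nat.succ) *
        coupleRight q (m k) (m (k + 1)) (α 0) b (α (k + 2)) (y 0)
          (part (y ∘ Nat.succ) (k + 1) - part m k) (y (k + 2)) := by
      rw [nestedAlt, nested_succ, nestedFactor, coupleRight, mul_assoc, hb]
      congr 2
      · congr 1
        rw [part_succ _ (k + 1)]; push_cast; simp only [Function.comp]; ring
      · rw [part_succ' y (k + 2), part_succ (y ∘ Nat.succ) (k + 1), part_succ m k,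
          rpart_succ (α ∘ Nat.succ) (k + 1)]
        congr 1
        · push_cast; simp only [Function.comp]; ring
        · push_cast; simp only [Function.comp]; ring
    -- After recoupling with intermediate degree $p$, factor $0$ is coupled to the block first. That
    -- part is `nestedAlt` with one factor fewer and with `m k` replaced by $p$, so the induction
    -- hypothesis expands it; the $6j$ coefficient becomes the new $q$-Racah factor.
    have e2 : ∀ p ∈ Finset.range (m k + m (k + 1) + 1),
        nested q (α ∘ Nat.succ) k m (y ∘ Nat.succ) *
        (sixJ q (m k) p (α 0) b (α (k + 2)) (m k + m (k + 1)) *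
          coupleLeft q p (m k + m (k + 1) - p) (α 0) b (α (k + 2)) (y 0)
          (part (y ∘ Nat.succ) (k + 1) - part m k) (y (k + 2))) =
        ∑ n ∈ comps (k + 1) (part m k + p),
          racahProd q α (k + 1) m (Function.update n (k + 1) (part m (k + 2) - (part m k + p))) *
          nested q α (k + 2) (Function.update n (k + 1) (part m (k + 2) - (part m k + p))) y := by
      intro p hp
      rw [Finset.mem_range] at hp
      have hm' : part (Function.update m k p) (k + 1) = part m k + p := by
        rw [part_succ, Function.update_self,
          part_congr fun i (hi : i < k) => Function.update_of_ne (show i ≠ k by omega) _ _]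
      have hm2 : part (Function.update m k p) k = part m k :=
        part_congr fun i (hi : i < k) => Function.update_of_ne (by omega) _ _
      have h1 : nestedAlt q α k (Function.update m k p) y =
          nested q (α ∘ Nat.succ) k m (y ∘ Nat.succ) *
          hahnHat q p (y 0) (α 0) b (y 0 + (part (y ∘ Nat.succ) (k + 1) - part m k)) := by
        rw [nestedAlt, Function.update_self, hm2, nested_congr (n' := m) (y' := y ∘ Nat.succ)]
        · congr 2
          rw [part_succ' y (k + 1)]; push_cast; ring
        · exact fun i hi => Function.update_of_ne (by omega) _ _
        · exact fun i hi => rfl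
      rw [coupleLeft]
      have h2 := ih (Function.update m k p)
      rw [h1, hm'] at h2
      rw [show ∀ u v w x : ℝ, u * (v * (w * x)) = u * w * (v * x) by intros; ring, h2,
        Finset.sum_mul]
      refine Finset.sum_congr rfl fun n hn => ?_
      rw [mem_comps] at hn
      have hm3 : part m (k + 2) = part m k + (m k + m (k + 1)) := by
        rw [part_succ, part_succ, add_assoc]
      set r := part m (k + 2) - (part m k + p) with hr
      have hu : ∀ i < k + 1, Function.update n (k + 1) r i = n i :=
        fun i hi => Function.update_of_ne (by omega) _ _
      have hu1 : part (Function.update n (k + 1) r) (k + 1) = part m k + p := by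
        rw [part_congr hu, hn.1]
      have hu2 : part (Function.update n (k + 1) r) (k + 2) =
          part m k + (m k + m (k + 1)) := by
        rw [part_succ, hu1, Function.update_self]; omega
      have f1 : racahProd q α k (Function.update m k p) n =
          racahProd q α k m (Function.update n (k + 1) r) :=
        racahProd_congr α (fun i hi => Function.update_of_ne (by omega) _ _)
          (fun i hi => (hu i hi).symm)
      have f2 : nested q α (k + 1) n y = nested q α (k + 1) (Function.update n (k + 1) r) y :=
        nested_congr α (fun i hi => (hu i hi).symm) (fun _ _ => rfl)
      have f3 : sixJ q (m k) p (α 0) b (α (k + 2)) (m k + m (k + 1)) =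
          racahFactor q α m (Function.update n (k + 1) r) k := by
        rw [sixJ, racahFactor, hu1, hu2, ← hb]
        congr 2
        · push_cast; ring
        · rw [hb, rpart_succ' α (k + 1)]; push_cast; ring
        · push_cast; ring
      have f4 : hahnHat q (m k + m (k + 1) - p) (y 0 + (part (y ∘ Nat.succ) (k + 1) - part m k) - p)
          (2 * p + α 0 + b + 1) (α (k + 2))
          (y 0 + (part (y ∘ Nat.succ) (k + 1) - part m k) + y (k + 2) - p) =
          nestedFactor q α (Function.update n (k + 1) r) y (k + 1) := by
        rw [nestedFactor, hu1, Function.update_self, part_succ y (k + 2), part_succ' y (k + 1),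
          rpart_succ' α (k + 1), show m k + m (k + 1) - p = r by omega, hb]
        congr 1
        · push_cast; ring
        · push_cast; ring
        · push_cast; ring
      rw [f1, f2, f3, f4, racahProd, racahProd, Finset.prod_range_succ, nested_succ _ (k + 1)]
      ring
    rw [e1, coupleRight_eq hq0 hq1 (hα 0) hb0 (hα _), Finset.mul_sum,
      Finset.Nat.sum_antidiagonal_eq_sum_range_succ_mk]
    rw [Finset.sum_congr rfl e2, sum_comps_succ, add_assoc,
      show part m (k + 1 + 1) + 1 = part m k + (m k + m (k + 1) + 1) by
        rw [part_succ, part_succ]; ring, Finset.sum_range_add _ (part m k), Finset.sum_eq_zero (s := Finset.range (part m k)), zero_add]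
    · rfl
    -- The sum over $p$ yields partial sums from `part m k` on. For smaller ones the last $q$-Racah
    -- factor has a negative argument and is zero.
    · intro c hc
      rw [Finset.mem_range] at hc
      refine Finset.sum_eq_zero fun n hn => ?_
      rw [mem_comps] at hn
      have : part (Function.update n (k + 1) (part m (k + 1 + 1) - c)) (k + 1) = c := by
        rw [← hn.1]; exact part_congr fun i hi => Function.update_of_ne (by omega) _ _
      rw [racahProd, Finset.prod_range_succ, racahFactor, this, racahHat, if_neg (by omega)]
      ring

end Nested

/-! ### Orthonormality and completeness of the multivariate `q`-Hahn functions -/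

section NestedOrthonormal

variable {q : ℝ}

/-- Orthonormality on a shifted grid, without restriction on the degrees: points $b<M$ lie off the
grid, and a degree beyond $p-M$ gives the zero function. -/
lemma hahnHat_sum_shift (hq0 : 0 < q) (hq1 : q < 1) {α β : ℝ} (hα : 0 < α) (hβ : 0 < β)
    (n n' M p : ℕ) :
    ∑ b ∈ Finset.range (p + 1), hahnHat q n ((b : ℤ) - M) α β ((p : ℤ) - M) *
      hahnHat q n' ((b : ℤ) - M) α β ((p : ℤ) - M) = if n = n' ∧ n + M ≤ p then 1 else 0 := by
  by_cases h : n + M ≤ p ∧ n' + M ≤ p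
  · obtain ⟨N, rfl⟩ : ∃ N, p = M + N := ⟨p - M, by omega⟩
    rw [add_assoc, Finset.sum_range_add _ M, Finset.sum_eq_zero (s := Finset.range M), zero_add]
    · have := hahnHat_orthonormal hq0 hq1 hα hβ (n := n) (m := n') (N := N) (by omega) (by omega)
      simp only [Nat.cast_add, add_sub_cancel_left]
      rw [this]
      simp only [h.1, and_true]
    · intro b hb
      rw [hahnHat_eq_zero_left (by simp at hb; omega), zero_mul]
  · rw [if_neg (by rintro ⟨rfl, h'⟩; exact h ⟨h', h'⟩)]
    refine Finset.sum_eq_zero fun b _ => ?_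
    rw [not_and_or] at h
    rcases h with h | h
    · rw [hahnHat_eq_zero_deg (n := n) (by omega), zero_mul]
    · rw [hahnHat_eq_zero_deg (n := n') (by omega), mul_zero]

lemma hahnHat_sum_ext (hq0 : 0 < q) (hq1 : q < 1) {α β : ℝ} (hα : 0 < α) (hβ : 0 < β)
    (n n' M p : ℕ) :
    ∑ a ∈ Finset.range (p + 1), hahnHat q n a α β ((p : ℤ) - M) *
      hahnHat q n' a α β ((p : ℤ) - M) = if n = n' ∧ n + M ≤ p then 1 else 0 := by
  by_cases h : n + M ≤ p ∧ n' + M ≤ p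
  · obtain ⟨N, rfl⟩ : ∃ N, p = M + N := ⟨p - M, by omega⟩
    have := hahnHat_orthonormal hq0 hq1 hα hβ (n := n) (m := n') (N := N) (by omega) (by omega)
    simp only [Nat.cast_add, add_sub_cancel_left]
    rw [← Finset.sum_subset (Finset.range_subset_range.2 (show N + 1 ≤ M + N + 1 by omega)), this]
    · simp only [h.1, and_true]
    · intro a _ ha
      rw [hahnHat_eq_zero_right (by simp at ha; omega), zero_mul]
  · rw [if_neg (by rintro ⟨rfl, h'⟩; exact h ⟨h', h'⟩)]
    refine Finset.sum_eq_zero fun b _ => ?_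
    rw [not_and_or] at h
    rcases h with h | h
    · rw [hahnHat_eq_zero_deg (n := n) (by omega), zero_mul]
    · rw [hahnHat_eq_zero_deg (n := n') (by omega), mul_zero]

lemma nested_param_pos {α : ℕ → ℝ} (hα : ∀ i, 0 < α i) (n k : ℕ) :
    0 < 2 * (n : ℝ) + rpart α (k + 1) + k := by
  have := rpart_pos hα k
  positivity

/-- The sum over the first $k+1$ entries with fixed partial sum $b$ is the induction hypothesis. It
forces $n_j=n'_j$ for $j<k$, hence equal parameters in the last factors, and the sum over $b$ is
then orthogonality in one variable. -/
theorem nested_orthonormal (hq0 : 0 < q) (hq1 : q < 1) {α : ℕ → ℝ} (hα : ∀ i, 0 < α i) (k : ℕ)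
    (n n' : ℕ → ℕ) (p : ℕ) :
    ∑ y ∈ comps (k + 1) p, nested q α k n y * nested q α k n' y =
      if (∀ j < k, n j = n' j) ∧ part n k ≤ p then 1 else 0 := by
  induction k generalizing p with
  | zero =>
    rw [sum_comps_succ, Finset.sum_eq_single 0]
    · have : comps 0 0 = {0} := by simp [comps]
      rw [this, Finset.sum_singleton]
      simp [nested]
    · intro b _ hb
      have : comps 0 b = ∅ := by simp [comps, hb]
      rw [this, Finset.sum_empty]
    · simp
  | succ k ih =>
    have e : ∀ b ∈ Finset.range (p + 1), ∑ f ∈ comps (k + 1) b,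
        nested q α (k + 1) n (Function.update f (k + 1) (p - b)) *
          nested q α (k + 1) n' (Function.update f (k + 1) (p - b)) =
        (if (∀ j < k, n j = n' j) ∧ part n k ≤ b then 1 else 0) *
          (hahnHat q (n k) ((b : ℤ) - part n k) (2 * (part n k : ℝ) + rpart α (k + 1) + k)
            (α (k + 1)) ((p : ℤ) - part n k) *
          hahnHat q (n' k) ((b : ℤ) - part n' k) (2 * (part n' k : ℝ) + rpart α (k + 1) + k)
            (α (k + 1)) ((p : ℤ) - part n' k)) := by
      intro b hb
      rw [Finset.mem_range] at hb
      rw [← ih, Finset.sum_mul]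
      refine Finset.sum_congr rfl fun f hf => ?_
      rw [mem_comps] at hf
      have hu : ∀ i < k + 1, Function.update f (k + 1) (p - b) i = f i :=
        fun i hi => Function.update_of_ne (by omega) _ _
      have h1 : part (Function.update f (k + 1) (p - b)) (k + 1) = b := by
        rw [part_congr hu, hf.1]
      have h2 : part (Function.update f (k + 1) (p - b)) (k + 2) = p := by
        rw [part_succ, h1, Function.update_self]; omega
      rw [nested_succ, nested_succ, nestedFactor, nestedFactor, h1, h2,
        nested_congr (n := n) α (fun _ _ => rfl) hu, nested_congr (n := n') α (fun _ _ => rfl) hu]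
      ring
    rw [sum_comps_succ, Finset.sum_congr rfl e]
    by_cases h : ∀ j < k, n j = n' j
    · have hp := part_congr h
      have h2 : ∀ b ∈ Finset.range (p + 1), (if (∀ j < k, n j = n' j) ∧ part n k ≤ b then
          (1 : ℝ) else 0) *
          (hahnHat q (n k) ((b : ℤ) - part n k) (2 * (part n k : ℝ) + rpart α (k + 1) + k)
            (α (k + 1)) ((p : ℤ) - part n k) *
          hahnHat q (n' k) ((b : ℤ) - part n' k) (2 * (part n' k : ℝ) + rpart α (k + 1) + k)
            (α (k + 1)) ((p : ℤ) - part n' k)) =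
          hahnHat q (n k) ((b : ℤ) - part n k) (2 * (part n k : ℝ) + rpart α (k + 1) + k)
            (α (k + 1)) ((p : ℤ) - part n k) *
          hahnHat q (n' k) ((b : ℤ) - part n k) (2 * (part n k : ℝ) + rpart α (k + 1) + k)
            (α (k + 1)) ((p : ℤ) - part n k) := by
        intro b _
        rw [← hp]
        -- The condition from the induction hypothesis may be dropped: when it fails, the argument
        -- of the $q$-Hahn factor is negative.
        by_cases hb : part n k ≤ b
        · rw [if_pos ⟨h, hb⟩, one_mul]
        · rw [hahnHat_eq_zero_left (by omega)]; ring
      rw [Finset.sum_congr rfl h2, hahnHat_sum_shift hq0 hq1 (nested_param_pos hα _ _) (hα _)]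
      refine if_congr ?_ rfl rfl
      rw [part_succ, add_comm (part n k), Nat.forall_lt_succ_right]
      tauto
    · rw [if_neg (fun h' => h fun j hj => h'.1 j (by omega)), Finset.sum_eq_zero]
      intro b _
      rw [if_neg (fun h' => h h'.1), zero_mul]

/-- Here the first entry is split off. The sum over the others, with total $b$, is
`nested_orthonormal` for the shifted parameters; the sum over the first entry $p-b$ is orthogonality
of the outer $q$-Hahn factor. -/
theorem nestedAlt_orthonormal (hq0 : 0 < q) (hq1 : q < 1) {α : ℕ → ℝ} (hα : ∀ i, 0 < α i) (k : ℕ)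
    (m m' : ℕ → ℕ) (p : ℕ) :
    ∑ y ∈ comps (k + 2) p, nestedAlt q α k m y * nestedAlt q α k m' y =
      if (∀ j < k + 1, m j = m' j) ∧ part m (k + 1) ≤ p then 1 else 0 := by
  have e : ∀ b ∈ Finset.range (p + 1), ∑ g ∈ comps (k + 1) b,
      nestedAlt q α k m (consSeq (p - b) g) * nestedAlt q α k m' (consSeq (p - b) g) =
      (if (∀ j < k, m j = m' j) ∧ part m k ≤ b then 1 else 0) *
        (hahnHat q (m k) (p - b : ℕ) (α 0) (2 * (part m k : ℝ) + rpart (α ∘ Nat.succ) (k + 1) + k)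
          ((p : ℤ) - part m k) *
        hahnHat q (m' k) (p - b : ℕ) (α 0) (2 * (part m' k : ℝ) + rpart (α ∘ Nat.succ) (k + 1) + k)
          ((p : ℤ) - part m' k)) := by
    intro b hb
    rw [Finset.mem_range] at hb
    rw [← nested_orthonormal hq0 hq1 (α := α ∘ Nat.succ) (fun i => hα _), Finset.sum_mul]
    refine Finset.sum_congr rfl fun g hg => ?_
    rw [mem_comps] at hg
    have h2 : part (consSeq (p - b) g) (k + 2) = p := by
      rw [part_succ', consSeq_comp_succ, hg.1, consSeq_zero]; omega
    rw [nestedAlt, nestedAlt, h2, consSeq_comp_succ, consSeq_zero]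
    ring
  rw [sum_comps_cons, Finset.sum_congr rfl e]
  by_cases h : ∀ j < k, m j = m' j
  · have hp := part_congr h
    have h2 : ∀ b ∈ Finset.range (p + 1), (if (∀ j < k, m j = m' j) ∧ part m k ≤ b then
        (1 : ℝ) else 0) *
        (hahnHat q (m k) (p - b : ℕ) (α 0) (2 * (part m k : ℝ) + rpart (α ∘ Nat.succ) (k + 1) + k)
          ((p : ℤ) - part m k) *
        hahnHat q (m' k) (p - b : ℕ) (α 0) (2 * (part m' k : ℝ) + rpart (α ∘ Nat.succ) (k + 1) + k)
          ((p : ℤ) - part m' k)) =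
        (fun a : ℕ => hahnHat q (m k) a (α 0)
          (2 * (part m k : ℝ) + rpart (α ∘ Nat.succ) (k + 1) + k) ((p : ℤ) - part m k) *
        hahnHat q (m' k) a (α 0) (2 * (part m k : ℝ) + rpart (α ∘ Nat.succ) (k + 1) + k)
          ((p : ℤ) - part m k)) (p + 1 - 1 - b) := by
      intro b hb
      rw [Finset.mem_range] at hb
      rw [← hp, Nat.add_sub_cancel]
      by_cases hb : part m k ≤ b
      · rw [if_pos ⟨h, hb⟩, one_mul]
      · simp only
        rw [hahnHat_eq_zero_right (by omega)]; ring
    rw [Finset.sum_congr rfl h2]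
    have h3 := hahnHat_sum_ext hq0 hq1 (hα 0) (nested_param_pos (α := α ∘ Nat.succ)
      (fun i => hα _) (part m k) k) (m k) (m' k) (part m k) p
    rw [← Finset.sum_range_reflect] at h3
    refine h3.trans ?_
    refine if_congr ?_ rfl rfl
    rw [part_succ, add_comm (part m k), Nat.forall_lt_succ_right]
    tauto
  · rw [if_neg (fun h' => h fun j hj => h'.1 j (by omega)), Finset.sum_eq_zero]
    intro b _
    rw [if_neg (fun h' => h h'.1), zero_mul]

lemma comps_ext {k p : ℕ} {n n' : ℕ → ℕ} (hn : n ∈ comps (k + 1) p) (hn' : n' ∈ comps (k + 1) p)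
    (h : ∀ j < k, n j = n' j) : n = n' := by
  rw [mem_comps] at hn hn'
  ext j
  rcases lt_trichotomy j k with hj | rfl | hj
  · exact h j hj
  · have h1 := hn.1
    have h2 := hn'.1
    rw [part_succ] at h1 h2
    rw [part_congr h] at h1
    omega
  · rw [hn.2 j hj, hn'.2 j hj]

-- Once the total is fixed, agreement in all entries but the last means equality, so the condition
-- on initial entries becomes a Kronecker delta.
open Classical in
lemma orthonormal_comps {k p : ℕ} (f : (ℕ → ℕ) → (ℕ → ℕ) → ℝ)
    (h : ∀ n n', ∑ y ∈ comps (k + 2) p, f n y * f n' y =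
      if (∀ j < k + 1, n j = n' j) ∧ part n (k + 1) ≤ p then 1 else 0)
    {n n' : ℕ → ℕ} (hn : n ∈ comps (k + 2) p) (hn' : n' ∈ comps (k + 2) p) :
    ∑ y ∈ comps (k + 2) p, f n y * f n' y = if n = n' then 1 else 0 := by
  rw [h]
  refine if_congr ⟨fun h => comps_ext hn hn' h.1, ?_⟩ rfl rfl
  rintro rfl
  refine ⟨fun _ _ => rfl, ?_⟩
  rw [mem_comps] at hn
  rw [← hn.1]
  exact part_mono n (by omega)

/-- The overlap of the two families of multivariate `q`-Hahn functions of the same total degree. -/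
theorem nested_overlap (hq0 : 0 < q) (hq1 : q < 1) {α : ℕ → ℝ} (hα : ∀ i, 0 < α i) (k : ℕ)
    {m n : ℕ → ℕ} {p : ℕ} (hn : part n (k + 1) ≤ p) :
    ∑ y ∈ comps (k + 2) p, nestedAlt q α k m y * nested q α (k + 1) n y =
      if part m (k + 1) = part n (k + 1) then racahProd q α k m n else 0 := by
  simp only [nestedAlt_eq hq0 hq1 hα, Finset.sum_mul]
  rw [Finset.sum_comm]
  simp only [mul_assoc, ← Finset.mul_sum, nested_orthonormal hq0 hq1 hα]
  by_cases h : part m (k + 1) = part n (k + 1)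
  -- After expanding `nestedAlt` and applying orthonormality of `nested`, the only surviving index
  -- is `n` cut off after its first $k+1$ entries.
  · rw [if_pos h, Finset.sum_eq_single (fun i => if i < k + 1 then n i else 0)]
    · have hc : ∀ j < k + 1, (if j < k + 1 then n j else 0) = n j := fun j hj => if_pos hj
      rw [if_pos ⟨hc, by rwa [part_congr hc]⟩, mul_one]
      exact racahProd_congr α (fun _ _ => rfl) hc
    · intro n' hn' hne
      rw [if_neg, mul_zero]
      rintro ⟨h', _⟩
      refine hne ?_
      rw [mem_comps] at hn'
      ext j
      split_ifs with hj
      · exact h' j hj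
      · exact hn'.2 j (by omega)
    · intro h'
      refine absurd ?_ h'
      rw [mem_comps, h]
      exact ⟨part_congr fun j hj => if_pos hj, fun i hi => if_neg (by omega)⟩
  · rw [if_neg h]
    refine Finset.sum_eq_zero fun n' hn' => ?_
    rw [mem_comps] at hn'
    rw [if_neg, mul_zero]
    rintro ⟨h', _⟩
    exact h (by rw [← hn'.1, part_congr h'])

end NestedOrthonormal

/-! ### From multi-indices to sequences -/

section FinSequences

variable {q : ℝ} {d s : ℕ}

/-- The extension by zero of a multi-index. -/
def toSeq (v : Fin d → ℕ) : ℕ → ℕ := fun i => if h : i < d then v ⟨i, h⟩ else 0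

/-- The extension by one of a vector of parameters. -/
def toSeqR (α : Fin d → ℝ) : ℕ → ℝ := fun i => if h : i < d then α ⟨i, h⟩ else 1

@[simp] lemma toSeq_val (v : Fin d → ℕ) (i : Fin d) : toSeq v i = v i := by simp [toSeq]

@[simp] lemma toSeqR_val (α : Fin d → ℝ) (i : Fin d) : toSeqR α i = α i := by simp [toSeqR]

lemma toSeq_of_le (v : Fin d → ℕ) {i : ℕ} (h : d ≤ i) : toSeq v i = 0 := dif_neg (by omega)

/-- The default value $1$ keeps every parameter positive, as the results on sequences demand. -/
lemma toSeqR_pos {α : Fin d → ℝ} (hα : ∀ i, 0 < α i) (i : ℕ) : 0 < toSeqR α i := by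
  unfold toSeqR; split_ifs
  · exact hα _
  · exact one_pos

lemma psum_eq (v : Fin d → ℕ) (k : ℕ) : psum v k = part (toSeq v) k := by
  have h : ∀ i : Fin d, (if (i : ℕ) < k then v i else 0) =
      (fun i : ℕ => if i < k then toSeq v i else 0) i := fun i => by simp
  rw [psum, part, Finset.sum_filter, Finset.sum_congr rfl fun i _ => h i,
    Fin.sum_univ_eq_sum_range (fun i : ℕ => if i < k then toSeq v i else 0) d, ← Finset.sum_filter]
  refine Finset.sum_subset (fun i hi => ?_) fun i hi hi' => ?_
  · simp at hi ⊢; exact hi.2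
  · simp at hi hi'; exact toSeq_of_le v (by omega)

lemma psumTail_eq (v : Fin d → ℕ) (k : ℕ) : psumTail v (k + 1) = part (toSeq v ∘ Nat.succ) k := by
  have h : ∀ i : Fin d, (if 1 ≤ (i : ℕ) ∧ (i : ℕ) < k + 1 then v i else 0) =
      (fun i : ℕ => if 1 ≤ i ∧ i < k + 1 then toSeq v i else 0) i := fun i => by simp
  rw [psumTail, part, Finset.sum_filter, Finset.sum_congr rfl fun i _ => h i,
    Fin.sum_univ_eq_sum_range (fun i : ℕ => if 1 ≤ i ∧ i < k + 1 then toSeq v i else 0) d,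
    ← Finset.sum_filter]
  have e : ∑ i ∈ Finset.range k, (toSeq v ∘ Nat.succ) i =
      ∑ i ∈ (Finset.range k).map ⟨Nat.succ, Nat.succ_injective⟩, toSeq v i := by simp
  rw [e]
  refine Finset.sum_subset (fun i hi => ?_) fun i hi hi' => ?_
  · simp only [Finset.mem_filter, Finset.mem_range] at hi
    simp only [Finset.mem_map, Finset.mem_range, Function.Embedding.coeFn_mk]
    exact ⟨i - 1, by omega, by omega⟩
  · simp only [Finset.mem_map, Finset.mem_range, Function.Embedding.coeFn_mk] at hi
    obtain ⟨j, hj, rfl⟩ := hi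
    simp at hi'
    exact toSeq_of_le v (by rw [Nat.succ_eq_add_one]; omega)

lemma rsum_eq (α : Fin d → ℝ) {k : ℕ} (hk : k ≤ d) : rsum α k = rpart (toSeqR α) k := by
  have h : ∀ i : Fin d, (if (i : ℕ) < k then α i else 0) =
      (fun i : ℕ => if i < k then toSeqR α i else 0) i := fun i => by simp
  rw [rsum, rpart, Finset.sum_filter, Finset.sum_congr rfl fun i _ => h i,
    Fin.sum_univ_eq_sum_range (fun i : ℕ => if i < k then toSeqR α i else 0) d, ← Finset.sum_filter]
  congr 1
  ext i; simp; omega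

lemma rsumTail_eq (α : Fin d → ℝ) {k : ℕ} (hk : k + 1 ≤ d) :
    rsumTail α (k + 1) = rpart (toSeqR α ∘ Nat.succ) k := by
  have h : ∀ i : Fin d, (if 1 ≤ (i : ℕ) ∧ (i : ℕ) < k + 1 then α i else 0) =
      (fun i : ℕ => if 1 ≤ i ∧ i < k + 1 then toSeqR α i else 0) i := fun i => by simp
  rw [rsumTail, rpart, Finset.sum_filter, Finset.sum_congr rfl fun i _ => h i,
    Fin.sum_univ_eq_sum_range (fun i : ℕ => if 1 ≤ i ∧ i < k + 1 then toSeqR α i else 0) d,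
    ← Finset.sum_filter]
  have e : ∑ i ∈ Finset.range k, (toSeqR α ∘ Nat.succ) i =
      ∑ i ∈ (Finset.range k).map ⟨Nat.succ, Nat.succ_injective⟩, toSeqR α i := by simp
  rw [e]
  congr 1
  ext i
  simp only [Finset.mem_filter, Finset.mem_range, Finset.mem_map, Function.Embedding.coeFn_mk]
  exact ⟨fun h => ⟨i - 1, by omega, by omega⟩, by rintro ⟨j, hj, rfl⟩; omega⟩

lemma psum_eq_sum (v : Fin d → ℕ) : psum v d = ∑ i, v i := by simp [psum]

lemma mem_piAntidiag_univ {v : Fin d → ℕ} {p : ℕ} :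
    v ∈ Finset.piAntidiag Finset.univ p ↔ psum v d = p := by
  simp [psum_eq_sum]

lemma sum_piAntidiag_toSeq {M : Type*} [AddCommMonoid M] (F : (ℕ → ℕ) → M) (p : ℕ) :
    ∑ y ∈ Finset.piAntidiag (Finset.univ : Finset (Fin d)) p, F (toSeq y) = ∑ f ∈ comps d p, F f := by
  refine Finset.sum_bij' (fun y _ => toSeq y) (fun f _ => fun i : Fin d => f i) ?_ ?_ ?_ ?_ ?_
  · intro y hy
    rw [mem_piAntidiag_univ, psum_eq] at hy
    exact mem_comps.2 ⟨hy, fun i hi => toSeq_of_le y hi⟩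
  · intro f hf
    rw [mem_comps] at hf
    rw [mem_piAntidiag_univ, psum_eq, ← hf.1]
    exact part_congr fun i hi => by simp [toSeq, hi]
  · intro y _
    ext i; simp
  · intro f hf
    rw [mem_comps] at hf
    ext i
    by_cases hi : i < d
    · simp [toSeq, hi]
    · rw [toSeq_of_le _ (by omega), hf.2 i (by omega)]
  · intros; rfl

lemma toSeq_injective : Function.Injective (toSeq (d := d)) := fun v w h => by
  ext i; simpa using congrFun h i

lemma Psi_eq (α : Fin (s + 2) → ℝ) (n y : Fin (s + 2) → ℕ) :
    Psi q α n y = (if psum n (s + 2) = psum y (s + 2) then 1 else 0) *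
      nested q (toSeqR α) (s + 1) (toSeq n) (toSeq y) := by
  rw [Psi, nested, ← Fin.prod_univ_eq_prod_range]
  congr 1
  refine Finset.prod_congr rfl fun k _ => ?_
  rw [nestedFactor, psum_eq, psum_eq, psum_eq, rsum_eq α (by omega)]
  congr 1
  · exact (toSeq_val n k.castSucc).symm
  · exact (toSeqR_val α k.succ).symm

lemma Xi_eq (α : Fin (s + 2) → ℝ) (m y : Fin (s + 2) → ℕ) :
    Xi q α m y = (if psum m (s + 2) = psum y (s + 2) then 1 else 0) *
      nestedAlt q (toSeqR α) s (toSeq m) (toSeq y) := by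
  rw [Xi, nestedAlt, nested, ← Fin.prod_univ_eq_prod_range, mul_assoc]
  congr 2
  · refine Finset.prod_congr rfl fun k _ => ?_
    rw [nestedFactor, psum_eq, psumTail_eq, psumTail_eq, rsumTail_eq α (by omega)]
    congr 1
    · exact (toSeq_val m k.castSucc.castSucc).symm
    · exact (toSeqR_val α k.succ.succ).symm
  · rw [psum_eq, psum_eq, rsumTail_eq α (by omega)]
    congr 1
    · exact (toSeq_val m (Fin.last s).castSucc).symm

lemma Psi_eq_zero {α : Fin (s + 2) → ℝ} {n y : Fin (s + 2) → ℕ}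
    (h : psum n (s + 2) ≠ psum y (s + 2)) : Psi q α n y = 0 := by rw [Psi_eq, if_neg h, zero_mul]

lemma Xi_eq_zero {α : Fin (s + 2) → ℝ} {n y : Fin (s + 2) → ℕ}
    (h : psum n (s + 2) ≠ psum y (s + 2)) : Xi q α n y = 0 := by rw [Xi_eq, if_neg h, zero_mul]

lemma sum_mul_eq_comps {F G : (Fin (s + 2) → ℕ) → ℝ} {f g : (ℕ → ℕ) → ℝ} {p : ℕ}
    (hF : ∀ y, psum y (s + 2) = p → F y = f (toSeq y))
    (hG : ∀ y, psum y (s + 2) = p → G y = g (toSeq y)) :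
    ∑ y ∈ Finset.piAntidiag Finset.univ p, F y * G y = ∑ y ∈ comps (s + 2) p, f y * g y := by
  rw [← sum_piAntidiag_toSeq]
  refine Finset.sum_congr rfl fun y hy => ?_
  rw [mem_piAntidiag_univ] at hy
  rw [hF y hy, hG y hy]

variable {α : Fin (s + 2) → ℝ}

lemma Psi_orthonormal (hq0 : 0 < q) (hq1 : q < 1) (hα : ∀ i, 0 < α i) {n n' : Fin (s + 2) → ℕ}
    {p : ℕ} (hn : psum n (s + 2) = p) (hn' : psum n' (s + 2) = p) :
    ∑ y ∈ Finset.piAntidiag Finset.univ p, Psi q α n y * Psi q α n' y =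
      if n = n' then 1 else 0 := by
  classical
  rw [sum_mul_eq_comps (f := nested q (toSeqR α) (s + 1) (toSeq n))
      (g := nested q (toSeqR α) (s + 1) (toSeq n'))
      (fun y hy => by rw [Psi_eq, if_pos (hn.trans hy.symm), one_mul])
      (fun y hy => by rw [Psi_eq, if_pos (hn'.trans hy.symm), one_mul]),
    orthonormal_comps _ (fun n n' => nested_orthonormal hq0 hq1 (toSeqR_pos hα) (s + 1) n n' p)
      (mem_comps.2 ⟨by rw [← psum_eq, hn], fun i hi => toSeq_of_le n hi⟩)
      (mem_comps.2 ⟨by rw [← psum_eq, hn'], fun i hi => toSeq_of_le n' hi⟩)]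
  simp only [toSeq_injective.eq_iff]

lemma Xi_orthonormal (hq0 : 0 < q) (hq1 : q < 1) (hα : ∀ i, 0 < α i) {n n' : Fin (s + 2) → ℕ}
    {p : ℕ} (hn : psum n (s + 2) = p) (hn' : psum n' (s + 2) = p) :
    ∑ y ∈ Finset.piAntidiag Finset.univ p, Xi q α n y * Xi q α n' y =
      if n = n' then 1 else 0 := by
  classical
  rw [sum_mul_eq_comps (f := nestedAlt q (toSeqR α) s (toSeq n))
      (g := nestedAlt q (toSeqR α) s (toSeq n'))
      (fun y hy => by rw [Xi_eq, if_pos (hn.trans hy.symm), one_mul])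
      (fun y hy => by rw [Xi_eq, if_pos (hn'.trans hy.symm), one_mul]),
    orthonormal_comps _ (fun n n' => nestedAlt_orthonormal hq0 hq1 (toSeqR_pos hα) s n n' p)
      (mem_comps.2 ⟨by rw [← psum_eq, hn], fun i hi => toSeq_of_le n hi⟩)
      (mem_comps.2 ⟨by rw [← psum_eq, hn'], fun i hi => toSeq_of_le n' hi⟩)]
  simp only [toSeq_injective.eq_iff]

lemma overlap_eq_sum (m n : Fin (s + 2) → ℕ) :
    overlap q α m n =
      ∑ y ∈ Finset.piAntidiag Finset.univ (psum m (s + 2)), Xi q α m y * Psi q α n y := by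
  rw [overlap, tsum_eq_sum]
  intro y hy
  rw [mem_piAntidiag_univ] at hy
  rw [Xi_eq_zero (Ne.symm hy), zero_mul]

lemma overlap_eq_zero {m n : Fin (s + 2) → ℕ} (h : psum m (s + 2) ≠ psum n (s + 2)) :
    overlap q α m n = 0 := by
  rw [overlap_eq_sum]
  refine Finset.sum_eq_zero fun y hy => ?_
  rw [mem_piAntidiag_univ] at hy
  rw [Psi_eq_zero (by omega), mul_zero]

lemma psum_succ_last (m : Fin (s + 2) → ℕ) :
    psum m (s + 2) = psum m (s + 1) + m (Fin.last (s + 1)) := by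
  rw [psum_eq, psum_eq, part_succ]; congr 1; exact toSeq_val m (Fin.last (s + 1))

/-- Functions of different total degree have disjoint supports. For equal total degrees the two
deltas are equivalent, so only `nested_overlap` is needed. -/
theorem overlap_eq_racahProd (hq0 : 0 < q) (hq1 : q < 1) (hα : ∀ i, 0 < α i)
    (m n : Fin (s + 2) → ℕ) :
    overlap q α m n = (if m (Fin.last (s + 1)) = n (Fin.last (s + 1)) then 1 else 0) *
      (if psum m (s + 1) = psum n (s + 1) then 1 else 0) *
        racahProd q (toSeqR α) s (toSeq m) (toSeq n) := by
  have e1 := psum_succ_last m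
  have e2 := psum_succ_last n
  by_cases h : psum m (s + 2) = psum n (s + 2)
  · rw [overlap_eq_sum, sum_mul_eq_comps (f := nestedAlt q (toSeqR α) s (toSeq m))
      (g := nested q (toSeqR α) (s + 1) (toSeq n))
      (fun y hy => by rw [Xi_eq, if_pos hy.symm, one_mul])
      (fun y hy => by rw [Psi_eq, if_pos (h.symm.trans hy.symm), one_mul]),
      nested_overlap hq0 hq1 (toSeqR_pos hα) s (by rw [← psum_eq]; omega), ← psum_eq, ← psum_eq]
    by_cases h' : psum m (s + 1) = psum n (s + 1)
    · rw [if_pos h', if_pos h', if_pos (by omega)]; ring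
    · rw [if_neg h', if_neg h']; ring
  · rw [overlap_eq_zero h]
    by_cases h' : psum m (s + 1) = psum n (s + 1)
    · rw [if_neg (by omega)]; ring
    · rw [if_neg h']; ring

lemma racahProd_toSeq (m n : Fin (s + 2) → ℕ) :
    racahProd q (toSeqR α) s (toSeq m) (toSeq n) =
      ∏ k : Fin s, (-1) ^ (m k.castSucc.castSucc) *
          racahHat q (m k.castSucc.castSucc)
            ((psum n (k.val + 1) : ℤ) - psum m k.val)
            (2 * (psum m k.val : ℝ) + rsumTail α (k.val + 2) + k.val)
            (α k.succ.succ)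
            ((psum n (k.val + 2) : ℝ) + psum m k.val + rsum α (k.val + 2) + ((k.val : ℝ) + 1))
            ((psum n (k.val + 2) : ℤ) - psum m k.val) := by
  rw [racahProd, ← Fin.prod_univ_eq_prod_range]
  refine Finset.prod_congr rfl fun k _ => ?_
  rw [racahFactor, psum_eq, psum_eq, psum_eq, rsum_eq α (by omega), rsumTail_eq α (by omega)]
  congr 2
  · exact toSeq_val m k.castSucc.castSucc
  · exact toSeq_val m k.castSucc.castSucc
  · exact toSeqR_val α k.succ.succ

lemma Psi_complete (hq0 : 0 < q) (hq1 : q < 1) (hα : ∀ i, 0 < α i) {y y' : Fin (s + 2) → ℕ}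
    {p : ℕ} (hy : psum y (s + 2) = p) (hy' : psum y' (s + 2) = p) :
    ∑ n ∈ Finset.piAntidiag Finset.univ p, Psi q α n y * Psi q α n y' =
      if y = y' then 1 else 0 :=
  orthonormal_dual rfl (fun n y => Psi q α n y) (fun _ hn _ hn' =>
    Psi_orthonormal hq0 hq1 hα (mem_piAntidiag_univ.1 hn) (mem_piAntidiag_univ.1 hn'))
    y (mem_piAntidiag_univ.2 hy) y' (mem_piAntidiag_univ.2 hy')

lemma Xi_complete (hq0 : 0 < q) (hq1 : q < 1) (hα : ∀ i, 0 < α i) {y y' : Fin (s + 2) → ℕ}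
    {p : ℕ} (hy : psum y (s + 2) = p) (hy' : psum y' (s + 2) = p) :
    ∑ n ∈ Finset.piAntidiag Finset.univ p, Xi q α n y * Xi q α n y' =
      if y = y' then 1 else 0 :=
  orthonormal_dual rfl (fun n y => Xi q α n y) (fun _ hn _ hn' =>
    Xi_orthonormal hq0 hq1 hα (mem_piAntidiag_univ.1 hn) (mem_piAntidiag_univ.1 hn'))
    y (mem_piAntidiag_univ.2 hy) y' (mem_piAntidiag_univ.2 hy')

/-- For a fixed total degree the functions $\Psi_{\boldsymbol n}$ are a complete orthonormal system
on a finite set. Other $\boldsymbol n$ have zero overlap, so the series is a finite sum. -/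
theorem hasSum_overlap (hq0 : 0 < q) (hq1 : q < 1) (hα : ∀ i, 0 < α i)
    (m y : Fin (s + 2) → ℕ) :
    HasSum (fun n => overlap q α m n * Psi q α n y) (Xi q α m y) := by
  have h : ∑ n ∈ Finset.piAntidiag Finset.univ (psum m (s + 2)),
      overlap q α m n * Psi q α n y = Xi q α m y := by
    by_cases hy : psum m (s + 2) = psum y (s + 2)
    · simp only [overlap_eq_sum, Finset.sum_mul]
      rw [Finset.sum_comm, Finset.sum_eq_single_of_mem y (mem_piAntidiag_univ.2 hy.symm)]
      · simp only [mul_assoc]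
        rw [← Finset.mul_sum, Psi_complete hq0 hq1 hα hy.symm hy.symm, if_pos rfl, mul_one]
      · intro y' hy' hne
        simp only [mul_assoc]
        rw [← Finset.mul_sum, Psi_complete hq0 hq1 hα (mem_piAntidiag_univ.1 hy') hy.symm,
          if_neg hne, mul_zero]
    · rw [Xi_eq_zero hy]
      refine Finset.sum_eq_zero fun n hn => ?_
      rw [mem_piAntidiag_univ] at hn
      rw [Psi_eq_zero (by omega), mul_zero]
  rw [← h]
  refine hasSum_sum_of_ne_finset_zero fun n hn => ?_
  rw [mem_piAntidiag_univ] at hn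
  rw [overlap_eq_zero (Ne.symm hn), zero_mul]

end FinSequences

/-! ### Raising and lowering operators on functions of sequences -/

section SegmentOperators

variable {q : ℝ}

/-- The weight of the entries `a, …, i - 1` of a sequence. -/
def segWeight (α : ℕ → ℝ) (a i : ℕ) (y : ℕ → ℕ) : ℝ :=
  ∑ l ∈ Finset.Ico a i, ((y l : ℝ) + (α l + 1) / 2)

/-- The lowering operator of the tensor factors `a, …, k - 1`. -/
def lowerSeg (q : ℝ) (α : ℕ → ℝ) (a k : ℕ) (F : (ℕ → ℕ) → ℝ) (y : ℕ → ℕ) : ℝ :=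
  ∑ i ∈ Finset.Ico a k, q ^ segWeight α a i y * ladder q (α i) (y i + 1) *
    F (Function.update y i (y i + 1))

/-- The raising operator of the tensor factors `a, …, k - 1`. -/
def raiseSeg (q : ℝ) (α : ℕ → ℝ) (a k : ℕ) (F : (ℕ → ℕ) → ℝ) (y : ℕ → ℕ) : ℝ :=
  ∑ i ∈ Finset.Ico a k, q ^ segWeight α a i y * ladder q (α i) (y i) *
    F (Function.update y i (y i - 1))

lemma part_update_of_le (y : ℕ → ℕ) {i m : ℕ} (h : m ≤ i) (c : ℕ) :
    part (Function.update y i c) m = part y m :=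
  part_congr fun _ hl => Function.update_of_ne (by omega) _ _

/-- Stated additively, so that it serves raising and lowering without truncated subtraction. -/
lemma part_update_of_lt (y : ℕ → ℕ) {i m : ℕ} (h : i < m) (c : ℕ) :
    part (Function.update y i c) m + y i = part y m + c := by
  have h1 := Finset.sum_update_of_mem (Finset.mem_range.2 h) y c
  have h2 := Finset.add_sum_erase _ y (Finset.mem_range.2 h)
  rw [← Finset.sdiff_singleton_eq_erase] at h2
  rw [part, part, h1, ← h2]; ring

lemma segWeight_zero (α : ℕ → ℝ) (i : ℕ) (y : ℕ → ℕ) :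
    segWeight α 0 i y = part y i + (rpart α i + i) / 2 := by
  induction i with
  | zero => simp [segWeight]
  | succ i ih =>
    rw [segWeight, Finset.sum_Ico_succ_top (Nat.zero_le i), part_succ, rpart_succ]
    rw [segWeight] at ih
    rw [ih]; push_cast; ring

lemma segWeight_one (α : ℕ → ℝ) (i : ℕ) (y : ℕ → ℕ) :
    segWeight α 1 (i + 1) y = segWeight (α ∘ Nat.succ) 0 i (y ∘ Nat.succ) := by
  rw [segWeight, segWeight, Finset.sum_Ico_eq_sum_range, Finset.sum_Ico_eq_sum_range]
  refine Finset.sum_congr rfl fun l _ => ?_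
  simp [add_comm]

lemma segWeight_zero_succ (α : ℕ → ℝ) (i : ℕ) (y : ℕ → ℕ) :
    segWeight α 0 (i + 1) y = (y 0 : ℝ) + (α 0 + 1) / 2 + segWeight α 1 (i + 1) y := by
  rw [segWeight, Finset.sum_eq_sum_Ico_succ_bot (Nat.succ_pos i)]; rfl

lemma update_succ_eq (y : ℕ → ℕ) (i c : ℕ) :
    Function.update y (i + 1) c = consSeq (y 0) (Function.update (y ∘ Nat.succ) i c) := by
  ext j
  cases j with
  | zero => rw [Function.update_of_ne (by omega), consSeq_zero]
  | succ j =>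
    rw [consSeq_succ]
    by_cases h : j = i
    · subst h; simp
    · rw [Function.update_of_ne (by omega), Function.update_of_ne h]; rfl

/-- With the first entry frozen, an operator on the factors from the second on is an operator on the
shifted sequence. -/
lemma lowerSeg_one (α : ℕ → ℝ) (k : ℕ) (F : (ℕ → ℕ) → ℝ) (y : ℕ → ℕ) :
    lowerSeg q α 1 (k + 1) F y =
      lowerSeg q (α ∘ Nat.succ) 0 k (F ∘ consSeq (y 0)) (y ∘ Nat.succ) := by
  rw [lowerSeg, lowerSeg, Finset.sum_Ico_eq_sum_range, Finset.sum_Ico_eq_sum_range]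
  refine Finset.sum_congr rfl fun i _ => ?_
  rw [add_comm 1 i, zero_add, segWeight_one, update_succ_eq]
  rfl

lemma raiseSeg_one (α : ℕ → ℝ) (k : ℕ) (F : (ℕ → ℕ) → ℝ) (y : ℕ → ℕ) :
    raiseSeg q α 1 (k + 1) F y =
      raiseSeg q (α ∘ Nat.succ) 0 k (F ∘ consSeq (y 0)) (y ∘ Nat.succ) := by
  rw [raiseSeg, raiseSeg, Finset.sum_Ico_eq_sum_range, Finset.sum_Ico_eq_sum_range]
  refine Finset.sum_congr rfl fun i _ => ?_
  rw [add_comm 1 i, zero_add, segWeight_one, update_succ_eq]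
  rfl

/-- The coproduct $A_-\otimes 1+q^{A_0}\otimes A_-$, split after the first factor. -/
lemma lowerSeg_bot (hq0 : 0 < q) (α : ℕ → ℝ) (k : ℕ) (F : (ℕ → ℕ) → ℝ) (y : ℕ → ℕ) :
    lowerSeg q α 0 (k + 1) F y = ladder q (α 0) (y 0 + 1) * F (Function.update y 0 (y 0 + 1)) +
      q ^ ((y 0 : ℝ) + (α 0 + 1) / 2) * lowerSeg q α 1 (k + 1) F y := by
  rw [lowerSeg, Finset.sum_eq_sum_Ico_succ_bot (Nat.succ_pos k), lowerSeg, Finset.mul_sum]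
  congr 1
  · simp [segWeight]
  · refine Finset.sum_congr rfl fun i hi => ?_
    rw [Finset.mem_Ico] at hi
    obtain ⟨j, rfl⟩ : ∃ j, i = j + 1 := ⟨i - 1, by omega⟩
    rw [segWeight_zero_succ, Real.rpow_add hq0]; ring

lemma raiseSeg_bot (hq0 : 0 < q) (α : ℕ → ℝ) (k : ℕ) (F : (ℕ → ℕ) → ℝ) (y : ℕ → ℕ) :
    raiseSeg q α 0 (k + 1) F y = ladder q (α 0) (y 0) * F (Function.update y 0 (y 0 - 1)) +
      q ^ ((y 0 : ℝ) + (α 0 + 1) / 2) * raiseSeg q α 1 (k + 1) F y := by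
  rw [raiseSeg, Finset.sum_eq_sum_Ico_succ_bot (Nat.succ_pos k), raiseSeg, Finset.mul_sum]
  congr 1
  · simp [segWeight]
  · refine Finset.sum_congr rfl fun i hi => ?_
    rw [Finset.mem_Ico] at hi
    obtain ⟨j, rfl⟩ : ∃ j, i = j + 1 := ⟨i - 1, by omega⟩
    rw [segWeight_zero_succ, Real.rpow_add hq0]; ring

/-- The parameter of the representation in which the first `j + 1` factors are coupled. -/
def couplingParam (α : ℕ → ℝ) (j N : ℕ) : ℝ := 2 * (N : ℝ) + rpart α (j + 1) + j

lemma couplingParam_succ (α : ℕ → ℝ) (j : ℕ) (n : ℕ → ℕ) :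
    couplingParam α (j + 1) (part n (j + 1)) =
      2 * (n j : ℝ) + couplingParam α j (part n j) + α (j + 1) + 1 := by
  rw [couplingParam, couplingParam, part_succ, rpart_succ α (j + 1)]; push_cast; ring

lemma couplingParam_weight (α : ℕ → ℝ) (j : ℕ) (n y : ℕ → ℕ) :
    segWeight α 0 (j + 1) y = (((part y (j + 1) : ℤ) - part n j : ℤ) : ℝ) +
      (couplingParam α j (part n j) + 1) / 2 := by
  rw [segWeight_zero, couplingParam]; push_cast; ring

lemma nestedFactor_eq (α : ℕ → ℝ) (n y : ℕ → ℕ) (j : ℕ) :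
    nestedFactor q α n y j = hahnHat q (n j) ((part y (j + 1) : ℤ) - part n j)
      (couplingParam α j (part n j)) (α (j + 1)) ((part y (j + 2) : ℤ) - part n j) := rfl

/-- By induction the first $j+1$ factors behave like one representation with parameter
`couplingParam`; coupling the next factor to it is `hahnHat_lower`. -/
theorem lowerSeg_nested (hq0 : 0 < q) (hq1 : q < 1) {α : ℕ → ℝ} (hα : ∀ i, 0 < α i) (j : ℕ)
    (n y : ℕ → ℕ) : lowerSeg q α 0 (j + 1) (nested q α j n) y =
      ladder q (couplingParam α j (part n j)) (part y (j + 1) + 1 - part n j) *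
        nested q α j n y := by
  induction j with
  | zero => simp [lowerSeg, nested, segWeight, couplingParam, part_succ, rpart_succ]
  | succ j ih =>
    -- The last $q$-Hahn factor sees only partial sums, so raising any of the first $j+1$ entries
    -- shifts it in the same way and it factors out of the sum.
    have hs : ∀ i ∈ Finset.Ico 0 (j + 1), q ^ segWeight α 0 i y * ladder q (α i) (y i + 1) *
        nested q α (j + 1) n (Function.update y i (y i + 1)) =
        q ^ segWeight α 0 i y * ladder q (α i) (y i + 1) *
        nested q α j n (Function.update y i (y i + 1)) *
        hahnHat q (n j) ((part y (j + 1) : ℤ) - part n j + 1)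
          (couplingParam α j (part n j)) (α (j + 1)) ((part y (j + 2) : ℤ) - part n j + 1) := by
      intro i hi
      rw [Finset.mem_Ico] at hi
      have h1 := part_update_of_lt y hi.2 (y i + 1)
      have h2 := part_update_of_lt y (show i < j + 2 by omega) (y i + 1)
      rw [nested_succ, nestedFactor_eq, mul_assoc _ (nested _ _ _ _ _)]
      congr 3
      · omega
      · omega
    have hl : nested q α (j + 1) n (Function.update y (j + 1) (y (j + 1) + 1)) =
        nested q α j n y * hahnHat q (n j) ((part y (j + 1) : ℤ) - part n j)
          (couplingParam α j (part n j)) (α (j + 1)) ((part y (j + 2) : ℤ) - part n j + 1) := by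
      have h1 := part_update_of_le y (le_refl (j + 1)) (y (j + 1) + 1)
      have h2 := part_update_of_lt y (show j + 1 < j + 2 by omega) (y (j + 1) + 1)
      rw [nested_succ, nestedFactor_eq, h1,
        nested_congr α (n' := n) (y' := y) (fun _ _ => rfl)
          (fun i hi => Function.update_of_ne (by omega) _ _)]
      congr 2
      omega
    rw [lowerSeg, Finset.sum_Ico_succ_top (Nat.zero_le _), Finset.sum_congr rfl hs,
      ← Finset.sum_mul, hl, nested_succ, nestedFactor_eq, couplingParam_succ]
    rw [lowerSeg] at ih
    rw [ih, couplingParam_weight α j n]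
    have h3 := hahnHat_lower hq0 hq1 (nested_param_pos hα (part n j) j) (hα (j + 1)) (n j)
      ((part y (j + 1) : ℤ) - part n j) ((part y (j + 2) : ℤ) - part n j)
    have e1 : (part y (j + 2) : ℤ) - part n j + 1 - ((part y (j + 1) : ℤ) - part n j) =
        y (j + 1) + 1 := by
      rw [part_succ]; push_cast; ring
    have e2 : (part y (j + 2) : ℤ) - part n j + 1 - n j =
        part y (j + 1 + 1) + 1 - part n (j + 1) := by
      rw [part_succ n]; push_cast; ring
    rw [e1, e2] at h3
    rw [show (part y (j + 1) : ℤ) - part n j + 1 = part y (j + 1) + 1 - part n j by ring] at *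
    unfold couplingParam at *
    linear_combination nested q α j n y * h3

theorem raiseSeg_nested (hq0 : 0 < q) (hq1 : q < 1) {α : ℕ → ℝ} (hα : ∀ i, 0 < α i) (j : ℕ)
    (n y : ℕ → ℕ) : raiseSeg q α 0 (j + 1) (nested q α j n) y =
      ladder q (couplingParam α j (part n j)) (part y (j + 1) - part n j) *
        nested q α j n y := by
  induction j with
  | zero => simp [raiseSeg, nested, segWeight, couplingParam, part_succ, rpart_succ]
  | succ j ih =>
    have hs : ∀ i ∈ Finset.Ico 0 (j + 1), q ^ segWeight α 0 i y * ladder q (α i) (y i) *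
        nested q α (j + 1) n (Function.update y i (y i - 1)) =
        q ^ segWeight α 0 i y * ladder q (α i) (y i) *
        nested q α j n (Function.update y i (y i - 1)) *
        hahnHat q (n j) ((part y (j + 1) : ℤ) - part n j - 1)
          (couplingParam α j (part n j)) (α (j + 1)) ((part y (j + 2) : ℤ) - part n j - 1) := by
      intro i hi
      rw [Finset.mem_Ico] at hi
      -- The truncated `y i - 1` is wrong exactly when `y i = 0`, where the ladder coefficient
      -- vanishes.
      rcases Nat.eq_zero_or_pos (y i) with h0 | h0
      · rw [h0, Nat.cast_zero, ladder_zero]; ring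
      have h1 := part_update_of_lt y hi.2 (y i - 1)
      have h2 := part_update_of_lt y (show i < j + 2 by omega) (y i - 1)
      rw [nested_succ, nestedFactor_eq, mul_assoc _ (nested _ _ _ _ _)]
      congr 3
      · omega
      · omega
    have hl : ladder q (α (j + 1)) (y (j + 1)) *
        nested q α (j + 1) n (Function.update y (j + 1) (y (j + 1) - 1)) =
        ladder q (α (j + 1)) (y (j + 1)) *
        (nested q α j n y * hahnHat q (n j) ((part y (j + 1) : ℤ) - part n j)
          (couplingParam α j (part n j)) (α (j + 1)) ((part y (j + 2) : ℤ) - part n j - 1)) := by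
      rcases Nat.eq_zero_or_pos (y (j + 1)) with h0 | h0
      · rw [h0, Nat.cast_zero, ladder_zero]; ring
      have h1 := part_update_of_le y (le_refl (j + 1)) (y (j + 1) - 1)
      have h2 := part_update_of_lt y (show j + 1 < j + 2 by omega) (y (j + 1) - 1)
      rw [nested_succ, nestedFactor_eq, h1,
        nested_congr α (n' := n) (y' := y) (fun _ _ => rfl)
          (fun i hi => Function.update_of_ne (by omega) _ _)]
      congr 3
      omega
    rw [raiseSeg, Finset.sum_Ico_succ_top (Nat.zero_le _), Finset.sum_congr rfl hs,
      ← Finset.sum_mul, mul_assoc (q ^ segWeight α 0 (j + 1) y), hl, nested_succ, nestedFactor_eq,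
      couplingParam_succ]
    rw [raiseSeg] at ih
    rw [ih, couplingParam_weight α j n]
    have h3 := hahnHat_raise hq0 hq1 (nested_param_pos hα (part n j) j) (hα (j + 1)) (n j)
      ((part y (j + 1) : ℤ) - part n j) ((part y (j + 2) : ℤ) - part n j)
    have e1 : (part y (j + 2) : ℤ) - part n j - ((part y (j + 1) : ℤ) - part n j) =
        y (j + 1) := by
      rw [part_succ]; push_cast; ring
    have e2 : (part y (j + 2) : ℤ) - part n j - n j =
        part y (j + 1 + 1) - part n (j + 1) := by
      rw [part_succ n]; push_cast; ring
    rw [e1, e2] at h3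
    unfold couplingParam at *
    linear_combination nested q α j n y * h3

end SegmentOperators

/-! ### The products $A_+A_-$ on coupled functions. -/

section SegmentOperators

variable {q : ℝ}

/-- A product of a ladder function of the first `k` entries and a function of the remaining partial
sums is an eigenfunction of the product of the raising and the lowering operator. -/
lemma raise_lower_mul (α : ℕ → ℝ) {k : ℕ} {P R : (ℕ → ℕ) → ℝ} {a : ℤ → ℝ}
    (hl : ∀ y, lowerSeg q α 0 k P y = a (part y k + 1) * P y)
    (hr : ∀ y, raiseSeg q α 0 k P y = a (part y k) * P y)
    (hR : ∀ y y', (∀ i, k ≤ i → part y i = part y' i) → R y = R y') (y : ℕ → ℕ) :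
    raiseSeg q α 0 k (lowerSeg q α 0 k fun y => P y * R y) y = a (part y k) ^ 2 * (P y * R y) := by
  -- The factor `R` notices that the total has increased by one but not in which entry, so entry $0$
  -- can represent every case. Raising undoes this shift.
  have hlow : ∀ y, lowerSeg q α 0 k (fun y => P y * R y) y =
      a (part y k + 1) * P y * R (Function.update y 0 (y 0 + 1)) := by
    intro y
    rw [← hl, lowerSeg, lowerSeg, Finset.sum_mul]
    refine Finset.sum_congr rfl fun i hi => ?_
    rw [Finset.mem_Ico] at hi
    rw [hR (Function.update y i (y i + 1)) (Function.update y 0 (y 0 + 1)), mul_assoc _ (P _)]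
    intro l hkl
    have h1 := part_update_of_lt y (show i < l by omega) (y i + 1)
    have h2 := part_update_of_lt y (show 0 < l by omega) (y 0 + 1)
    omega
  have hraise : ∀ i ∈ Finset.Ico 0 k, q ^ segWeight α 0 i y * ladder q (α i) (y i) *
      lowerSeg q α 0 k (fun y => P y * R y) (Function.update y i (y i - 1)) =
      q ^ segWeight α 0 i y * ladder q (α i) (y i) * P (Function.update y i (y i - 1)) *
        (a (part y k) * R y) := by
    intro i hi
    rw [Finset.mem_Ico] at hi
    rcases Nat.eq_zero_or_pos (y i) with h0 | h0
    · rw [h0, Nat.cast_zero, ladder_zero]; ring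
    rw [hlow]
    have h1 := part_update_of_lt y hi.2 (y i - 1)
    have h2 : ((part (Function.update y i (y i - 1)) k : ℕ) : ℤ) + 1 = part y k := by omega
    rw [h2, hR _ y]
    · ring
    · intro l hkl
      have h3 := part_update_of_lt (Function.update y i (y i - 1)) (show 0 < l by omega)
        (Function.update y i (y i - 1) 0 + 1)
      have h4 := part_update_of_lt y (show i < l by omega) (y i - 1)
      omega
  rw [raiseSeg, Finset.sum_congr rfl hraise, ← Finset.sum_mul]
  have := hr y
  rw [raiseSeg] at this
  rw [this]; ring

lemma nested_split (α : ℕ → ℝ) {j K : ℕ} (h : j ≤ K) (n y : ℕ → ℕ) : nested q α K n y =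
    nested q α j n y * ∏ i ∈ Finset.Ico j K, nestedFactor q α n y i := by
  rw [nested, nested, Finset.prod_range_mul_prod_Ico _ h]

lemma nestedFactor_congr_part (α : ℕ → ℝ) (n : ℕ → ℕ) {y y' : ℕ → ℕ} {i : ℕ}
    (h1 : part y (i + 1) = part y' (i + 1)) (h2 : part y (i + 2) = part y' (i + 2)) :
    nestedFactor q α n y i = nestedFactor q α n y' i := by
  rw [nestedFactor, nestedFactor, h1, h2]

/-- The factors with index below $j$ obey the ladder relations. The later factors and the constraint
involve only partial sums of length at least $j+1$, so they play the role of `R` in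
`raise_lower_mul`. -/
theorem raise_lower_nested (hq0 : 0 < q) (hq1 : q < 1) {α : ℕ → ℝ} (hα : ∀ i, 0 < α i) {j K D : ℕ}
    (hj : j ≤ K) (hD : j + 1 ≤ D) (T : ℕ) (n y : ℕ → ℕ) :
    raiseSeg q α 0 (j + 1) (lowerSeg q α 0 (j + 1) fun y =>
      (if T = part y D then 1 else 0) * nested q α K n y) y =
      ladder q (couplingParam α j (part n j)) (part y (j + 1) - part n j) ^ 2 *
        ((if T = part y D then 1 else 0) * nested q α K n y) := by
  have e : ∀ y, (if T = part y D then 1 else 0) * nested q α K n y =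
      nested q α j n y * ((if T = part y D then 1 else 0) *
        ∏ i ∈ Finset.Ico j K, nestedFactor q α n y i) := fun y => by
    rw [nested_split α hj]; ring
  simp only [e]
  refine raise_lower_mul α
    (a := fun t => ladder q (couplingParam α j (part n j)) (t - part n j))
    (lowerSeg_nested hq0 hq1 hα j n) (raiseSeg_nested hq0 hq1 hα j n) ?_ y
  intro y y' h
  rw [h D hD]
  congr 1
  refine Finset.prod_congr rfl fun i hi => ?_
  rw [Finset.mem_Ico] at hi
  exact nestedFactor_congr_part α n (h _ (by omega)) (h _ (by omega))

/-- With the first entry frozen this is the previous argument for the shifted sequence. The outer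
$q$-Hahn factor depends on the remaining entries through `part z (K + 1)` only, so it belongs to
`R`. -/
theorem raise_lower_nestedAlt_tail (hq0 : 0 < q) (hq1 : q < 1) {α : ℕ → ℝ} (hα : ∀ i, 0 < α i)
    {j K D : ℕ} (hj : j ≤ K) (hD : j + 1 ≤ D) (T : ℕ) (m y : ℕ → ℕ) :
    raiseSeg q α 1 (j + 2) (lowerSeg q α 1 (j + 2) fun y =>
      (if T = part y (D + 1) then 1 else 0) * nestedAlt q α K m y) y =
      ladder q (couplingParam (α ∘ Nat.succ) j (part m j))
        (part (y ∘ Nat.succ) (j + 1) - part m j) ^ 2 *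
        ((if T = part y (D + 1) then 1 else 0) * nestedAlt q α K m y) := by
  have e : ∀ a : ℕ, ∀ z, (if T = part (consSeq a z) (D + 1) then 1 else 0) *
      nestedAlt q α K m (consSeq a z) =
      nested q (α ∘ Nat.succ) j m z * ((if T = part z D + a then 1 else 0) *
        (∏ i ∈ Finset.Ico j K, nestedFactor q (α ∘ Nat.succ) m z i) *
        hahnHat q (m K) a (α 0) (2 * (part m K : ℝ) + rpart (α ∘ Nat.succ) (K + 1) + K)
          (((part z (K + 1) + a : ℕ) : ℤ) - part m K)) := fun a z => by
    rw [nestedAlt, consSeq_comp_succ, nested_split (α ∘ Nat.succ) hj, part_succ', part_succ' _ (K + 1),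
      consSeq_comp_succ, consSeq_zero]
    ring
  have key := raise_lower_mul (α ∘ Nat.succ) (k := j + 1)
    (P := nested q (α ∘ Nat.succ) j m)
    (R := fun z => (if T = part z D + y 0 then 1 else 0) *
        (∏ i ∈ Finset.Ico j K, nestedFactor q (α ∘ Nat.succ) m z i) *
        hahnHat q (m K) (y 0) (α 0) (2 * (part m K : ℝ) + rpart (α ∘ Nat.succ) (K + 1) + K)
          (((part z (K + 1) + y 0 : ℕ) : ℤ) - part m K))
    (a := fun t => ladder q (couplingParam (α ∘ Nat.succ) j (part m j)) (t - part m j))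
    (lowerSeg_nested hq0 hq1 (fun i => hα _) j m) (raiseSeg_nested hq0 hq1 (fun i => hα _) j m) (by
      intro y y' h
      rw [h D hD, h (K + 1) (by omega)]
      congr 2
      refine Finset.prod_congr rfl fun i hi => ?_
      rw [Finset.mem_Ico] at hi
      exact nestedFactor_congr_part _ m (h _ (by omega)) (h _ (by omega))) (y ∘ Nat.succ)
  rw [raiseSeg_one]
  have e2 := e (y 0) (y ∘ Nat.succ)
  rw [consSeq_eta] at e2
  rw [e2, ← key]
  congr 1
  funext z
  simp only [Function.comp]
  rw [lowerSeg_one, consSeq_comp_succ, consSeq_zero]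
  congr 1
  funext z'
  exact e (y 0) z'

/-- Splitting off the first factor, `lowerSeg_nested` handles the others as a single representation,
and one `hahnHat_lower` couples the first factor to it. -/
theorem lowerSeg_nestedAlt (hq0 : 0 < q) (hq1 : q < 1) {α : ℕ → ℝ} (hα : ∀ i, 0 < α i) (k : ℕ)
    (m y : ℕ → ℕ) : lowerSeg q α 0 (k + 2) (nestedAlt q α k m) y =
      ladder q (couplingParam α (k + 1) (part m (k + 1))) (part y (k + 2) + 1 - part m (k + 1)) *
        nestedAlt q α k m y := by
  have ht : lowerSeg q α 1 (k + 2) (nestedAlt q α k m) y =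
      ladder q (couplingParam (α ∘ Nat.succ) k (part m k))
        (part (y ∘ Nat.succ) (k + 1) + 1 - part m k) * nested q (α ∘ Nat.succ) k m (y ∘ Nat.succ) *
        hahnHat q (m k) (y 0) (α 0) (couplingParam (α ∘ Nat.succ) k (part m k))
          ((part y (k + 2) : ℤ) - part m k + 1) := by
    rw [← lowerSeg_nested hq0 hq1 (α := α ∘ Nat.succ) (fun i => hα _), lowerSeg_one, lowerSeg, lowerSeg, Finset.sum_mul]
    refine Finset.sum_congr rfl fun i hi => ?_
    rw [Finset.mem_Ico] at hi
    have h1 := part_update_of_lt (y ∘ Nat.succ) hi.2 ((y ∘ Nat.succ) i + 1)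
    rw [Function.comp_apply (f := nestedAlt q α k m), nestedAlt, consSeq_comp_succ, consSeq_zero,
      mul_assoc _ (nested _ _ _ _ _), part_succ' _ (k + 1), part_succ' _ (k + 1), consSeq_comp_succ,
      consSeq_zero]
    congr 3
    omega
  have h0 : nestedAlt q α k m (Function.update y 0 (y 0 + 1)) =
      nested q (α ∘ Nat.succ) k m (y ∘ Nat.succ) *
        hahnHat q (m k) ((y 0 : ℤ) + 1) (α 0) (couplingParam (α ∘ Nat.succ) k (part m k))
          ((part y (k + 2) : ℤ) - part m k + 1) := by
    have h1 := part_update_of_lt y (show 0 < k + 2 by omega) (y 0 + 1)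
    rw [nestedAlt, Function.update_self]
    congr 2
    omega
  rw [lowerSeg_bot hq0, h0, ht, nestedAlt]
  have h3 := hahnHat_lower hq0 hq1 (hα 0) (nested_param_pos (α := α ∘ Nat.succ) (fun i => hα _)
    (part m k) k) (m k) (y 0) ((part y (k + 2) : ℤ) - part m k)
  have e1 : (part y (k + 2) : ℤ) - part m k + 1 - y 0 =
      part (y ∘ Nat.succ) (k + 1) + 1 - part m k := by
    rw [part_succ']; push_cast; ring
  have e2 : (part y (k + 2) : ℤ) - part m k + 1 - m k = part y (k + 2) + 1 - part m (k + 1) := by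
    rw [part_succ m]; push_cast; ring
  have e3 : couplingParam α (k + 1) (part m (k + 1)) =
      2 * (m k : ℝ) + α 0 + (2 * (part m k : ℝ) + rpart (α ∘ Nat.succ) (k + 1) + k) + 1 := by
    rw [couplingParam, part_succ, rpart_succ' α (k + 1)]; push_cast; ring
  rw [e1, e2] at h3
  rw [e3, ← couplingParam]
  rw [← couplingParam] at h3
  rw [Int.cast_natCast] at h3
  linear_combination nested q (α ∘ Nat.succ) k m (y ∘ Nat.succ) * h3

theorem raiseSeg_nestedAlt (hq0 : 0 < q) (hq1 : q < 1) {α : ℕ → ℝ} (hα : ∀ i, 0 < α i) (k : ℕ)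
    (m y : ℕ → ℕ) : raiseSeg q α 0 (k + 2) (nestedAlt q α k m) y =
      ladder q (couplingParam α (k + 1) (part m (k + 1))) (part y (k + 2) - part m (k + 1)) *
        nestedAlt q α k m y := by
  have ht : raiseSeg q α 1 (k + 2) (nestedAlt q α k m) y =
      ladder q (couplingParam (α ∘ Nat.succ) k (part m k))
        (part (y ∘ Nat.succ) (k + 1) - part m k) * nested q (α ∘ Nat.succ) k m (y ∘ Nat.succ) *
        hahnHat q (m k) (y 0) (α 0) (couplingParam (α ∘ Nat.succ) k (part m k))
          ((part y (k + 2) : ℤ) - part m k - 1) := by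
    rw [← raiseSeg_nested hq0 hq1 (α := α ∘ Nat.succ) (fun i => hα _), raiseSeg_one, raiseSeg, raiseSeg, Finset.sum_mul]
    refine Finset.sum_congr rfl fun i hi => ?_
    rw [Finset.mem_Ico] at hi
    rcases Nat.eq_zero_or_pos ((y ∘ Nat.succ) i) with h0 | h0
    · rw [h0, Nat.cast_zero, ladder_zero]; ring
    have h1 := part_update_of_lt (y ∘ Nat.succ) hi.2 ((y ∘ Nat.succ) i - 1)
    rw [Function.comp_apply (f := nestedAlt q α k m), nestedAlt, consSeq_comp_succ, consSeq_zero,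
      mul_assoc _ (nested _ _ _ _ _), part_succ' _ (k + 1), part_succ' _ (k + 1), consSeq_comp_succ,
      consSeq_zero]
    congr 3
    push_cast
    omega
  have h0 : ladder q (α 0) (y 0) * nestedAlt q α k m (Function.update y 0 (y 0 - 1)) =
      ladder q (α 0) (y 0) * (nested q (α ∘ Nat.succ) k m (y ∘ Nat.succ) *
        hahnHat q (m k) ((y 0 : ℤ) - 1) (α 0) (couplingParam (α ∘ Nat.succ) k (part m k))
          ((part y (k + 2) : ℤ) - part m k - 1)) := by
    rcases Nat.eq_zero_or_pos (y 0) with h0 | h0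
    · rw [h0, Nat.cast_zero, ladder_zero]; ring
    have h1 := part_update_of_lt y (show 0 < k + 2 by omega) (y 0 - 1)
    rw [nestedAlt, Function.update_self]
    congr 3
    · omega
    · omega
  rw [raiseSeg_bot hq0, h0, ht, nestedAlt]
  have h3 := hahnHat_raise hq0 hq1 (hα 0) (nested_param_pos (α := α ∘ Nat.succ) (fun i => hα _)
    (part m k) k) (m k) (y 0) ((part y (k + 2) : ℤ) - part m k)
  have e1 : (part y (k + 2) : ℤ) - part m k - y 0 =
      part (y ∘ Nat.succ) (k + 1) - part m k := by
    rw [part_succ']; push_cast; ring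
  have e2 : (part y (k + 2) : ℤ) - part m k - m k = part y (k + 2) - part m (k + 1) := by
    rw [part_succ m]; push_cast; ring
  have e3 : couplingParam α (k + 1) (part m (k + 1)) =
      2 * (m k : ℝ) + α 0 + (2 * (part m k : ℝ) + rpart (α ∘ Nat.succ) (k + 1) + k) + 1 := by
    rw [couplingParam, part_succ, rpart_succ' α (k + 1)]; push_cast; ring
  rw [e1, e2] at h3
  rw [e3, ← couplingParam]
  rw [← couplingParam] at h3
  rw [Int.cast_natCast] at h3
  linear_combination nested q (α ∘ Nat.succ) k m (y ∘ Nat.succ) * h3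

theorem raise_lower_nestedAlt (hq0 : 0 < q) (hq1 : q < 1) {α : ℕ → ℝ} (hα : ∀ i, 0 < α i)
    (k T : ℕ) (m y : ℕ → ℕ) :
    raiseSeg q α 0 (k + 2) (lowerSeg q α 0 (k + 2) fun y =>
      (if T = part y (k + 2) then 1 else 0) * nestedAlt q α k m y) y =
      ladder q (couplingParam α (k + 1) (part m (k + 1))) (part y (k + 2) - part m (k + 1)) ^ 2 *
        ((if T = part y (k + 2) then 1 else 0) * nestedAlt q α k m y) := by
  simp only [mul_comm (ite _ _ _)]
  refine raise_lower_mul α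
    (a := fun t => ladder q (couplingParam α (k + 1) (part m (k + 1))) (t - part m (k + 1)))
    (lowerSeg_nestedAlt hq0 hq1 hα k m) (raiseSeg_nestedAlt hq0 hq1 hα k m) ?_ y
  intro y y' h
  rw [h _ le_rfl]

end SegmentOperators

/-! ### The operators on the tensor product in coordinates -/

section Operators

variable {q : ℝ} {d : ℕ}

lemma qPowA0_apply (α : Fin d → ℝ) (S : Finset (Fin d)) (c : ℝ) (v : TensorSpace d)
    (y : Fin d → ℕ) : qPowA0 q α S c v y = ((q ^ (c * weightOn α S y) : ℝ) : ℂ) * v y := by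
  induction v using Finsupp.induction_linear with
  | zero => simp
  | add f g hf hg => rw [map_add, Finsupp.add_apply, hf, hg, Finsupp.add_apply, mul_add]
  | single z a =>
    rw [qPowA0, Finsupp.linearCombination_single, prodBasis, Finsupp.smul_apply, Finsupp.smul_apply]
    by_cases h : z = y
    · subst h; simp [mul_comm]
    · simp [Finsupp.single_eq_of_ne' h]

lemma structConst_zero (q α : ℝ) : structConst q α 0 = 0 := by simp [structConst]

/-- The coefficient at `y` comes from the basis vector with entry `y k - 1`; for `y k = 0` there is
none, which $\sigma_0=0$ accounts for. -/
lemma raiseAt_apply (α : Fin d → ℝ) (k : Fin d) (v : TensorSpace d) (y : Fin d → ℕ) :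
    raiseAt q α k v y = ((Real.sqrt (structConst q (α k) (y k)) : ℝ) : ℂ) *
      v (Function.update y k (y k - 1)) := by
  induction v using Finsupp.induction_linear with
  | zero => simp
  | add f g hf hg => rw [map_add, Finsupp.add_apply, hf, hg, Finsupp.add_apply, mul_add]
  | single z a =>
    rw [raiseAt, Finsupp.linearCombination_single, prodBasis, Finsupp.smul_apply, Finsupp.smul_apply]
    by_cases h : Function.update z k (z k + 1) = y
    · have h1 : Function.update y k (y k - 1) = z := by
        rw [← h]; simp
      rw [h1, ← h]
      simp [mul_comm]
    · rw [Finsupp.single_eq_of_ne' h]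
      by_cases h0 : y k = 0
      · simp [h0, structConst_zero]
      · rw [Finsupp.single_eq_of_ne']
        · simp
        · rintro rfl
          apply h
          simp only [Function.update_idem, Function.update_self]
          rw [Nat.sub_add_cancel (by omega), Function.update_eq_self]

lemma lowerAt_apply (α : Fin d → ℝ) (k : Fin d) (v : TensorSpace d) (y : Fin d → ℕ) :
    lowerAt q α k v y = ((Real.sqrt (structConst q (α k) (y k + 1)) : ℝ) : ℂ) *
      v (Function.update y k (y k + 1)) := by
  induction v using Finsupp.induction_linear with
  | zero => simp
  | add f g hf hg => rw [map_add, Finsupp.add_apply, hf, hg, Finsupp.add_apply, mul_add]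
  | single z a =>
    rw [lowerAt, Finsupp.linearCombination_single, prodBasis, Finsupp.smul_apply, Finsupp.smul_apply]
    by_cases h : Function.update y k (y k + 1) = z
    · have h1 : Function.update z k (z k - 1) = y := by
        rw [← h]; simp
      rw [h1, ← h]
      simp [mul_comm]
    · rw [Finsupp.single_eq_of_ne' (Ne.symm h)]
      by_cases h0 : z k = 0
      · simp [h0, structConst_zero]
      · rw [Finsupp.single_eq_of_ne']
        · simp
        · rintro rfl
          apply h
          simp only [Function.update_idem, Function.update_self]
          rw [Nat.sub_add_cancel (by omega), Function.update_eq_self]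

lemma raiseOn_apply (α : Fin d → ℝ) (S : Finset (Fin d)) (v : TensorSpace d) (y : Fin d → ℕ) :
    raiseOn q α S v y = ∑ k ∈ S, ((q ^ weightOn α (S.filter fun l => l < k) y : ℝ) : ℂ) *
      (((Real.sqrt (structConst q (α k) (y k)) : ℝ) : ℂ) * v (Function.update y k (y k - 1))) := by
  rw [raiseOn, LinearMap.sum_apply, Finsupp.finsetSum_apply]
  refine Finset.sum_congr rfl fun k _ => ?_
  rw [LinearMap.comp_apply, qPowA0_apply, raiseAt_apply, one_mul]

lemma lowerOn_apply (α : Fin d → ℝ) (S : Finset (Fin d)) (v : TensorSpace d) (y : Fin d → ℕ) :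
    lowerOn q α S v y = ∑ k ∈ S, ((q ^ weightOn α (S.filter fun l => l < k) y : ℝ) : ℂ) *
      (((Real.sqrt (structConst q (α k) (y k + 1)) : ℝ) : ℂ) *
        v (Function.update y k (y k + 1))) := by
  rw [lowerOn, LinearMap.sum_apply, Finsupp.finsetSum_apply]
  refine Finset.sum_congr rfl fun k _ => ?_
  rw [LinearMap.comp_apply, qPowA0_apply, lowerAt_apply, one_mul]

lemma toSeq_update (y : Fin d → ℕ) (k : Fin d) (c : ℕ) :
    toSeq (Function.update y k c) = Function.update (toSeq y) k c := by
  ext i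
  by_cases hi : i < d
  · lift i to Fin d using hi
    rw [toSeq_val]
    by_cases h : i = k
    · subst h; simp
    · rw [Function.update_of_ne h, Function.update_of_ne (fun h' => h (Fin.ext h')), toSeq_val]
  · rw [toSeq_of_le _ (by omega), Function.update_of_ne (by have := k.2; omega),
      toSeq_of_le _ (by omega)]

/-- Passes from the 1-based segment $[a+1;k]$ to the 0-based interval $a,\dots,k-1$. -/
lemma sum_segment {M : Type*} [AddCommMonoid M] (a k : ℕ) (hk : k ≤ d) (f : ℕ → M) :
    ∑ l ∈ (segment (a + 1) k : Finset (Fin d)), f l = ∑ l ∈ Finset.Ico a k, f l := by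
  refine (Finset.sum_map (segment (a + 1) k : Finset (Fin d)) Fin.valEmbedding f).symm.trans ?_
  congr 1
  ext i
  simp only [segment, Finset.mem_map, Finset.mem_filter, Finset.mem_univ, true_and,
    Fin.valEmbedding_apply, Finset.mem_Ico]
  constructor
  · rintro ⟨j, hj, rfl⟩; omega
  · intro h
    exact ⟨⟨i, by omega⟩, by simp only; omega, rfl⟩

lemma weightOn_segment (α : Fin d → ℝ) {a k : ℕ} (hk : k ≤ d) (y : Fin d → ℕ) :
    weightOn α (segment (a + 1) k) y = segWeight (toSeqR α) a k (toSeq y) := by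
  rw [weightOn, segWeight, ← sum_segment a k hk]
  exact Finset.sum_congr rfl fun l _ => by simp

lemma weightOn_segment_filter (α : Fin d → ℝ) {a k : ℕ} {l : Fin d}
    (hl : l ∈ (segment (a + 1) k : Finset (Fin d))) (y : Fin d → ℕ) :
    weightOn α ((segment (a + 1) k).filter fun i => i < l) y =
      segWeight (toSeqR α) a l (toSeq y) := by
  rw [← weightOn_segment α l.2.le]
  congr 1
  ext i
  simp only [segment, Finset.mem_filter, Finset.mem_univ, true_and, Fin.lt_def] at hl ⊢
  omega

lemma raiseOn_segment (α : Fin d → ℝ) {a k : ℕ} (hk : k ≤ d) {v : TensorSpace d}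
    {F : (ℕ → ℕ) → ℝ} (hv : ∀ y, v y = (F (toSeq y) : ℂ)) (y : Fin d → ℕ) :
    raiseOn q α (segment (a + 1) k) v y =
      ((raiseSeg q (toSeqR α) a k F (toSeq y) : ℝ) : ℂ) := by
  rw [raiseOn_apply, raiseSeg, ← sum_segment a k hk, Complex.ofReal_sum]
  refine Finset.sum_congr rfl fun l hl => ?_
  rw [hv, weightOn_segment_filter α hl, toSeq_update, toSeqR_val, toSeq_val, ladder_natCast,
    Complex.ofReal_mul, Complex.ofReal_mul, mul_assoc]

lemma lowerOn_segment (α : Fin d → ℝ) {a k : ℕ} (hk : k ≤ d) {v : TensorSpace d}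
    {F : (ℕ → ℕ) → ℝ} (hv : ∀ y, v y = (F (toSeq y) : ℂ)) (y : Fin d → ℕ) :
    lowerOn q α (segment (a + 1) k) v y =
      ((lowerSeg q (toSeqR α) a k F (toSeq y) : ℝ) : ℂ) := by
  rw [lowerOn_apply, lowerSeg, ← sum_segment a k hk, Complex.ofReal_sum]
  refine Finset.sum_congr rfl fun l hl => ?_
  have : ((y l : ℕ) : ℤ) + 1 = ((y l + 1 : ℕ) : ℤ) := by push_cast; rfl
  rw [hv, weightOn_segment_filter α hl, toSeq_update, toSeqR_val, toSeq_val, this, ladder_natCast,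
    Complex.ofReal_mul, Complex.ofReal_mul, mul_assoc]

lemma segWeight_update (α : ℕ → ℝ) {a k i : ℕ} (hi : i ∈ Finset.Ico a k) (y : ℕ → ℕ) (c : ℕ) :
    segWeight α a k (Function.update y i c) = segWeight α a k y + c - y i := by
  rw [segWeight, segWeight, ← Finset.add_sum_erase _ _ hi,
    ← Finset.add_sum_erase (Finset.Ico a k) (fun l => (y l : ℝ) + (α l + 1) / 2) hi,
    Function.update_self]
  have : ∑ x ∈ (Finset.Ico a k).erase i, ((Function.update y i c x : ℕ) + (α x + 1) / 2 : ℝ) =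
      ∑ x ∈ (Finset.Ico a k).erase i, ((y x : ℝ) + (α x + 1) / 2) :=
    Finset.sum_congr rfl fun x hx => by
      rw [Function.update_of_ne (Finset.ne_of_mem_erase hx)]
  rw [this]; ring

/-- Lowering changes the weight by one, which absorbs the factor $q$ of $q^{1-A_0}$; in
`raiseSeg_weight` raising brings it back. Thus $q^{1-A_0}$ moves to the left of $A_+A_-$ unchanged.
-/
lemma lowerSeg_weight (hq0 : 0 < q) (α : ℕ → ℝ) (a k : ℕ) (F : (ℕ → ℕ) → ℝ) (y : ℕ → ℕ) :
    lowerSeg q α a k (fun y => q * (q ^ (-segWeight α a k y) * F y)) y =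
      q ^ (-segWeight α a k y) * lowerSeg q α a k F y := by
  rw [lowerSeg, lowerSeg, Finset.mul_sum]
  refine Finset.sum_congr rfl fun i hi => ?_
  have e : q * q ^ (-segWeight α a k (Function.update y i (y i + 1))) =
      q ^ (-segWeight α a k y) := by
    rw [segWeight_update α hi, mul_comm, ← Real.rpow_add_one hq0.ne']
    congr 1; push_cast; ring
  rw [← mul_assoc q, e]; ring

lemma raiseSeg_weight (hq0 : 0 < q) (α : ℕ → ℝ) (a k : ℕ) (F : (ℕ → ℕ) → ℝ) (y : ℕ → ℕ) :
    raiseSeg q α a k (fun y => q ^ (-segWeight α a k y) * F y) y =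
      q * (q ^ (-segWeight α a k y) * raiseSeg q α a k F y) := by
  rw [raiseSeg, raiseSeg, Finset.mul_sum, Finset.mul_sum]
  refine Finset.sum_congr rfl fun i hi => ?_
  rcases Nat.eq_zero_or_pos (y i) with h0 | h0
  · rw [h0, Nat.cast_zero, ladder_zero]; ring
  have e : q ^ (-segWeight α a k (Function.update y i (y i - 1))) =
      q * q ^ (-segWeight α a k y) := by
    rw [segWeight_update α hi, Nat.cast_sub h0, mul_comm, ← Real.rpow_add_one hq0.ne']
    congr 1; push_cast; ring
  rw [e]; ring

lemma casimir_segment (hq0 : 0 < q) (α : Fin d → ℝ) {a k : ℕ} (hk : k ≤ d) {v : TensorSpace d}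
    {F : (ℕ → ℕ) → ℝ} (hv : ∀ y, v y = (F (toSeq y) : ℂ)) (y : Fin d → ℕ) :
    casimir q α (segment (a + 1) k) v y =
      ((((q ^ (1 / 2 : ℝ) - q ^ (-1 / 2 : ℝ)) ^ 2)⁻¹ *
        ((q ^ (-1 / 2 : ℝ) * q ^ segWeight (toSeqR α) a k (toSeq y) +
          q ^ (1 / 2 : ℝ) * q ^ (-segWeight (toSeqR α) a k (toSeq y))) * F (toSeq y)) -
        q * (q ^ (-segWeight (toSeqR α) a k (toSeq y)) *
          raiseSeg q (toSeqR α) a k (lowerSeg q (toSeqR α) a k F) (toSeq y)) : ℝ) : ℂ) := by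
  have h1 : ∀ y, ((q : ℂ) • qPowA0 q α (segment (a + 1) k) (-1)) v y =
      ((q * (q ^ (-segWeight (toSeqR α) a k (toSeq y)) * F (toSeq y)) : ℝ) : ℂ) := by
    intro y
    rw [LinearMap.smul_apply, Finsupp.smul_apply, qPowA0_apply, weightOn_segment α hk, hv, neg_one_mul,
      smul_eq_mul]
    push_cast; rfl
  have h2 := raiseOn_segment (q := q) α hk (a := a) (F := fun z => q ^ (-segWeight (toSeqR α) a k z) *
      lowerSeg q (toSeqR α) a k F z)
    (v := lowerOn q α (segment (a + 1) k) (((q : ℂ) • qPowA0 q α (segment (a + 1) k) (-1)) v))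
    (fun z => by
      rw [lowerOn_segment α hk (F := fun z => q * (q ^ (-segWeight (toSeqR α) a k z) * F z)) h1,
        lowerSeg_weight hq0]) y
  rw [raiseSeg_weight hq0] at h2
  rw [casimir, LinearMap.sub_apply, Finsupp.sub_apply, LinearMap.comp_apply, LinearMap.comp_apply, h2,
    LinearMap.smul_apply, Finsupp.smul_apply, LinearMap.add_apply, Finsupp.add_apply,
    LinearMap.smul_apply, LinearMap.smul_apply, Finsupp.smul_apply, Finsupp.smul_apply, qPowA0_apply,
    qPowA0_apply, weightOn_segment α hk, hv, one_mul, neg_one_mul]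
  simp only [smul_eq_mul]
  push_cast
  ring

/-- On the vector of index $x$ in $V^{(c)}$ the product $A_+A_-$ is $\sigma_x$, and the Casimir
value does not depend on $x$. In terms of $q^{1/2}$, $q^x$ and $q^{c/2}$ this is a rational
identity. -/
lemma casimirVal_identity (hq0 : 0 < q) (hq1 : q < 1) (c : ℝ) (x : ℕ) (hx : 0 < c) :
    ((q ^ (1 / 2 : ℝ) - q ^ (-1 / 2 : ℝ)) ^ 2)⁻¹ *
        (q ^ (-1 / 2 : ℝ) * q ^ ((x : ℝ) + (c + 1) / 2) +
          q ^ (1 / 2 : ℝ) * q ^ (-((x : ℝ) + (c + 1) / 2))) -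
      q * (q ^ (-((x : ℝ) + (c + 1) / 2)) * ladder q c x ^ 2) = casimirVal q c := by
  have hs : 0 ≤ structConst q c x := by
    have h1 := pow_le_one₀ hq0.le hq1.le (n := x)
    have h2 := Real.rpow_le_one hq0.le hq1.le (show 0 ≤ (x : ℝ) + c by positivity)
    have h3 := Real.rpow_pos_of_pos hq0 (1 / 2)
    unfold structConst
    have h4 : 0 ≤ 1 - q ^ x := by linarith
    have h5 : 0 ≤ 1 - q ^ ((x : ℝ) + c) := by linarith
    positivity
  rw [ladder_natCast, Real.sq_sqrt hs, structConst, casimirVal, Real.rpow_neg hq0.le, neg_div,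
    Real.rpow_neg hq0.le, neg_div, Real.rpow_neg hq0.le]
  have e1 : q = q ^ (1 / 2 : ℝ) * q ^ (1 / 2 : ℝ) := by
    rw [← Real.rpow_add hq0]; norm_num
  have e2 : q ^ ((x : ℝ) + (c + 1) / 2) = q ^ x * q ^ (c / 2) * q ^ (1 / 2 : ℝ) := by
    rw [← Real.rpow_natCast, ← Real.rpow_add hq0, ← Real.rpow_add hq0]; congr 1; ring
  have e3 : q ^ ((x : ℝ) + c) = q ^ x * (q ^ (c / 2) * q ^ (c / 2)) := by
    rw [← Real.rpow_natCast, ← Real.rpow_add hq0, ← Real.rpow_add hq0]; congr 1; ring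
  rw [e2, e3]
  have hX := pow_pos hq0 x
  have hC := Real.rpow_pos_of_pos hq0 (c / 2)
  have hu := Real.rpow_pos_of_pos hq0 (1 / 2)
  generalize q ^ x = X at *
  generalize q ^ (c / 2) = C at *
  generalize q ^ (1 / 2 : ℝ) = u at *
  have hu1 : 1 - u * u ≠ 0 := by rw [← e1]; linarith
  have e4 : u - u⁻¹ = -(1 - u * u) / u := by field_simp; ring
  rw [e1, e4]
  have hX' := hX.ne'
  have hC' := hC.ne'
  have hu' := hu.ne'
  generalize hw : 1 - u * u = w at *
  have hq2 : u * u = 1 - w := by linarith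
  field_simp
  ring

end Operators

/-! ### The eigenvalue equations of the coupled bases -/

section Eigenvectors

variable {q : ℝ} {d s : ℕ}

lemma vectorOf_apply (F : (Fin d → ℕ) → ℝ) (L : ℕ) (y : Fin d → ℕ) :
    vectorOf F L y = if psum y d = L then (F y : ℂ) else 0 := by
  classical
  rw [vectorOf, Finsupp.finsetSum_apply]
  simp only [prodBasis, Finsupp.smul_apply, Finsupp.single_apply, smul_eq_mul, mul_ite, mul_one,
    mul_zero]
  rw [Finset.sum_ite_eq']
  exact if_congr mem_piAntidiag_univ rfl rfl

/-- The coupled segment acts as one representation with parameter $c$, in which `y` has index `X y -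
N`. Where this is negative the vector has no component, so `casimirVal_identity` is needed for
natural numbers only. -/
lemma casimir_eigenvector (hq0 : 0 < q) (hq1 : q < 1) (α : Fin d → ℝ) {a k : ℕ} (hk : k ≤ d)
    {v : TensorSpace d} {F : (ℕ → ℕ) → ℝ} (hv : ∀ y, v y = (F (toSeq y) : ℂ)) {c : ℝ} (hc : 0 < c)
    {X : (ℕ → ℕ) → ℕ} {N : ℕ}
    (hw : ∀ y, segWeight (toSeqR α) a k y = (((X y : ℤ) - N : ℤ) : ℝ) + (c + 1) / 2)
    (hl : ∀ y, raiseSeg q (toSeqR α) a k (lowerSeg q (toSeqR α) a k F) y =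
      ladder q c (X y - N) ^ 2 * F y)
    (h0 : ∀ y, X y < N → F y = 0) :
    casimir q α (segment (a + 1) k) v = ((casimirVal q c : ℝ) : ℂ) • v := by
  ext y
  rw [casimir_segment hq0 α hk hv, Finsupp.smul_apply, hv, smul_eq_mul, ← Complex.ofReal_mul, hl, hw]
  rcases lt_or_ge (X (toSeq y)) N with h | h
  · rw [h0 _ h]; simp
  · have e : ((X (toSeq y) : ℕ) : ℤ) - N = ((X (toSeq y) - N : ℕ) : ℤ) := by omega
    rw [e, Int.cast_natCast, ← casimirVal_identity hq0 hq1 c _ hc]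
    congr 1
    ring

lemma nested_eq_zero (α : ℕ → ℝ) {j K : ℕ} (hj : j < K) {n y : ℕ → ℕ}
    (h : part y (j + 2) < part n (j + 1)) : nested q α K n y = 0 := by
  refine Finset.prod_eq_zero (Finset.mem_range.2 hj) ?_
  rw [nestedFactor]
  refine hahnHat_eq_zero_deg ?_
  rw [part_succ n] at h
  omega

lemma nestedAlt_eq_zero_tail (α : ℕ → ℝ) {j K : ℕ} (hj : j < K) {m y : ℕ → ℕ}
    (h : part (y ∘ Nat.succ) (j + 2) < part m (j + 1)) : nestedAlt q α K m y = 0 := by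
  rw [nestedAlt, nested_eq_zero _ hj h, zero_mul]

lemma nestedAlt_eq_zero (α : ℕ → ℝ) {K : ℕ} {m y : ℕ → ℕ}
    (h : part y (K + 2) < part m (K + 1)) : nestedAlt q α K m y = 0 := by
  rw [nestedAlt, hahnHat_eq_zero_deg, mul_zero]
  rw [part_succ m] at h
  omega

variable {α : Fin (s + 2) → ℝ}

lemma coupledFirst_apply (α : Fin (s + 2) → ℝ) (n y : Fin (s + 2) → ℕ) :
    coupledFirst q α n y = (Psi q α n y : ℂ) := by
  rw [coupledFirst, vectorOf_apply]
  split_ifs with h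
  · rfl
  · rw [Psi_eq_zero (Ne.symm h), Complex.ofReal_zero]

lemma coupledSecond_apply (α : Fin (s + 2) → ℝ) (n y : Fin (s + 2) → ℕ) :
    coupledSecond q α n y = (Xi q α n y : ℂ) := by
  rw [coupledSecond, vectorOf_apply]
  split_ifs with h
  · rfl
  · rw [Xi_eq_zero (Ne.symm h), Complex.ofReal_zero]

lemma qPowA0_eigenvector (α : Fin d → ℝ) {v : TensorSpace d} {L : ℕ}
    (hv : ∀ y, psum y d ≠ L → v y = 0) :
    qPowA0 q α (segment 1 d) 1 v = ((q ^ ((L : ℝ) + (rsum α d + d) / 2) : ℝ) : ℂ) • v := by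
  ext y
  rw [qPowA0_apply, Finsupp.smul_apply, smul_eq_mul]
  by_cases h : psum y d = L
  · rw [weightOn_segment α (a := 0) le_rfl, segWeight_zero, ← psum_eq, ← rsum_eq α le_rfl, h,
      one_mul]
  · rw [hv y h, mul_zero, mul_zero]

theorem isCoupledFirst_coupledFirst (hq0 : 0 < q) (hq1 : q < 1) (hα : ∀ i, 0 < α i)
    (n : Fin (s + 2) → ℕ) : IsCoupledFirst q α n (coupledFirst q α n) := by
  refine ⟨fun k hk2 hk => ?_, qPowA0_eigenvector α fun y hy => ?_⟩
  · obtain ⟨j, rfl⟩ : ∃ j, k = j + 2 := ⟨k - 2, by omega⟩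
    have e : 2 * (psum n (j + 2 - 1) : ℝ) + rsum α (j + 2) + ((j + 2 : ℕ) : ℝ) - 1 =
        couplingParam (toSeqR α) (j + 1) (part (toSeq n) (j + 1)) := by
      rw [couplingParam, rsum_eq α hk, psum_eq, show j + 2 - 1 = j + 1 by omega]; push_cast; ring
    rw [e]
    refine casimir_eigenvector hq0 hq1 α (a := 0) hk
      (F := fun y => (if part (toSeq n) (s + 2) = part y (s + 2) then 1 else 0) *
        nested q (toSeqR α) (s + 1) (toSeq n) y)
      (fun y => by rw [coupledFirst_apply, Psi_eq, psum_eq, psum_eq])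
      (nested_param_pos (toSeqR_pos hα) _ _) (X := fun y => part y (j + 2))
      (N := part (toSeq n) (j + 1))
      (fun y => couplingParam_weight _ (j + 1) _ y)
      (fun y => raise_lower_nested hq0 hq1 (toSeqR_pos hα) (by omega) (by omega) _ _ _) ?_
    intro y hy
    rw [nested_eq_zero _ (by omega) hy, mul_zero]
  · rw [coupledFirst_apply, Psi_eq_zero (Ne.symm hy), Complex.ofReal_zero]

theorem isCoupledSecond_coupledSecond (hq0 : 0 < q) (hq1 : q < 1) (hα : ∀ i, 0 < α i)
    (m : Fin (s + 2) → ℕ) : IsCoupledSecond q α m (coupledSecond q α m) := by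
  have hF : ∀ y, coupledSecond q α m y =
      (((fun y => (if part (toSeq m) (s + 2) = part y (s + 2) then 1 else 0) *
        nestedAlt q (toSeqR α) s (toSeq m) y) (toSeq y) : ℝ) : ℂ) := fun y => by
    rw [coupledSecond_apply, Xi_eq, psum_eq, psum_eq]
  refine ⟨fun k hk2 hk => ?_, ?_, qPowA0_eigenvector α fun y hy => ?_⟩
  · obtain ⟨j, rfl⟩ : ∃ j, k = j + 3 := ⟨k - 3, by omega⟩
    have e : 2 * (psum m (j + 3 - 2) : ℝ) + rsumTail α (j + 3) + ((j + 3 : ℕ) : ℝ) - 2 =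
        couplingParam (toSeqR α ∘ Nat.succ) (j + 1) (part (toSeq m) (j + 1)) := by
      rw [couplingParam, rsumTail_eq α hk, psum_eq, show j + 3 - 2 = j + 1 by omega]; push_cast
      ring
    rw [e]
    refine casimir_eigenvector hq0 hq1 α (a := 1) hk hF
      (nested_param_pos (α := toSeqR α ∘ Nat.succ) (fun i => toSeqR_pos hα _) _ _)
      (X := fun y => part (y ∘ Nat.succ) (j + 2))
      (N := part (toSeq m) (j + 1))
      (fun y => by rw [segWeight_one, couplingParam_weight _ (j + 1) (toSeq m)])
      (fun y => raise_lower_nestedAlt_tail hq0 hq1 (toSeqR_pos hα) (by omega) (by omega) _ _ _) ?_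
    intro y hy
    rw [nestedAlt_eq_zero_tail _ (by omega) hy, mul_zero]
  · have e : 2 * (psum m (s + 2 - 1) : ℝ) + rsum α (s + 2) + ((s + 2 : ℕ) : ℝ) - 1 =
        couplingParam (toSeqR α) (s + 1) (part (toSeq m) (s + 1)) := by
      rw [couplingParam, rsum_eq α le_rfl, psum_eq, show s + 2 - 1 = s + 1 by omega]; push_cast
      ring
    rw [e]
    refine casimir_eigenvector hq0 hq1 α (a := 0) le_rfl hF
      (nested_param_pos (toSeqR_pos hα) _ _) (X := fun y => part y (s + 2))
      (N := part (toSeq m) (s + 1))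
      (fun y => couplingParam_weight _ (s + 1) _ y)
      (fun y => raise_lower_nestedAlt hq0 hq1 (toSeqR_pos hα) _ _ _ _) ?_
    intro y hy
    rw [nestedAlt_eq_zero _ hy, mul_zero]
  · rw [coupledSecond_apply, Xi_eq_zero (Ne.symm hy), Complex.ofReal_zero]

end Eigenvectors

/-! ### Orthonormal bases of the tensor product and simplicity of the joint spectra. -/

section OrthonormalBases

variable {q : ℝ} {d s : ℕ}

lemma innerW_add_right (v w w' : TensorSpace d) :
    innerW v (w + w') = innerW v w + innerW v w' := by
  simp [innerW, Finsupp.sum, mul_add, Finset.sum_add_distrib]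

lemma innerW_smul_right (v w : TensorSpace d) (c : ℂ) : innerW v (c • w) = c * innerW v w := by
  simp only [innerW, Finsupp.sum, Finsupp.smul_apply, smul_eq_mul, Finset.mul_sum]
  exact Finset.sum_congr rfl fun _ _ => by ring

/-- The inner product with a fixed vector as a linear functional. -/
def innerFunctional (v : TensorSpace d) : TensorSpace d →ₗ[ℂ] ℂ where
  toFun := innerW v
  map_add' := innerW_add_right v
  map_smul' c w := innerW_smul_right v w c

lemma linearIndependent_of_innerW {b : (Fin d → ℕ) → TensorSpace d}
    (hb : ∀ n n', innerW (b n) (b n') = if n = n' then 1 else 0) : LinearIndependent ℂ b := by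
  rw [linearIndependent_iff']
  intro t g h i hi
  have h1 := congrArg (innerFunctional (b i)) h
  rw [map_sum, map_zero] at h1
  have h2 : ∀ j, innerFunctional (b i) (g j • b j) = if i = j then g j else 0 := fun j => by
    rw [map_smul, innerFunctional, LinearMap.coe_mk, AddHom.coe_mk, hb, smul_eq_mul, mul_ite, mul_one,
      mul_zero]
  simpa [h2, hi] using h1

/-- The basis of the tensor product defined by an orthonormal spanning family. -/
def IsOrthonormalBasis.basis {b : (Fin d → ℕ) → TensorSpace d} (hb : IsOrthonormalBasis b) :
    Module.Basis (Fin d → ℕ) ℂ (TensorSpace d) :=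
  Module.Basis.mk (linearIndependent_of_innerW hb.1) hb.2.ge

lemma IsOrthonormalBasis.basis_apply {b : (Fin d → ℕ) → TensorSpace d} (hb : IsOrthonormalBasis b)
    (n : Fin d → ℕ) : hb.basis n = b n := Module.Basis.mk_apply _ _ _

/-- The $i$-th coordinate functional turns `T` into multiplication by `eig i`, as is seen on the
basis. On an eigenvector whose $i$-th coordinate is non-zero this equates the two eigenvalues. -/
lemma IsOrthonormalBasis.repr_eq_zero {b : (Fin d → ℕ) → TensorSpace d} (hb : IsOrthonormalBasis b)
    {T : TensorSpace d →ₗ[ℂ] TensorSpace d} {eig : (Fin d → ℕ) → ℝ}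
    (hT : ∀ i, T (b i) = ((eig i : ℝ) : ℂ) • b i) {n i : Fin d → ℕ} {v : TensorSpace d}
    (hv : T v = ((eig n : ℝ) : ℂ) • v) (hi : hb.basis.repr v i ≠ 0) : eig i = eig n := by
  have h : ∀ w, hb.basis.repr (T w) i = ((eig i : ℝ) : ℂ) * hb.basis.repr w i := by
    intro w
    have e : (Finsupp.lapply i ∘ₗ hb.basis.repr.toLinearMap) ∘ₗ T =
        ((eig i : ℝ) : ℂ) • (Finsupp.lapply i ∘ₗ hb.basis.repr.toLinearMap) := by
      refine hb.basis.ext fun j => ?_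
      rw [hb.basis_apply, LinearMap.comp_apply, hT, map_smul, LinearMap.smul_apply]
      simp only [LinearMap.comp_apply, LinearEquiv.coe_coe, Finsupp.lapply_apply, smul_eq_mul]
      rw [← hb.basis_apply j, Module.Basis.repr_self]
      by_cases h : i = j
      · rw [h]
      · rw [Finsupp.single_eq_of_ne h, mul_zero, mul_zero]
    exact LinearMap.congr_fun e w
  have h1 := h v
  rw [hv, map_smul, Finsupp.smul_apply, smul_eq_mul] at h1
  exact_mod_cast (mul_right_cancel₀ hi h1).symm

lemma IsOrthonormalBasis.eq_smul {b : (Fin d → ℕ) → TensorSpace d} (hb : IsOrthonormalBasis b)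
    {n : Fin d → ℕ} {v : TensorSpace d} (h : ∀ i, hb.basis.repr v i ≠ 0 → i = n) :
    ∃ c : ℂ, v = c • b n := by
  refine ⟨hb.basis.repr v n, hb.basis.repr.injective ?_⟩
  ext i
  rw [map_smul, Finsupp.smul_apply, ← hb.basis_apply n, Module.Basis.repr_self, smul_eq_mul]
  by_cases hi : i = n
  · subst hi; simp
  · rw [Finsupp.single_eq_of_ne hi, mul_zero]
    by_contra h'
    exact hi (h i h')

/-- The function $u+u^{-1}$ identifies only $u$ and $u^{-1}$, and both $q^{a/2}$ and $q^{b/2}$ lie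
in $(0,1)$. -/
lemma casimirVal_injOn (hq0 : 0 < q) (hq1 : q < 1) {a b : ℝ} (ha : 0 < a) (hb : 0 < b)
    (h : casimirVal q a = casimirVal q b) : a = b := by
  have hu : ∀ {c : ℝ}, 0 < c → q ^ (c / 2) < 1 := fun hc =>
    Real.rpow_lt_one hq0.le hq1 (by positivity)
  have h1 : (q ^ (1 / 2 : ℝ) - q ^ (-1 / 2 : ℝ)) ^ 2 ≠ 0 := by
    have h2 : q ^ (1 / 2 : ℝ) < 1 := Real.rpow_lt_one hq0.le hq1 (by norm_num)
    have h3 : 1 < q ^ (-1 / 2 : ℝ) := Real.one_lt_rpow_of_pos_of_lt_one_of_neg hq0 hq1 (by norm_num)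
    exact pow_ne_zero _ (by linarith)
  rw [casimirVal, casimirVal, div_left_inj' h1, neg_div, neg_div, Real.rpow_neg hq0.le,
    Real.rpow_neg hq0.le] at h
  have ha' := hu ha
  have hb' := hu hb
  have hpa := Real.rpow_pos_of_pos hq0 (a / 2)
  have hpb := Real.rpow_pos_of_pos hq0 (b / 2)
  have h5 : q ^ (a / 2) = q ^ (b / 2) := by
    have h4 : (q ^ (a / 2) - q ^ (b / 2)) * (1 - q ^ (a / 2) * q ^ (b / 2)) = 0 := by
      field_simp at h
      linear_combination -h
    have h6 : q ^ (a / 2) * q ^ (b / 2) < 1 := by nlinarith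
    rcases mul_eq_zero.1 h4 with h7 | h7 <;> linarith
  have := (Real.rpow_right_inj hq0 hq1.ne).1 h5
  linarith

lemma ext_of_psum {n n' : Fin d → ℕ} (h : ∀ k, 1 ≤ k → k ≤ d → psum n k = psum n' k) : n = n' := by
  have h' : ∀ k ≤ d, part (toSeq n) k = part (toSeq n') k := by
    intro k hk
    rcases Nat.eq_zero_or_pos k with rfl | h0
    · simp
    · rw [← psum_eq, ← psum_eq, h k h0 hk]
  ext i
  have h1 := h' i i.2.le
  have h2 := h' (i + 1) i.2
  rw [part_succ, part_succ, toSeq_val, toSeq_val] at h2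
  omega

lemma innerW_eq_sum {v w : TensorSpace d} {F G : (Fin d → ℕ) → ℝ} {L : ℕ}
    (hv : ∀ y, v y = (F y : ℂ)) (hw : ∀ y, w y = (G y : ℂ)) (hF : ∀ y, psum y d ≠ L → F y = 0) :
    innerW v w = ((∑ y ∈ Finset.piAntidiag Finset.univ L, F y * G y : ℝ) : ℂ) := by
  rw [innerW, Finsupp.sum_of_support_subset v (s := Finset.piAntidiag Finset.univ L)]
  · push_cast
    refine Finset.sum_congr rfl fun y _ => ?_
    rw [hv, hw, Complex.conj_ofReal]
  · intro y hy
    rw [mem_piAntidiag_univ]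
    by_contra h
    rw [Finsupp.mem_support_iff, hv, hF y h] at hy
    exact hy Complex.ofReal_zero
  · simp

/-- Row orthogonality is orthonormality; column orthogonality writes each $e_{\boldsymbol y}$ as a
finite combination of the vectors of the same total degree. -/
lemma isOrthonormalBasis_of_real {b : (Fin d → ℕ) → TensorSpace d}
    {F : (Fin d → ℕ) → (Fin d → ℕ) → ℝ} (hb : ∀ n y, b n y = (F n y : ℂ))
    (h0 : ∀ n y, psum n d ≠ psum y d → F n y = 0)
    (ho : ∀ {n n' : Fin d → ℕ} {p : ℕ}, psum n d = p → psum n' d = p →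
      ∑ y ∈ Finset.piAntidiag Finset.univ p, F n y * F n' y = if n = n' then 1 else 0)
    (hc : ∀ {y y' : Fin d → ℕ} {p : ℕ}, psum y d = p → psum y' d = p →
      ∑ n ∈ Finset.piAntidiag Finset.univ p, F n y * F n y' = if y = y' then 1 else 0) :
    IsOrthonormalBasis b := by
  constructor
  · intro n n'
    rw [innerW_eq_sum (hb n) (hb n') (L := psum n d) fun y hy => h0 n y (Ne.symm hy)]
    by_cases h : psum n' d = psum n d
    · rw [ho rfl h]; split_ifs <;> simp
    · rw [if_neg (by rintro rfl; exact h rfl), Finset.sum_eq_zero]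
      · simp
      · intro y hy
        rw [mem_piAntidiag_univ] at hy
        rw [h0 n' y (by omega), mul_zero]
  · rw [eq_top_iff]
    rintro v -
    induction v using Finsupp.induction_linear with
    | zero => exact zero_mem _
    | add f g hf hg => exact add_mem hf hg
    | single y a =>
      have h : Finsupp.single y a =
          ∑ n ∈ Finset.piAntidiag Finset.univ (psum y d), (a * (F n y : ℂ)) • b n := by
        ext y'
        rw [Finsupp.finsetSum_apply]
        simp only [Finsupp.smul_apply, hb, smul_eq_mul, mul_assoc]
        rw [← Finset.mul_sum]
        by_cases h : psum y' d = psum y d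
        · have := hc (y := y) (y' := y') rfl h
          have h' : ∑ n ∈ Finset.piAntidiag Finset.univ (psum y d), (F n y : ℂ) * (F n y' : ℂ) =
              ((if y = y' then 1 else 0 : ℝ) : ℂ) := by
            rw [← this]; push_cast; rfl
          rw [h', Finsupp.single_apply]
          split_ifs <;> simp
        · rw [Finsupp.single_eq_of_ne (by rintro rfl; exact h rfl), Finset.sum_eq_zero, mul_zero]
          intro n hn
          rw [mem_piAntidiag_univ] at hn
          rw [h0 n y' (by omega), Complex.ofReal_zero, mul_zero]
      rw [h]
      exact Submodule.sum_mem _ fun n _ => Submodule.smul_mem _ _ (Submodule.subset_span ⟨n, rfl⟩)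

variable {α : Fin (s + 2) → ℝ}

theorem isOrthonormalBasis_coupledFirst (hq0 : 0 < q) (hq1 : q < 1) (hα : ∀ i, 0 < α i) :
    IsOrthonormalBasis (coupledFirst q α) :=
  isOrthonormalBasis_of_real (coupledFirst_apply α) (fun _ _ h => Psi_eq_zero h)
    (fun h h' => Psi_orthonormal hq0 hq1 hα h h') (fun h h' => Psi_complete hq0 hq1 hα h h')

theorem isOrthonormalBasis_coupledSecond (hq0 : 0 < q) (hq1 : q < 1) (hα : ∀ i, 0 < α i) :
    IsOrthonormalBasis (coupledSecond q α) :=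
  isOrthonormalBasis_of_real (coupledSecond_apply α) (fun _ _ h => Xi_eq_zero h)
    (fun h h' => Xi_orthonormal hq0 hq1 hα h h') (fun h h' => Xi_complete hq0 hq1 hα h h')

theorem innerW_coupled (m n : Fin (s + 2) → ℕ) :
    innerW (coupledSecond q α m) (coupledFirst q α n) = (overlap q α m n : ℂ) := by
  rw [innerW_eq_sum (coupledSecond_apply α m) (coupledFirst_apply α n) (L := psum m (s + 2))
    fun y hy => Xi_eq_zero (Ne.symm hy), overlap_eq_sum]

lemma rsum_nonneg (hα : ∀ i, 0 < α i) (k : ℕ) : 0 ≤ rsum α k :=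
  Finset.sum_nonneg fun i _ => (hα i).le

lemma rsumTail_nonneg (hα : ∀ i, 0 < α i) (k : ℕ) : 0 ≤ rsumTail α k :=
  Finset.sum_nonneg fun i _ => (hα i).le

lemma psum_eq_of_rpow (hq0 : 0 < q) (hq1 : q < 1) {N N' : ℕ} {c : ℝ}
    (h : q ^ ((N : ℝ) + c) = q ^ ((N' : ℝ) + c)) : N = N' := by
  have := (Real.rpow_right_inj hq0 hq1.ne).1 h
  exact_mod_cast add_right_cancel this

/-- The operator $\Gamma^{[1;k+1]}$ determines $N_k$ for $1\le k\le d-1$ and the total weight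
determines $N_d$. Partial sums determine the index, so only one coordinate of a joint eigenvector
can be non-zero. -/
theorem isCoupledFirst_iff (hq0 : 0 < q) (hq1 : q < 1) (hα : ∀ i, 0 < α i)
    (n : Fin (s + 2) → ℕ) (v : TensorSpace (s + 2)) :
    IsCoupledFirst q α n v ↔ ∃ c : ℂ, v = c • coupledFirst q α n := by
  constructor
  · rintro ⟨h1, h2⟩
    refine (isOrthonormalBasis_coupledFirst hq0 hq1 hα).eq_smul fun i hi => ext_of_psum ?_
    intro k hk1 hk
    rcases Nat.lt_or_ge k (s + 2) with hk' | hk'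
    · have h := (isOrthonormalBasis_coupledFirst hq0 hq1 hα).repr_eq_zero
        (eig := fun n => casimirVal q (2 * (psum n k : ℝ) + rsum α (k + 1) + ((k + 1 : ℕ) : ℝ) - 1))
        (fun i => (isCoupledFirst_coupledFirst hq0 hq1 hα i).1 (k + 1) (by omega) hk')
        (h1 (k + 1) (by omega) hk') hi
      have hp : ∀ N : ℕ, 0 < 2 * (N : ℝ) + rsum α (k + 1) + ((k + 1 : ℕ) : ℝ) - 1 := by
        intro N
        have := rsum_nonneg hα (k + 1)
        have h3 : (1 : ℝ) ≤ k := by exact_mod_cast hk1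
        push_cast; linarith [Nat.cast_nonneg (α := ℝ) N]
      have := casimirVal_injOn hq0 hq1 (hp _) (hp _) h
      have : (psum i k : ℝ) = psum n k := by linarith
      exact_mod_cast this
    · obtain rfl : k = s + 2 := by omega
      exact psum_eq_of_rpow hq0 hq1 ((isOrthonormalBasis_coupledFirst hq0 hq1 hα).repr_eq_zero
        (eig := fun n => q ^ ((psum n (s + 2) : ℝ) + (rsum α (s + 2) + ((s + 2 : ℕ) : ℝ)) / 2))
        (fun i => (isCoupledFirst_coupledFirst hq0 hq1 hα i).2) h2 hi)
  · rintro ⟨c, rfl⟩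
    obtain ⟨h1, h2⟩ := isCoupledFirst_coupledFirst hq0 hq1 hα n
    exact ⟨fun k hk hk' => by rw [map_smul, h1 k hk hk', smul_comm], by rw [map_smul, h2, smul_comm]⟩

/-- The same separation: $M_k$ is read off from $\Gamma^{[2;k+2]}$ for $k\le d-2$, $M_{d-1}$ from
$\Gamma^{[1;d]}$, and $M_d$ from the weight. -/
theorem isCoupledSecond_iff (hq0 : 0 < q) (hq1 : q < 1) (hα : ∀ i, 0 < α i)
    (m : Fin (s + 2) → ℕ) (v : TensorSpace (s + 2)) :
    IsCoupledSecond q α m v ↔ ∃ c : ℂ, v = c • coupledSecond q α m := by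
  constructor
  · rintro ⟨h1, h2, h3⟩
    refine (isOrthonormalBasis_coupledSecond hq0 hq1 hα).eq_smul fun i hi => ext_of_psum ?_
    intro k hk1 hk
    have hk0 : (1 : ℝ) ≤ k := by exact_mod_cast hk1
    rcases Nat.lt_or_ge k (s + 1) with hk' | hk'
    · have h := (isOrthonormalBasis_coupledSecond hq0 hq1 hα).repr_eq_zero
        (eig := fun n =>
          casimirVal q (2 * (psum n k : ℝ) + rsumTail α (k + 2) + ((k + 2 : ℕ) : ℝ) - 2))
        (fun i => (isCoupledSecond_coupledSecond hq0 hq1 hα i).1 (k + 2) (by omega) (by omega))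
        (h1 (k + 2) (by omega) (by omega)) hi
      have hp : ∀ N : ℕ, 0 < 2 * (N : ℝ) + rsumTail α (k + 2) + ((k + 2 : ℕ) : ℝ) - 2 := by
        intro N
        have := rsumTail_nonneg hα (k + 2)
        push_cast; linarith [Nat.cast_nonneg (α := ℝ) N]
      have := casimirVal_injOn hq0 hq1 (hp _) (hp _) h
      have : (psum i k : ℝ) = psum m k := by linarith
      exact_mod_cast this
    rcases Nat.lt_or_ge k (s + 2) with hk'' | hk''
    · obtain rfl : k = s + 1 := by omega
      have h := (isOrthonormalBasis_coupledSecond hq0 hq1 hα).repr_eq_zero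
        (eig := fun n =>
          casimirVal q (2 * (psum n (s + 1) : ℝ) + rsum α (s + 2) + ((s + 2 : ℕ) : ℝ) - 1))
        (fun i => (isCoupledSecond_coupledSecond hq0 hq1 hα i).2.1) h2 hi
      have hp : ∀ N : ℕ, 0 < 2 * (N : ℝ) + rsum α (s + 2) + ((s + 2 : ℕ) : ℝ) - 1 := by
        intro N
        have := rsum_nonneg hα (s + 2)
        push_cast; linarith [Nat.cast_nonneg (α := ℝ) N, Nat.cast_nonneg (α := ℝ) s]
      have := casimirVal_injOn hq0 hq1 (hp _) (hp _) h
      have : (psum i (s + 1) : ℝ) = psum m (s + 1) := by linarith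
      exact_mod_cast this
    · obtain rfl : k = s + 2 := by omega
      exact psum_eq_of_rpow hq0 hq1 ((isOrthonormalBasis_coupledSecond hq0 hq1 hα).repr_eq_zero
        (eig := fun n => q ^ ((psum n (s + 2) : ℝ) + (rsum α (s + 2) + ((s + 2 : ℕ) : ℝ)) / 2))
        (fun i => (isCoupledSecond_coupledSecond hq0 hq1 hα i).2.2) h3 hi)
  · rintro ⟨c, rfl⟩
    obtain ⟨h1, h2, h3⟩ := isCoupledSecond_coupledSecond hq0 hq1 hα m
    exact ⟨fun k hk hk' => by rw [map_smul, h1 k hk hk', smul_comm], by rw [map_smul, h2, smul_comm],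
      by rw [map_smul, h3, smul_comm]⟩

end OrthonormalBases

/-! ### Little `q`-Jacobi functions as limits of `q`-Hahn functions -/

section LittleJacobi

open Filter Topology

variable {q : ℝ}

lemma summable_mul_pow (hq0 : 0 < q) (hq1 : q < 1) (a : ℝ) : Summable fun j : ℕ => -(a * q ^ j) :=
  ((summable_geometric_of_lt_one hq0.le hq1).mul_left a).neg

lemma tendsto_qPoch (hq0 : 0 < q) (hq1 : q < 1) (a : ℝ) :
    Tendsto (fun n => qPoch a q n) atTop (𝓝 (qPochInf a q)) := by
  have h := (Real.multipliable_one_add_of_summable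
    (summable_mul_pow hq0 hq1 a)).tendsto_prod_tprod_nat
  simpa only [qPoch, qPochInf, sub_eq_add_neg] using h

lemma one_sub_mul_pow_pos_of_lt_one (hq0 : 0 < q) (hq1 : q < 1) {a : ℝ} (ha0 : 0 ≤ a) (ha : a < 1)
    (j : ℕ) : 0 < 1 - a * q ^ j := by
  have := mul_le_of_le_one_right ha0 (pow_le_one₀ hq0.le hq1.le (n := j))
  linarith

lemma qPochInf_pos (hq0 : 0 < q) (hq1 : q < 1) {a : ℝ} (ha0 : 0 ≤ a) (ha : a < 1) :
    0 < qPochInf a q := by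
  rw [qPochInf, ← Real.rexp_tsum_eq_tprod (one_sub_mul_pow_pos_of_lt_one hq0 hq1 ha0 ha)]
  · exact Real.exp_pos _
  · simpa only [sub_eq_add_neg] using
      Real.summable_log_one_add_of_summable (summable_mul_pow hq0 hq1 a)

lemma qPoch_antitone (hq0 : 0 < q) (hq1 : q < 1) {a : ℝ} (ha0 : 0 ≤ a) (ha : a < 1) :
    Antitone fun n => qPoch a q n := antitone_nat_of_succ_le fun n => by
  rw [qPoch_succ]
  have := mul_nonneg ha0 (pow_pos hq0 n).le
  exact mul_le_of_le_one_right (qPoch_pos hq0 hq1 ha0 ha n).le (by linarith)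

lemma qPochInf_le (hq0 : 0 < q) (hq1 : q < 1) {a : ℝ} (ha0 : 0 ≤ a) (ha : a < 1) (n : ℕ) :
    qPochInf a q ≤ qPoch a q n :=
  (qPoch_antitone hq0 hq1 ha0 ha).le_of_tendsto (tendsto_qPoch hq0 hq1 a) n

lemma qPoch_le_one (hq0 : 0 < q) (hq1 : q < 1) {a : ℝ} (ha0 : 0 ≤ a) (ha : a < 1) (n : ℕ) :
    qPoch a q n ≤ 1 := by
  simpa [qPoch] using qPoch_antitone hq0 hq1 ha0 ha (Nat.zero_le n)

/-- The `q`-Hahn polynomial multiplied by `U^n` with `U = q^N`, as a function of `U` and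
`t = q^{N-x}`; it is continuous at `U = 0`. -/
def scaledHahn (q A B : ℝ) (n : ℕ) (t U : ℝ) : ℝ :=
  ∑ k ∈ Finset.range (n + 1), qcoef q n k * qPoch (A * B * q ^ n / q) q k *
    qPoch (A * q ^ k) q (n - k) * (∏ j ∈ Finset.range (n - k), (U - q ^ k * q ^ j)) *
    ∏ j ∈ Finset.range k, (U - t * q ^ j)

/-- The little `q`-Jacobi polynomial as a function of `t = q^x`. -/
def jacobiPoly (q A B : ℝ) (n : ℕ) (t : ℝ) : ℝ :=
  ∑ k ∈ Finset.range (n + 1), qcoef q n k * qPoch (A * B * q ^ n / q) q k *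
    qPoch (A * q ^ k) q (n - k) * t ^ k

/-- The squared norm of the little `q`-Jacobi polynomials in multiplicative form. -/
def jacobiE (q A B : ℝ) (n : ℕ) : ℝ :=
  (1 - A * B / q) / (1 - q ^ (2 * n) * (A * B / q)) *
    (qPoch q q n * qPoch A q n * qPoch B q n / qPoch (A * B / q) q n) * A ^ n

lemma pow_mul_qPoch_div {U : ℝ} (hU : U ≠ 0) (q a : ℝ) (n : ℕ) :
    U ^ n * qPoch (a / U) q n = ∏ j ∈ Finset.range n, (U - a * q ^ j) := by
  induction n with
  | zero => simp
  | succ n ih =>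
    rw [Finset.prod_range_succ, ← ih, qPoch_succ, pow_succ]
    field_simp

lemma scaledHahn_eq {U : ℝ} (hU : U ≠ 0) (q A B : ℝ) (n : ℕ) (t : ℝ) :
    scaledHahn q A B n t U = U ^ n * hahnPoly q A B n (t / U) U⁻¹ := by
  rw [scaledHahn, hahnPoly, Finset.mul_sum]
  refine Finset.sum_congr rfl fun k hk => ?_
  have hk' : k ≤ n := by have := Finset.mem_range.1 hk; omega
  rw [← pow_mul_qPoch_div hU, ← pow_mul_qPoch_div hU, inv_mul_eq_div,
    show U ^ n = U ^ (n - k) * U ^ k by rw [← pow_add, Nat.sub_add_cancel hk']]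
  ring

lemma prod_neg_mul_pow (a q : ℝ) (n : ℕ) :
    ∏ j ∈ Finset.range n, (0 - a * q ^ j) = (-a) ^ n * q ^ n.choose 2 := by
  induction n with
  | zero => simp
  | succ n ih =>
    rw [Finset.prod_range_succ, ih, Nat.choose_succ_succ' n 1, Nat.choose_one_right, pow_add q, pow_succ]
    ring

/-- The two products at $U=0$ contribute exponents $\binom k2$, $\binom{n-k}2$ and $k(n-k)$, which
add up to $\binom n2$ for every $k$; the signs combine to $(-1)^n$. -/
lemma scaledHahn_zero (q A B : ℝ) (n : ℕ) (t : ℝ) :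
    scaledHahn q A B n t 0 = (-1) ^ n * q ^ n.choose 2 * jacobiPoly q A B n t := by
  rw [scaledHahn, jacobiPoly, Finset.mul_sum]
  refine Finset.sum_congr rfl fun k hk => ?_
  have hk' : k ≤ n := by have := Finset.mem_range.1 hk; omega
  obtain ⟨p, rfl⟩ := Nat.exists_eq_add_of_le hk'
  rw [prod_neg_mul_pow, prod_neg_mul_pow, Nat.add_sub_cancel_left, choose_two_add, neg_pow (q ^ k),
    neg_pow t, ← pow_mul q k p]
  ring

lemma tendsto_scaledHahn (q A B : ℝ) (n : ℕ) (t : ℝ) :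
    Tendsto (scaledHahn q A B n t) (𝓝 0)
      (𝓝 ((-1) ^ n * q ^ n.choose 2 * jacobiPoly q A B n t)) := by
  rw [← scaledHahn_zero]
  refine Continuous.tendsto ?_ 0
  unfold scaledHahn
  fun_prop

lemma abs_prod_sub_le_one (hq0 : 0 < q) (hq1 : q < 1) {U t : ℝ} (hU0 : 0 ≤ U) (hU1 : U ≤ 1)
    (ht0 : 0 ≤ t) (ht1 : t ≤ 1) (n : ℕ) : |∏ j ∈ Finset.range n, (U - t * q ^ j)| ≤ 1 := by
  rw [Finset.abs_prod]
  refine Finset.prod_le_one (fun _ _ => abs_nonneg _) fun j _ => ?_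
  have h1 := pow_pos hq0 j
  have h2 := pow_le_one₀ hq0.le hq1.le (n := j)
  rw [abs_le]
  constructor <;> nlinarith

/-- A bound uniform in $t$ and $U$, for the majorant in the limit $N\to\infty$. -/
lemma abs_scaledHahn_le (hq0 : 0 < q) (hq1 : q < 1) (A B : ℝ) (n : ℕ) {U t : ℝ} (hU0 : 0 ≤ U)
    (hU1 : U ≤ 1) (ht0 : 0 ≤ t) (ht1 : t ≤ 1) : |scaledHahn q A B n t U| ≤
      ∑ k ∈ Finset.range (n + 1), |qcoef q n k * qPoch (A * B * q ^ n / q) q k *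
        qPoch (A * q ^ k) q (n - k)| := by
  refine (Finset.abs_sum_le_sum_abs _ _).trans (Finset.sum_le_sum fun k _ => ?_)
  rw [abs_mul, abs_mul, mul_assoc]
  refine mul_le_of_le_one_right (abs_nonneg _) (mul_le_one₀ ?_ (abs_nonneg _) ?_)
  · exact abs_prod_sub_le_one hq0 hq1 hU0 hU1 (pow_pos hq0 k).le (pow_le_one₀ hq0.le hq1.le) _
  · exact abs_prod_sub_le_one hq0 hq1 hU0 hU1 ht0 ht1 _

lemma jacobi_eq (hq0 : 0 < q) (hq1 : q < 1) (n x : ℕ) {α β : ℝ} (hα : 0 < α) :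
    jacobi q n x α β = jacobiPoly q (q ^ (α + 1)) (q ^ (β + 1)) n (q ^ x) := by
  have h1 : q ^ ((n : ℝ) + α + β + 1) = q ^ (α + 1) * q ^ (β + 1) * q ^ n / q := by
    rw [mul_div_right_comm, ← (rpow_params hq0 α β).2, ← Real.rpow_natCast, ← Real.rpow_add hq0]
    congr 1; ring
  have h2 : q ^ ((x : ℝ) + 1) = q * q ^ x := by
    rw [Real.rpow_add_one hq0.ne', Real.rpow_natCast, mul_comm]
  rw [jacobi, basicHyp, rpow_neg_nat hq0, h1, h2, tsum_eq_sum (s := Finset.range (n + 1))]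
  · rw [jacobiPoly, Finset.mul_sum]
    refine Finset.sum_congr rfl fun k hk => ?_
    have hk' : k ≤ n := by have := Finset.mem_range.1 hk; omega
    have hA : qPoch (q ^ (α + 1)) q k ≠ 0 := (qPoch_pos hq0 hq1 (Real.rpow_pos_of_pos hq0 _).le
      ((rpow_add_one_lt hq0 hq1 hα).trans hq1) k).ne'
    have hQ := qPoch_q_ne_zero hq0 hq1 k
    rw [qPoch_split (q ^ (α + 1)) q hk', qcoef, mul_pow]
    simp only [List.map_cons, List.map_nil, List.prod_cons, List.prod_nil, List.length_cons,
      List.length_nil]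
    norm_num
    generalize qPoch (q ^ (α + 1)) q k = u at *
    generalize qPoch q q k = w at *
    field_simp
  · intro k hk
    simp [qPoch_inv_pow_eq_zero hq0 (show n < k by simpa using hk)]

lemma jacobiNorm_eq (hq0 : 0 < q) (n : ℕ) (α β : ℝ) :
    jacobiNorm q n α β = jacobiE q (q ^ (α + 1)) (q ^ (β + 1)) n := by
  obtain ⟨h1, h2⟩ := rpow_params hq0 α β
  have h3 : q ^ (2 * (n : ℝ) + α + β + 1) = q ^ (2 * n) * (q ^ (α + 1) * q ^ (β + 1) / q) := by
    rw [← h2, ← Real.rpow_natCast, ← Real.rpow_add hq0]; congr 1; push_cast; ring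
  have h5 : q ^ ((n : ℝ) * (α + 1)) = (q ^ (α + 1)) ^ n := by
    rw [mul_comm, Real.rpow_mul hq0.le, Real.rpow_natCast]
  rw [jacobiNorm, jacobiE, h2, h3, h5]

lemma jacobiE_pos (hq0 : 0 < q) (hq1 : q < 1) {A B : ℝ} (hA0 : 0 < A) (hA : A < q) (hB0 : 0 < B)
    (hB : B < q) (n : ℕ) : 0 < jacobiE q A B n := by
  have h1 := mul_div_lt_one hq0 hq1 hA hB0 hB
  have h0 : 0 < A * B / q := by positivity
  have h2 := one_sub_mul_pow_pos_of_lt_one hq0 hq1 h0.le h1 (2 * n)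
  have h3 := qPoch_pos hq0 hq1 hA0.le (hA.trans hq1) n
  have h4 := qPoch_pos hq0 hq1 hB0.le (hB.trans hq1) n
  have h5 := qPoch_pos hq0 hq1 hq0.le hq1 n
  have h6 := qPoch_pos hq0 hq1 h0.le h1 n
  rw [mul_comm] at h2
  have h7 : 0 < 1 - A * B / q := by linarith
  unfold jacobiE
  positivity

/-- The quotient of the `q`-Hahn weight at `N - x` and the rescaled squared norm. -/
def hahnRatio (q A B : ℝ) (n x N : ℕ) : ℝ :=
  qPoch A q (N - x) * qPoch B q x / (qPoch q q (N - x) * qPoch q q x) * A ^ x /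
    (qPoch (A * B) q (n + N) / qPoch q q (N - n) * q ^ (2 * n.choose 2) * jacobiE q A B n)

/-- At the point $N-x$ one has $q^{-(N-x)}=t/U$ with $t=q^x$ and $U=q^N$. The factor $U^n$ that
makes the polynomial converge is supplied by $q^{-2Nn}$ in the squared norm. -/
lemma hahnHat_reflect (hq0 : 0 < q) (hq1 : q < 1) {n N x : ℕ} (hn : n ≤ N) (hx : x ≤ N) {α β : ℝ}
    (hα : 0 < α) : hahnHat q n ((N : ℤ) - x) α β N =
      √(hahnRatio q (q ^ (α + 1)) (q ^ (β + 1)) n x N) *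
        scaledHahn q (q ^ (α + 1)) (q ^ (β + 1)) n (q ^ x) (q ^ N) := by
  rw [← Nat.cast_sub hx, hahnHat_eq hq0 hq1 hn (Nat.sub_le N x) hα, scaledHahn_eq (pow_pos hq0 N).ne']
  have e1 : (q ^ (N - x))⁻¹ = q ^ x / q ^ N := by
    rw [← pow_mul_pow_sub q hx]
    have := (pow_pos hq0 x).ne'
    field_simp
  have e2 : hahnRatio q (q ^ (α + 1)) (q ^ (β + 1)) n x N * ((q ^ N) ^ n) ^ 2 =
      hW q (q ^ (α + 1)) (q ^ (β + 1)) N (N - x) / hE q (q ^ (α + 1)) (q ^ (β + 1)) N n := by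
    rw [hahnRatio, hW, hE, Nat.sub_sub_self hx, ← pow_mul q N n, ← pow_mul q (N * n) 2,
      show N * n * 2 = 2 * N * n by ring, jacobiE]
    have := (pow_pos hq0 (2 * N * n)).ne'
    simp only [div_eq_mul_inv, mul_inv, inv_inv]
    ring
  rw [e1, ← e2, Real.sqrt_mul' _ (sq_nonneg _), Real.sqrt_sq (by positivity)]
  ring

/-- Finite symbols with base in $[0,1)$ lie between the infinite product and $1$, so only the
geometric factor $A^x$ depends on $x$. -/
lemma hahnRatio_le (hq0 : 0 < q) (hq1 : q < 1) {A B : ℝ} (hA0 : 0 < A) (hA : A < q)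
    (hB0 : 0 < B) (hB : B < q) (n x N : ℕ) : hahnRatio q A B n x N ≤
      A ^ x * (qPochInf q q * qPochInf q q * (qPochInf (A * B) q * q ^ (2 * n.choose 2) *
        jacobiE q A B n))⁻¹ := by
  have hAB : A * B < 1 := by nlinarith
  have hAB0 : 0 < A * B := by positivity
  have i1 := qPochInf_pos hq0 hq1 hq0.le hq1
  have i2 := qPochInf_pos hq0 hq1 hAB0.le hAB
  have i3 := jacobiE_pos hq0 hq1 hA0 hA hB0 hB n
  have i4 := pow_pos hq0 (2 * n.choose 2)
  have p1 := qPoch_pos hq0 hq1 hq0.le hq1 (N - x)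
  have p2 := qPoch_pos hq0 hq1 hq0.le hq1 x
  have p3 := qPoch_pos hq0 hq1 hq0.le hq1 (N - n)
  have p4 := qPoch_pos hq0 hq1 hAB0.le hAB (n + N)
  have hx := pow_pos hA0 x
  have h1 : qPoch A q (N - x) * qPoch B q x / (qPoch q q (N - x) * qPoch q q x) ≤
      (qPochInf q q * qPochInf q q)⁻¹ := by
    rw [← one_div]
    gcongr
    · exact mul_le_one₀ (qPoch_le_one hq0 hq1 hA0.le (hA.trans hq1) _)
        (qPoch_pos hq0 hq1 hB0.le (hB.trans hq1) _).le
        (qPoch_le_one hq0 hq1 hB0.le (hB.trans hq1) _)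
    · exact qPochInf_le hq0 hq1 hq0.le hq1 _
    · exact qPochInf_le hq0 hq1 hq0.le hq1 _
  have h2 : qPochInf (A * B) q ≤ qPoch (A * B) q (n + N) / qPoch q q (N - n) := by
    rw [le_div_iff₀ p3]
    refine le_trans (mul_le_of_le_one_right i2.le (qPoch_le_one hq0 hq1 hq0.le hq1 _)) ?_
    exact qPochInf_le hq0 hq1 hAB0.le hAB _
  calc hahnRatio q A B n x N ≤ (qPochInf q q * qPochInf q q)⁻¹ * A ^ x /
        (qPochInf (A * B) q * q ^ (2 * n.choose 2) * jacobiE q A B n) := by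
        unfold hahnRatio; gcongr
    _ = _ := by rw [mul_inv (qPochInf q q * qPochInf q q)]; ring

lemma tendsto_hahnRatio (hq0 : 0 < q) (hq1 : q < 1) {A B : ℝ} (hA0 : 0 < A) (hA : A < q)
    (hB0 : 0 < B) (hB : B < q) (n x : ℕ) : Tendsto (hahnRatio q A B n x) atTop
      (𝓝 (qPochInf A q / qPochInf (A * B) q * (qPoch B q x / qPoch q q x) * A ^ x /
        (q ^ (2 * n.choose 2) * jacobiE q A B n))) := by
  have hAB : A * B < 1 := by nlinarith
  have hAB0 : 0 < A * B := by positivity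
  have i1 := qPochInf_pos hq0 hq1 hq0.le hq1
  have i2 := qPochInf_pos hq0 hq1 hAB0.le hAB
  have i3 := jacobiE_pos hq0 hq1 hA0 hA hB0 hB n
  have i4 := pow_pos hq0 (2 * n.choose 2)
  have p2 := qPoch_pos hq0 hq1 hq0.le hq1 x
  have s1 := tendsto_sub_atTop_nat x
  have s2 := tendsto_sub_atTop_nat n
  have s3 := tendsto_add_atTop_nat n
  have t1 := (tendsto_qPoch hq0 hq1 A).comp s1
  have t2 := (tendsto_qPoch hq0 hq1 q).comp s1
  have t3 := (tendsto_qPoch hq0 hq1 q).comp s2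
  have t4 := (tendsto_qPoch hq0 hq1 (A * B)).comp s3
  have t := (((t1.mul_const (qPoch B q x)).div (t2.mul_const (qPoch q q x))
    (by positivity)).mul_const (A ^ x)).div (((t4.div t3 i1.ne').mul_const
      (q ^ (2 * n.choose 2))).mul_const (jacobiE q A B n)) (by positivity)
  have e : qPochInf A q / qPochInf (A * B) q * (qPoch B q x / qPoch q q x) * A ^ x /
        (q ^ (2 * n.choose 2) * jacobiE q A B n) =
      qPochInf A q * qPoch B q x / (qPochInf q q * qPoch q q x) * A ^ x /
        (qPochInf (A * B) q / qPochInf q q * q ^ (2 * n.choose 2) * jacobiE q A B n) := by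
    field_simp
  rw [e]
  refine t.congr fun N => ?_
  simp only [Function.comp, hahnRatio, add_comm n N, Pi.div_apply]

lemma jacobiHat_eq (hq0 : 0 < q) (hq1 : q < 1) (n x : ℕ) {α β : ℝ} (hα : 0 < α) :
    jacobiHat q n x α β = √(qPochInf (q ^ (α + 1)) q / qPochInf (q ^ (α + 1) * q ^ (β + 1)) q *
        (qPoch (q ^ (β + 1)) q x / qPoch q q x) * (q ^ (α + 1)) ^ x /
          jacobiE q (q ^ (α + 1)) (q ^ (β + 1)) n) *
      jacobiPoly q (q ^ (α + 1)) (q ^ (β + 1)) n (q ^ x) := by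
  rw [jacobiHat, if_pos (by omega), Int.toNat_natCast, Int.cast_natCast, jacobi_eq hq0 hq1 n x hα,
    jacobiNorm_eq hq0, jacobiWeight, (rpow_params hq0 α β).1, mul_comm (x : ℝ),
    Real.rpow_mul hq0.le, Real.rpow_natCast]

/-- The little `q`-Jacobi functions as limits of the `q`-Hahn functions. -/
lemma tendsto_hahnHat_nat (hq0 : 0 < q) (hq1 : q < 1) {α β : ℝ} (hα : 0 < α) (hβ : 0 < β) (n x : ℕ) :
    Tendsto (fun N : ℕ => hahnHat q n ((N : ℤ) - x) α β N) atTop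
      (𝓝 ((-1) ^ n * jacobiHat q n x α β)) := by
  have hA0 := Real.rpow_pos_of_pos hq0 (α + 1)
  have hB0 := Real.rpow_pos_of_pos hq0 (β + 1)
  have hA := rpow_add_one_lt hq0 hq1 hα
  have hB := rpow_add_one_lt hq0 hq1 hβ
  have t1 := (tendsto_hahnRatio hq0 hq1 hA0 hA hB0 hB n x).sqrt
  have t2 := (tendsto_scaledHahn q (q ^ (α + 1)) (q ^ (β + 1)) n (q ^ x)).comp
    (tendsto_pow_atTop_nhds_zero_of_lt_one hq0.le hq1)
  have t := t1.mul t2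
  have e : (-1) ^ n * jacobiHat q n x α β =
      √(qPochInf (q ^ (α + 1)) q / qPochInf (q ^ (α + 1) * q ^ (β + 1)) q *
        (qPoch (q ^ (β + 1)) q x / qPoch q q x) * (q ^ (α + 1)) ^ x /
          (q ^ (2 * n.choose 2) * jacobiE q (q ^ (α + 1)) (q ^ (β + 1)) n)) *
      ((-1) ^ n * q ^ n.choose 2 * jacobiPoly q (q ^ (α + 1)) (q ^ (β + 1)) n (q ^ x)) := by
    have hp := pow_pos hq0 (n.choose 2)
    rw [jacobiHat_eq hq0 hq1 n x hα, mul_comm (q ^ (2 * n.choose 2)), ← div_div, mul_comm 2,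
      pow_mul q, Real.sqrt_div' _ (sq_nonneg _), Real.sqrt_sq hp.le]
    field_simp
  rw [e]
  refine t.congr' ?_
  filter_upwards [eventually_ge_atTop n, eventually_ge_atTop x] with N h1 h2
  rw [hahnHat_reflect hq0 hq1 h1 h2 hα]; rfl

lemma abs_hahnHat_le (hq0 : 0 < q) (hq1 : q < 1) {α β : ℝ} (hα : 0 < α) (hβ : 0 < β) (n : ℕ) :
    ∃ C, ∀ N x : ℕ, |hahnHat q n ((N : ℤ) - x) α β N| ≤ C * √((q ^ (α + 1)) ^ x) := by
  have hA0 := Real.rpow_pos_of_pos hq0 (α + 1)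
  have hB0 := Real.rpow_pos_of_pos hq0 (β + 1)
  have hA := rpow_add_one_lt hq0 hq1 hα
  have hB := rpow_add_one_lt hq0 hq1 hβ
  set A := q ^ (α + 1) with hAd
  set B := q ^ (β + 1) with hBd
  set D := (qPochInf q q * qPochInf q q * (qPochInf (A * B) q * q ^ (2 * n.choose 2) *
        jacobiE q A B n))⁻¹
  set M := ∑ k ∈ Finset.range (n + 1), |qcoef q n k * qPoch (A * B * q ^ n / q) q k *
        qPoch (A * q ^ k) q (n - k)|
  have hM : 0 ≤ M := Finset.sum_nonneg fun _ _ => abs_nonneg _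
  refine ⟨√D * M, fun N x => ?_⟩
  by_cases h : n ≤ N ∧ x ≤ N
  · rw [hahnHat_reflect hq0 hq1 h.1 h.2 hα, ← hAd, ← hBd, abs_mul, abs_of_nonneg (Real.sqrt_nonneg _)]
    have h1 : √(hahnRatio q A B n x N) ≤ √(A ^ x) * √D := by
      rw [← Real.sqrt_mul (pow_pos hA0 x).le]
      exact Real.sqrt_le_sqrt (hahnRatio_le hq0 hq1 hA0 hA hB0 hB n x N)
    have h2 := abs_scaledHahn_le hq0 hq1 A B n (pow_pos hq0 N).le (pow_le_one₀ hq0.le hq1.le)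
      (pow_pos hq0 x).le (pow_le_one₀ hq0.le hq1.le)
    calc _ ≤ √(A ^ x) * √D * M := mul_le_mul h1 h2 (abs_nonneg _) (by positivity)
      _ = _ := by ring
  · have h0 : hahnHat q n ((N : ℤ) - x) α β N = 0 := if_neg (by omega)
    rw [h0, abs_zero]
    positivity

/-- The limit $N\to\infty$ of the $q$-Hahn orthonormality, summed from the right end of the grid. By
`abs_hahnHat_le` each function is bounded by a constant times $\sqrt{A^x}$ with $A=q^{\alpha+1}$, so
products have the summable majorant $CC'A^x$. -/
theorem jacobiHat_orthonormal (hq0 : 0 < q) (hq1 : q < 1) {α β : ℝ} (hα : 0 < α) (hβ : 0 < β)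
    (n m : ℕ) : HasSum (fun x : ℕ => jacobiHat q n x α β * jacobiHat q m x α β)
      (if n = m then 1 else 0) := by
  have hA0 := Real.rpow_pos_of_pos hq0 (α + 1)
  have hA := rpow_add_one_lt hq0 hq1 hα
  obtain ⟨C, hC⟩ := abs_hahnHat_le hq0 hq1 hα hβ n
  obtain ⟨C', hC'⟩ := abs_hahnHat_le hq0 hq1 hα hβ m
  have hs : Summable fun x : ℕ => C * C' * (q ^ (α + 1)) ^ x :=
    (summable_geometric_of_lt_one hA0.le (hA.trans hq1)).mul_left _
  have hb : ∀ N x : ℕ, ‖hahnHat q n ((N : ℤ) - x) α β N * hahnHat q m ((N : ℤ) - x) α β N‖ ≤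
      C * C' * (q ^ (α + 1)) ^ x := by
    intro N x
    rw [norm_mul, Real.norm_eq_abs, Real.norm_eq_abs]
    calc _ ≤ C * √((q ^ (α + 1)) ^ x) * (C' * √((q ^ (α + 1)) ^ x)) :=
          mul_le_mul (hC N x) (hC' N x) (abs_nonneg _) ((abs_nonneg _).trans (hC N x))
      _ = C * C' * (√((q ^ (α + 1)) ^ x) * √((q ^ (α + 1)) ^ x)) := by ring
      _ = _ := by rw [Real.mul_self_sqrt (pow_pos hA0 x).le]
  have hlim : ∀ x : ℕ, Tendsto (fun N : ℕ =>
      hahnHat q n ((N : ℤ) - x) α β N * hahnHat q m ((N : ℤ) - x) α β N) atTop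
      (𝓝 ((-1) ^ n * jacobiHat q n x α β * ((-1) ^ m * jacobiHat q m x α β))) := fun x =>
    (tendsto_hahnHat_nat hq0 hq1 hα hβ n x).mul (tendsto_hahnHat_nat hq0 hq1 hα hβ m x)
  have ht := tendsto_tsum_of_dominated_convergence hs hlim
    (Eventually.of_forall fun N => hb N)
  have hsum : ∀ᶠ N : ℕ in atTop, ∑' x : ℕ,
      hahnHat q n ((N : ℤ) - x) α β N * hahnHat q m ((N : ℤ) - x) α β N =
      if n = m then 1 else 0 := by
    filter_upwards [eventually_ge_atTop n, eventually_ge_atTop m] with N h1 h2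
    rw [tsum_eq_sum (s := Finset.range (N + 1)), ← hahnHat_orthonormal hq0 hq1 hα hβ h1 h2,
      ← Finset.sum_range_reflect]
    · refine Finset.sum_congr rfl fun x hx => ?_
      have hx' := Finset.mem_range.1 hx
      have e : ((N + 1 - 1 - x : ℕ) : ℤ) = N - x := by omega
      rw [e, sub_sub_cancel]
    · intro x hx
      rw [hahnHat_eq_zero_left, zero_mul]
      simp at hx; omega
  have hval := tendsto_nhds_unique (tendsto_const_nhds.congr' (hsum.mono fun N h => h.symm)) ht
  -- The limit function inherits the majorant, so the value of the sum can be stated as a `HasSum`.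
  -- The signs $(-1)^n(-1)^m$ are removed afterwards and matter only for $n=m$, where they cancel.
  have hsm : Summable fun x : ℕ =>
      (-1) ^ n * jacobiHat q n x α β * ((-1) ^ m * jacobiHat q m x α β) :=
    Summable.of_norm_bounded hs fun x =>
      le_of_tendsto (hlim x).norm (Eventually.of_forall fun N => hb N x)
  have hh := hsm.hasSum
  rw [← hval] at hh
  have h2 := hh.mul_left ((-1) ^ n * (-1) ^ m)
  have e : (-1 : ℝ) ^ n * (-1) ^ m * (if n = m then 1 else 0) = if n = m then 1 else 0 := by
    split_ifs with h
    · rw [h, neg_one_pow_mul_self, mul_one]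
    · rw [mul_zero]
  rw [e] at h2
  refine h2.congr_fun fun x => ?_
  linear_combination (-(jacobiHat q n x α β * jacobiHat q m x α β) * (-1) ^ m * (-1) ^ m) *
    neg_one_pow_mul_self n - jacobiHat q n x α β * jacobiHat q m x α β * neg_one_pow_mul_self m

/-- The form needed for nested products: the right end is $Y+c$ with a fixed integer $c$, and the
distance $x$ to it is fixed. For $x<0$ the point lies off the grid on both sides. -/
theorem tendsto_hahnHat (hq0 : 0 < q) (hq1 : q < 1) {α β : ℝ} (hα : 0 < α) (hβ : 0 < β) (n : ℕ)
    (x c : ℤ) : Tendsto (fun Y : ℕ => hahnHat q n ((Y : ℤ) + c - x) α β ((Y : ℤ) + c)) atTop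
      (𝓝 ((-1) ^ n * jacobiHat q n x α β)) := by
  rcases lt_or_ge x 0 with hx | hx
  · rw [jacobiHat, if_neg (by omega), mul_zero]
    refine tendsto_const_nhds.congr fun Y => ?_
    rw [hahnHat_eq_zero_right (by omega)]
  · lift x to ℕ using hx
    have h : Tendsto (fun Y : ℕ => ((Y : ℤ) + c).toNat) atTop atTop :=
      tendsto_atTop.2 fun b => by
        filter_upwards [eventually_ge_atTop (b + c.natAbs)] with Y hY
        omega
    refine ((tendsto_hahnHat_nat hq0 hq1 hα hβ n x).comp h).congr' ?_
    filter_upwards [eventually_ge_atTop c.natAbs] with Y hY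
    have e : ((((Y : ℤ) + c).toNat : ℕ) : ℤ) = Y + c := by omega
    simp only [Function.comp, e]

end LittleJacobi

/-! ### The multivariate `q`-Jacobi functions -/

section MultivariateJacobi

open Filter Topology

variable {q : ℝ}

/-- The products of little `q`-Jacobi functions, on sequences. -/
def nestedJacobi (q : ℝ) (α : ℕ → ℝ) (k : ℕ) (t x : ℕ → ℕ) : ℝ :=
  ∏ j ∈ Finset.range k, ((-1) ^ t j *
    jacobiHat q (t j) (x j) (2 * (part t j : ℝ) + rpart α (j + 1) + j) (α (j + 1)))

/-- The mixed products of `q`-Hahn and little `q`-Jacobi functions, on sequences. -/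
def nestedJacobiAlt (q : ℝ) (α : ℕ → ℝ) (k : ℕ) (t x : ℕ → ℕ) : ℝ :=
  nested q (α ∘ Nat.succ) k t x * ((-1) ^ t k *
    jacobiHat q (t k) ((part x (k + 1) : ℤ) - part t k) (α 0)
      (2 * (part t k : ℝ) + rpart (α ∘ Nat.succ) (k + 1) + k))

/-- When the first entry $Y$ tends to infinity, argument and right end of the $j$-th factor grow
together at the fixed distance $x_j$. -/
lemma tendsto_nested (hq0 : 0 < q) (hq1 : q < 1) {α : ℕ → ℝ} (hα : ∀ i, 0 < α i) (k : ℕ)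
    (t x : ℕ → ℕ) : Tendsto (fun Y => nested q α k t (consSeq Y x)) atTop
      (𝓝 (nestedJacobi q α k t x)) := by
  refine tendsto_finsetProd _ fun j _ => ?_
  refine (tendsto_hahnHat hq0 hq1 (nested_param_pos hα (part t j) j) (hα (j + 1)) (t j) (x j)
    ((part x (j + 1) : ℤ) - part t j)).congr fun Y => ?_
  have h1 : part (consSeq Y x) (j + 1) = part x j + Y := part_succ' _ _
  have h2 : part (consSeq Y x) (j + 2) = part x (j + 1) + Y := part_succ' _ _
  have h3 := part_succ x j
  rw [nestedFactor]
  congr 1 <;> omega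

/-- Only the outer factor contains the first entry. It is evaluated at $Y$, at the fixed distance
$X_{k+1}-T_k$ from its right end. -/
lemma tendsto_nestedAlt (hq0 : 0 < q) (hq1 : q < 1) {α : ℕ → ℝ} (hα : ∀ i, 0 < α i) (k : ℕ)
    (t x : ℕ → ℕ) : Tendsto (fun Y => nestedAlt q α k t (consSeq Y x)) atTop
      (𝓝 (nestedJacobiAlt q α k t x)) := by
  refine ((tendsto_hahnHat hq0 hq1 (hα 0) (nested_param_pos (α := α ∘ Nat.succ) (fun i => hα _)
    (part t k) k) (t k) ((part x (k + 1) : ℤ) - part t k)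
    ((part x (k + 1) : ℤ) - part t k)).const_mul (nested q (α ∘ Nat.succ) k t x)).congr fun Y => ?_
  rw [nestedAlt, part_succ' _ (k + 1), consSeq_comp_succ, consSeq_zero]
  congr 2 <;> push_cast <;> ring

/-- The sum in `nestedAlt_eq` is finite and its coefficients do not involve the variables, so it
passes to the limit. -/
theorem nestedJacobiAlt_eq (hq0 : 0 < q) (hq1 : q < 1) {α : ℕ → ℝ} (hα : ∀ i, 0 < α i) (k : ℕ)
    (t x : ℕ → ℕ) : nestedJacobiAlt q α k t x =
      ∑ n ∈ comps (k + 1) (part t (k + 1)), racahProd q α k t n * nestedJacobi q α (k + 1) n x := by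
  refine tendsto_nhds_unique (tendsto_nestedAlt hq0 hq1 hα k t x) ?_
  simp only [nestedAlt_eq hq0 hq1 hα]
  exact tendsto_finsetSum _ fun n _ => (tendsto_nested hq0 hq1 hα (k + 1) n x).const_mul _

/-- Expanding one of two `nestedAlt` by the connection formula leaves overlaps with `nested`, which
are again the coefficients. So their Gram matrix is that of the functions `nestedAlt`. -/
theorem racahProd_orthonormal (hq0 : 0 < q) (hq1 : q < 1) {α : ℕ → ℝ} (hα : ∀ i, 0 < α i) (k : ℕ)
    {m m' : ℕ → ℕ} (h : part m (k + 1) = part m' (k + 1)) :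
    ∑ n ∈ comps (k + 1) (part m (k + 1)), racahProd q α k m n * racahProd q α k m' n =
      if ∀ j < k + 1, m j = m' j then 1 else 0 := by
  have h1 := nestedAlt_orthonormal hq0 hq1 hα k m m' (part m (k + 1))
  simp only [le_refl, and_true] at h1
  rw [← h1]
  have h2 : ∀ y, nestedAlt q α k m y * nestedAlt q α k m' y =
      ∑ n ∈ comps (k + 1) (part m (k + 1)), racahProd q α k m' n *
        (nestedAlt q α k m y * nested q α (k + 1) n y) := by
    intro y
    rw [nestedAlt_eq hq0 hq1 hα k m' y, ← h, Finset.mul_sum]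
    exact Finset.sum_congr rfl fun n _ => by ring
  simp only [h2]
  rw [Finset.sum_comm]
  refine Finset.sum_congr rfl fun n hn => ?_
  rw [mem_comps] at hn
  rw [← Finset.mul_sum, nested_overlap hq0 hq1 hα k hn.1.le, if_pos hn.1.symm]
  ring

/-- Infinite sums of products of functions of one variable. -/
lemma hasSum_prod_fin {d : ℕ} {f : Fin d → ℕ → ℝ} {a : Fin d → ℝ} (h : ∀ k, HasSum (f k) (a k)) :
    HasSum (fun x : Fin d → ℕ => ∏ k, f k (x k)) (∏ k, a k) := by
  induction d with
  | zero => simp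
  | succ d ih =>
    set g : (Fin d → ℕ) → ℝ := fun x => ∏ k, f k.succ (x k) with hg
    have h1 : HasSum g (∏ k : Fin d, a k.succ) := ih fun k => h k.succ
    have hs : Summable fun p : ℕ × (Fin d → ℕ) => f 0 p.1 * g p.2 := by
      clear_value g
      exact summable_mul_of_summable_norm (h 0).summable.norm h1.summable.norm
    have h2 : HasSum (fun p : ℕ × (Fin d → ℕ) => f 0 p.1 * g p.2)
        (a 0 * ∏ k : Fin d, a k.succ) := by
      clear_value g
      exact HasSum.mul (h 0) h1 hs
    rw [Fin.prod_univ_succ, ← (Fin.consEquiv fun _ : Fin (d + 1) => ℕ).hasSum_iff]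
    convert h2 using 2 with p
    rw [Function.comp_apply, Fin.prod_univ_succ]
    rfl

/-- For different multi-indices the later factors have different parameters and need not be
orthogonal; summability is all that is required of them. -/
lemma summable_jacobiHat_mul (hq0 : 0 < q) (hq1 : q < 1) {α β α' β' : ℝ} (hα : 0 < α) (hβ : 0 < β)
    (hα' : 0 < α') (hβ' : 0 < β') (n m : ℕ) :
    Summable fun x : ℕ => jacobiHat q n x α β * jacobiHat q m x α' β' := by
  refine Summable.of_norm_bounded ((jacobiHat_orthonormal hq0 hq1 hα hβ n n).summable.add
    (jacobiHat_orthonormal hq0 hq1 hα' hβ' m m).summable) fun x => ?_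
  rw [Real.norm_eq_abs, abs_le]
  constructor <;> nlinarith [sq_nonneg (jacobiHat q n x α β + jacobiHat q m x α' β'),
    sq_nonneg (jacobiHat q n x α β - jacobiHat q m x α' β'), sq_nonneg (jacobiHat q n x α β),
    sq_nonneg (jacobiHat q m x α' β')]

variable {s : ℕ} {α : Fin (s + 2) → ℝ}

lemma JacobiJ_eq (α : Fin (s + 2) → ℝ) (t x : Fin (s + 1) → ℕ) :
    JacobiJ q α t x = nestedJacobi q (toSeqR α) (s + 1) (toSeq t) (toSeq x) := by
  rw [JacobiJ, nestedJacobi, ← Fin.prod_univ_eq_prod_range]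
  refine Finset.prod_congr rfl fun k _ => ?_
  rw [psum_eq, rsum_eq α (by omega), toSeq_val, toSeq_val]
  congr 2
  exact (toSeqR_val α k.succ).symm

lemma JacobiQ_eq (α : Fin (s + 2) → ℝ) (t x : Fin (s + 1) → ℕ) :
    JacobiQ q α t x = nestedJacobiAlt q (toSeqR α) s (toSeq t) (toSeq x) := by
  rw [JacobiQ, nestedJacobiAlt, nested, ← Fin.prod_univ_eq_prod_range]
  have e : toSeq t s = t (Fin.last s) := toSeq_val t (Fin.last s)
  congr 1
  · refine Finset.prod_congr rfl fun k _ => ?_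
    rw [nestedFactor, psum_eq, psum_eq, psum_eq, rsumTail_eq α (by omega)]
    congr 1
    · exact (toSeq_val t k.castSucc).symm
    · exact (toSeqR_val α k.succ.succ).symm
  · rw [psum_eq, psum_eq, rsumTail_eq α (by omega), e]
    congr 2

/-- The sum factorizes over the variables. For $t\ne t'$ consider the first index where they differ:
the preceding entries agree, hence so do the parameters, and this factor is zero whatever the later
ones are. -/
theorem JacobiJ_orthonormal (hq0 : 0 < q) (hq1 : q < 1) (hα : ∀ i, 0 < α i)
    (t t' : Fin (s + 1) → ℕ) :
    HasSum (fun x => JacobiJ q α t x * JacobiJ q α t' x) (if t = t' then 1 else 0) := by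
  have hpos : ∀ (t : Fin (s + 1) → ℕ) (k : Fin (s + 1)),
      0 < 2 * (psum t k.val : ℝ) + rsum α (k.val + 1) + k.val := fun t k => by
    rw [rsum_eq α (by omega)]; exact nested_param_pos (toSeqR_pos hα) _ _
  set f : Fin (s + 1) → ℕ → ℝ := fun k x => (-1) ^ (t k) * (-1) ^ (t' k) *
    (jacobiHat q (t k) x (2 * (psum t k.val : ℝ) + rsum α (k.val + 1) + k.val) (α k.succ) *
      jacobiHat q (t' k) x (2 * (psum t' k.val : ℝ) + rsum α (k.val + 1) + k.val) (α k.succ)) with hf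
  have hs : ∀ k, HasSum (f k) (∑' x, f k x) := fun k =>
    ((summable_jacobiHat_mul hq0 hq1 (hpos t k) (hα _) (hpos t' k) (hα _) _ _).mul_left _).hasSum
  have h := hasSum_prod_fin hs
  have e : ∀ k, psum t k.val = psum t' k.val → ∑' x, f k x = if t k = t' k then 1 else 0 := by
    intro k hk
    rw [hf]
    simp only [hk]
    rw [((jacobiHat_orthonormal hq0 hq1 (hpos t' k) (hα k.succ) (t k) (t' k)).mul_left _).tsum_eq]
    split_ifs with h'
    · rw [h', neg_one_pow_mul_self, mul_one]
    · rw [mul_zero]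
  have e2 : ∏ k, ∑' x, f k x = if t = t' then 1 else 0 := by
    split_ifs with h'
    · refine Finset.prod_eq_one fun k _ => ?_
      rw [e k (by rw [h']), if_pos (by rw [h'])]
    · have hex : ∃ k : ℕ, k < s + 1 ∧ toSeq t k ≠ toSeq t' k := by
        by_contra! hc
        apply h'
        ext k
        simpa using hc k k.2
      classical
      obtain ⟨hk, hne⟩ := Nat.find_spec hex
      refine Finset.prod_eq_zero (Finset.mem_univ (⟨Nat.find hex, hk⟩ : Fin (s + 1))) ?_
      rw [e, if_neg]
      · intro heq
        exact hne (by rw [← toSeq_val t, ← toSeq_val t'] at heq; exact heq)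
      · rw [psum_eq, psum_eq]
        refine part_congr fun i hi => ?_
        have := Nat.find_min hex hi
        by_contra hc
        exact this ⟨lt_trans hi hk, hc⟩
  rw [e2] at h
  refine h.congr_fun fun x => ?_
  rw [JacobiJ, JacobiJ, ← Finset.prod_mul_distrib]
  refine Finset.prod_congr rfl fun k _ => ?_
  rw [hf]; ring

lemma JacobiQ_eq_sum (hq0 : 0 < q) (hq1 : q < 1) (hα : ∀ i, 0 < α i) (t x : Fin (s + 1) → ℕ) :
    JacobiQ q α t x = ∑ t' ∈ Finset.piAntidiag Finset.univ (psum t (s + 1)),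
      racahProd q (toSeqR α) s (toSeq t) (toSeq t') * JacobiJ q α t' x := by
  simp only [JacobiJ_eq]
  rw [JacobiQ_eq, nestedJacobiAlt_eq hq0 hq1 (toSeqR_pos hα), psum_eq]
  exact (sum_piAntidiag_toSeq (fun n => racahProd q (toSeqR α) s (toSeq t) n *
    nestedJacobi q (toSeqR α) (s + 1) n (toSeq x)) _).symm

lemma hasSum_JacobiQ_mul_JacobiJ (hq0 : 0 < q) (hq1 : q < 1) (hα : ∀ i, 0 < α i)
    (t t' : Fin (s + 1) → ℕ) : HasSum (fun x => JacobiQ q α t x * JacobiJ q α t' x)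
      (if psum t (s + 1) = psum t' (s + 1) then
        racahProd q (toSeqR α) s (toSeq t) (toSeq t') else 0) := by
  have h := hasSum_sum fun u (_ : u ∈ Finset.piAntidiag Finset.univ (psum t (s + 1))) =>
    (JacobiJ_orthonormal hq0 hq1 hα u t').mul_left (racahProd q (toSeqR α) s (toSeq t) (toSeq u))
  have e : (∑ u ∈ Finset.piAntidiag Finset.univ (psum t (s + 1)),
      racahProd q (toSeqR α) s (toSeq t) (toSeq u) * (if u = t' then 1 else 0)) =
      if psum t (s + 1) = psum t' (s + 1) then
        racahProd q (toSeqR α) s (toSeq t) (toSeq t') else 0 := by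
    simp only [mul_ite, mul_one, mul_zero]
    rw [Finset.sum_ite_eq']
    exact if_congr (mem_piAntidiag_univ.trans eq_comm) rfl rfl
  rw [e] at h
  refine h.congr_fun fun x => ?_
  rw [JacobiQ_eq_sum hq0 hq1 hα, Finset.sum_mul]
  exact Finset.sum_congr rfl fun u _ => by ring

/-- Expanding the second function in the system $\mathcal J$ reduces the claim to orthonormality of
the coefficients. For different totals no index contributes to both expansions. -/
theorem JacobiQ_orthonormal (hq0 : 0 < q) (hq1 : q < 1) (hα : ∀ i, 0 < α i)
    (t t' : Fin (s + 1) → ℕ) :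
    HasSum (fun x => JacobiQ q α t x * JacobiQ q α t' x) (if t = t' then 1 else 0) := by
  have h := hasSum_sum fun (u : Fin (s + 1) → ℕ)
      (_ : u ∈ Finset.piAntidiag Finset.univ (psum t' (s + 1))) =>
    (hasSum_JacobiQ_mul_JacobiJ hq0 hq1 hα t u).mul_left
      (racahProd q (toSeqR α) s (toSeq t') (toSeq u))
  have e : (∑ u ∈ Finset.piAntidiag (Finset.univ : Finset (Fin (s + 1))) (psum t' (s + 1)),
      racahProd q (toSeqR α) s (toSeq t') (toSeq u) * (if psum t (s + 1) = psum u (s + 1) then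
        racahProd q (toSeqR α) s (toSeq t) (toSeq u) else 0)) = if t = t' then 1 else 0 := by
    by_cases hp : psum t (s + 1) = psum t' (s + 1)
    · have e1 := racahProd_orthonormal hq0 hq1 (toSeqR_pos hα) s (m := toSeq t) (m' := toSeq t')
        (by rw [← psum_eq, ← psum_eq, hp])
      rw [← sum_piAntidiag_toSeq (fun n => racahProd q (toSeqR α) s (toSeq t) n *
        racahProd q (toSeqR α) s (toSeq t') n), ← psum_eq] at e1
      have e2 : (∀ j < s + 1, toSeq t j = toSeq t' j) ↔ t = t' := by
        constructor
        · intro h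
          ext k
          simpa using h k k.2
        · rintro rfl j _; rfl
      simp only [e2] at e1
      rw [← e1, ← hp]
      refine Finset.sum_congr rfl fun u hu => ?_
      rw [mem_piAntidiag_univ] at hu
      rw [if_pos hu.symm, mul_comm]
    · rw [if_neg (by rintro rfl; exact hp rfl)]
      refine Finset.sum_eq_zero fun u hu => ?_
      rw [mem_piAntidiag_univ] at hu
      rw [if_neg (by omega), mul_zero]
  rw [e] at h
  refine h.congr_fun fun x => ?_
  rw [JacobiQ_eq_sum hq0 hq1 hα t', Finset.mul_sum]
  exact Finset.sum_congr rfl fun u _ => by ring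

lemma toSeq_snoc (t : Fin (s + 1) → ℕ) (c : ℕ) {i : ℕ} (hi : i < s + 1) :
    toSeq (Fin.snoc (α := fun _ => ℕ) t c) i = toSeq t i := by
  have h1 := toSeq_val (Fin.snoc (α := fun _ => ℕ) t c) (⟨i, hi⟩ : Fin (s + 1)).castSucc
  rw [Fin.snoc_castSucc] at h1
  exact h1.trans (toSeq_val t ⟨i, hi⟩).symm

/-- The last entries enter the overlap through a Kronecker delta only, so the common value $c$ is
immaterial. -/
theorem overlap_snoc (hq0 : 0 < q) (hq1 : q < 1) (hα : ∀ i, 0 < α i) (t t' : Fin (s + 1) → ℕ)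
    (c : ℕ) : overlap q α (Fin.snoc (α := fun _ => ℕ) t c) (Fin.snoc (α := fun _ => ℕ) t' c) =
      if psum t (s + 1) = psum t' (s + 1) then
        racahProd q (toSeqR α) s (toSeq t) (toSeq t') else 0 := by
  have hp : ∀ t : Fin (s + 1) → ℕ, psum (Fin.snoc (α := fun _ => ℕ) t c) (s + 1) =
      psum t (s + 1) := fun t => by
    rw [psum_eq, psum_eq]; exact part_congr fun i hi => toSeq_snoc t c hi
  rw [overlap_eq_racahProd hq0 hq1 hα, Fin.snoc_last, Fin.snoc_last, if_pos rfl, one_mul, hp, hp,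
    racahProd_congr (toSeqR α) (fun i hi => toSeq_snoc t c (by omega))
      (fun i hi => toSeq_snoc t' c hi), ite_mul, one_mul, zero_mul]

end MultivariateJacobi

/-! ### Factorization of the weights and norms of the multivariate `q`-Racah polynomials -/

section RacahFactorization

variable {q : ℝ}

lemma one_sub_mul_qPoch_div (hq0 : 0 < q) (a : ℝ) (K : ℕ) :
    qPoch (a / q) q K * (1 - a / q * q ^ K) = (1 - a / q) * qPoch a q K := by
  rw [← qPoch_succ, qPoch_succ', div_mul_cancel₀ _ hq0.ne']

/-- With $B=Dq^K$, all symbols whose base contains a power of $q$ become quotients of symbols with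
bases free of it, as the telescoping product requires. The powers of $C$ cancel. -/
lemma rW_shift (hq0 : 0 < q) (hq1 : q < 1) {A D C : ℝ} (hA0 : 0 < A) (hA : A < q)
    (hD0 : 0 < D) (hD : D < q) (hC0 : 0 < C) (hC : C < q) (K x r : ℕ) :
    rW q A (D * q ^ K) C x r =
      (1 - q ^ (2 * x) * (A * D / q * q ^ K)) / (1 - A * D / q * q ^ K) *
        (qPoch (A * D / q) q (K + x) / qPoch (A * D / q) q K * (qPoch D q (K + x) / qPoch D q K) *
          (qPoch (A * D * C / q) q (K + (x + r) + x) / qPoch (A * D * C / q) q (K + (x + r))) *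
          (qPoch q q (x + r) / qPoch q q r) /
        (qPoch q q x * qPoch A q x * (qPoch C q (r + x) / qPoch C q r) *
          (qPoch (A * D) q (K + (x + r) + x) / qPoch (A * D) q (K + (x + r))))) /
      (D * q ^ K) ^ x := by
  have hAD := mul_div_lt_one hq0 hq1 hA hD0 hD
  have hADq : A * D < q := by rwa [div_lt_one hq0] at hAD
  have hG1 : A * D * C / q < 1 := by
    rw [div_lt_one hq0]; nlinarith [mul_pos hA0 hD0]
  rw [rW, ← div_qPoch hq0 hq1 (show 0 < A * D / q by positivity) hAD,
    ← div_qPoch hq0 hq1 hD0 (hD.trans hq1), ← div_qPoch hq0 hq1 hC0 (hC.trans hq1),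
    ← div_qPoch hq0 hq1 (show 0 < A * D by positivity) (hADq.trans hq1),
    ← div_qPoch hq0 hq1 (show 0 < A * D * C / q by positivity) hG1,
    show A * (D * q ^ K) / q = A * D / q * q ^ K by ring,
    show A * (D * q ^ K) * C * q ^ (x + r) / q = A * D * C / q * q ^ (K + (x + r)) by ring,
    show A * (D * q ^ K) * q ^ (x + r) = A * D * q ^ (K + (x + r)) by ring, div_pow, mul_pow _ C]
  have z1 := pow_ne_zero x hq0.ne'
  have z2 := pow_ne_zero x hC0.ne'
  have e : (1 / q ^ x * C ^ x) * (q ^ x / ((D * q ^ K) ^ x * C ^ x)) = 1 / (D * q ^ K) ^ x := by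
    generalize (D * q ^ K) ^ x = w
    field_simp
  linear_combination ((1 - q ^ (2 * x) * (A * D / q * q ^ K)) / (1 - A * D / q * q ^ K) *
        (qPoch (A * D / q * q ^ K) q x * qPoch (D * q ^ K) q x *
          qPoch (A * D * C / q * q ^ (K + (x + r))) q x *
          (qPoch q q (x + r) / qPoch q q r) /
        (qPoch q q x * qPoch A q x * qPoch (C * q ^ r) q x *
          qPoch (A * D * q ^ (K + (x + r))) q x))) * e

lemma rE_shift (hq0 : 0 < q) (hq1 : q < 1) {A D C : ℝ} (hA0 : 0 < A) (hA : A < q)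
    (hD0 : 0 < D) (hD : D < q) (hC0 : 0 < C) (hC : C < q) (K m J : ℕ) :
    rE q A (D * q ^ K) C m J =
      qPoch (A * D) q (K + (m + J)) / qPoch (A * D) q K *
        (qPoch (D * C) q (K + (m + J)) / qPoch (D * C) q K) /
        (qPoch A q (m + J) * qPoch C q (m + J) * (D * q ^ K) ^ (m + J)) *
      (qPoch q q m * (qPoch D q (K + m) / qPoch D q K) * qPoch C q m *
        (qPoch A q (J + m) / qPoch A q J / (A ^ m * (q ^ J) ^ m * q ^ m.choose 2)) *
        (qPoch (A * D * C / q) q (K + (m + J) + m) / qPoch (A * D * C / q) q (K + (m + J))) *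
        (qPoch q q (m + J) / (qPoch q q J * q ^ m.choose 2 * q ^ m * (q ^ J) ^ m))) *
      ((1 - D * C / q * q ^ K) / (1 - q ^ (2 * m) * (D * C / q * q ^ K))) *
      (qPoch (D * C) q (K + (m + J) + m) / qPoch (D * C) q (K + (m + J)) /
        (qPoch (D * C / q) q (K + m) / qPoch (D * C / q) q K)) := by
  have hAD := mul_div_lt_one hq0 hq1 hA hD0 hD
  have hADq : A * D < q := by rwa [div_lt_one hq0] at hAD
  have hDC := mul_div_lt_one hq0 hq1 hD hC0 hC
  have hDCq : D * C < q := by rwa [div_lt_one hq0] at hDC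
  have hG1 : A * D * C / q < 1 := by
    rw [div_lt_one hq0]; nlinarith [mul_pos hA0 hD0]
  rw [rE, ← div_qPoch hq0 hq1 (show 0 < D * C / q by positivity) hDC,
    ← div_qPoch hq0 hq1 (show 0 < D * C by positivity) (hDCq.trans hq1),
    ← div_qPoch hq0 hq1 (show 0 < D * C by positivity) (hDCq.trans hq1),
    ← div_qPoch hq0 hq1 hD0 (hD.trans hq1), ← div_qPoch hq0 hq1 hA0 (hA.trans hq1),
    ← div_qPoch hq0 hq1 (show 0 < A * D by positivity) (hADq.trans hq1),
    ← div_qPoch hq0 hq1 (show 0 < A * D * C / q by positivity) hG1,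
    show D * q ^ K * C / q = D * C / q * q ^ K by ring, show D * q ^ K * C = D * C * q ^ K by ring,
    show A * (D * q ^ K) * C * q ^ (m + J) / q = A * D * C / q * q ^ (K + (m + J)) by ring,
    show D * C * q ^ K * q ^ (m + J) = D * C * q ^ (K + (m + J)) by ring,
    show A * (D * q ^ K) = A * D * q ^ K by ring]

/-- The grouping anticipates the application: a factor of $\chi$, a factor of $\Upsilon$, the
telescoping terms with index $k$ and $k+1$, and a pure power. -/
lemma rW_div_rE (hq0 : 0 < q) (hq1 : q < 1) {A D C : ℝ} (hA0 : 0 < A) (hA : A < q)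
    (hD0 : 0 < D) (hD : D < q) (hC0 : 0 < C) (hC : C < q) {K x r m J : ℕ} (hL : m + J = x + r) :
    rW q A (D * q ^ K) C x r / rE q A (D * q ^ K) C m J =
      (qPoch C q r * qPoch (A * D * C / q) q (K + (x + r) + x) /
          (qPoch q q r * qPoch (A * D) q (K + (x + r) + x)) *
        ((1 - q ^ (2 * x) * (A * D / q * q ^ K)) / (1 - A * D / q))) /
      (qPoch q q m * qPoch C q m * qPoch D q (K + m) / qPoch (D * C / q) q (K + m) *
        ((1 - D * C / q) / (1 - q ^ (2 * m) * (D * C / q * q ^ K)))) *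
      (qPoch (A * D / q) q (K + x) * qPoch D q (K + x) / (qPoch q q x * qPoch A q x)) /
      (qPoch (A * D * C / q) q (K + (m + J) + m) * qPoch (D * C) q (K + (m + J) + m) /
        (qPoch q q J * qPoch A q J)) *
      ((D * q ^ K) ^ r * A ^ m * (q ^ J) ^ m * (q ^ J) ^ m * (q ^ m.choose 2) ^ 2 * q ^ m) := by
  have hAD := mul_div_lt_one hq0 hq1 hA hD0 hD
  have hAD0 : 0 < A * D / q := by positivity
  have hADq : A * D < q := by rwa [div_lt_one hq0] at hAD
  have hDC := mul_div_lt_one hq0 hq1 hD hC0 hC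
  have hDC0 : 0 < D * C / q := by positivity
  have hDCq : D * C < q := by rwa [div_lt_one hq0] at hDC
  have hG1 : A * D * C / q < 1 := by
    rw [div_lt_one hq0]; nlinarith [mul_pos hA0 hD0]
  have zA := fun k => (qPoch_pos hq0 hq1 hA0.le (hA.trans hq1) k).ne'
  have zD := fun k => (qPoch_pos hq0 hq1 hD0.le (hD.trans hq1) k).ne'
  have zC := fun k => (qPoch_pos hq0 hq1 hC0.le (hC.trans hq1) k).ne'
  have zQ := qPoch_q_ne_zero hq0 hq1
  have zAD := fun k => (qPoch_pos hq0 hq1 (by positivity) (hADq.trans hq1) k).ne'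
  have zDC := fun k => (qPoch_pos hq0 hq1 (by positivity) (hDCq.trans hq1) k).ne'
  have zADq := fun k => (qPoch_pos hq0 hq1 hAD0.le hAD k).ne'
  have zDCq := fun k => (qPoch_pos hq0 hq1 hDC0.le hDC k).ne'
  have zG := fun k => (qPoch_pos hq0 hq1 (by positivity) hG1 k).ne'
  have k1 := one_sub_mul_qPoch_div hq0 (A * D) K
  have k2 := one_sub_mul_qPoch_div hq0 (D * C) K
  have x1 := (one_sub_mul_pow_pos_of_lt_one hq0 hq1 hAD0.le hAD K).ne'
  have x2 := (one_sub_mul_pow_pos_of_lt_one hq0 hq1 hDC0.le hDC K).ne'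
  have x3 : 1 - A * D / q ≠ 0 := by linarith
  have x4 : 1 - D * C / q ≠ 0 := by linarith
  have x5 : 1 - q ^ (2 * m) * (D * C / q * q ^ K) ≠ 0 := by
    have := (one_sub_mul_pow_pos_of_lt_one hq0 hq1 hDC0.le hDC (2 * m + K)).ne'
    rw [pow_add] at this
    rwa [show q ^ (2 * m) * (D * C / q * q ^ K) = D * C / q * (q ^ (2 * m) * q ^ K) by ring]
  have hy1 : qPoch (A * D / q) q K = (1 - A * D / q) * qPoch (A * D) q K /
      (1 - A * D / q * q ^ K) := by rw [eq_div_iff x1, k1]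
  have hy2 : qPoch (D * C / q) q K = (1 - D * C / q) * qPoch (D * C) q K /
      (1 - D * C / q * q ^ K) := by rw [eq_div_iff x2, k2]
  have z0 := (mul_pos hD0 (pow_pos hq0 K)).ne'
  have zAm := pow_ne_zero m hA0.ne'
  have zJ := pow_ne_zero m (pow_ne_zero J hq0.ne')
  have zc := pow_ne_zero (m.choose 2) hq0.ne'
  have zm := pow_ne_zero m hq0.ne'
  rw [rW_shift hq0 hq1 hA0 hA hD0 hD hC0 hC, rE_shift hq0 hq1 hA0 hA hD0 hD hC0 hC, hy1, hy2,
    add_comm r x, add_comm J m, hL, pow_add (D * q ^ K) x r]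
  have i1 := zA m; have i2 := zA x; have i3 := zA J; have i4 := zA (x + r)
  have i5 := zD (K + m); have i6 := zD (K + x); have i7 := zD K
  have i8 := zC (x + r); have i9 := zC r; have i10 := zC m
  have i11 := zQ (x + r); have i12 := zQ r; have i13 := zQ m; have i14 := zQ x; have i15 := zQ J
  have i16 := zAD K; have i17 := zAD (K + (x + r)); have i18 := zAD (K + (x + r) + x)
  have i19 := zDC K; have i20 := zDC (K + (x + r)); have i21 := zDC (K + (x + r) + m)
  have i22 := zADq (K + x); have i23 := zDCq (K + m)
  have i24 := zG (K + (x + r)); have i25 := zG (K + (x + r) + x); have i26 := zG (K + (x + r) + m)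
  have j1 := pow_ne_zero x z0
  have j2 := pow_ne_zero r z0
  clear zA zD zC zQ zAD zDC zADq zDCq zG k1 k2 hy1 hy2
  generalize qPoch A q m = a1 at *
  generalize qPoch A q x = a2 at *
  generalize qPoch A q J = a3 at *
  generalize qPoch A q (x + r) = a4 at *
  generalize qPoch D q (K + m) = a5 at *
  generalize qPoch D q (K + x) = a6 at *
  generalize qPoch D q K = a7 at *
  generalize qPoch C q (x + r) = a8 at *
  generalize qPoch C q r = a9 at *
  generalize qPoch C q m = a10 at *
  generalize qPoch q q (x + r) = a11 at *
  generalize qPoch q q r = a12 at *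
  generalize qPoch q q m = a13 at *
  generalize qPoch q q x = a14 at *
  generalize qPoch q q J = a15 at *
  generalize qPoch (A * D) q K = a16 at *
  generalize qPoch (A * D) q (K + (x + r)) = a17 at *
  generalize qPoch (A * D) q (K + (x + r) + x) = a18 at *
  generalize qPoch (D * C) q K = a19 at *
  generalize qPoch (D * C) q (K + (x + r)) = a20 at *
  generalize qPoch (D * C) q (K + (x + r) + m) = a21 at *
  generalize qPoch (A * D / q) q (K + x) = a22 at *
  generalize qPoch (D * C / q) q (K + m) = a23 at *
  generalize qPoch (A * D * C / q) q (K + (x + r)) = a24 at *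
  generalize qPoch (A * D * C / q) q (K + (x + r) + x) = a25 at *
  generalize qPoch (A * D * C / q) q (K + (x + r) + m) = a26 at *
  generalize (D * q ^ K) ^ x = b1 at *
  generalize (D * q ^ K) ^ r = b2 at *
  generalize 1 - A * D / q * q ^ K = b3 at *
  generalize 1 - D * C / q * q ^ K = b4 at *
  generalize 1 - A * D / q = b5 at *
  generalize 1 - D * C / q = b6 at *
  generalize 1 - q ^ (2 * m) * (D * C / q * q ^ K) = b7 at *
  generalize 1 - q ^ (2 * x) * (A * D / q * q ^ K) = b8 at *
  generalize A ^ m = b9 at *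
  generalize (q ^ J) ^ m = b10 at *
  generalize q ^ m.choose 2 = b11 at *
  generalize q ^ m = b12 at *
  field_simp

end RacahFactorization

/-! ### Gasper–Rahman polynomials -/

section GasperRahman

variable {q : ℝ}

/-- The factor of the weight `χ` that depends on the entries `k + 1` and `k + 2`. -/
def chiFactor (q : ℝ) (b : ℕ → ℝ) (N : ℕ → ℕ) (k : ℕ) : ℝ :=
  qPoch (q ^ (b (k + 2) - b (k + 1))) q (N (k + 2) - N (k + 1)) *
      qPoch (q ^ b (k + 2)) q (N (k + 2) + N (k + 1)) /
    (qPoch q q (N (k + 2) - N (k + 1)) * qPoch (q ^ (b (k + 1) + 1)) q (N (k + 2) + N (k + 1))) *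
  ((1 - q ^ (2 * (N (k + 1) : ℝ) + b (k + 1))) / (1 - q ^ b (k + 1)) *
    q ^ ((N (k + 1) : ℝ) * (b k - b (k + 1))))

/-- The factor with index `k` of the squared norm `Υ`. -/
def upsilonFactor (q : ℝ) (b : ℕ → ℝ) (M : ℕ → ℕ) (k : ℕ) : ℝ :=
  qPoch q q (M (k + 1) - M k) * qPoch (q ^ (b (k + 2) - b (k + 1))) q (M (k + 1) - M k) *
      qPoch (q ^ (b (k + 1) - b 0)) q (M (k + 1) + M k) /
    qPoch (q ^ (b (k + 2) - b 0 - 1)) q (M (k + 1) + M k) *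
  ((1 - q ^ (b (k + 2) - b 0 - 1)) / (1 - q ^ (b (k + 2) - b 0 - 1 + 2 * (M (k + 1) : ℝ))))

/-- The telescoping part of the factors of `χ` and `Υ`. -/
def telescopeTerm (q : ℝ) (b : ℕ → ℝ) (N M : ℕ → ℕ) (k : ℕ) : ℝ :=
  q ^ (-(N (k + 1) : ℝ) * (2 * (M k : ℝ) + b k) + (M k : ℝ) * ((M k : ℝ) - 1) +
      b 0 * ((N (k + 1) : ℝ) - M k)) *
    (qPoch (q ^ b (k + 1)) q (N (k + 1) + M k) * qPoch (q ^ (b (k + 1) - b 0)) q (N (k + 1) + M k) /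
      (qPoch q q (N (k + 1) - M k) * qPoch (q ^ (b 0 + 1)) q (N (k + 1) - M k)))

lemma add_one_lt_of_gap {b : ℕ → ℝ} (hb : ∀ k, b k + 1 < b (k + 1)) (k : ℕ) :
    b 0 + 1 < b (k + 1) := by
  induction k with
  | zero => exact hb 0
  | succ k ih => have := hb (k + 1); linarith

/-- This is `rW_div_rE` with $K=2M_k$, $A=q^{\beta_0+1}$, $D=q^{\beta_{k+1}-\beta_0}$ and
$C=q^{\beta_{k+2}-\beta_{k+1}}$. -/
lemma racahWeight_div_racahNorm (hq0 : 0 < q) (hq1 : q < 1) {b : ℕ → ℝ} (hb0 : 0 < b 0)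
    (hb : ∀ k, b k + 1 < b (k + 1)) {N M : ℕ → ℕ} {k : ℕ} (h1 : M k ≤ N (k + 1))
    (h2 : N (k + 1) ≤ N (k + 2)) (h3 : M k ≤ M (k + 1)) (h4 : M (k + 1) ≤ N (k + 2)) :
    racahWeight q (N (k + 1) - M k) (2 * (M k : ℝ) + b (k + 1) - b 0 - 1) (b (k + 2) - b (k + 1) - 1)
        ((N (k + 2) : ℝ) + M k + b (k + 1)) (N (k + 2) - M k) /
      racahNorm q (M (k + 1) - M k) (2 * (M k : ℝ) + b (k + 1) - b 0 - 1)
        (b (k + 2) - b (k + 1) - 1) ((N (k + 2) : ℝ) + M k + b (k + 1)) (N (k + 2) - M k) =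
      chiFactor q b N k / upsilonFactor q b M k *
        (telescopeTerm q b N M k / telescopeTerm q b N M (k + 1)) := by
  obtain ⟨x, hx⟩ := Nat.exists_eq_add_of_le h1
  obtain ⟨r, hr⟩ := Nat.exists_eq_add_of_le h2
  obtain ⟨m, hm⟩ := Nat.exists_eq_add_of_le h3
  obtain ⟨J, hJ⟩ := Nat.exists_eq_add_of_le h4
  have hL : m + J = x + r := by omega
  have g1 := add_one_lt_of_gap hb k
  have g2 := hb (k + 1)
  set a := b 0 with ha
  set β₁ := b (k + 1) with hβ₁
  set β₂ := b (k + 2) with hβ₂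
  have e1 : N (k + 1) - M k = x := by omega
  have e2 : N (k + 2) - M k = x + r := by omega
  have e3 : M (k + 1) - M k = m := by omega
  have e4 : (N (k + 2) : ℝ) + M k + β₁ =
      ((x + r : ℕ) : ℝ) + a + (2 * (M k : ℝ) + β₁ - a - 1) + 1 := by
    rw [hr, hx]; push_cast; ring
  have e5 : N (k + 2) - N (k + 1) = r := by omega
  have e6 : N (k + 2) + N (k + 1) = 2 * M k + (x + r) + x := by omega
  have e7 : M (k + 1) + M k = 2 * M k + m := by omega
  have e8 : N (k + 1) + M k = 2 * M k + x := by omega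
  have e9 : N (k + 2) + M (k + 1) = 2 * M k + (m + J) + m := by omega
  have e10 : N (k + 2) - M (k + 1) = J := by omega
  have w := racahWeight_eq hq0 hq1 (n := x) (r := r) a (2 * (M k : ℝ) + β₁ - a - 1)
    (c := β₂ - β₁ - 1) (by linarith)
  have v := racahNorm_eq hq0 hq1 (m := m) (J := J) (a := a) hb0 (2 * (M k : ℝ) + β₁ - a - 1)
    (β₂ - β₁ - 1)
  rw [← hL] at e2 e4
  rw [e1, e2, e3, e4, v, hL, w, ← rW, ← hL, ← rE]
  have c1 : q ^ (2 * (M k : ℝ) + β₁ - a - 1 + 1) = q ^ (β₁ - a) * q ^ (2 * M k) := by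
    rw [← Real.rpow_natCast, ← Real.rpow_add hq0]; congr 1; push_cast; ring
  have hA := rpow_add_one_lt hq0 hq1 hb0
  have hA0 := Real.rpow_pos_of_pos hq0 (a + 1)
  have hD : q ^ (β₁ - a) < q := by
    simpa using rpow_add_one_lt hq0 hq1 (show 0 < β₁ - a - 1 by linarith)
  have hD0 := Real.rpow_pos_of_pos hq0 (β₁ - a)
  have hC : q ^ (β₂ - β₁ - 1 + 1) < q := rpow_add_one_lt hq0 hq1 (by linarith)
  have hC0 := Real.rpow_pos_of_pos hq0 (β₂ - β₁ - 1 + 1)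
  rw [c1, rW_div_rE hq0 hq1 hA0 hA hD0 hD hC0 hC hL, sub_add_cancel]
  have d1 : q ^ (a + 1) * q ^ (β₁ - a) = q ^ (β₁ + 1) := by
    rw [← Real.rpow_add hq0]; congr 1; ring
  have d2 : q ^ (β₁ + 1) / q = q ^ β₁ := by rw [Real.rpow_add_one hq0.ne']; field_simp
  have d3 : q ^ (β₁ + 1) * q ^ (β₂ - β₁) / q = q ^ β₂ := by
    rw [← Real.rpow_add hq0, div_eq_iff hq0.ne', ← Real.rpow_add_one hq0.ne']; congr 1; ring
  have d4 : q ^ (β₁ - a) * q ^ (β₂ - β₁) = q ^ (β₂ - a) := by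
    rw [← Real.rpow_add hq0]; congr 1; ring
  have d5 : q ^ (β₂ - a) / q = q ^ (β₂ - a - 1) := by rw [Real.rpow_sub_one hq0.ne']
  have d6 : q ^ (2 * x) * (q ^ β₁ * q ^ (2 * M k)) = q ^ (2 * (N (k + 1) : ℝ) + β₁) := by
    rw [← Real.rpow_natCast, ← Real.rpow_natCast, ← Real.rpow_add hq0, ← Real.rpow_add hq0, hx]
    congr 1; push_cast; ring
  have d7 : q ^ (2 * m) * (q ^ (β₂ - a - 1) * q ^ (2 * M k)) =
      q ^ (β₂ - a - 1 + 2 * (M (k + 1) : ℝ)) := by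
    rw [← Real.rpow_natCast, ← Real.rpow_natCast, ← Real.rpow_add hq0, ← Real.rpow_add hq0, hm]
    congr 1; push_cast; ring
  -- The remaining powers are distributed over the factor of $\chi$ and the two telescoping terms.
  -- The quadratic exponents match because of $m+J=x+r$.
  have d8 : (q ^ (β₁ - a) * q ^ (2 * M k)) ^ r * (q ^ (a + 1)) ^ m * (q ^ J) ^ m * (q ^ J) ^ m *
      (q ^ m.choose 2) ^ 2 * q ^ m =
      q ^ ((N (k + 1) : ℝ) * (b k - β₁)) *
        (q ^ (-(N (k + 1) : ℝ) * (2 * (M k : ℝ) + b k) + (M k : ℝ) * ((M k : ℝ) - 1) +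
          a * ((N (k + 1) : ℝ) - M k)) /
        q ^ (-(N (k + 2) : ℝ) * (2 * (M (k + 1) : ℝ) + β₁) +
          (M (k + 1) : ℝ) * ((M (k + 1) : ℝ) - 1) + a * ((N (k + 2) : ℝ) - M (k + 1)))) := by
    have hJ' : (J : ℝ) = x + r - m := by
      have : ((m + J : ℕ) : ℝ) = ((x + r : ℕ) : ℝ) := by rw [hL]
      push_cast at this; linarith
    rw [mul_assoc _ _ (q ^ m), ← pow_mul_self_eq, mul_pow, ← pow_mul, ← pow_mul]
    simp only [← Real.rpow_natCast, ← Real.rpow_mul hq0.le, ← Real.rpow_add hq0, ← Real.rpow_sub hq0]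
    congr 1
    rw [hr, hx, hm]
    push_cast
    rw [hJ']
    ring
  rw [d1, d2, d3, d4, d5, d6, d7, d8, chiFactor, upsilonFactor, telescopeTerm, telescopeTerm,
    e1, e3, e5, e6, e7, e8, show k + 1 + 1 = k + 2 from rfl, e9, e10, hL, ← ha, ← hβ₁, ← hβ₂]
  simp only [div_eq_mul_inv, mul_inv, inv_inv]
  ring

lemma prod_range_div_succ (s : ℕ) {f : ℕ → ℝ} (hf : ∀ k ≤ s, f k ≠ 0) :
    ∏ k ∈ Finset.range s, f k / f (k + 1) = f 0 / f s := by
  induction s with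
  | zero => simp [hf 0 le_rfl]
  | succ s ih =>
    rw [Finset.prod_range_succ, ih fun k hk => hf k (by omega)]
    have := hf s (by omega)
    field_simp

lemma telescopeTerm_ne_zero (hq0 : 0 < q) (hq1 : q < 1) {b : ℕ → ℝ} (hb0 : 0 < b 0)
    (hb : ∀ k, b k + 1 < b (k + 1)) (N M : ℕ → ℕ) (k : ℕ) : telescopeTerm q b N M k ≠ 0 := by
  have h : ∀ {c : ℝ}, 0 < c → ∀ n, qPoch (q ^ c) q n ≠ 0 := fun hc n =>
    (qPoch_pos hq0 hq1 (Real.rpow_pos_of_pos hq0 _).le (Real.rpow_lt_one hq0.le hq1 hc) n).ne'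
  have g1 := add_one_lt_of_gap hb k
  exact mul_ne_zero (Real.rpow_pos_of_pos hq0 _).ne' (div_ne_zero
    (mul_ne_zero (h (by linarith) _) (h (by linarith) _))
    (mul_ne_zero (qPoch_q_ne_zero hq0 hq1 _) (h (by linarith) _)))

lemma prod_racahWeight_div_racahNorm (hq0 : 0 < q) (hq1 : q < 1) {b : ℕ → ℝ} (hb0 : 0 < b 0)
    (hb : ∀ k, b k + 1 < b (k + 1)) {N M : ℕ → ℕ} {s : ℕ} (h1 : ∀ k ≤ s, M k ≤ N (k + 1))
    (h2 : Monotone N) (h3 : Monotone M) :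
    ∏ k ∈ Finset.range s, (racahWeight q (N (k + 1) - M k) (2 * (M k : ℝ) + b (k + 1) - b 0 - 1)
        (b (k + 2) - b (k + 1) - 1) ((N (k + 2) : ℝ) + M k + b (k + 1)) (N (k + 2) - M k) /
      racahNorm q (M (k + 1) - M k) (2 * (M k : ℝ) + b (k + 1) - b 0 - 1)
        (b (k + 2) - b (k + 1) - 1) ((N (k + 2) : ℝ) + M k + b (k + 1)) (N (k + 2) - M k)) =
    (telescopeTerm q b N M 0 * ∏ k ∈ Finset.range s, chiFactor q b N k) /
      (telescopeTerm q b N M s * ∏ k ∈ Finset.range s, upsilonFactor q b M k) := by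
  have h : ∀ k ∈ Finset.range s, (racahWeight q (N (k + 1) - M k)
        (2 * (M k : ℝ) + b (k + 1) - b 0 - 1)
        (b (k + 2) - b (k + 1) - 1) ((N (k + 2) : ℝ) + M k + b (k + 1)) (N (k + 2) - M k) /
      racahNorm q (M (k + 1) - M k) (2 * (M k : ℝ) + b (k + 1) - b 0 - 1)
        (b (k + 2) - b (k + 1) - 1) ((N (k + 2) : ℝ) + M k + b (k + 1)) (N (k + 2) - M k)) =
      chiFactor q b N k / upsilonFactor q b M k *
        (telescopeTerm q b N M k / telescopeTerm q b N M (k + 1)) := fun k hk => by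
    rw [Finset.mem_range] at hk
    exact racahWeight_div_racahNorm hq0 hq1 hb0 hb (h1 k hk.le) (h2 (by omega)) (h3 (by omega))
      (h1 (k + 1) hk)
  rw [Finset.prod_congr rfl h, Finset.prod_mul_distrib, Finset.prod_div_distrib,
    prod_range_div_succ s fun k _ => telescopeTerm_ne_zero hq0 hq1 hb0 hb N M k]
  ring

/-- Needed to distribute the square root over the product. It is read off from the factorization,
where every symbol has a positive power of $q$ as base. -/
lemma racahWeight_div_racahNorm_nonneg (hq0 : 0 < q) (hq1 : q < 1) {b : ℕ → ℝ} (hb0 : 0 < b 0)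
    (hb : ∀ k, b k + 1 < b (k + 1)) {N M : ℕ → ℕ} {k : ℕ} (h1 : M k ≤ N (k + 1))
    (h2 : N (k + 1) ≤ N (k + 2)) (h3 : M k ≤ M (k + 1)) (h4 : M (k + 1) ≤ N (k + 2)) :
    0 ≤ racahWeight q (N (k + 1) - M k) (2 * (M k : ℝ) + b (k + 1) - b 0 - 1)
        (b (k + 2) - b (k + 1) - 1) ((N (k + 2) : ℝ) + M k + b (k + 1)) (N (k + 2) - M k) /
      racahNorm q (M (k + 1) - M k) (2 * (M k : ℝ) + b (k + 1) - b 0 - 1)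
        (b (k + 2) - b (k + 1) - 1) ((N (k + 2) : ℝ) + M k + b (k + 1)) (N (k + 2) - M k) := by
  rw [racahWeight_div_racahNorm hq0 hq1 hb0 hb h1 h2 h3 h4]
  have g1 := add_one_lt_of_gap hb k
  have g2 := add_one_lt_of_gap hb (k + 1)
  have g3 := hb (k + 1)
  have h : ∀ {c : ℝ}, 0 < c → ∀ n, 0 ≤ qPoch (q ^ c) q n := fun hc n =>
    (qPoch_pos hq0 hq1 (Real.rpow_pos_of_pos hq0 _).le (Real.rpow_lt_one hq0.le hq1 hc) n).le
  have hQ : ∀ n, 0 ≤ qPoch q q n := fun n => (qPoch_pos hq0 hq1 hq0.le hq1 n).le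
  have hs : ∀ {c : ℝ}, 0 < c → 0 ≤ 1 - q ^ c := fun hc =>
    sub_nonneg.2 (Real.rpow_lt_one hq0.le hq1 hc).le
  have hp : ∀ c : ℝ, 0 ≤ q ^ c := fun c => (Real.rpow_pos_of_pos hq0 c).le
  have hT : ∀ j, b 0 + 1 < b (j + 1) → 0 ≤ telescopeTerm q b N M j := fun j hj =>
    mul_nonneg (hp _) (div_nonneg (mul_nonneg (h (by linarith) _) (h (by linarith) _))
      (mul_nonneg (hQ _) (h (by linarith) _)))
  refine mul_nonneg (div_nonneg ?_ ?_) (div_nonneg (hT k g1) (hT (k + 1) g2))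
  · exact mul_nonneg (div_nonneg (mul_nonneg (h (by linarith) _) (h (by linarith) _))
      (mul_nonneg (hQ _) (h (by linarith) _)))
      (mul_nonneg (div_nonneg (hs (by
        have : (0 : ℝ) ≤ 2 * (N (k + 1) : ℝ) := by positivity
        linarith)) (hs (by linarith))) (hp _))
  · exact mul_nonneg (div_nonneg (mul_nonneg (mul_nonneg (hQ _) (h (by linarith) _))
      (h (by linarith) _)) (h (by linarith) _))
      (div_nonneg (hs (by linarith)) (hs (by
        have : (0 : ℝ) ≤ 2 * (M (k + 1) : ℝ) := by positivity
        linarith)))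

lemma racah_eq_zero (hq0 : 0 < q) {n L : ℕ} (h : L < n) (x a b c : ℝ) :
    racah q n x a b c L = 0 := by
  rw [racah, rpow_neg_nat hq0, qPoch_inv_pow_eq_zero hq0 h]; ring

end GasperRahman

/-! ### The overlaps as normalized Gasper–Rahman polynomials. -/

section GasperRahmanOverlap

variable {q : ℝ}

/-- The parameters of the Gasper–Rahman polynomials as a sequence. -/
def grParam (α : ℕ → ℝ) (j : ℕ) : ℝ := rpart α (j + 1) + j

lemma grParam_zero (α : ℕ → ℝ) : grParam α 0 = α 0 := by simp [grParam, rpart_succ]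

lemma grParam_succ (α : ℕ → ℝ) (j : ℕ) : grParam α (j + 1) = grParam α j + α (j + 1) + 1 := by
  rw [grParam, grParam, rpart_succ α (j + 1)]; push_cast; ring

/-- The multivariate `q`-Racah functions, without normalization, on sequences. -/
def grProd (q : ℝ) (α : ℕ → ℝ) (s : ℕ) (m : ℕ → ℕ) (N M : ℕ → ℕ) : ℝ :=
  ∏ k ∈ Finset.range s, racah q (m k) ((N (k + 1) : ℝ) - M k)
    (2 * (M k : ℝ) + grParam α (k + 1) - grParam α 0 - 1) (grParam α (k + 2) - grParam α (k + 1) - 1)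
    ((N (k + 2) : ℝ) + M k + grParam α (k + 1)) ((N (k + 2) : ℝ) - M k)

lemma racahFactor_eq_grParam (α : ℕ → ℝ) (m n : ℕ → ℕ) (k : ℕ) : racahFactor q α m n k =
    (-1) ^ m k * racahHat q (m k) ((part n (k + 1) : ℤ) - part m k)
      (2 * (part m k : ℝ) + grParam α (k + 1) - grParam α 0 - 1)
      (grParam α (k + 2) - grParam α (k + 1) - 1)
      ((part n (k + 2) : ℝ) + part m k + grParam α (k + 1)) ((part n (k + 2) : ℤ) - part m k) := by
  rw [racahFactor]
  congr 2
  · rw [grParam_zero, grParam, rpart_succ' α (k + 1)]; push_cast; ring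
  · rw [grParam_succ α (k + 1)]; ring
  · rw [grParam]; push_cast; ring

/-- When every $M_k\le N_{k+1}$, the roots of the single factors combine into one root and the
products telescope. Otherwise the left side is zero by convention, and the unnormalized product on
the right vanishes as well, through a degree that is too large. -/
theorem racahProd_eq_grProd (hq0 : 0 < q) (hq1 : q < 1) {α : ℕ → ℝ} (hα : ∀ i, 0 < α i) {s : ℕ}
    {m n : ℕ → ℕ} (h : part m (s + 1) = part n (s + 1)) :
    racahProd q α s m n = (-1) ^ part m s *
      √((telescopeTerm q (grParam α) (part n) (part m) 0 *
          ∏ k ∈ Finset.range s, chiFactor q (grParam α) (part n) k) /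
        (telescopeTerm q (grParam α) (part n) (part m) s *
          ∏ k ∈ Finset.range s, upsilonFactor q (grParam α) (part m) k)) *
      grProd q α s m (part n) (part m) := by
  have hb0 : 0 < grParam α 0 := by rw [grParam_zero]; exact hα 0
  have hb : ∀ k, grParam α k + 1 < grParam α (k + 1) := fun k => by
    rw [grParam_succ]; linarith [hα (k + 1)]
  have hmn : Monotone (part n) := fun _ _ hij => part_mono n hij
  have hmm : Monotone (part m) := fun _ _ hij => part_mono m hij
  by_cases hg : ∀ k < s, part m k ≤ part n (k + 1)
  -- The case $k=s$, not among the factors, is needed for the last telescoping term; it follows from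
  -- $M_{s+1}=N_{s+1}$.
  · have hg' : ∀ k ≤ s, part m k ≤ part n (k + 1) := by
      intro k hk
      rcases Nat.lt_or_ge k s with hk' | hk'
      · exact hg k hk'
      · obtain rfl : k = s := by omega
        rw [← h, part_succ]; omega
    have hm : ∀ k, part m (k + 1) - part m k = m k := fun k => by rw [part_succ]; omega
    rw [← prod_racahWeight_div_racahNorm hq0 hq1 hb0 hb hg' hmn hmm, Real.sqrt_prod, grProd,
      racahProd, part, ← Finset.prod_pow_eq_pow_sum, ← Finset.prod_mul_distrib,
      ← Finset.prod_mul_distrib]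
    · refine Finset.prod_congr rfl fun k hk => ?_
      rw [Finset.mem_range] at hk
      have h1 := hg k hk
      have h2 : part m (k + 1) ≤ part n (k + 2) := hg' (k + 1) hk
      have h3 := part_succ n (k + 1)
      have h4 := part_succ m k
      have h5 : part n (k + 1) ≤ part n (k + 2) := hmn (by omega)
      rw [racahFactor_eq_grParam, racahHat, if_pos ⟨by omega, by omega, by omega⟩, hm, mul_assoc]
      rw [show ((part n (k + 1) : ℤ) - part m k).toNat = part n (k + 1) - part m k by omega,
        show ((part n (k + 2) : ℤ) - part m k).toNat = part n (k + 2) - part m k by omega]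
      push_cast
      rfl
    · intro k hk
      rw [Finset.mem_range] at hk
      exact racahWeight_div_racahNorm_nonneg hq0 hq1 hb0 hb (hg k hk) (hmn (by omega))
        (hmm (by omega)) (hg' (k + 1) hk)
  · have hex : ∃ k, k < s ∧ part n (k + 1) < part m k := by
      push Not at hg; exact hg
    classical
    obtain ⟨hk, hbad⟩ := Nat.find_spec hex
    have hleft : racahProd q α s m n = 0 := by
      refine Finset.prod_eq_zero (Finset.mem_range.2 hk) ?_
      rw [racahFactor, racahHat, if_neg (by omega), mul_zero]
    -- The first violation is at some $k=j+1$, because $M_0=0$. It says that the degree $m_j$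
    -- exceeds $N_{j+2}-M_j$, so the prefactor $(q^{-N};q)_n$ of the polynomial with index $j$ is
    -- zero.
    have hright : grProd q α s m (part n) (part m) = 0 := by
      obtain ⟨j, hj⟩ : ∃ j, Nat.find hex = j + 1 := by
        refine ⟨Nat.find hex - 1, ?_⟩
        rcases Nat.eq_zero_or_pos (Nat.find hex) with h0 | h0
        · rw [h0, part_zero] at hbad; omega
        · omega
      rw [hj] at hk hbad
      have hbad' : part n (j + 2) < part m (j + 1) := hbad
      have hgood : part m j ≤ part n (j + 1) := by
        have := Nat.find_min hex (m := j) (by omega)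
        by_contra hc
        exact this ⟨by omega, by omega⟩
      have h4 := part_succ m j
      have h5 : part n (j + 1) ≤ part n (j + 2) := hmn (by omega)
      refine Finset.prod_eq_zero (Finset.mem_range.2 (show j < s by omega)) ?_
      rw [← Nat.cast_sub (hgood.trans h5)]
      exact racah_eq_zero hq0 (by omega) _ _ _ _
    rw [hleft, hright, mul_zero]

variable {s : ℕ} {α : Fin (s + 2) → ℝ} {m n : Fin (s + 2) → ℕ} {l y : Fin s → ℕ}
  {β : Fin (s + 2) → ℝ} {M : ℕ}

lemma bordered_eq (hy : ∀ i, y i = psum n (i.val + 1)) (hM : M = psum n (s + 1)) (j : Fin (s + 2)) :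
    bordered y M j = part (toSeq n) j := by
  unfold bordered
  induction j using Fin.lastCases with
  | last => rw [Fin.snoc_last, hM, psum_eq]; rfl
  | cast i =>
    rw [Fin.snoc_castSucc]
    induction i using Fin.cases with
    | zero => simp
    | succ i => rw [Fin.cons_succ, hy, psum_eq]; rfl

lemma psum_eq_part_of_castSucc (hl : ∀ i, l i = m i.castSucc.castSucc) {k : ℕ} (hk : k ≤ s) :
    psum l k = part (toSeq m) k := by
  rw [psum_eq]
  refine part_congr fun i hi => ?_
  have h1 := toSeq_val l (⟨i, by omega⟩ : Fin s)
  exact h1.trans ((hl _).trans (toSeq_val m (⟨i, by omega⟩ : Fin s).castSucc.castSucc).symm)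

lemma beta_eq (hβ : ∀ k, β k = rsum α (k.val + 1) + k.val) (k : Fin (s + 2)) :
    β k = grParam (toSeqR α) k := by
  rw [hβ, grParam, rsum_eq α (by omega)]

theorem overlap_eq_gasperRahman (hq0 : 0 < q) (hq1 : q < 1) (hα : ∀ i, 0 < α i)
    (hl : ∀ i, l i = m i.castSucc.castSucc) (hy : ∀ i, y i = psum n (i.val + 1))
    (hM : M = psum n (s + 1)) (hβ : ∀ k, β k = rsum α (k.val + 1) + k.val) :
    overlap q α m n =
      (if m (Fin.last (s + 1)) = n (Fin.last (s + 1)) then 1 else 0) *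
        (if psum m (s + 1) = psum n (s + 1) then 1 else 0) *
        (-1) ^ (psum m s) * √(grWeight q y β M / grNorm q l β M) * gasperRahman q l y β M := by
  have hl' : ∀ k : Fin s, l k = toSeq m k := fun k =>
    (hl k).trans (toSeq_val m k.castSucc.castSucc).symm
  have hN := bordered_eq (s := s) hy hM
  have hMp : M = part (toSeq n) (s + 1) := hM.trans (psum_eq _ _)
  have hyp : ∀ k : Fin s, y k = part (toSeq n) (k.val + 1) := fun k => (hy k).trans (psum_eq _ _)
  have hb := beta_eq hβ
  have hp : ∀ k : Fin s, psum l k.val = part (toSeq m) k.val := fun k =>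
    psum_eq_part_of_castSucc hl k.2.le
  have hp' : ∀ k : Fin s, psum l (k.val + 1) = part (toSeq m) (k.val + 1) := fun k =>
    psum_eq_part_of_castSucc hl k.2
  have hZ : gasperRahman q l y β M =
      grProd q (toSeqR α) s (toSeq m) (part (toSeq n)) (part (toSeq m)) := by
    rw [grProd, gasperRahman, ← Fin.prod_univ_eq_prod_range (fun k => racah q (toSeq m k)
      ((part (toSeq n) (k + 1) : ℝ) - part (toSeq m) k) _ _ _ _)]
    refine Finset.prod_congr rfl fun k _ => ?_
    simp only [hN, hb, hp, hl']
    rfl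
  -- The first factor of the product in $\chi$ is the telescoping term with index $0$, since $y_0=0$
  -- and $M_0=0$ make its power of $q$ trivial.
  have hW : grWeight q y β M =
      telescopeTerm q (grParam (toSeqR α)) (part (toSeq n)) (part (toSeq m)) 0 *
        ∏ k ∈ Finset.range s, chiFactor q (grParam (toSeqR α)) (part (toSeq n)) k := by
    rw [grWeight, Fin.prod_univ_succ, mul_assoc, ← Finset.prod_mul_distrib,
      ← Fin.prod_univ_eq_prod_range]
    congr 1
    · simp only [hN, hb, telescopeTerm]
      simp only [Fin.val_succ, Fin.val_zero, Fin.castSucc_zero, part_zero, zero_add, tsub_zero, add_zero,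
        Nat.cast_zero, mul_zero, zero_mul, neg_mul]
      rw [mul_comm (grParam (toSeqR α) 0), neg_add_cancel, Real.rpow_zero, one_mul,
        mul_comm (qPoch (q ^ grParam (toSeqR α) 1) q _)]
    · refine Finset.prod_congr rfl fun k _ => ?_
      simp only [hN, hb, hyp, chiFactor]
      rfl
  -- The prefactor of $\Upsilon$ is the telescoping term with index $s$, where $N_{s+1}=M$.
  have hE : grNorm q l β M =
      telescopeTerm q (grParam (toSeqR α)) (part (toSeq n)) (part (toSeq m)) s *
        ∏ k ∈ Finset.range s, upsilonFactor q (grParam (toSeqR α)) (part (toSeq m)) k := by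
    rw [grNorm, ← Fin.prod_univ_eq_prod_range]
    congr 1
    · rw [telescopeTerm, psum_eq_part_of_castSucc hl le_rfl]
      simp only [hb, hMp]
      rfl
    · refine Finset.prod_congr rfl fun k _ => ?_
      have hd : part (toSeq m) (k.val + 1) - part (toSeq m) k.val = toSeq m k := by
        rw [part_succ]; omega
      simp only [hb, hp, hp', hl', upsilonFactor, hd]
      rfl
  rw [overlap_eq_racahProd hq0 hq1 hα, hZ, hW, hE]
  by_cases h : psum m (s + 1) = psum n (s + 1)
  · rw [racahProd_eq_grProd hq0 hq1 (toSeqR_pos hα) (by rw [← psum_eq, ← psum_eq, h]), psum_eq m s]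
    ring
  · rw [if_neg h]; ring

end GasperRahmanOverlap

end SUq

end

theorem mainTheorem1 (s : ℕ) (q : ℝ) (hq0 : 0 < q) (hq1 : q < 1)
    (α : Fin (s + 2) → ℝ) (hα : ∀ i, 0 < α i) :
    -- explicit product formula for the overlap coefficients
    (∀ m n : Fin (s + 2) → ℕ,
      SUq.overlap q α m n =
        (if m (Fin.last (s + 1)) = n (Fin.last (s + 1)) then 1 else 0) *
        (if SUq.psum m (s + 1) = SUq.psum n (s + 1) then 1 else 0) *
        ∏ k : Fin s, (-1) ^ (m k.castSucc.castSucc) *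
          SUq.racahHat q (m k.castSucc.castSucc)
            ((SUq.psum n (k.val + 1) : ℤ) - SUq.psum m k.val)
            (2 * (SUq.psum m k.val : ℝ) + SUq.rsumTail α (k.val + 2) + k.val)
            (α k.succ.succ)
            ((SUq.psum n (k.val + 2) : ℝ) + SUq.psum m k.val + SUq.rsum α (k.val + 2) + ((k.val : ℝ) + 1))
            ((SUq.psum n (k.val + 2) : ℤ) - SUq.psum m k.val)) ∧
    -- identification with the normalized Gasper–Rahman polynomials
    (∀ (m n : Fin (s + 2) → ℕ) (l y : Fin s → ℕ) (β : Fin (s + 2) → ℝ) (M : ℕ),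
      (∀ i, l i = m i.castSucc.castSucc) →
      (∀ i, y i = SUq.psum n (i.val + 1)) → M = SUq.psum n (s + 1) →
      (∀ k, β k = SUq.rsum α (k.val + 1) + k.val) →
      SUq.overlap q α m n =
        (if m (Fin.last (s + 1)) = n (Fin.last (s + 1)) then 1 else 0) *
        (if SUq.psum m (s + 1) = SUq.psum n (s + 1) then 1 else 0) *
        (-1) ^ (SUq.psum m s) *
        Real.sqrt (SUq.grWeight q y β M / SUq.grNorm q l β M) *
        SUq.gasperRahman q l y β M) ∧
    -- the overlaps are the `3nj` coefficients between the two coupled bases, which are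
    -- characterized up to scalars by their joint eigenvalue equations
    (SUq.IsOrthonormalBasis (SUq.coupledFirst q α) ∧
      SUq.IsOrthonormalBasis (SUq.coupledSecond q α) ∧
      (∀ n v, SUq.IsCoupledFirst q α n v ↔ ∃ c : ℂ, v = c • SUq.coupledFirst q α n) ∧
      (∀ m v, SUq.IsCoupledSecond q α m v ↔ ∃ c : ℂ, v = c • SUq.coupledSecond q α m) ∧
      ∀ m n, SUq.innerW (SUq.coupledSecond q α m) (SUq.coupledFirst q α n) =
        (SUq.overlap q α m n : ℂ)) ∧
    -- they are the connection coefficients between the two `q`-Hahn bases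
    (∀ m y : Fin (s + 2) → ℕ,
      HasSum (fun n => SUq.overlap q α m n * SUq.Psi q α n y) (SUq.Xi q α m y)) ∧
    -- they are the connection coefficients between the two orthonormal `q`-Jacobi systems
    ((∀ t t' : Fin (s + 1) → ℕ,
        HasSum (fun x => SUq.JacobiJ q α t x * SUq.JacobiJ q α t' x)
          (if t = t' then 1 else 0)) ∧
      (∀ t t' : Fin (s + 1) → ℕ,
        HasSum (fun x => SUq.JacobiQ q α t x * SUq.JacobiQ q α t' x)
          (if t = t' then 1 else 0)) ∧
      (∀ (t x : Fin (s + 1) → ℕ) (c : ℕ),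
        SUq.JacobiQ q α t x =
          ∑ t' ∈ Finset.piAntidiag Finset.univ (SUq.psum t (s + 1)),
            SUq.overlap q α (Fin.snoc (α := fun _ => ℕ) t c) (Fin.snoc (α := fun _ => ℕ) t' c) *
              SUq.JacobiJ q α t' x) ∧
      (∀ (t t' : Fin (s + 1) → ℕ) (c : ℕ),
        HasSum (fun x => SUq.JacobiQ q α t x * SUq.JacobiJ q α t' x)
          (SUq.overlap q α (Fin.snoc (α := fun _ => ℕ) t c)
            (Fin.snoc (α := fun _ => ℕ) t' c)))) := by
  refine ⟨fun m n => ?_, fun m n l y β M hl hy hM hβ =>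
    SUq.overlap_eq_gasperRahman hq0 hq1 hα hl hy hM hβ,
    ⟨SUq.isOrthonormalBasis_coupledFirst hq0 hq1 hα, SUq.isOrthonormalBasis_coupledSecond hq0 hq1 hα,
      SUq.isCoupledFirst_iff hq0 hq1 hα, SUq.isCoupledSecond_iff hq0 hq1 hα, SUq.innerW_coupled⟩,
    SUq.hasSum_overlap hq0 hq1 hα, SUq.JacobiJ_orthonormal hq0 hq1 hα,
    SUq.JacobiQ_orthonormal hq0 hq1 hα, fun t x c => ?_, fun t t' c => ?_⟩
  · rw [SUq.overlap_eq_racahProd hq0 hq1 hα, SUq.racahProd_toSeq]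
  · rw [SUq.JacobiQ_eq_sum hq0 hq1 hα]
    refine Finset.sum_congr rfl fun t' ht' => ?_
    rw [SUq.mem_piAntidiag_univ] at ht'
    rw [SUq.overlap_snoc hq0 hq1 hα, if_pos ht'.symm]
  · rw [SUq.overlap_snoc hq0 hq1 hα]
    exact SUq.hasSum_JacobiQ_mul_JacobiJ hq0 hq1 hα t t'
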